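/- Work over $\mathbb{Q}(q)$, put $[r]=\frac{q^r-q^{-r}}{q-q^{-1}}$, $\mathbb{I}_N=\{-\frac{N-1}{2},-\frac{N-3}{2},\dots,\frac{N-1}{2}\}$, and write $\delta_P\in\{0,1\}$ for the truth value of $P$. **Quantum groups.** $\mathbf{U}(\mathfrak{gl}_N)$ is the algebra generated by $E_i,F_i$ ($i\in\mathbb{I}_{N-1}$) and $D_a^{\pm1}$ ($a\in\mathbb{I}_N$), where the $D_a^{\pm 1}$ commute, $D_aD_a^{-1}=1$, $D_aE_i=q^{\delta_{a=i-1/2}-\delta_{a=i+1/2}}E_iD_a$, $D_aF_i=q^{-\delta_{a=i-1/2}+\delta_{a=i+1/2}}F_iD_a$, $[E_i,F_j]=\delta_{i=j}\frac{K_i-K_i^{-1}}{q-q^{-1}}$ with $K_i=D_{i-1/2}D_{i+1/2}^{-1}$, and the quantum Serre relations hold. Its comultiplication is $\Delta(E_i)=E_i\otimes1+K_i\otimes E_i$, $\Delta(F_i)=F_i\otimes K_i^{-1}+1\otimes F_i$, $\Delta(D_a)=D_a\otimes D_a$. Its natural representation $V=\mathbb{Q}(q)^N$ has basis $(v_r)_{r\in\mathbb{I}_N}$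 with $E_iv_r=\delta_{r=i+1/2}v_{r-1}$, $F_iv_r=\delta_{r=i-1/2}v_{r+1}$, $D_sv_r=q^{\delta_{r=s}}v_r$. The iquantum group $\mathbf{U}^\imath_n\subset\mathbf{U}(\mathfrak{gl}_{2n})$ is the subalgebra generated by $B_i=F_i+E_{-i}K_i^{-1}$ ($i\neq0$), $B_0=F_0+q^{-1}E_0K_0^{-1}+K_0^{-1}$ and $d_r^{\pm1}=(D_rD_{-r})^{\pm1}$. The iquantum group $\mathbf{U}^\jmath_n\subset\mathbf{U}(\mathfrak{gl}_{2n+1})$ is the subalgebra generated by $B_i=F_i+E_{-i}K_i^{-1}$ and $B_{-i}=F_{-i}+K_{-i}^{-1}E_i$ ($i>0$), $d_0^{\pm1}=D_0^{\pm1}$ and $d_r^{\pm1}=(D_rD_{-r})^{\pm1}$ ($r>0$). **The spaces.** Let $\mathcal{T}_P$ be the algebra generated by $t_{ij}$ ($i,j\in\mathbb{I}_P$) with, for $i<k$, $j<l$: $t_{ij}t_{kj}=qt_{kj}t_{ij}$, $t_{ij}t_{il}=qt_{il}t_{ij}$, $t_{il}t_{kj}=t_{kj}t_{il}$, $t_{ij}t_{kl}=t_{kl}t_{ij}+(q-q^{-1})t_{il}t_{kj}$.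 Let $\overline{\mathcal{T}}_P$ be its quotient by the right ideal generated by $t_{ij}-t_{-i,-j}-(q-q^{-1})t_{i,-j}$, $t_{i,-j}-t_{-i,j}$ ($i,j>0$) and, if $P$ is odd, also $t_{i,0}-qt_{-i,0}$, $t_{0,j}-qt_{0,-j}$ ($i,j>0$). Let $m,n\in\mathbb{N}$ and $\mathfrak{c}\in\{\imath,\jmath\}$; put $(M,N)=(2m,2n)$ if $\mathfrak{c}=\imath$ and $(M,N)=(2m+1,2n+1)$ if $\mathfrak{c}=\jmath$. Let $\Xi^{\mathfrak{c}}_{m|n,n}$ be the set of matrices $A=(a_{ij})\in\mathrm{Mat}_{M\times N}(\mathbb{N})$, $i\in\mathbb{I}_M$, $j\in\mathbb{I}_N$, with $a_{ij}=a_{-i,-j}$ and $\sum a_{ij}=2n$ (if $\mathfrak{c}=\imath$), resp. $2n+1$ (if $\mathfrak{c}=\jmath$). Let $t^{(A)}\in\overline{\mathcal{T}}_{\max(M,N)}$ be the class of $\prod_{(i,j)>(0,0)}t_{ij}^{a_{ij}}$ (factors in increasing lexicographic order of $(i,j)$), preceded by $t_{00}^{(a_{00}-1)/2}$ if $\mathfrak{c}=\jmath$.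 Let $\mathcal{V}^{\mathfrak{c}}_{m|n,n}$ be the span of the $t^{(A)}$, $A\in\Xi^{\mathfrak{c}}_{m|n,n}$. Put $E^\theta_{ij}=E_{ij}+E_{-i,-j}$ with $E_{ij}$ the elementary matrices. In the following formulas, terms with coefficient $0$ are omitted, $j,k$ run over $\mathbb{I}_N$ in left actions and over $\mathbb{I}_M$ in right actions, and $i_\pm=i\pm\frac12$. *Case $\imath$.* For $i\neq0$, $$B_it^{(A)}=\sum_jq^{\sum_{k\ge j}(a_{i_+,k}-a_{i_-,k})+1}[a_{i_-,j}]\,t^{(A+E^\theta_{i_+,j}-E^\theta_{i_-,j})},\qquad t^{(A)}B_i=\sum_jq^{\sum_{k>j}(a_{k,i_+}-a_{k,i_-})}[a_{j,i_+}]\,t^{(A+E^\theta_{j,i_-}-E^\theta_{j,i_+})},$$ $$B_0t^{(A)}=\sum_jq^{\sum_{k\ge j}(a_{1/2,k}-a_{-1/2,k})+\delta_{j>0}}[a_{-1/2,j}]\,t^{(A+E^\theta_{1/2,j}-E^\theta_{-1/2,j})}+q^{\sum_{j>0}(a_{1/2,j}-a_{-1/2,j})}t^{(A)},$$ $$t^{(A)}B_0=\sum_jq^{\sum_{k>j}(a_{k,1/2}-a_{k,-1/2})+\delta_{j<0}}[a_{j,1/2}]\,t^{(A+E^\theta_{j,-1/2}-E^\theta_{j,1/2})}+q^{\sum_{j>0}(a_{j,1/2}-a_{j,-1/2})}t^{(A)}.$$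 *Case $\jmath$.* For $i>0$, with $\delta=\delta_{i=1/2}$, $$B_it^{(A)}=\sum_{j\le0}q^{\sum_{k\ge j}(a_{i_+,k}-a_{i_-,k})+1+\delta}[a_{i_-,j}-\delta\delta_{j=0}]\,t^{(A+E^\theta_{i_+,j}-E^\theta_{i_-,j})}+\sum_{j>0}q^{\sum_{k\ge j}(a_{i_+,k}-a_{i_-,k})+1}[a_{i_-,j}]\,t^{(A+E^\theta_{i_+,j}-E^\theta_{i_-,j})},$$ $$B_{-i}t^{(A)}=\sum_jq^{\sum_{k\le j}(a_{i_-,k}-a_{i_+,k})+1}[a_{i_+,j}]\,t^{(A+E^\theta_{i_-,j}-E^\theta_{i_+,j})},\qquad t^{(A)}B_i=\sum_jq^{\sum_{k>j}(a_{k,i_+}-a_{k,i_-})}[a_{j,i_+}]\,t^{(A+E^\theta_{j,i_-}-E^\theta_{j,i_+})},$$ $$t^{(A)}B_{-i}=\sum_{j\le0}q^{\sum_{k<j}(a_{k,i_-}-a_{k,i_+})}[a_{j,i_-}-\delta\delta_{j=0}]\,t^{(A+E^\theta_{j,i_+}-E^\theta_{j,i_-})}+\sum_{j>0}q^{\sum_{k<j}(a_{k,i_-}-a_{k,i_+})-\delta}[a_{j,i_-}]\,t^{(A+E^\theta_{j,i_+}-E^\theta_{j,i_-})}.$$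 *In both cases,* $d_rt^{(A)}=q^{\sum_ka_{r,k}}t^{(A)}$ and $t^{(A)}d_r=q^{\sum_ka_{k,r}}t^{(A)}$ for $r\neq0$, and, if $\mathfrak{c}=\jmath$, $d_0t^{(A)}=q^{(-1+\sum_ka_{0,k})/2}t^{(A)}$ and $t^{(A)}d_0=q^{(-1+\sum_ka_{k,0})/2}t^{(A)}$. **Theorem A.** For all $m,n\in\mathbb{N}$ and $\mathfrak{c}\in\{\imath,\jmath\}$, these formulas define on $\mathcal{V}^{\mathfrak{c}}_{m|n,n}$ the structure of a $(\mathbf{U}^{\mathfrak{c}}_m,\mathbf{U}^{\mathfrak{c}}_n)$-bimodule. Let $\rho=\sum_{r\in\mathbb{I}_N,\,r>0}\epsilon_r$ and let $$\mathcal{V}^{\mathfrak{c},0}_{m|n,n}=\{v\in\mathcal{V}^{\mathfrak{c}}_{m|n,n}\mid v\,d_r=q\,v\ \text{for all } r>0,\ \text{and } v\,d_0=v \text{ if } \mathfrak{c}=\jmath\}$$ be the $\mathbf{U}^{\mathfrak{c}}_n$-weight space of weight $\overline\rho$. Let $V=\mathbb{Q}(q)^M$ be the natural representation of $\mathbf{U}(\mathfrak{gl}_M)$,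 and let $\mathbf{U}^{\mathfrak{c}}_m\subset\mathbf{U}(\mathfrak{gl}_M)$ act on $V^{\otimes n}$ by restriction. Then $\mathcal{V}^{\mathfrak{c},0}_{m|n,n}$ is stable under $\mathbf{U}^{\mathfrak{c}}_m$, and there is an isomorphism of $\mathbf{U}^{\mathfrak{c}}_m$-modules $$\Lambda^{\mathfrak{c}}:V^{\otimes n}\longrightarrow\mathcal{V}^{\mathfrak{c},0}_{m|n,n},\qquad v_{\lambda_1}\otimes\cdots\otimes v_{\lambda_n}\longmapsto t^{(A_\lambda)}\qquad(\lambda\in\mathbb{I}_M^n),$$ where $A_\lambda$ is the matrix with columns $(e_{-\lambda_n},\dots,e_{-\lambda_1},e_{\lambda_1},\dots,e_{\lambda_n})$ if $\mathfrak{c}=\imath$ and $(e_{-\lambda_n},\dots,e_{-\lambda_1},e_0,e_{\lambda_1},\dots,e_{\lambda_n})$ if $\mathfrak{c}=\jmath$, and $e_i$ is the unit column vector whose $i$-th entry is $1$. -/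

import Mathlib

open scoped TensorProduct

noncomputable section

namespace IHowe

/-- The ground field `ℚ(q)`. -/
abbrev Kq := RatFunc ℚ

/-- The indeterminate `q`. -/
def q : Kq := RatFunc.X

/-- The `q`-integer `[r]`. -/
def qInt (r : ℕ) : Kq := (q ^ (r : ℤ) - q ^ (-(r : ℤ))) / (q - q⁻¹)

lemma q_ne_zero : q ≠ 0 := RatFunc.X_ne_zero

lemma q_sub_inv_ne_zero : q - q⁻¹ ≠ 0 := by
  intro h
  have h2 : q * q = 1 := by
    have := congrArg (fun x => x * q) h
    simp only [sub_mul, inv_mul_cancel₀ q_ne_zero, zero_mul] at this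
    exact sub_eq_zero.mp this
  have h3 : (algebraMap (Polynomial ℚ) Kq) (Polynomial.X * Polynomial.X)
      = (algebraMap (Polynomial ℚ) Kq) 1 := by
    rw [map_mul, map_one, RatFunc.algebraMap_X]; exact h2
  have h4 := RatFunc.algebraMap_injective ℚ h3
  have := congrArg (Polynomial.eval 0) h4
  simp at this

lemma qInt_two : qInt 2 = q + q⁻¹ := by
  have h : q ^ (2 : ℤ) - q ^ (-(2 : ℤ)) = (q + q⁻¹) * (q - q⁻¹) := by
    rw [zpow_neg, ← inv_zpow, zpow_ofNat, zpow_ofNat]; ring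
  unfold qInt
  push_cast
  rw [h, mul_div_assoc, div_self q_sub_inv_ne_zero, mul_one]

lemma qInt_two_ne_zero : qInt 2 ≠ 0 := by
  intro h
  rw [qInt_two] at h
  have h2 : q * q + 1 = 0 := by
    have := congrArg (fun x => x * q) h
    simpa only [add_mul, inv_mul_cancel₀ q_ne_zero, zero_mul] using this
  have h3 : (algebraMap (Polynomial ℚ) Kq) (Polynomial.X * Polynomial.X + 1)
      = (algebraMap (Polynomial ℚ) Kq) 0 := by
    rw [map_add, map_mul, map_one, map_zero, RatFunc.algebraMap_X]; exact h2
  have h4 := RatFunc.algebraMap_injective ℚ h3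
  have := congrArg (Polynomial.eval 0) h4
  simp at this

/-! ### Index sets

The index set `𝕀_N = {-(N-1)/2, …, (N-1)/2}` is represented by `Fin N`: the element `k` stands for
the label `k - (N-1)/2`. So negation of labels is `Fin.rev`, the order is the usual one, and for a
label `i ∈ 𝕀_{N-1}` the labels `i - 1/2` and `i + 1/2` of `𝕀_N` are `lo i` and `hi i`. -/

/-- `i ↦ i - 1/2`. -/
def lo {N : ℕ} (i : Fin (N - 1)) : Fin N := ⟨i, by omega⟩

/-- `i ↦ i + 1/2`. -/
def hi {N : ℕ} (i : Fin (N - 1)) : Fin N := ⟨i + 1, by omega⟩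

/-- The label of `k` is positive. -/
abbrev IsPos {N : ℕ} (k : Fin N) : Prop := k.rev < k

/-- The label of `k` is zero (impossible when `N` is even). -/
abbrev IsZero {N : ℕ} (k : Fin N) : Prop := k.rev = k

/-! ### The quantum general linear group -/

/-- Generators of `U(gl_N)`. -/
inductive UGen (N : ℕ) : Type
  | E (i : Fin (N - 1)) : UGen N
  | F (i : Fin (N - 1)) : UGen N
  | D (a : Fin N) : UGen N
  | Dinv (a : Fin N) : UGen N

section Rel
open FreeAlgebra UGen

/-- The free-algebra generators. -/
abbrev gE {N : ℕ} (i : Fin (N - 1)) : FreeAlgebra Kq (UGen N) := ι Kq (E i)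
abbrev gF {N : ℕ} (i : Fin (N - 1)) : FreeAlgebra Kq (UGen N) := ι Kq (F i)
abbrev gD {N : ℕ} (a : Fin N) : FreeAlgebra Kq (UGen N) := ι Kq (D a)
abbrev gDinv {N : ℕ} (a : Fin N) : FreeAlgebra Kq (UGen N) := ι Kq (Dinv a)
abbrev gK {N : ℕ} (i : Fin (N - 1)) : FreeAlgebra Kq (UGen N) := gD (lo i) * gDinv (hi i)
abbrev gKinv {N : ℕ} (i : Fin (N - 1)) : FreeAlgebra Kq (UGen N) := gD (hi i) * gDinv (lo i)

/-- The integer `δ_{a,i-1/2} - δ_{a,i+1/2}`. -/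
def wtE {N : ℕ} (a : Fin N) (i : Fin (N - 1)) : ℤ :=
  (if a = lo i then 1 else 0) - (if a = hi i then 1 else 0)

/-- `|i - j| = 1`. -/
abbrev Adjacent {N : ℕ} (i j : Fin N) : Prop := (i : ℕ) + 1 = j ∨ (j : ℕ) + 1 = i

/-- The defining relations of `U(gl_N)`. -/
inductive URel (N : ℕ) : FreeAlgebra Kq (UGen N) → FreeAlgebra Kq (UGen N) → Prop
  | D_Dinv (a) : URel N (gD a * gDinv a) 1
  | Dinv_D (a) : URel N (gDinv a * gD a) 1
  | D_D (a b) : URel N (gD a * gD b) (gD b * gD a)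
  | D_Dinv_comm (a b) : URel N (gD a * gDinv b) (gDinv b * gD a)
  | Dinv_Dinv (a b) : URel N (gDinv a * gDinv b) (gDinv b * gDinv a)
  | D_E (a i) : URel N (gD a * gE i) (q ^ wtE a i • (gE i * gD a))
  | D_F (a i) : URel N (gD a * gF i) (q ^ (-wtE a i) • (gF i * gD a))
  | E_F (i) : URel N (gE i * gF i - gF i * gE i) ((q - q⁻¹)⁻¹ • (gK i - gKinv i))
  | E_F_ne (i j) : i ≠ j → URel N (gE i * gF j - gF j * gE i) 0
  | E_E (i j) : i ≠ j → ¬ Adjacent i j → URel N (gE i * gE j) (gE j * gE i)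
  | F_F (i j) : i ≠ j → ¬ Adjacent i j → URel N (gF i * gF j) (gF j * gF i)
  | serreE (i j) : Adjacent i j →
      URel N ((qInt 2)⁻¹ • gE i ^ 2 * gE j + gE j * ((qInt 2)⁻¹ • gE i ^ 2)) (gE i * gE j * gE i)
  | serreF (i j) : Adjacent i j →
      URel N ((qInt 2)⁻¹ • gF i ^ 2 * gF j + gF j * ((qInt 2)⁻¹ • gF i ^ 2)) (gF i * gF j * gF i)

end Rel

/-- The quantum general linear group `U(gl_N)` over `ℚ(q)`. -/
abbrev U (N : ℕ) := RingQuot (URel N)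

/-- The quotient map onto `U(gl_N)`. -/
def U.mk (N : ℕ) : FreeAlgebra Kq (UGen N) →ₐ[Kq] U N := RingQuot.mkAlgHom Kq (URel N)

namespace U
variable {N : ℕ}

def E (i : Fin (N - 1)) : U N := mk N (gE i)
def F (i : Fin (N - 1)) : U N := mk N (gF i)
def D (a : Fin N) : U N := mk N (gD a)
def Dinv (a : Fin N) : U N := mk N (gDinv a)
/-- `K_i = D_{i-1/2} D_{i+1/2}⁻¹`. -/
def K (i : Fin (N - 1)) : U N := D (lo i) * Dinv (hi i)
/-- `K_i⁻¹`. -/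
def Kinv (i : Fin (N - 1)) : U N := D (hi i) * Dinv (lo i)

lemma rel {x y : FreeAlgebra Kq (UGen N)} (h : URel N x y) : mk N x = mk N y :=
  RingQuot.mkAlgHom_rel Kq h

end U

/-- The families `e`, `f`, `d`, `d'` of an algebra satisfy the defining relations of `U(gl_N)`. -/
structure IsURep {A : Type*} [Ring A] [Algebra Kq A] {N : ℕ}
    (e f : Fin (N - 1) → A) (d d' : Fin N → A) : Prop where
  D_Dinv : ∀ a, d a * d' a = 1
  Dinv_D : ∀ a, d' a * d a = 1
  D_D : ∀ a b, d a * d b = d b * d a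
  D_Dinv_comm : ∀ a b, d a * d' b = d' b * d a
  Dinv_Dinv : ∀ a b, d' a * d' b = d' b * d' a
  D_E : ∀ a i, d a * e i = q ^ wtE a i • (e i * d a)
  D_F : ∀ a i, d a * f i = q ^ (-wtE a i) • (f i * d a)
  E_F : ∀ i, e i * f i - f i * e i =
    (q - q⁻¹)⁻¹ • (d (lo i) * d' (hi i) - d (hi i) * d' (lo i))
  E_F_ne : ∀ i j, i ≠ j → e i * f j - f j * e i = 0
  E_E : ∀ i j, i ≠ j → ¬ Adjacent i j → e i * e j = e j * e i
  F_F : ∀ i j, i ≠ j → ¬ Adjacent i j → f i * f j = f j * f i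
  serreE : ∀ i j, Adjacent i j →
    (qInt 2)⁻¹ • e i ^ 2 * e j + e j * ((qInt 2)⁻¹ • e i ^ 2) = e i * e j * e i
  serreF : ∀ i j, Adjacent i j →
    (qInt 2)⁻¹ • f i ^ 2 * f j + f j * ((qInt 2)⁻¹ • f i ^ 2) = f i * f j * f i

namespace U
variable {N : ℕ}

lemma isURep : IsURep (N := N) E F D Dinv where
  D_Dinv a := by simpa [D, Dinv] using rel (URel.D_Dinv a)
  Dinv_D a := by simpa [D, Dinv] using rel (URel.Dinv_D a)
  D_D a b := by simpa [D, Dinv] using rel (URel.D_D a b)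
  D_Dinv_comm a b := by simpa [D, Dinv] using rel (URel.D_Dinv_comm a b)
  Dinv_Dinv a b := by simpa [D, Dinv] using rel (URel.Dinv_Dinv a b)
  D_E a i := by simpa [D, E] using rel (URel.D_E a i)
  D_F a i := by simpa only [D, F, map_mul, map_smul] using rel (URel.D_F a i)
  E_F i := by simpa [D, Dinv, E, F] using rel (URel.E_F i)
  E_F_ne i j h := by simpa [E, F] using rel (URel.E_F_ne i j h)
  E_E i j h h' := by simpa only [E, map_mul] using rel (URel.E_E i j h h')
  F_F i j h h' := by simpa only [F, map_mul] using rel (URel.F_F i j h h')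
  serreE i j h := by
    simpa only [E, map_mul, map_add, map_smul, map_pow] using rel (URel.serreE i j h)
  serreF i j h := by
    simpa only [F, map_mul, map_add, map_smul, map_pow] using rel (URel.serreF i j h)

/-- The images of the generators. -/
def genMap {A : Type*} (e f : Fin (N - 1) → A) (d d' : Fin N → A) : UGen N → A
  | .E i => e i
  | .F i => f i
  | .D a => d a
  | .Dinv a => d' a

/-- The algebra homomorphism out of `U(gl_N)` with prescribed values on the generators. -/
def lift {A : Type*} [Ring A] [Algebra Kq A] {e f : Fin (N - 1) → A} {d d' : Fin N → A}
    (h : IsURep e f d d') : U N →ₐ[Kq] A :=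
  RingQuot.liftAlgHom Kq ⟨FreeAlgebra.lift Kq (genMap e f d d'), by
    intro x y hxy
    cases hxy with
    | D_Dinv a => simpa [genMap] using h.D_Dinv a
    | Dinv_D a => simpa [genMap] using h.Dinv_D a
    | D_D a b => simpa [genMap] using h.D_D a b
    | D_Dinv_comm a b => simpa [genMap] using h.D_Dinv_comm a b
    | Dinv_Dinv a b => simpa [genMap] using h.Dinv_Dinv a b
    | D_E a i => simpa [genMap] using h.D_E a i
    | D_F a i =>
      simpa only [map_mul, map_smul, FreeAlgebra.lift_ι_apply, genMap] using h.D_F a i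
    | E_F i => simpa [genMap] using h.E_F i
    | E_F_ne i j hij => simpa [genMap] using h.E_F_ne i j hij
    | E_E i j hij hij' => simpa [genMap] using h.E_E i j hij hij'
    | F_F i j hij hij' => simpa [genMap] using h.F_F i j hij hij'
    | serreE i j hij =>
      simpa only [map_mul, map_add, map_smul, map_pow, FreeAlgebra.lift_ι_apply, genMap]
        using h.serreE i j hij
    | serreF i j hij =>
      simpa only [map_mul, map_add, map_smul, map_pow, FreeAlgebra.lift_ι_apply, genMap]
        using h.serreF i j hij⟩

section
variable {A : Type*} [Ring A] [Algebra Kq A] {e f : Fin (N - 1) → A} {d d' : Fin N → A}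
  (h : IsURep e f d d')

@[simp] lemma lift_E (i : Fin (N - 1)) : lift h (E i) = e i := by
  simp [lift, E, mk, genMap, RingQuot.liftAlgHom_mkAlgHom_apply]
@[simp] lemma lift_F (i : Fin (N - 1)) : lift h (F i) = f i := by
  simp [lift, F, mk, genMap, RingQuot.liftAlgHom_mkAlgHom_apply]
@[simp] lemma lift_D (a : Fin N) : lift h (D a) = d a := by
  simp [lift, D, mk, genMap, RingQuot.liftAlgHom_mkAlgHom_apply]
@[simp] lemma lift_Dinv (a : Fin N) : lift h (Dinv a) = d' a := by
  simp [lift, Dinv, mk, genMap, RingQuot.liftAlgHom_mkAlgHom_apply]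

end

end U

/-! ### Comultiplication and counit -/

lemma serre_add_aux {k A : Type*} [Field k] [Ring A] [Algebra k A] {s c : k} (q0 : s ≠ 0)
    (hc : c = s + s⁻¹) (c0 : c ≠ 0) {a b x y : A}
    (hba : b * a = s ^ 2 • (a * b)) (hbx : b * x = s⁻¹ • (x * b))
    (hya : y * a = s⁻¹ • (a * y))
    (hax : c⁻¹ • a ^ 2 * x + x * (c⁻¹ • a ^ 2) = a * x * a)
    (hby : c⁻¹ • b ^ 2 * y + y * (c⁻¹ • b ^ 2) = b * y * b) :
    c⁻¹ • (a + b) ^ 2 * (x + y) + (x + y) * (c⁻¹ • (a + b) ^ 2) = (a + b) * (x + y) * (a + b) := by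
  have h3 : s ^ 2 + 1 ≠ 0 := by
    intro hh; apply c0; rw [hc]; field_simp; linear_combination hh
  have hba' (z : A) : b * (a * z) = s ^ 2 • (a * (b * z)) := by
    rw [← mul_assoc, hba, smul_mul_assoc, mul_assoc]
  have hbx' (z : A) : b * (x * z) = s⁻¹ • (x * (b * z)) := by
    rw [← mul_assoc, hbx, smul_mul_assoc, mul_assoc]
  have hya' (z : A) : y * (a * z) = s⁻¹ • (a * (y * z)) := by
    rw [← mul_assoc, hya, smul_mul_assoc, mul_assoc]
  subst hc
  simp only [pow_two a, pow_two b, pow_two (a + b), mul_add, add_mul, smul_add, mul_smul_comm,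
    smul_mul_assoc, smul_smul, mul_assoc, hba, hbx, hya, hba', hbx', hya'] at hax hby ⊢
  have e := congrArg₂ (fun u v : A => u + v) (sub_eq_zero.mpr hax) (sub_eq_zero.mpr hby)
  refine sub_eq_zero.mp (Eq.trans ?_ (e.trans (add_zero 0)))
  match_scalars <;> field_simp <;> ring

lemma serre_add {A : Type*} [Ring A] [Algebra Kq A] {a b x y : A}
    (hba : b * a = q ^ (2 : ℤ) • (a * b)) (hbx : b * x = q ^ (-1 : ℤ) • (x * b))
    (hya : y * a = q ^ (-1 : ℤ) • (a * y))
    (hax : (qInt 2)⁻¹ • a ^ 2 * x + x * ((qInt 2)⁻¹ • a ^ 2) = a * x * a)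
    (hby : (qInt 2)⁻¹ • b ^ 2 * y + y * ((qInt 2)⁻¹ • b ^ 2) = b * y * b) :
    (qInt 2)⁻¹ • (a + b) ^ 2 * (x + y) + (x + y) * ((qInt 2)⁻¹ • (a + b) ^ 2)
      = (a + b) * (x + y) * (a + b) := by
  rw [zpow_neg_one] at hbx hya
  exact serre_add_aux q_ne_zero qInt_two qInt_two_ne_zero (by exact_mod_cast hba) hbx hya hax hby

namespace U
variable {N : ℕ}

lemma Dinv_mul_of {A : Type*} [Ring A] [Algebra Kq A] {d d' x : A} {c : ℤ}
    (h1 : d' * d = 1) (h2 : d * d' = 1) (h : d * x = q ^ c • (x * d)) :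
    d' * x = q ^ (-c) • (x * d') := by
  have : d' * (d * x) * d' = q ^ c • (d' * x) := by
    rw [h, mul_smul_comm, smul_mul_assoc, mul_assoc, mul_assoc, h2, mul_one]
  rw [← mul_assoc, h1, one_mul] at this
  rw [this, smul_smul, ← zpow_add₀ q_ne_zero]; simp

/-- The Cartan integers of `gl_N`. -/
def cart (i j : Fin (N - 1)) : ℤ := wtE (lo i) j - wtE (hi i) j

lemma cart_self (i : Fin (N - 1)) : cart i i = 2 := by
  simp [cart, wtE, lo, hi]

lemma cart_adj {i j : Fin (N - 1)} (h : Adjacent i j) : cart i j = -1 := by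
  simp only [cart, wtE, lo, hi, Fin.ext_iff]
  unfold Adjacent at h
  split_ifs <;> omega

lemma cart_comm (i j : Fin (N - 1)) : cart i j = cart j i := by
  simp only [cart, wtE, lo, hi, Fin.ext_iff]
  split_ifs <;> omega

lemma cart_far {i j : Fin (N - 1)} (h : i ≠ j) (h' : ¬ Adjacent i j) : cart i j = 0 := by
  rw [Ne, Fin.ext_iff] at h
  simp only [cart, wtE, lo, hi, Fin.ext_iff]
  unfold Adjacent at h'
  split_ifs <;> omega

lemma comm_mul {A : Type*} [Ring A] [Algebra Kq A] {u v x : A} {c c' : ℤ}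
    (hu : u * x = q ^ c • (x * u)) (hv : v * x = q ^ c' • (x * v)) :
    u * v * x = q ^ (c + c') • (x * (u * v)) := by
  rw [mul_assoc, hv, mul_smul_comm, ← mul_assoc, hu, smul_mul_assoc, smul_smul, mul_assoc,
    ← zpow_add₀ q_ne_zero, add_comm]

lemma Dinv_E (a : Fin N) (i : Fin (N - 1)) : Dinv a * E i = q ^ (-wtE a i) • (E i * Dinv a) :=
  Dinv_mul_of (isURep.Dinv_D a) (isURep.D_Dinv a) (isURep.D_E a i)

lemma Dinv_F (a : Fin N) (i : Fin (N - 1)) : Dinv a * F i = q ^ (wtE a i) • (F i * Dinv a) := by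
  simpa using Dinv_mul_of (isURep.Dinv_D a) (isURep.D_Dinv a) (isURep.D_F a i)

lemma K_E (i j : Fin (N - 1)) : K i * E j = q ^ cart i j • (E j * K i) :=
  comm_mul (isURep.D_E _ _) (Dinv_E _ _)

lemma Kinv_F (i j : Fin (N - 1)) : Kinv i * F j = q ^ cart i j • (F j * Kinv i) := by
  have := comm_mul (isURep.D_F (hi i) j) (Dinv_F (lo i) j)
  rwa [neg_add_eq_sub] at this

lemma K_F (i j : Fin (N - 1)) : K i * F j = q ^ (-cart i j) • (F j * K i) := by
  have := comm_mul (isURep.D_F (lo i) j) (Dinv_F (hi i) j)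
  rwa [show -wtE (lo i) j + wtE (hi i) j = -cart i j by unfold cart; ring] at this

lemma Kinv_E (i j : Fin (N - 1)) : Kinv i * E j = q ^ (-cart i j) • (E j * Kinv i) := by
  have := comm_mul (isURep.D_E (hi i) j) (Dinv_E (lo i) j)
  rwa [show wtE (hi i) j + -wtE (lo i) j = -cart i j by unfold cart; ring] at this

lemma K_K (i j : Fin (N - 1)) : K i * K j = K j * K i := by
  have h : ∀ a b : Fin N, Commute (D a) (D b) := fun a b => isURep.D_D a b
  have h1 : ∀ a b : Fin N, Commute (D a) (Dinv b) := fun a b => isURep.D_Dinv_comm a b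
  have h2 : ∀ a b : Fin N, Commute (Dinv a) (Dinv b) := fun a b => isURep.Dinv_Dinv a b
  exact ((h _ _).mul_right (h1 _ _)).mul_left ((h1 _ _).symm.mul_right (h2 _ _))

lemma Kinv_Kinv (i j : Fin (N - 1)) : Kinv i * Kinv j = Kinv j * Kinv i := by
  have h : ∀ a b : Fin N, Commute (D a) (D b) := fun a b => isURep.D_D a b
  have h1 : ∀ a b : Fin N, Commute (D a) (Dinv b) := fun a b => isURep.D_Dinv_comm a b
  have h2 : ∀ a b : Fin N, Commute (Dinv a) (Dinv b) := fun a b => isURep.Dinv_Dinv a b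
  exact ((h _ _).mul_right (h1 _ _)).mul_left ((h1 _ _).symm.mul_right (h2 _ _))

open Algebra.TensorProduct in
lemma isURep_comul : IsURep (N := N) (A := U N ⊗[Kq] U N)
    (fun i => E i ⊗ₜ 1 + K i ⊗ₜ E i) (fun i => F i ⊗ₜ Kinv i + 1 ⊗ₜ F i)
    (fun a => D a ⊗ₜ D a) (fun a => Dinv a ⊗ₜ Dinv a) where
  D_Dinv a := by simp [isURep.D_Dinv, one_def]
  Dinv_D a := by simp [isURep.Dinv_D, one_def]
  D_D a b := by simp [isURep.D_D a b]
  D_Dinv_comm a b := by simp [isURep.D_Dinv_comm a b]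
  Dinv_Dinv a b := by simp [isURep.Dinv_Dinv a b]
  D_E a i := by
    have hK : D a * K i = K i * D a := by
      have h : Commute (D a) (K i) :=
        Commute.mul_right (isURep.D_D a (lo i)) (isURep.D_Dinv_comm a (hi i))
      exact h
    simp only [mul_add, add_mul, tmul_mul_tmul, mul_one, one_mul, isURep.D_E a i, hK,
      TensorProduct.smul_tmul', TensorProduct.tmul_smul, smul_add]
  D_F a i := by
    have hK : D a * Kinv i = Kinv i * D a := by
      have h : Commute (D a) (Kinv i) :=
        Commute.mul_right (isURep.D_D a (hi i)) (isURep.D_Dinv_comm a (lo i))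
      exact h
    simp only [mul_add, add_mul, tmul_mul_tmul, mul_one, one_mul, isURep.D_F a i, hK,
      TensorProduct.smul_tmul', TensorProduct.tmul_smul, smul_add]
  E_F i := by
    have h := isURep.E_F i
    rw [sub_eq_iff_eq_add] at h
    change E i * F i = (q - q⁻¹)⁻¹ • (K i - Kinv i) + F i * E i at h
    have h1 := K_F i i
    have h2 := Kinv_E i i
    simp only [mul_add, add_mul, tmul_mul_tmul, mul_one, one_mul, h, h1, h2,
      TensorProduct.tmul_smul, TensorProduct.add_tmul,
      TensorProduct.tmul_add, TensorProduct.sub_tmul, TensorProduct.tmul_sub, smul_sub,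
      ← TensorProduct.smul_tmul']
    change _ = (q - q⁻¹)⁻¹ • (K i ⊗ₜ[Kq] K i) - (q - q⁻¹)⁻¹ • (Kinv i ⊗ₜ[Kq] Kinv i)
    abel
  E_F_ne i j hij := by
    have h := sub_eq_zero.mp (isURep.E_F_ne i j hij)
    have h1 := K_F i j
    have h2 := Kinv_E j i
    rw [cart_comm] at h2
    simp only [mul_add, add_mul, tmul_mul_tmul, mul_one, one_mul, h, h1, h2,
      TensorProduct.smul_tmul', TensorProduct.tmul_smul]
    abel
  E_E i j h h' := by
    have h1 := isURep.E_E i j h h'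
    have h2 := K_E i j
    have h3 := K_E j i
    rw [cart_comm] at h3
    rw [cart_far h h', zpow_zero, one_smul] at h2 h3
    simp only [mul_add, add_mul, tmul_mul_tmul, mul_one, one_mul, h1, h2, h3, K_K i j]
    abel
  F_F i j h h' := by
    have h1 := isURep.F_F i j h h'
    have h2 := Kinv_F i j
    have h3 := Kinv_F j i
    rw [cart_comm] at h3
    rw [cart_far h h', zpow_zero, one_smul] at h2 h3
    simp only [mul_add, add_mul, tmul_mul_tmul, mul_one, one_mul, h1, h2, h3, Kinv_Kinv i j]
    abel
  serreE i j h := by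
    refine serre_add (A := U N ⊗[Kq] U N) (a := E i ⊗ₜ 1) (b := K i ⊗ₜ E i) (x := E j ⊗ₜ 1)
      (y := K j ⊗ₜ E j) ?_ ?_ ?_ ?_ ?_
    · simp only [tmul_mul_tmul, mul_one, one_mul, K_E, cart_self, TensorProduct.smul_tmul']
    · simp only [tmul_mul_tmul, mul_one, one_mul, K_E, cart_adj h, TensorProduct.smul_tmul']
    · simp only [tmul_mul_tmul, mul_one, one_mul, K_E, cart_comm j i, cart_adj h,
        TensorProduct.smul_tmul']
    · have := congrArg (fun z => z ⊗ₜ[Kq] (1 : U N)) (isURep.serreE i j h)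
      simpa only [pow_two, tmul_mul_tmul, mul_one, TensorProduct.add_tmul,
        TensorProduct.smul_tmul', smul_mul_assoc, mul_smul_comm] using this
    · have := congrArg (fun z => (K i * K i * K j) ⊗ₜ[Kq] z) (isURep.serreE i j h)
      simpa only [pow_two, tmul_mul_tmul, TensorProduct.tmul_add, TensorProduct.tmul_smul,
        smul_mul_assoc, mul_smul_comm, mul_assoc, K_K j i,
        (show K j * (K i * K i) = K i * (K i * K j) by
          rw [← mul_assoc, K_K j i, mul_assoc, K_K j i])] using this
  serreF i j h := by
    rw [add_comm (F i ⊗ₜ[Kq] Kinv i), add_comm (F j ⊗ₜ[Kq] Kinv j)]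
    refine serre_add (A := U N ⊗[Kq] U N) (a := 1 ⊗ₜ F i) (b := F i ⊗ₜ Kinv i) (x := 1 ⊗ₜ F j)
      (y := F j ⊗ₜ Kinv j) ?_ ?_ ?_ ?_ ?_
    · simp only [tmul_mul_tmul, mul_one, one_mul, Kinv_F, cart_self, TensorProduct.tmul_smul]
    · simp only [tmul_mul_tmul, mul_one, one_mul, Kinv_F, cart_adj h, TensorProduct.tmul_smul]
    · simp only [tmul_mul_tmul, mul_one, one_mul, Kinv_F, cart_comm j i, cart_adj h,
        TensorProduct.tmul_smul]
    · have := congrArg (fun z => (1 : U N) ⊗ₜ[Kq] z) (isURep.serreF i j h)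
      simpa only [pow_two, tmul_mul_tmul, mul_one, TensorProduct.tmul_add,
        TensorProduct.tmul_smul, smul_mul_assoc, mul_smul_comm] using this
    · have := congrArg (fun z => z ⊗ₜ[Kq] (Kinv i * Kinv i * Kinv j)) (isURep.serreF i j h)
      simpa only [pow_two, tmul_mul_tmul, TensorProduct.add_tmul, TensorProduct.smul_tmul',
        smul_mul_assoc, mul_smul_comm, mul_assoc, Kinv_Kinv j i,
        (show Kinv j * (Kinv i * Kinv i) = Kinv i * (Kinv i * Kinv j) by
          rw [← mul_assoc, Kinv_Kinv j i, mul_assoc, Kinv_Kinv j i])] using this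

/-- The comultiplication: `Δ(E_i) = E_i ⊗ 1 + K_i ⊗ E_i`, `Δ(F_i) = F_i ⊗ K_i⁻¹ + 1 ⊗ F_i`,
`Δ(D_a) = D_a ⊗ D_a`. -/
def comul (N : ℕ) : U N →ₐ[Kq] U N ⊗[Kq] U N := lift isURep_comul

lemma isURep_counit : IsURep (N := N) (A := Kq) (fun _ => 0) (fun _ => 0) (fun _ => 1)
    (fun _ => 1) where
  D_Dinv := by simp
  Dinv_D := by simp
  D_D := by simp
  D_Dinv_comm := by simp
  Dinv_Dinv := by simp
  D_E := by simp
  D_F := by simp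
  E_F := by simp
  E_F_ne := by simp
  E_E := by simp
  F_F := by simp
  serreE := by simp
  serreF := by simp

/-- The counit: `ε(E_i) = ε(F_i) = 0`, `ε(D_a) = 1`. -/
def counit (N : ℕ) : U N →ₐ[Kq] Kq := lift isURep_counit

lemma lo_ne_hi (i : Fin (N - 1)) : lo i ≠ hi i := by
  simp [lo, hi, Fin.ext_iff]

lemma isURep_natural : IsURep (N := N) (A := Matrix (Fin N) (Fin N) Kq)
    (fun i => Matrix.single (lo i) (hi i) 1) (fun i => Matrix.single (hi i) (lo i) 1)
    (fun a => Matrix.diagonal fun b => if b = a then q else 1)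
    (fun a => Matrix.diagonal fun b => if b = a then q⁻¹ else 1) where
  D_Dinv a := by
    rw [Matrix.diagonal_mul_diagonal, ← Matrix.diagonal_one]
    congr 1; ext b; split_ifs <;> simp [q_ne_zero]
  Dinv_D a := by
    rw [Matrix.diagonal_mul_diagonal, ← Matrix.diagonal_one]
    congr 1; ext b; split_ifs <;> simp [q_ne_zero]
  D_D a b := by simp only [Matrix.diagonal_mul_diagonal, mul_comm]
  D_Dinv_comm a b := by simp only [Matrix.diagonal_mul_diagonal, mul_comm]
  Dinv_Dinv a b := by simp only [Matrix.diagonal_mul_diagonal, mul_comm]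
  D_E a i := by
    have h := lo_ne_hi i
    ext r s
    rw [Matrix.diagonal_mul, Matrix.smul_apply, Matrix.mul_diagonal, Matrix.single_apply, wtE]
    by_cases hrs : lo i = r ∧ hi i = s
    · obtain ⟨rfl, rfl⟩ := hrs
      by_cases h1 : a = lo i
      · subst h1; simp [h, h.symm]
      · by_cases h2 : a = hi i
        · subst h2; simp [h, h.symm, q_ne_zero]
        · simp [h1, h2, Ne.symm h1, Ne.symm h2]
    · simp [hrs]
  D_F a i := by
    have h := lo_ne_hi i
    ext r s
    rw [Matrix.diagonal_mul, Matrix.smul_apply, Matrix.mul_diagonal, Matrix.single_apply, wtE]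
    by_cases hrs : hi i = r ∧ lo i = s
    · obtain ⟨rfl, rfl⟩ := hrs
      by_cases h1 : a = lo i
      · subst h1; simp [h, h.symm, q_ne_zero]
      · by_cases h2 : a = hi i
        · subst h2; simp [h, h.symm]
        · simp [h1, h2, Ne.symm h1, Ne.symm h2]
    · simp [hrs]
  E_F i := by
    have h := lo_ne_hi i
    have hq := q_sub_inv_ne_zero
    have hq' : q⁻¹ - q ≠ 0 := by rw [← neg_sub]; exact neg_ne_zero.mpr hq
    simp only [Matrix.single_mul_single_same, Matrix.diagonal_mul_diagonal, mul_one]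
    ext r s
    rw [Matrix.smul_apply, Matrix.sub_apply, Matrix.sub_apply, Matrix.single_apply,
      Matrix.single_apply, Matrix.diagonal_apply, Matrix.diagonal_apply]
    by_cases hrs : r = s
    · subst hrs
      by_cases h1 : r = lo i
      · subst h1
        simp [h, h.symm, hq]
      · by_cases h2 : r = hi i
        · subst h2
          simp only [h, h.symm, if_true, if_false, and_self, zero_sub, one_mul, mul_one,
            smul_eq_mul]
          rw [← neg_sub q q⁻¹, mul_neg, inv_mul_cancel₀ hq]
        · simp [h1, h2, Ne.symm h1, Ne.symm h2]
    · have : ∀ c : Fin N, ¬ (c = r ∧ c = s) := fun c hc => hrs (hc.1 ▸ hc.2)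
      simp [hrs, this]
  E_F_ne i j h := by
    have h1 : hi i ≠ hi j := fun e => h (by simpa [hi, Fin.ext_iff] using e)
    have h2 : lo j ≠ lo i := fun e => h (by simpa [lo, Fin.ext_iff, eq_comm] using e)
    rw [Matrix.single_mul_single_of_ne _ _ _ _ h1, Matrix.single_mul_single_of_ne _ _ _ _ h2,
      sub_zero]
  E_E i j h h' := by
    have h1 : hi i ≠ lo j := fun e => h' (Or.inl (by simpa [hi, lo, Fin.ext_iff] using e))
    have h2 : hi j ≠ lo i := fun e => h' (Or.inr (by simpa [hi, lo, Fin.ext_iff] using e))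
    rw [Matrix.single_mul_single_of_ne _ _ _ _ h1, Matrix.single_mul_single_of_ne _ _ _ _ h2]
  F_F i j h h' := by
    have h1 : lo i ≠ hi j := fun e =>
      h' (Or.inr (by simpa [hi, lo, Fin.ext_iff, eq_comm] using e))
    have h2 : lo j ≠ hi i := fun e =>
      h' (Or.inl (by simpa [hi, lo, Fin.ext_iff, eq_comm] using e))
    rw [Matrix.single_mul_single_of_ne _ _ _ _ h1, Matrix.single_mul_single_of_ne _ _ _ _ h2]
  serreE i j h := by
    rw [pow_two, Matrix.single_mul_single_of_ne _ _ _ _ (lo_ne_hi i).symm]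
    by_cases h1 : hi i = lo j
    · have h2 : hi j ≠ lo i := by
        simp only [hi, lo, Fin.ext_iff, ne_eq] at h1 ⊢; omega
      rw [mul_assoc, Matrix.single_mul_single_of_ne _ _ _ _ h2]; simp
    · rw [Matrix.single_mul_single_of_ne _ _ _ _ h1]; simp
  serreF i j h := by
    rw [pow_two, Matrix.single_mul_single_of_ne _ _ _ _ (lo_ne_hi i)]
    by_cases h1 : lo i = hi j
    · have h2 : lo j ≠ hi i := by
        simp only [hi, lo, Fin.ext_iff, ne_eq] at h1 ⊢; omega
      rw [mul_assoc, Matrix.single_mul_single_of_ne _ _ _ _ h2]; simp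
    · rw [Matrix.single_mul_single_of_ne _ _ _ _ h1]; simp

/-- The natural representation of `U(gl_N)` on `V = ℚ(q)^N`: with `v_r = Pi.single r 1`,
`E_i v_r = δ_{i+1/2,r} v_{r-1}`, `F_i v_r = δ_{i-1/2,r} v_{r+1}`, `D_s v_r = q^{δ_{s,r}} v_r`. -/
def natural (N : ℕ) : U N →ₐ[Kq] Module.End Kq (Fin N → Kq) :=
  (Matrix.toLinAlgEquiv' : Matrix (Fin N) (Fin N) Kq ≃ₐ[Kq] _).toAlgHom.comp (lift isURep_natural)

/-- The tensor product of two representations, through the comultiplication. -/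
def tensorRep {V W : Type} [AddCommGroup V] [Module Kq V] [AddCommGroup W] [Module Kq W]
    (ρ : U N →ₐ[Kq] Module.End Kq V) (σ : U N →ₐ[Kq] Module.End Kq W) :
    U N →ₐ[Kq] Module.End Kq (V ⊗[Kq] W) :=
  (Module.endTensorEndAlgHom.comp (Algebra.TensorProduct.map ρ σ)).comp (comul N)

/-- The identification `V^{⊗n} ⊗ V ≃ V^{⊗(n+1)}`. -/
def snocEquiv (V : Type) [AddCommGroup V] [Module Kq V] (n : ℕ) :
    (⨂[Kq]^n V) ⊗[Kq] V ≃ₗ[Kq] ⨂[Kq]^(n + 1) V :=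
  (TensorProduct.congr (LinearEquiv.refl Kq _)
    (PiTensorProduct.subsingletonEquiv (R := Kq) (s := fun _ : Fin 1 => V) 0).symm).trans
    TensorPower.mulEquiv

/-- The representation of `U(gl_N)` on the `n`-th tensor power of a representation `V`, through the
iterated comultiplication (the counit for `n = 0`). -/
def tensorPow {V : Type} [AddCommGroup V] [Module Kq V] (ρ : U N →ₐ[Kq] Module.End Kq V) :
    (n : ℕ) → (U N →ₐ[Kq] Module.End Kq (⨂[Kq]^n V))
  | 0 => (Algebra.ofId Kq _).comp (counit N)
  | n + 1 => ((snocEquiv V n).conjAlgEquiv Kq).toAlgHom.comp (tensorRep (tensorPow ρ n) ρ)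

/-! ### The iquantum groups -/

/-- `B_i = F_i + E_{-i} K_i⁻¹` for `i ≠ 0`, and `B_0 = F_0 + q⁻¹ E_0 K_0⁻¹ + K_0⁻¹`. -/
def Bi (i : Fin (N - 1)) : U N :=
  if IsZero i then F i + q⁻¹ • (E i * Kinv i) + Kinv i else F i + E i.rev * Kinv i

/-- `B_i = F_i + E_{-i} K_i⁻¹` for `i > 0`, and `B_i = F_i + K_i⁻¹ E_{-i}` for `i < 0`. -/
def Bj (i : Fin (N - 1)) : U N :=
  if IsPos i then F i + E i.rev * Kinv i else F i + Kinv i * E i.rev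

/-- `d_r = D_r D_{-r}` for `r ≠ 0`, and `d_0 = D_0`. -/
def d (r : Fin N) : U N := if IsZero r then D r else D r * D r.rev

/-- `d_r⁻¹`. -/
def dinv (r : Fin N) : U N := if IsZero r then Dinv r else Dinv r * Dinv r.rev

end U

/-- The iquantum group `U^ı_n ⊆ U(gl_{2n})`. -/
def Ui (n : ℕ) : Subalgebra Kq (U (2 * n)) :=
  Algebra.adjoin Kq (Set.range U.Bi ∪ Set.range U.d ∪ Set.range U.dinv)

/-- The iquantum group `U^ȷ_n ⊆ U(gl_{2n+1})`. -/
def Uj (n : ℕ) : Subalgebra Kq (U (2 * n + 1)) :=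
  Algebra.adjoin Kq (Set.range U.Bj ∪ Set.range U.d ∪ Set.range U.dinv)

namespace Ui
variable {n : ℕ}

/-- The generators of `U^ı_n` as elements of it. -/
def B (i : Fin (2 * n - 1)) : Ui n :=
  ⟨U.Bi i, Algebra.subset_adjoin (Or.inl (Or.inl ⟨i, rfl⟩))⟩
def d (r : Fin (2 * n)) : Ui n :=
  ⟨U.d r, Algebra.subset_adjoin (Or.inl (Or.inr ⟨r, rfl⟩))⟩

end Ui

namespace Uj
variable {n : ℕ}

/-- The generators of `U^ȷ_n` as elements of it. -/
def B (i : Fin (2 * n + 1 - 1)) : Uj n :=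
  ⟨U.Bj i, Algebra.subset_adjoin (Or.inl (Or.inl ⟨i, rfl⟩))⟩
def d (r : Fin (2 * n + 1)) : Uj n :=
  ⟨U.d r, Algebra.subset_adjoin (Or.inl (Or.inr ⟨r, rfl⟩))⟩

end Uj

/-! ### The quantum coordinate ring and its quotient -/

/-- Free generators of the quantum coordinate ring. -/
abbrev gt {P : ℕ} (i j : Fin P) : FreeAlgebra Kq (Fin P × Fin P) := FreeAlgebra.ι Kq (i, j)

/-- The defining relations of the quantum coordinate ring, for `i < k` and `j < l`. -/
inductive TRel (P : ℕ) :
    FreeAlgebra Kq (Fin P × Fin P) → FreeAlgebra Kq (Fin P × Fin P) → Prop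
  | col (i k j) : i < k → TRel P (gt i j * gt k j) (q • (gt k j * gt i j))
  | row (i j l) : j < l → TRel P (gt i j * gt i l) (q • (gt i l * gt i j))
  | anti (i k j l) : i < k → j < l → TRel P (gt i l * gt k j) (gt k j * gt i l)
  | diag (i k j l) : i < k → j < l →
      TRel P (gt i j * gt k l) (gt k l * gt i j + (q - q⁻¹) • (gt i l * gt k j))

/-- The quantum coordinate ring `𝒯_P` generated by `t_{ij}`, `i, j ∈ 𝕀_P`. -/
abbrev T (P : ℕ) := RingQuot (TRel P)

/-- The generators `t_{ij}`. -/
def t {P : ℕ} (i j : Fin P) : T P := RingQuot.mkAlgHom Kq (TRel P) (gt i j)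

/-- For `i, j > 0`: the elements `t_{i,j} - t_{-i,-j} - (q - q⁻¹) t_{i,-j}` and
`t_{i,-j} - t_{-i,j}`, and, if `P` is odd, also `t_{i,0} - q t_{-i,0}` and
`t_{0,j} - q t_{0,-j}`. -/
def idealGens (P : ℕ) : Set (T P) :=
  {x | (∃ i j : Fin P, IsPos i ∧ IsPos j ∧
      (x = t i j - t i.rev j.rev - (q - q⁻¹) • t i j.rev ∨ x = t i j.rev - t i.rev j)) ∨
    (∃ i z : Fin P, IsPos i ∧ IsZero z ∧
      (x = t i z - q • t i.rev z ∨ x = t z i - q • t z i.rev))}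

/-- The right ideal generated by `idealGens P`, as a `ℚ(q)`-subspace. -/
def rightIdeal (P : ℕ) : Submodule Kq (T P) :=
  Submodule.span Kq {z | ∃ x ∈ idealGens P, ∃ y, z = x * y}

/-- The quotient of `𝒯_P` by the right ideal: `𝒯^ı_p` for `P = 2p`, `𝒯^ȷ_p` for `P = 2p+1`. -/
abbrev TQuot (P : ℕ) := T P ⧸ rightIdeal P

/-- Inclusion of labels `𝕀_M ⊆ 𝕀_P`, for `M ≤ P` of the same parity. -/
def emb {M P : ℕ} (h : M ≤ P) (k : Fin M) : Fin P := ⟨k + (P - M) / 2, by omega⟩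

section
variable {M N : ℕ}

/-- The exponent of `t_{ij}` in `t^{(A)}`: it is `a_{ij}` if `(i,j) > (0,0)` lexicographically,
`(a_{00}-1)/2` if `(i,j) = (0,0)`, and `0` otherwise. -/
def tExp (A : Matrix (Fin M) (Fin N) ℕ) (i : Fin M) (j : Fin N) : ℕ :=
  if IsPos i ∨ (IsZero i ∧ IsPos j) then A i j
  else if IsZero i ∧ IsZero j then (A i j - 1) / 2
  else 0

/-- The monomial `t^{(A)}`: the product of the powers of the `t_{ij}`, in increasing lexicographic
order of `(i,j)`, as an element of `TQuot (max M N)`. -/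
def tA (A : Matrix (Fin M) (Fin N) ℕ) : TQuot (max M N) :=
  Submodule.Quotient.mk
    (((List.finRange M).flatMap fun i => (List.finRange N).map fun j =>
      t (emb (le_max_left M N) i) (emb (le_max_right M N) j) ^ tExp A i j).prod)

/-- Matrices with `a_{ij} = a_{-i,-j}` and total sum `s`. -/
def Xi (M N s : ℕ) : Set (Matrix (Fin M) (Fin N) ℕ) :=
  {A | (∀ i j, A i j = A i.rev j.rev) ∧ ∑ i, ∑ j, A i j = s}

/-- The span of the `t^{(A)}`, `A ∈ Xi M N s`. -/
def V (M N s : ℕ) : Submodule Kq (TQuot (max M N)) :=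
  Submodule.span Kq (tA '' Xi M N s)

/-- `t^{(A)}` as an element of the span. -/
def tVec {s : ℕ} (A : Matrix (Fin M) (Fin N) ℕ) (hA : A ∈ Xi M N s) : V M N s :=
  ⟨tA A, Submodule.subset_span ⟨A, hA, rfl⟩⟩

/-- `E^θ_{ij} = E_{ij} + E_{-i,-j}`. -/
def Eθ (i : Fin M) (j : Fin N) : Matrix (Fin M) (Fin N) ℕ :=
  Matrix.single i j 1 + Matrix.single i.rev j.rev 1

/-- The exponent by which `d_r` acts, for a row or column `r` with sum `s`. -/
def dExp {P : ℕ} (r : Fin P) (s : ℕ) : ℕ := if IsZero r then (s - 1) / 2 else s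

/-- Columns `f` of unit vectors: the `c`-th column is `e_{f(c)}`. -/
def unitColumns (f : Fin N → Fin M) : Matrix (Fin M) (Fin N) ℕ :=
  fun i c => if f c = i then 1 else 0

/-- The weight `ρ = ∑_{r > 0} ε_r`. -/
def rho (N : ℕ) : Fin N → ℤ := fun r => if IsPos r then 1 else 0

/-- The exponent of `q` by which `d_r` acts on weight `μ̄`. -/
def iwt (μ : Fin N → ℤ) (r : Fin N) : ℤ := if IsZero r then μ r else μ r + μ r.rev

end

/-- `𝒱^ı_{m|n,d}`. -/
abbrev Vi (m n d : ℕ) := V (2 * m) (2 * n) (2 * d)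

/-- `𝒱^ȷ_{m|n,d}`. -/
abbrev Vj (m n d : ℕ) := V (2 * m + 1) (2 * n + 1) (2 * d + 1)

/-! ### The actions, type `ı`

In the sums below, a summand in which `A + E^θ - E^θ` would have a negative entry has coefficient
zero. -/

section i
variable {m n : ℕ}

/-- `B_i t^{(A)}`. -/
def leftBi (i : Fin (2 * m - 1)) (A : Matrix (Fin (2 * m)) (Fin (2 * n)) ℕ) :
    TQuot (max (2 * m) (2 * n)) :=
  if IsZero i then
    (∑ j, (q ^ (∑ k ∈ Finset.Ici j, ((A (hi i) k : ℤ) - A (lo i) k) + if IsPos j then 1 else 0)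
        * qInt (A (lo i) j)) • tA (A + Eθ (hi i) j - Eθ (lo i) j))
      + q ^ (∑ j with IsPos j, ((A (hi i) j : ℤ) - A (lo i) j)) • tA A
  else
    ∑ j, (q ^ (∑ k ∈ Finset.Ici j, ((A (hi i) k : ℤ) - A (lo i) k) + 1)
        * qInt (A (lo i) j)) • tA (A + Eθ (hi i) j - Eθ (lo i) j)

/-- `t^{(A)} B_i`. -/
def rightBi (i : Fin (2 * n - 1)) (A : Matrix (Fin (2 * m)) (Fin (2 * n)) ℕ) :
    TQuot (max (2 * m) (2 * n)) :=
  if IsZero i then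
    (∑ j, (q ^ (∑ k ∈ Finset.Ioi j, ((A k (hi i) : ℤ) - A k (lo i)) + if j < j.rev then 1 else 0)
        * qInt (A j (hi i))) • tA (A + Eθ j (lo i) - Eθ j (hi i)))
      + q ^ (∑ j with IsPos j, ((A j (hi i) : ℤ) - A j (lo i))) • tA A
  else
    ∑ j, (q ^ (∑ k ∈ Finset.Ioi j, ((A k (hi i) : ℤ) - A k (lo i)))
        * qInt (A j (hi i))) • tA (A + Eθ j (lo i) - Eθ j (hi i))

/-- The left action of `U^ı_m` on `𝒱^ı_{m|n,d}`. -/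
structure IsLeftActionI {d : ℕ} (Φ : Ui m →ₐ[Kq] Module.End Kq (Vi m n d)) : Prop where
  map_d : ∀ r A (hA : A ∈ Xi _ _ _),
    (Φ (Ui.d r) (tVec A hA) : TQuot _) = q ^ dExp r (∑ k, A r k) • tA A
  map_B : ∀ i A (hA : A ∈ Xi _ _ _), (Φ (Ui.B i) (tVec A hA) : TQuot _) = leftBi i A

/-- The right action of `U^ı_n` on `𝒱^ı_{m|n,d}`; `Ψ (op y) v` is `v · y`. -/
structure IsRightActionI {d : ℕ} (Ψ : (Ui n)ᵐᵒᵖ →ₐ[Kq] Module.End Kq (Vi m n d)) : Prop where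
  map_d : ∀ r A (hA : A ∈ Xi _ _ _),
    (Ψ (.op (Ui.d r)) (tVec A hA) : TQuot _) = q ^ dExp r (∑ k, A k r) • tA A
  map_B : ∀ i A (hA : A ∈ Xi _ _ _), (Ψ (.op (Ui.B i)) (tVec A hA) : TQuot _) = rightBi i A

/-- The `U^ı_n`-weight space of weight `μ̄`. -/
def weightSpaceI {d : ℕ} (Ψ : (Ui n)ᵐᵒᵖ →ₐ[Kq] Module.End Kq (Vi m n d)) (μ : Fin (2 * n) → ℤ) :
    Submodule Kq (Vi m n d) :=
  ⨅ r, Module.End.eigenspace (Ψ (.op (Ui.d r))) (q ^ iwt μ r)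

/-- `A_λ = (e_{-λ_n}, …, e_{-λ_1}, e_{λ_1}, …, e_{λ_n})`. -/
def AlamI (lam : Fin n → Fin (2 * m)) : Matrix (Fin (2 * m)) (Fin (2 * n)) ℕ :=
  unitColumns fun c =>
    if h : (c : ℕ) < n then (lam ⟨n - 1 - c, by omega⟩).rev else lam ⟨c - n, by omega⟩

end i

/-! ### The actions, type `ȷ` -/

section j
variable {m n : ℕ}

/-- `B_i t^{(A)}` for `i > 0`. -/
def leftBjPos (i : Fin (2 * m + 1 - 1)) (A : Matrix (Fin (2 * m + 1)) (Fin (2 * n + 1)) ℕ) :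
    TQuot (max (2 * m + 1) (2 * n + 1)) :=
  -- `δ = δ_{i,1/2}`
  let δ : ℕ := if IsZero (lo i) then 1 else 0
  let δ₀ : Fin (2 * n + 1) → ℕ := fun j => if IsZero j then δ else 0
  (∑ j with ¬ IsPos j ∧ A (lo i) j > δ₀ j,
      (q ^ (∑ k ∈ Finset.Ici j, ((A (hi i) k : ℤ) - A (lo i) k) + 1 + δ)
        * qInt (A (lo i) j - δ₀ j)) • tA (A + Eθ (hi i) j - Eθ (lo i) j))
    + ∑ j with IsPos j,
      (q ^ (∑ k ∈ Finset.Ici j, ((A (hi i) k : ℤ) - A (lo i) k) + 1)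
        * qInt (A (lo i) j)) • tA (A + Eθ (hi i) j - Eθ (lo i) j)

/-- `B_{-i} t^{(A)}` for `i > 0`. -/
def leftBjNeg (i : Fin (2 * m + 1 - 1)) (A : Matrix (Fin (2 * m + 1)) (Fin (2 * n + 1)) ℕ) :
    TQuot (max (2 * m + 1) (2 * n + 1)) :=
  ∑ j, (q ^ (∑ k ∈ Finset.Iic j, ((A (lo i) k : ℤ) - A (hi i) k) + 1)
    * qInt (A (hi i) j)) • tA (A + Eθ (lo i) j - Eθ (hi i) j)

/-- `t^{(A)} B_i` for `i > 0`. -/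
def rightBjPos (i : Fin (2 * n + 1 - 1)) (A : Matrix (Fin (2 * m + 1)) (Fin (2 * n + 1)) ℕ) :
    TQuot (max (2 * m + 1) (2 * n + 1)) :=
  ∑ j, (q ^ (∑ k ∈ Finset.Ioi j, ((A k (hi i) : ℤ) - A k (lo i)))
    * qInt (A j (hi i))) • tA (A + Eθ j (lo i) - Eθ j (hi i))

/-- `t^{(A)} B_{-i}` for `i > 0`. -/
def rightBjNeg (i : Fin (2 * n + 1 - 1)) (A : Matrix (Fin (2 * m + 1)) (Fin (2 * n + 1)) ℕ) :
    TQuot (max (2 * m + 1) (2 * n + 1)) :=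
  -- `δ = δ_{i,1/2}`
  let δ : ℕ := if IsZero (lo i) then 1 else 0
  let δ₀ : Fin (2 * m + 1) → ℕ := fun j => if IsZero j then δ else 0
  (∑ j with ¬ IsPos j ∧ A j (lo i) > δ₀ j,
      (q ^ (∑ k ∈ Finset.Iio j, ((A k (lo i) : ℤ) - A k (hi i)))
        * qInt (A j (lo i) - δ₀ j)) • tA (A + Eθ j (hi i) - Eθ j (lo i)))
    + ∑ j with IsPos j,
      (q ^ (∑ k ∈ Finset.Iio j, ((A k (lo i) : ℤ) - A k (hi i)) - δ)
        * qInt (A j (lo i))) • tA (A + Eθ j (hi i) - Eθ j (lo i))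

/-- The left action of `U^ȷ_m` on `𝒱^ȷ_{m|n,d}`. -/
structure IsLeftActionJ {d : ℕ} (Φ : Uj m →ₐ[Kq] Module.End Kq (Vj m n d)) : Prop where
  map_d : ∀ r A (hA : A ∈ Xi _ _ _),
    (Φ (Uj.d r) (tVec A hA) : TQuot _) = q ^ dExp r (∑ k, A r k) • tA A
  map_B_pos : ∀ i, IsPos i → ∀ A (hA : A ∈ Xi _ _ _),
    (Φ (Uj.B i) (tVec A hA) : TQuot _) = leftBjPos i A
  map_B_neg : ∀ i, IsPos i → ∀ A (hA : A ∈ Xi _ _ _),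
    (Φ (Uj.B i.rev) (tVec A hA) : TQuot _) = leftBjNeg i A

/-- The right action of `U^ȷ_n` on `𝒱^ȷ_{m|n,d}`; `Ψ (op y) v` is `v · y`. -/
structure IsRightActionJ {d : ℕ} (Ψ : (Uj n)ᵐᵒᵖ →ₐ[Kq] Module.End Kq (Vj m n d)) : Prop where
  map_d : ∀ r A (hA : A ∈ Xi _ _ _),
    (Ψ (.op (Uj.d r)) (tVec A hA) : TQuot _) = q ^ dExp r (∑ k, A k r) • tA A
  map_B_pos : ∀ i, IsPos i → ∀ A (hA : A ∈ Xi _ _ _),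
    (Ψ (.op (Uj.B i)) (tVec A hA) : TQuot _) = rightBjPos i A
  map_B_neg : ∀ i, IsPos i → ∀ A (hA : A ∈ Xi _ _ _),
    (Ψ (.op (Uj.B i.rev)) (tVec A hA) : TQuot _) = rightBjNeg i A

/-- The `U^ȷ_n`-weight space of weight `μ̄`. -/
def weightSpaceJ {d : ℕ} (Ψ : (Uj n)ᵐᵒᵖ →ₐ[Kq] Module.End Kq (Vj m n d))
    (μ : Fin (2 * n + 1) → ℤ) : Submodule Kq (Vj m n d) :=
  ⨅ r, Module.End.eigenspace (Ψ (.op (Uj.d r))) (q ^ iwt μ r)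

/-- `A_λ = (e_{-λ_n}, …, e_{-λ_1}, e_0, e_{λ_1}, …, e_{λ_n})`. -/
def AlamJ (lam : Fin n → Fin (2 * m + 1)) : Matrix (Fin (2 * m + 1)) (Fin (2 * n + 1)) ℕ :=
  unitColumns fun c =>
    if h : (c : ℕ) < n then (lam ⟨n - 1 - c, by omega⟩).rev
    else if h' : (c : ℕ) = n then ⟨m, by omega⟩
    else lam ⟨c - n - 1, by omega⟩

end j

/-- The basis vector `v_λ = v_{λ_1} ⊗ ⋯ ⊗ v_{λ_n}` of `V^{⊗n}`. -/
def vLam {M n : ℕ} (lam : Fin n → Fin M) : ⨂[Kq]^n (Fin M → Kq) :=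
  PiTensorProduct.tprod Kq fun k => Pi.single (lam k) 1

end IHowe

end

noncomputable section
namespace IHowe

/-! The relations of the quantum groups are never checked on the quotient. On `V^{⊗d} ⊗ W^{⊗d}`,
with `V` and `W` the natural representations of `U(gl_M)` and `U(gl_N)`, the first algebra acts on
the left factor and the second acts from the right on the other factor, through the
anti-automorphism `U.anti`. These are representations, and they commute for trivial reasons. The
pairing `tpair` sends `v_λ ⊗ v_μ` to the word `∏ t_{λ_k μ_k}`. It intertwines the generators of `U`
with operators on the coordinate ring, because those operators are twisted derivations whose Leibniz
rule is the comultiplication. Hence, as soon as the operators of `B_i` and `d_r^{±1}` preserve the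
right ideal and the span of the `t^{(A)}`, both actions descend to that span (`compatAct`), together
with all relations and the commutation of left with right.

The right ideal is preserved because the iquantum group is a coideal. The linear span of the ideal
generators is stable under `B_i` (`T.bI_linRel`, `T.bJ_linRel`), and in the Leibniz rule for `B_i (x
y)` the operators falling on `x` are only `B_i`, the identity and `K_{-i} K_i⁻¹`, all of which
preserve that span. The right action reduces to the left one: transposition preserves the ideal, and
the transposed right action of `B_i` is a scalar multiple of `B_{-i}` composed with such a diagonal
operator (`T.bIT_eq`, `T.bJT_eq`).

The formulas come from expanding a twisted derivation on an ordered monomial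
(`IsTwDer.map_monL_right`, `IsTwDer.map_monL_left`): one generator is replaced by another and
`q`-commuted to its place. Some terms contain one generator outside the cells used by the `t^{(A)}`.
That generator can be brought to the far left, where the relations of a right ideal apply. For `B_0`
in type ı the resulting corrections telescope to the coefficient of `t^{(A)}` (`sum_telescope`); in
type ȷ two contributions at the cell `(0,0)` merge into one `q`-integer (`qInt_double`).

The isomorphism sends `a` to the class of `tpair a v`, where `v` is the tensor of the positive
column labels in increasing order. It is equivariant since the left action does not touch `v`, and
straightening words identifies the image of `v_λ` with `t^{(A_λ)}` (`mk_word_posLabel`). It is onto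
because the matrices of weight `ρ` are exactly those with unit columns, and eigenvectors of other
weights cannot contribute (`mem_span_of_weight`).

Injectivity is shown without a basis of the quotient, by producing functionals. Evaluation at the
unit matrix kills the right ideal and, among the words with fixed columns `c`, detects only the word
with rows `c` (`single_self_mem_reps`). Composing a functional with `B_i` turns the detected word
into a combination of neighbouring ones. A triangularity argument then reaches every word
(`single_mem_reps`); it works because the `n` letters of `c` have distinct absolute values, and so
can be moved, permuted and sign-changed one at a time. -/

instance : Algebra ℕ Kq := Semiring.toNatAlgebra

instance : Algebra ℤ Kq := Ring.toIntAlgebra _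

/-! ### Families satisfying the relations of the quantum coordinate ring -/

/-- The relations of the quantum coordinate ring, for a rectangular family. -/
structure IsQMat {R : Type*} [Ring R] [Algebra Kq R] {M N : ℕ} (X : Fin M → Fin N → R) : Prop where
  col : ∀ i k j, i < k → X i j * X k j = q • (X k j * X i j)
  row : ∀ i j l, j < l → X i j * X i l = q • (X i l * X i j)
  anti : ∀ i k j l, i < k → j < l → X i l * X k j = X k j * X i l
  diag : ∀ i k j l, i < k → j < l →
    X i j * X k l = X k l * X i j + (q - q⁻¹) • (X i l * X k j)

lemma t_rel {P : ℕ} {x y : FreeAlgebra Kq (Fin P × Fin P)} (h : TRel P x y) :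
    RingQuot.mkAlgHom Kq (TRel P) x = RingQuot.mkAlgHom Kq (TRel P) y :=
  RingQuot.mkAlgHom_rel Kq h

lemma isQMat_t (P : ℕ) : IsQMat (t (P := P)) where
  col i k j h := by simpa only [t, map_mul, map_smul] using t_rel (TRel.col i k j h)
  row i j l h := by simpa only [t, map_mul, map_smul] using t_rel (TRel.row i j l h)
  anti i k j l h h' := by simpa only [t, map_mul] using t_rel (TRel.anti i k j l h h')
  diag i k j l h h' := by
    simpa only [t, map_mul, map_smul, map_add] using t_rel (TRel.diag i k j l h h')

namespace IsQMat
variable {R : Type*} [Ring R] [Algebra Kq R] {M N : ℕ} {X : Fin M → Fin N → R}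

/-- Transposition exchanges the row and column relations; the diagonal relation is symmetric because
the two antidiagonal generators commute. -/
lemma transpose (h : IsQMat X) : IsQMat fun i j => X j i where
  col i k j := h.row j i k
  row i j l := h.col j l i
  anti i k j l hik hjl := (h.anti j l i k hjl hik).symm
  diag i k j l hik hjl := by
    rw [h.diag j l i k hjl hik, h.anti j l i k hjl hik]

lemma comp (h : IsQMat X) {M' N' : ℕ} {u : Fin M' → Fin M} {v : Fin N' → Fin N}
    (hu : StrictMono u) (hv : StrictMono v) : IsQMat fun i j => X (u i) (v j) where
  col i k j hik := h.col _ _ _ (hu hik)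
  row i j l hjl := h.row _ _ _ (hv hjl)
  anti i k j l hik hjl := h.anti _ _ _ _ (hu hik) (hv hjl)
  diag i k j l hik hjl := h.diag _ _ _ _ (hu hik) (hv hjl)

end IsQMat

/-! ### Homomorphisms and twisted derivations of the quantum coordinate ring. -/

namespace T
variable {P : ℕ} {R : Type*} [Ring R] [Algebra Kq R]

/-- The algebra homomorphism out of `T P` given by a family satisfying the relations. -/
def lift {X : Fin P → Fin P → R} (h : IsQMat X) : T P →ₐ[Kq] R :=
  RingQuot.liftAlgHom Kq ⟨FreeAlgebra.lift Kq fun c => X c.1 c.2, by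
    intro x y hxy
    cases hxy with
    | col i k j hik => simpa using h.col i k j hik
    | row i j l hjl => simpa using h.row i j l hjl
    | anti i k j l hik hjl => simpa using h.anti i k j l hik hjl
    | diag i k j l hik hjl => simpa using h.diag i k j l hik hjl⟩

@[simp] lemma lift_t {X : Fin P → Fin P → R} (h : IsQMat X) (i j : Fin P) :
    lift h (t i j) = X i j := by
  simp [lift, t, RingQuot.liftAlgHom_mkAlgHom_apply]

@[elab_as_elim]
lemma induction {p : T P → Prop} (x : T P) (algebraMap : ∀ r, p (algebraMap Kq (T P) r))
    (gen : ∀ i j, p (t i j)) (mul : ∀ a b, p a → p b → p (a * b))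
    (add : ∀ a b, p a → p b → p (a + b)) : p x := by
  obtain ⟨y, rfl⟩ := RingQuot.mkAlgHom_surjective Kq (TRel P) x
  induction y using FreeAlgebra.induction with
  | grade0 r => rw [AlgHom.commutes]; exact algebraMap r
  | grade1 c => exact gen c.1 c.2
  | mul a b ha hb => rw [map_mul]; exact mul _ _ ha hb
  | add a b ha hb => rw [map_add]; exact add _ _ ha hb

lemma algHom_ext {f g : T P →ₐ[Kq] R} (h : ∀ i j, f (t i j) = g (t i j)) : f = g := by
  refine AlgHom.ext fun x => ?_
  induction x using T.induction with
  | algebraMap r => simp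
  | gen i j => exact h i j
  | mul a b ha hb => rw [map_mul, map_mul, ha, hb]
  | add a b ha hb => rw [map_add, map_add, ha, hb]

/-- The condition under which a family extends to a `(σ, τ)`-twisted derivation of `T P`. -/
structure IsTwisted (σ τ : T P →ₐ[Kq] T P) (Y : Fin P → Fin P → T P) : Prop where
  col : ∀ i k j, i < k → Y i j * σ (t k j) + τ (t i j) * Y k j =
    q • (Y k j * σ (t i j) + τ (t k j) * Y i j)
  row : ∀ i j l, j < l → Y i j * σ (t i l) + τ (t i j) * Y i l =
    q • (Y i l * σ (t i j) + τ (t i l) * Y i j)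
  anti : ∀ i k j l, i < k → j < l → Y i l * σ (t k j) + τ (t i l) * Y k j =
    Y k j * σ (t i l) + τ (t k j) * Y i l
  diag : ∀ i k j l, i < k → j < l → Y i j * σ (t k l) + τ (t i j) * Y k l =
    (Y k l * σ (t i j) + τ (t k l) * Y i j) +
      (q - q⁻¹) • (Y i l * σ (t k j) + τ (t i l) * Y k j)

section
variable {σ τ : T P →ₐ[Kq] T P} {Y : Fin P → Fin P → T P}

/-- For homomorphisms `σ`, `τ`, the rule `δ(ab) = δ(a) σ(b) + τ(a) δ(b)` says that sending `x` to
the upper triangular matrix with diagonal `τ x`, `σ x` and corner `δ x` is multiplicative. A twisted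
derivation therefore exists once these matrices satisfy the relations, and `IsTwisted` is what the
corner entries demand. -/
lemma IsTwisted.isQMat (h : IsTwisted σ τ Y) :
    IsQMat fun i j => !![τ (t i j), Y i j; 0, σ (t i j)] := by
  have hT := isQMat_t P
  constructor
  · intro i k j hik
    have e := hT.col i k j hik
    have e1 := congrArg τ e
    have e2 := congrArg σ e
    simp only [map_mul, map_smul] at e1 e2
    ext a b; fin_cases a <;> fin_cases b <;>
      simp [Matrix.mul_apply, Fin.sum_univ_two, e1, e2]
    rw [add_comm, h.col i k j hik, add_comm]; simp [add_comm]
  · intro i j l hik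
    have e := hT.row i j l hik
    have e1 := congrArg τ e
    have e2 := congrArg σ e
    simp only [map_mul, map_smul] at e1 e2
    ext a b; fin_cases a <;> fin_cases b <;>
      simp [Matrix.mul_apply, Fin.sum_univ_two, e1, e2]
    rw [add_comm, h.row i j l hik, add_comm]; simp [add_comm]
  · intro i k j l hik hjl
    have e := hT.anti i k j l hik hjl
    have e1 := congrArg τ e
    have e2 := congrArg σ e
    simp only [map_mul] at e1 e2
    ext a b; fin_cases a <;> fin_cases b <;>
      simp [Matrix.mul_apply, Fin.sum_univ_two, e1, e2]
    rw [add_comm, h.anti i k j l hik hjl, add_comm]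
  · intro i k j l hik hjl
    have e := hT.diag i k j l hik hjl
    have e1 := congrArg τ e
    have e2 := congrArg σ e
    simp only [map_mul, map_smul, map_add] at e1 e2
    ext a b; fin_cases a <;> fin_cases b <;>
      simp [Matrix.mul_apply, Fin.sum_univ_two, e1, e2]
    rw [add_comm, h.diag i k j l hik hjl, add_comm (Y k l * _), add_comm (Y i l * _)]; simp

lemma IsTwisted.entries (h : IsTwisted σ τ Y) (x : T P) :
    lift h.isQMat x 0 0 = τ x ∧ lift h.isQMat x 1 0 = 0 ∧ lift h.isQMat x 1 1 = σ x := by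
  induction x using T.induction with
  | algebraMap r => simp [Matrix.algebraMap_matrix_apply]
  | gen i j => simp
  | mul a b ha hb =>
    obtain ⟨a1, a2, a3⟩ := ha
    obtain ⟨b1, b2, b3⟩ := hb
    simp [Matrix.mul_apply, Fin.sum_univ_two, a1, a2, a3, b1, b2, b3]
  | add a b ha hb => simp [ha, hb]

/-- The twisted derivation with given values on the generators. -/
def IsTwisted.der (h : IsTwisted σ τ Y) : T P →ₗ[Kq] T P where
  toFun x := lift h.isQMat x 0 1
  map_add' := by simp
  map_smul' := by simp

@[simp] lemma IsTwisted.der_t (h : IsTwisted σ τ Y) (i j : Fin P) : h.der (t i j) = Y i j := by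
  simp [der]

lemma IsTwisted.der_one (h : IsTwisted σ τ Y) : h.der 1 = 0 := by
  simp [der]

lemma IsTwisted.der_mul (h : IsTwisted σ τ Y) (a b : T P) :
    h.der (a * b) = h.der a * σ b + τ a * h.der b := by
  have ha := h.entries a
  have hb := h.entries b
  simp [der, Matrix.mul_apply, Fin.sum_univ_two, ha, hb, add_comm]

end

/-! ### The diagonal operators and the root operators -/

/-- Every relation is homogeneous in the row labels, so rescaling the rows preserves it. -/
lemma isQMat_diag (χ : Fin P → ℤ) : IsQMat fun r s => q ^ χ r • t (P := P) r s := by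
  have h := isQMat_t P
  constructor
  · intro i k j hik
    simp only [smul_mul_smul_comm, h.col i k j hik, smul_smul]; congr 1; ring
  · intro i k j hik
    simp only [smul_mul_smul_comm, h.row i k j hik, smul_smul]; congr 1; ring
  · intro i k j l hik hjl
    simp only [smul_mul_smul_comm, h.anti i k j l hik hjl]; congr 1; ring
  · intro i k j l hik hjl
    simp only [smul_mul_smul_comm, h.diag i k j l hik hjl, smul_smul, smul_add]
    congr 2 <;> ring

/-- The automorphism of `T P` multiplying `t_{rs}` by `q ^ χ r`. -/
def diagOp (χ : Fin P → ℤ) : T P →ₐ[Kq] T P := lift (isQMat_diag χ)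

@[simp] lemma diagOp_t (χ : Fin P → ℤ) (r s : Fin P) : diagOp χ (t r s) = q ^ χ r • t r s := by
  simp [diagOp]

lemma diagOp_diagOp (χ ψ : Fin P → ℤ) (x : T P) :
    diagOp χ (diagOp ψ x) = diagOp (fun r => χ r + ψ r) x := by
  have : (diagOp χ).comp (diagOp ψ) = diagOp (fun r => χ r + ψ r) := by
    apply algHom_ext
    intro i j
    simp [smul_smul, zpow_add₀ q_ne_zero, mul_comm]
  exact congrArg (fun f => f x) this

lemma diagOp_zero (x : T P) : diagOp (fun _ => 0) x = x := by
  have : diagOp (fun _ : Fin P => 0) = AlgHom.id Kq _ := by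
    apply algHom_ext
    intro i j
    simp
  rw [this]; rfl

lemma smul_smul_eq_add {k A : Type*} [Field k] [AddCommGroup A] [Module k A] {s : k} (hs : s ≠ 0)
    (x : A) : s • s • x = x + (s - s⁻¹) • s • x := by
  match_scalars
  field_simp
  ring

lemma add_smul_add_smul {k A : Type*} [Field k] [AddCommGroup A] [Module k A] {s : k}
    (hs : s ≠ 0) (x y : A) :
    y + (s - s⁻¹) • x + s⁻¹ • x = s • x + s • s⁻¹ • y := by
  match_scalars <;> field_simp <;> ring

/-- The rows `lo i` and `hi i` are neighbours: a third row lies on the same side of both, so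
replacing `hi i` by `lo i` leads to the same type of relation. The twist matters only inside the
pair, where the extra term of the diagonal relation is balanced by the factors `q^{±1}` of `K_i`. -/
lemma isTwisted_e (i : Fin (P - 1)) :
    IsTwisted (AlgHom.id Kq (T P)) (diagOp fun r => wtE r i)
      fun r s => if r = hi i then t (lo i) s else 0 := by
  have h := isQMat_t P
  have hlh : lo i < hi i := by simp [lo, hi, Fin.lt_def]
  have key : ∀ a : Fin P, a < hi i → a ≠ lo i → a < lo i := by
    intro a; simp only [lo, hi, Fin.lt_def, Fin.ext_iff, ne_eq]; omega
  have hq := q_ne_zero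
  constructor
  · intro a b j hab
    simp only [AlgHom.id_apply, diagOp_t, smul_mul_assoc]
    by_cases hb : b = hi i
    · subst hb
      by_cases ha : a = lo i
      · subst ha; simp [wtE, hlh.ne, hlh.ne']
      · have hal := key a hab ha
        simp [wtE, hab.ne, ha, h.col _ _ j hal]
    · by_cases ha : a = hi i
      · subst ha
        simp [wtE, hab.ne', (hlh.trans hab).ne', h.col _ _ j (hlh.trans hab)]
      · simp [ha, hb]
  · intro a j l hjl
    simp only [AlgHom.id_apply, diagOp_t, smul_mul_assoc]
    by_cases ha : a = hi i
    · subst ha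
      simp only [wtE, hlh.ne', if_true, if_false, h.anti _ _ _ _ hlh hjl, h.diag _ _ _ _ hlh hjl]
      simp
      exact add_smul_add_smul q_ne_zero _ _
    · simp [ha]
  · intro a b j l hab hjl
    simp only [AlgHom.id_apply, diagOp_t, smul_mul_assoc]
    by_cases hb : b = hi i
    · subst hb
      by_cases ha : a = lo i
      · subst ha; simp [wtE, hlh.ne, h.row _ _ _ hjl]
      · have hal := key a hab ha
        simp [wtE, hab.ne, ha, h.anti _ _ _ _ hal hjl]
    · by_cases ha : a = hi i
      · subst ha
        simp [wtE, hab.ne', (hlh.trans hab).ne', h.anti _ _ _ _ (hlh.trans hab) hjl]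
      · simp [ha, hb]
  · intro a b j l hab hjl
    simp only [AlgHom.id_apply, diagOp_t, smul_mul_assoc]
    by_cases hb : b = hi i
    · subst hb
      by_cases ha : a = lo i
      · subst ha
        simp only [wtE, hlh.ne, if_true, if_false, h.row _ _ _ hjl]
        simp
        exact smul_smul_eq_add q_ne_zero (t (lo i) l * t (lo i) j)
      · have hal := key a hab ha
        simp [wtE, hab.ne, ha, h.diag _ _ _ _ hal hjl]
    · by_cases ha : a = hi i
      · subst ha
        simp [wtE, hab.ne', (hlh.trans hab).ne', h.diag _ _ _ _ (hlh.trans hab) hjl]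
      · simp [ha, hb]

lemma isTwisted_f (i : Fin (P - 1)) :
    IsTwisted (diagOp fun r => -wtE r i) (AlgHom.id Kq (T P))
      fun r s => if r = lo i then t (hi i) s else 0 := by
  have h := isQMat_t P
  have hlh : lo i < hi i := by simp [lo, hi, Fin.lt_def]
  have key : ∀ a : Fin P, lo i < a → a ≠ hi i → hi i < a := by
    intro a; simp only [lo, hi, Fin.lt_def, Fin.ext_iff, ne_eq]; omega
  have hq := q_ne_zero
  constructor
  · intro a b j hab
    simp only [AlgHom.id_apply, diagOp_t, mul_smul_comm]
    by_cases ha : a = lo i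
    · subst ha
      by_cases hb : b = hi i
      · subst hb; simp [wtE, hlh.ne, hlh.ne']
      · have hal := key b hab hb
        simp [wtE, hab.ne', hb, h.col _ _ j hal]
    · by_cases hb : b = lo i
      · subst hb
        simp [wtE, hab.ne, (hab.trans hlh).ne, h.col _ _ j (hab.trans hlh)]
      · simp [ha, hb]
  · intro a j l hjl
    simp only [AlgHom.id_apply, diagOp_t, mul_smul_comm]
    by_cases ha : a = lo i
    · subst ha
      simp only [wtE, hlh.ne, if_true, if_false, h.anti _ _ _ _ hlh hjl, h.diag _ _ _ _ hlh hjl]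
      simp
      rw [add_comm, add_comm (q • q⁻¹ • _)]
      exact add_smul_add_smul q_ne_zero _ _
    · simp [ha]
  · intro a b j l hab hjl
    simp only [AlgHom.id_apply, diagOp_t, mul_smul_comm]
    by_cases ha : a = lo i
    · subst ha
      by_cases hb : b = hi i
      · subst hb; simp [wtE, hlh.ne', h.row _ _ _ hjl]
      · have hal := key b hab hb
        simp [wtE, hab.ne', hb, h.anti _ _ _ _ hal hjl]
    · by_cases hb : b = lo i
      · subst hb
        simp [wtE, hab.ne, (hab.trans hlh).ne, h.anti _ _ _ _ (hab.trans hlh) hjl]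
      · simp [ha, hb]
  · intro a b j l hab hjl
    simp only [AlgHom.id_apply, diagOp_t, mul_smul_comm]
    by_cases ha : a = lo i
    · subst ha
      by_cases hb : b = hi i
      · subst hb
        simp only [wtE, hlh.ne, hlh.ne', if_true, if_false, h.row _ _ _ hjl]
        simp
        exact smul_smul_eq_add q_ne_zero (t (hi i) l * t (hi i) j)
      · have hal := key b hab hb
        simp [wtE, hab.ne', hb, h.diag _ _ _ _ hal hjl]
    · by_cases hb : b = lo i
      · subst hb
        simp [wtE, hab.ne, (hab.trans hlh).ne, h.diag _ _ _ _ (hab.trans hlh) hjl]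
      · simp [ha, hb]

/-- The left action of `K_i`. -/
def kOp (i : Fin (P - 1)) : T P →ₐ[Kq] T P := diagOp fun r => wtE r i
/-- The left action of `K_i⁻¹`. -/
def kinvOp (i : Fin (P - 1)) : T P →ₐ[Kq] T P := diagOp fun r => -wtE r i
/-- The left action of `E_i`. -/
def eOp (i : Fin (P - 1)) : T P →ₗ[Kq] T P := (isTwisted_e i).der
/-- The left action of `F_i`. -/
def fOp (i : Fin (P - 1)) : T P →ₗ[Kq] T P := (isTwisted_f i).der

@[simp] lemma eOp_t (i : Fin (P - 1)) (r s : Fin P) :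
    eOp i (t r s) = if r = hi i then t (lo i) s else 0 := by simp [eOp]
@[simp] lemma fOp_t (i : Fin (P - 1)) (r s : Fin P) :
    fOp i (t r s) = if r = lo i then t (hi i) s else 0 := by simp [fOp]
@[simp] lemma kOp_t (i : Fin (P - 1)) (r s : Fin P) :
    kOp i (t r s) = q ^ wtE r i • t r s := by simp [kOp]
@[simp] lemma kinvOp_t (i : Fin (P - 1)) (r s : Fin P) :
    kinvOp i (t r s) = q ^ (-wtE r i) • t r s := by simp [kinvOp]
@[simp] lemma eOp_one (i : Fin (P - 1)) : eOp i (1 : T P) = 0 := (isTwisted_e i).der_one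
@[simp] lemma fOp_one (i : Fin (P - 1)) : fOp i (1 : T P) = 0 := (isTwisted_f i).der_one
lemma eOp_mul (i : Fin (P - 1)) (a b : T P) : eOp i (a * b) = eOp i a * b + kOp i a * eOp i b :=
  (isTwisted_e i).der_mul a b
lemma fOp_mul (i : Fin (P - 1)) (a b : T P) :
    fOp i (a * b) = fOp i a * kinvOp i b + a * fOp i b :=
  (isTwisted_f i).der_mul a b

/-- The transposition `t_{rs} ↦ t_{sr}`. -/
def transp : T P →ₐ[Kq] T P := lift (isQMat_t P).transpose

@[simp] lemma transp_t (r s : Fin P) : transp (t r s) = t s r := by simp [transp]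

@[simp] lemma transp_transp (x : T P) : transp (transp x) = x := by
  have : (transp (P := P)).comp transp = AlgHom.id Kq _ := by
    apply algHom_ext
    intro i j
    simp
  exact congrArg (fun f => f x) this

end T

/-! ### Twisted derivations of ordered monomials -/

lemma qInt_zero : qInt 0 = 0 := by simp [qInt]

lemma qInt_succ (a : ℕ) : qInt (a + 1) = q⁻¹ * qInt a + q ^ (a : ℤ) := by
  have h := q_sub_inv_ne_zero
  have hq := q_ne_zero
  rw [qInt, qInt, div_eq_iff h, add_mul, mul_assoc, div_mul_cancel₀ _ h]
  push_cast
  rw [neg_add, zpow_add₀ hq, zpow_add₀ hq, zpow_one, zpow_neg_one]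
  ring

/-- `δ` is a `(σ, τ)`-twisted derivation. -/
def IsTwDer {R : Type*} [Ring R] [Algebra Kq R] (δ : R →ₗ[Kq] R) (σ τ : R →ₐ[Kq] R) : Prop :=
  ∀ a b, δ (a * b) = δ a * σ b + τ a * δ b

namespace IsTwDer
variable {R : Type*} [Ring R] [Algebra Kq R] {δ : R →ₗ[Kq] R} {σ τ : R →ₐ[Kq] R}

lemma map_one (h : IsTwDer δ σ τ) : δ 1 = 0 := by
  have := h 1 1
  simpa using this

/-- Expanding gives `∑ τ(x)^k δ(x) σ(x)^{a-1-k}`. After `δ x` is moved to the right this is a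
geometric sum in which each factor `x` before `δ x` costs `q^{w+1}` and each one after it costs
`q^{w-1}`. The exponents are thus centred at `w (a-1)` in steps of two, which is a `q`-integer. -/
lemma map_pow_right (h : IsTwDer δ σ τ) {x : R} {s u e w : ℤ} (hσ : σ x = q ^ s • x)
    (hτ : τ x = q ^ u • x) (hc : δ x * x = q ^ e • (x * δ x)) (hu : u = w + 1) (hs : s + e = w - 1)
    (a : ℕ) : δ (x ^ a) = (q ^ (w * ((a : ℤ) - 1)) * qInt a) • (x ^ (a - 1) * δ x) := by
  induction a with
  | zero => simp [h.map_one, qInt_zero]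
  | succ a ih =>
    rw [pow_succ, h, ih, hσ, map_pow, hτ]
    have hq := q_ne_zero
    -- For `a = 0` the truncated exponent `a - 1` is harmless, since `[0] = 0`.
    have e1 : (q ^ (w * ((a : ℤ) - 1)) * qInt a) • (x ^ (a - 1) * δ x) * q ^ s • x =
        (q ^ (w * ((a : ℤ) - 1)) * qInt a * q ^ (s + e)) • (x ^ a * δ x) := by
      rcases Nat.eq_zero_or_pos a with rfl | ha
      · simp [qInt_zero]
      · rw [smul_mul_smul_comm, mul_assoc (x ^ (a - 1)), hc, mul_smul_comm, smul_smul,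
          ← mul_assoc (x ^ (a - 1)), ← pow_succ, Nat.sub_add_cancel ha, zpow_add₀ hq]
        simp only [mul_assoc]
    rw [e1, smul_pow, smul_mul_assoc, ← add_smul, qInt_succ]
    simp only [Nat.add_sub_cancel]
    congr 1
    rw [← zpow_natCast, ← zpow_mul, hu, hs, mul_add, ← mul_assoc]
    push_cast
    rw [show w * ((a : ℤ) + 1 - 1) = w * ((a : ℤ) - 1) + w by ring, zpow_sub_one₀ hq,
      zpow_add₀ hq, show (w + 1) * (a : ℤ) = w * ((a : ℤ) - 1) + w + a by ring, zpow_add₀ hq,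
      zpow_add₀ hq]
    ring

lemma map_pow_left (h : IsTwDer δ σ τ) {x : R} {s u e w : ℤ} (hσ : σ x = q ^ s • x)
    (hτ : τ x = q ^ u • x) (hc : δ x * x = q ^ e • (x * δ x)) (hs : s = w + 1) (hu : u - e = w - 1)
    (a : ℕ) : δ (x ^ a) = (q ^ (w * ((a : ℤ) - 1)) * qInt a) • (δ x * x ^ (a - 1)) := by
  have hq := q_ne_zero
  have hc' : x * δ x = q ^ (-e) • (δ x * x) := by
    rw [hc, smul_smul, ← zpow_add₀ hq]; simp
  induction a with
  | zero => simp [h.map_one, qInt_zero]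
  | succ a ih =>
    rw [pow_succ', h, ih, map_pow, hσ, hτ]
    have e1 : q ^ u • x * ((q ^ (w * ((a : ℤ) - 1)) * qInt a) • (δ x * x ^ (a - 1))) =
        (q ^ (w * ((a : ℤ) - 1)) * qInt a * q ^ (u - e)) • (δ x * x ^ a) := by
      rcases Nat.eq_zero_or_pos a with rfl | ha
      · simp [qInt_zero]
      · rw [smul_mul_smul_comm, ← mul_assoc x, hc', smul_mul_assoc, smul_smul, mul_assoc (δ x),
          ← pow_succ', Nat.sub_add_cancel ha, sub_eq_add_neg u e, zpow_add₀ hq]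
        congr 1
        ring
    rw [e1, smul_pow, mul_smul_comm, ← add_smul, qInt_succ]
    simp only [Nat.add_sub_cancel]
    congr 1
    rw [← zpow_natCast, ← zpow_mul, hu, hs, mul_add, ← mul_assoc]
    push_cast
    rw [show w * ((a : ℤ) + 1 - 1) = w * ((a : ℤ) - 1) + w by ring, zpow_sub_one₀ hq,
      zpow_add₀ hq, show (w + 1) * (a : ℤ) = w * ((a : ℤ) - 1) + w + a by ring, zpow_add₀ hq,
      zpow_add₀ hq]
    ring

end IsTwDer

/-! ### Ordered monomials over a linearly ordered set of generators. -/

section Ordered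
variable {R : Type*} [Ring R] [Algebra Kq R] {ι : Type*} [LinearOrder ι] {X : ι → R}

/-- The ordered monomial with exponents `a`. -/
def monL (l : List ι) (X : ι → R) (a : ι → ℕ) : R := (l.map fun y => X y ^ a y).prod

/-- Increase the exponent at `z` by one. -/
def incr (a : ι → ℕ) (z : ι) : ι → ℕ := fun y => a y + if y = z then 1 else 0

/-- Move one unit of the exponent from `x` to `z`. -/
def shift (a : ι → ℕ) (x z : ι) : ι → ℕ :=
  fun y => a y - (if y = x then 1 else 0) + if y = z then 1 else 0

@[simp] lemma monL_nil (a : ι → ℕ) : monL [] X a = 1 := rfl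
@[simp] lemma monL_cons (y : ι) (l : List ι) (a : ι → ℕ) :
    monL (y :: l) X a = X y ^ a y * monL l X a := by simp [monL]
@[simp] lemma monL_append (l l' : List ι) (a : ι → ℕ) :
    monL (l ++ l') X a = monL l X a * monL l' X a := by simp [monL]

lemma monL_congr {l : List ι} {a b : ι → ℕ} (h : ∀ y ∈ l, a y = b y) :
    monL l X a = monL l X b := by
  unfold monL
  congr 1
  exact List.map_congr_left fun y hy => by rw [h y hy]

lemma map_monL {φ : R →ₐ[Kq] R} {s : ι → ℤ} (hφ : ∀ y, φ (X y) = q ^ s y • X y) (l : List ι)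
    (a : ι → ℕ) : φ (monL l X a) = q ^ (l.map fun y => s y * a y).sum • monL l X a := by
  induction l with
  | nil => simp
  | cons y l ih =>
    rw [monL_cons, map_mul, ih, map_pow, hφ, smul_pow, smul_mul_smul_comm, List.map_cons,
      List.sum_cons, zpow_add₀ q_ne_zero, zpow_mul, zpow_natCast]

lemma qcomm_pow {x z : R} {e : ℤ} (h : z * x = q ^ e • (x * z)) (a : ℕ) :
    z * x ^ a = q ^ (e * a) • (x ^ a * z) := by
  induction a with
  | zero => simp
  | succ a ih =>
    rw [pow_succ, ← mul_assoc, ih, smul_mul_assoc, mul_assoc, h, mul_smul_comm, smul_smul,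
      ← mul_assoc, ← zpow_add₀ q_ne_zero]
    congr 2
    push_cast; ring

/-- The generator travels rightwards past the smaller factors. Only factors that occur need to
`q`-commute with it; this restriction is useful because the diagonal relation is not a
`q`-commutation. -/
lemma gen_mul_monL {l : List ι} (hl : l.Pairwise (· < ·)) {z : ι} (hz : z ∈ l) (a : ι → ℕ)
    {e : ι → ℤ} (hc : ∀ y ∈ l, y < z → a y ≠ 0 → X z * X y = q ^ e y • (X y * X z)) :
    X z * monL l X a =
      q ^ (l.map fun y => (if y < z then e y else 0) * a y).sum • monL l X (incr a z) := by
  induction l with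
  | nil => simp at hz
  | cons y l ih =>
    rw [List.pairwise_cons] at hl
    rw [monL_cons, monL_cons]
    rcases eq_or_ne z y with rfl | hzy
    · have e1 : monL l X (incr a z) = monL l X a :=
        monL_congr fun y hy => by simp [incr, (hl.1 y hy).ne']
      have e2 : (l.map fun y => (if y < z then e y else 0) * (a y : ℤ)).sum = 0 := by
        apply List.sum_eq_zero
        intro v hv
        obtain ⟨y, hy, rfl⟩ := List.mem_map.mp hv
        simp [(hl.1 y hy).le]
      rw [List.map_cons, List.sum_cons, e2, e1, if_neg (lt_irrefl _)]
      simp [incr, pow_succ', mul_assoc]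
    · have hz' : z ∈ l := by simpa [hzy] using hz
      have hyz := hl.1 z hz'
      have ih' := ih hl.2 hz' fun y hy => hc y (List.mem_cons_of_mem _ hy)
      have e0 : X z * X y ^ a y = q ^ (e y * a y) • (X y ^ a y * X z) := by
        rcases Nat.eq_zero_or_pos (a y) with h0 | h0
        · simp [h0]
        · exact qcomm_pow (hc y (by simp) hyz h0.ne') _
      rw [← mul_assoc, e0, smul_mul_assoc, mul_assoc, ih', mul_smul_comm, smul_smul,
        ← zpow_add₀ q_ne_zero]
      simp [hyz, incr, hzy.symm]

lemma monL_mul_gen {l : List ι} (hl : l.Pairwise (· < ·)) {z : ι} (hz : z ∈ l) (a : ι → ℕ)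
    {e : ι → ℤ} (hc : ∀ y ∈ l, z < y → X z * X y = q ^ e y • (X y * X z)) :
    monL l X a * X z =
      q ^ (l.map fun y => (if z < y then -e y else 0) * a y).sum • monL l X (incr a z) := by
  induction l using List.reverseRecOn with
  | nil => simp at hz
  | append_singleton l y ih =>
    rw [List.pairwise_append] at hl
    rw [monL_append, monL_append]
    rcases eq_or_ne z y with rfl | hzy
    · have hlt : ∀ y ∈ l, y < z := fun y hy => hl.2.2 y hy z (by simp)
      have e1 : monL l X (incr a z) = monL l X a :=
        monL_congr fun y hy => by simp [incr, (hlt y hy).ne]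
      have e2 : (l.map fun y => (if z < y then -e y else 0) * (a y : ℤ)).sum = 0 := by
        apply List.sum_eq_zero
        intro v hv
        obtain ⟨y, hy, rfl⟩ := List.mem_map.mp hv
        simp [(hlt y hy).le]
      rw [List.map_append, List.sum_append, e2, e1]
      simp [incr, pow_succ, mul_assoc]
    · have hz' : z ∈ l := by simpa [hzy] using hz
      have hyz := hl.2.2 z hz' y (by simp)
      have ih' := ih hl.1 hz' fun y hy => hc y (List.mem_append_left _ hy)
      have e0 : X y ^ a y * X z = q ^ (-e y * a y) • (X z * X y ^ a y) := by
        rw [qcomm_pow (hc y (by simp) hyz), smul_smul, ← zpow_add₀ q_ne_zero]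
        simp
      simp only [monL_cons, monL_nil, mul_one]
      rw [mul_assoc, e0, mul_smul_comm, ← mul_assoc, ih', smul_mul_assoc, smul_smul,
        ← zpow_add₀ q_ne_zero, List.map_append, List.sum_append, add_comm]
      simp [hyz, incr, hzy.symm]

namespace IsTwDer
variable {δ : R →ₗ[Kq] R} {σ τ : R →ₐ[Kq] R}

/-- The term of `x` collects `τ` on the factors before `x`, `σ` on those after it, and the cost `e`
of carrying the new generator `X (g x)` rightwards to its slot, past the factors strictly between.
The condition `hw` is the one under which the powers of `X x` itself contribute a `q`-integer. -/
lemma map_monL_right (h : IsTwDer δ σ τ) {s u : ι → ℤ} {dom : ι → Prop} [DecidablePred dom]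
    {g : ι → ι} {w : ℤ} {e : ι → ι → ℤ} (hσ : ∀ y, σ (X y) = q ^ s y • X y)
    (hτ : ∀ y, τ (X y) = q ^ u y • X y) (hd : ∀ y, dom y → δ (X y) = X (g y))
    (hnd : ∀ y, ¬ dom y → δ (X y) = 0)
    (hc : ∀ x, dom x → ∀ y, x ≤ y → y < g x → X (g x) * X y = q ^ e (g x) y • (X y * X (g x)))
    (hw : ∀ x, dom x → u x = w + 1 ∧ s x + e (g x) x = w - 1)
    {l : List ι} (hl : l.Pairwise (· < ·)) (hg : ∀ x ∈ l, dom x → x < g x ∧ g x ∈ l) (a : ι → ℕ) :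
    δ (monL l X a) = (l.map fun x => if dom x then
      (q ^ (w * ((a x : ℤ) - 1) + (l.map fun y => (if y < x then u y else if x < y then
        s y + (if y < g x then e (g x) y else 0) else 0) * (a y : ℤ)).sum) * qInt (a x)) •
          monL l X (shift a x (g x)) else 0).sum := by
  have hq := q_ne_zero
  induction l with
  | nil => simp [h.map_one]
  | cons y l ih =>
    rw [List.pairwise_cons] at hl
    have hg' : ∀ x ∈ l, dom x → x < g x ∧ g x ∈ l := fun x hx hxd => by
      obtain ⟨h1, h2⟩ := hg x (List.mem_cons_of_mem _ hx) hxd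
      refine ⟨h1, ?_⟩
      rcases List.mem_cons.mp h2 with h3 | h3
      · exact absurd (h3 ▸ h1) (hl.1 x hx).not_gt
      · exact h3
    have mulsum : ∀ (c : R) (f f' : ι → R), (∀ x ∈ l, c * f x = f' x) →
        c * (l.map f).sum = (l.map f').sum := fun c f f' hff => by
      rw [← List.sum_map_mul_left]
      exact congrArg List.sum (List.map_congr_left hff)
    rw [monL_cons, h, ih hl.2 hg', map_monL hσ, map_pow τ, hτ, List.map_cons, List.sum_cons]
    congr 1
    · by_cases hy : dom y
      · obtain ⟨h1, h2⟩ := hg y (by simp) hy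
        have h2 : g y ∈ l := by simpa [h1.ne'] using h2
        rw [if_pos hy, h.map_pow_right (hσ y) (hτ y)
          (by rw [hd y hy]; exact hc y hy y le_rfl h1) (hw y hy).1 (hw y hy).2, hd y hy,
          mul_smul_comm, smul_mul_assoc, mul_assoc, gen_mul_monL (e := e (g y)) hl.2 h2 a
            fun z hz hzg _ => hc y hy z (hl.1 z hz).le hzg, mul_smul_comm, smul_smul, smul_smul]
        congr 1
        · rw [mul_left_comm, ← mul_assoc, mul_right_comm, mul_comm (q ^ _) (q ^ _)]
          refine congrArg (· * qInt (a y)) ?_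
          rw [mul_right_comm, ← zpow_add₀ hq, ← zpow_add₀ hq, ← List.sum_map_add,
            add_comm]
          congr 2
          rw [List.map_cons, List.sum_cons, if_neg (lt_irrefl _), if_neg (lt_irrefl _), zero_mul,
            zero_add]
          refine congrArg List.sum (List.map_congr_left fun z hz => ?_)
          rw [if_neg (hl.1 z hz).not_gt, if_pos (hl.1 z hz)]
          ring
        · rw [monL_cons]
          congr 1
          · simp [shift, h1.ne]
          · exact monL_congr fun z hz => by simp [shift, incr, (hl.1 z hz).ne']
      · rw [if_neg hy]
        have : δ (X y ^ a y) = 0 := by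
          generalize a y = n
          induction n with
          | zero => simp [h.map_one]
          | succ n ihn => rw [pow_succ, h, ihn, hnd y hy]; simp
        simp [this]
    · refine mulsum _ _ _ fun x hx => ?_
      by_cases hxd : dom x
      · rw [if_pos hxd, if_pos hxd, smul_pow, smul_mul_smul_comm, monL_cons, ← mul_assoc (_ ^ a y)]
        have hyx := hl.1 x hx
        congr 1
        · rw [← zpow_natCast, ← zpow_mul, ← zpow_add₀ hq, List.map_cons, List.sum_cons, if_pos hyx]
          congr 2
          ring
        · congr 1
          simp [shift, hyx.ne, (hyx.trans (hg' x hx hxd).1).ne]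
      · simp [hxd]

/-- Mirror image for `g x < x`: the new generator is produced to the left of the remaining powers of
`X x` and travels leftwards, so the list is built up from its right end. -/
lemma map_monL_left (h : IsTwDer δ σ τ) {s u : ι → ℤ} {dom : ι → Prop} [DecidablePred dom]
    {g : ι → ι} {w : ℤ} {e : ι → ι → ℤ} (hσ : ∀ y, σ (X y) = q ^ s y • X y)
    (hτ : ∀ y, τ (X y) = q ^ u y • X y) (hd : ∀ y, dom y → δ (X y) = X (g y))
    (hnd : ∀ y, ¬ dom y → δ (X y) = 0)
    (hc : ∀ x, dom x → ∀ y, y ≤ x → g x < y → X (g x) * X y = q ^ e (g x) y • (X y * X (g x)))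
    (hw : ∀ x, dom x → s x = w + 1 ∧ u x - e (g x) x = w - 1)
    {l : List ι} (hl : l.Pairwise (· < ·)) (hg : ∀ x ∈ l, dom x → g x < x ∧ g x ∈ l) (a : ι → ℕ) :
    δ (monL l X a) = (l.map fun x => if dom x then
      (q ^ (w * ((a x : ℤ) - 1) + (l.map fun y => (if x < y then s y else if y < x then
        u y - (if g x < y then e (g x) y else 0) else 0) * (a y : ℤ)).sum) * qInt (a x)) •
          monL l X (shift a x (g x)) else 0).sum := by
  have hq := q_ne_zero
  induction l using List.reverseRecOn with
  | nil => simp [h.map_one]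
  | append_singleton l y ih =>
    rw [List.pairwise_append] at hl
    have hlt : ∀ z ∈ l, z < y := fun z hz => hl.2.2 z hz y (by simp)
    have hg' : ∀ x ∈ l, dom x → g x < x ∧ g x ∈ l := fun x hx hxd => by
      obtain ⟨h1, h2⟩ := hg x (List.mem_append_left _ hx) hxd
      refine ⟨h1, ?_⟩
      rcases List.mem_append.mp h2 with h3 | h3
      · exact h3
      · rw [List.mem_singleton] at h3
        exact absurd (h3 ▸ h1) (hlt x hx).not_gt
    have mulsum : ∀ (c : R) (f f' : ι → R), (∀ x ∈ l, f x * c = f' x) →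
        (l.map f).sum * c = (l.map f').sum := fun c f f' hff => by
      rw [← List.sum_map_mul_right]
      exact congrArg List.sum (List.map_congr_left hff)
    rw [monL_append, h, ih hl.1 hg', map_monL hτ, List.map_append, List.sum_append]
    simp only [monL_cons, monL_nil, mul_one]
    rw [map_pow σ, hσ]
    congr 1
    · refine mulsum _ _ _ fun x hx => ?_
      by_cases hxd : dom x
      · rw [if_pos hxd, if_pos hxd, smul_pow, smul_mul_smul_comm, monL_append]
        have hyx := hlt x hx
        congr 1
        · rw [← zpow_natCast, ← zpow_mul, List.map_append, List.sum_append, mul_right_comm,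
            ← zpow_add₀ hq]
          congr 2
          simp [hyx, add_assoc]
        · congr 1
          simp [shift, hyx.ne', ((hg' x hx hxd).1.trans hyx).ne']
      · simp [hxd]
    · rw [List.map_singleton, List.sum_singleton]
      by_cases hy : dom y
      · obtain ⟨h1, h2⟩ := hg y (by simp) hy
        have h2 : g y ∈ l := by simpa [h1.ne] using h2
        rw [if_pos hy, h.map_pow_left (hσ y) (hτ y)
          (by rw [hd y hy]; exact hc y hy y le_rfl h1) (hw y hy).1 (hw y hy).2, hd y hy,
          mul_smul_comm, smul_mul_assoc, ← mul_assoc, monL_mul_gen (e := e (g y)) hl.1 h2 a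
            fun z hz hzg => hc y hy z (hlt z hz).le hzg, smul_mul_assoc, smul_smul, smul_smul]
        congr 1
        · rw [mul_assoc, mul_right_comm]
          refine congrArg (· * qInt (a y)) ?_
          rw [← zpow_add₀ hq, ← zpow_add₀ hq, ← List.sum_map_add]
          congr 2
          rw [List.map_append, List.sum_append, List.map_singleton, List.sum_singleton,
            if_neg (lt_irrefl _), if_neg (lt_irrefl _), zero_mul, add_zero]
          refine congrArg List.sum (List.map_congr_left fun z hz => ?_)
          rw [if_neg (hlt z hz).not_gt, if_pos (hlt z hz)]
          split_ifs <;> ring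
        · rw [monL_append]
          congr 1
          · exact monL_congr fun z hz => by simp [shift, incr, (hlt z hz).ne]
          · simp [shift, h1.ne']
      · rw [if_neg hy]
        have : δ (X y ^ a y) = 0 := by
          generalize a y = n
          induction n with
          | zero => simp [h.map_one]
          | succ n ihn => rw [pow_succ, h, ihn, hnd y hy]; simp
        simp [this]

end IsTwDer
end Ordered

/-! ### Ordered monomials in a rectangular family -/

/-- The cells of a rectangular array in increasing lexicographic order. -/
def cells (M N : ℕ) : List (Fin M ×ₗ Fin N) :=
  (List.finRange M).flatMap fun i => (List.finRange N).map fun j => toLex (i, j)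

lemma mem_cells {M N : ℕ} (c : Fin M ×ₗ Fin N) : c ∈ cells M N := by
  simp only [cells, List.mem_flatMap, List.mem_finRange, List.mem_map, true_and]
  exact ⟨(ofLex c).1, (ofLex c).2, rfl⟩

lemma cells_pairwise (M N : ℕ) : (cells M N).Pairwise (· < ·) := by
  rw [cells, List.pairwise_flatMap]
  constructor
  · intro i _
    rw [List.pairwise_map]
    refine (List.pairwise_lt_finRange N).imp ?_
    intro a b h
    exact Prod.Lex.toLex_lt_toLex.mpr (Or.inr ⟨rfl, h⟩)
  · refine (List.pairwise_lt_finRange M).imp ?_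
    intro a b h x hx y hy
    obtain ⟨_, _, rfl⟩ := List.mem_map.mp hx
    obtain ⟨_, _, rfl⟩ := List.mem_map.mp hy
    exact Prod.Lex.toLex_lt_toLex.mpr (Or.inl h)

lemma sum_cells {M N : ℕ} {A : Type*} [AddCommMonoid A] (f : Fin M ×ₗ Fin N → A) :
    ((cells M N).map f).sum = ∑ i, ∑ j, f (toLex (i, j)) := by
  rw [cells, List.map_flatMap, List.flatMap_def, List.sum_flatten, List.map_map,
    ← List.sum_ofFn]
  rw [List.ofFn_eq_map]
  congr 1
  refine List.map_congr_left fun i _ => ?_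
  rw [← List.sum_ofFn, List.ofFn_eq_map]
  simp [Function.comp_def]

section
variable {R : Type*} [Ring R] [Algebra Kq R] {M N : ℕ}

/-- The monomial with exponents `a`, in increasing lexicographic order. -/
def mon (X : Fin M → Fin N → R) (a : Fin M → Fin N → ℕ) : R :=
  ((List.finRange M).flatMap fun i => (List.finRange N).map fun j => X i j ^ a i j).prod

/-- Exponents increased by one at `(i, j)`. -/
def mincr (a : Fin M → Fin N → ℕ) (i : Fin M) (j : Fin N) : Fin M → Fin N → ℕ :=
  fun r s => a r s + if r = i ∧ s = j then 1 else 0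

/-- One unit of the exponents moved from `(i, j)` to `(k, l)`. -/
def mshift (a : Fin M → Fin N → ℕ) (i : Fin M) (j : Fin N) (k : Fin M) (l : Fin N) :
    Fin M → Fin N → ℕ :=
  fun r s => a r s - (if r = i ∧ s = j then 1 else 0) + if r = k ∧ s = l then 1 else 0

/-- A family indexed by cells. -/
def onCells {A : Type*} (X : Fin M → Fin N → A) (c : Fin M ×ₗ Fin N) : A :=
  X (ofLex c).1 (ofLex c).2

@[simp] lemma onCells_toLex {A : Type*} (X : Fin M → Fin N → A) (i : Fin M) (j : Fin N) :
    onCells X (toLex (i, j)) = X i j := rfl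

lemma mon_eq_monL (X : Fin M → Fin N → R) (a : Fin M → Fin N → ℕ) :
    mon X a = monL (cells M N) (onCells X) (onCells a) := by
  simp [mon, monL, cells, List.map_flatMap, Function.comp_def]

lemma toLex_eq_iff {r i : Fin M} {s j : Fin N} :
    (toLex (r, s) : Fin M ×ₗ Fin N) = toLex (i, j) ↔ r = i ∧ s = j := by
  rw [toLex.injective.eq_iff, Prod.mk.injEq]

lemma onCells_mshift (a : Fin M → Fin N → ℕ) (i : Fin M) (j : Fin N) (k : Fin M) (l : Fin N) :
    onCells (mshift a i j k l) = shift (onCells a) (toLex (i, j)) (toLex (k, l)) := by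
  funext c
  obtain ⟨r, s⟩ := c
  change mshift a i j k l r s = a r s - (if toLex (r, s) = toLex (i, j) then 1 else 0) +
    if toLex (r, s) = toLex (k, l) then 1 else 0
  simp only [toLex_eq_iff, mshift]

lemma onCells_mincr (a : Fin M → Fin N → ℕ) (i : Fin M) (j : Fin N) :
    onCells (mincr a i j) = incr (onCells a) (toLex (i, j)) := by
  funext c
  obtain ⟨r, s⟩ := c
  change mincr a i j r s = a r s + if toLex (r, s) = toLex (i, j) then 1 else 0
  simp only [toLex_eq_iff, mincr]

lemma sum_two {n : ℕ} {A : Type*} [AddCommMonoid A] {f : Fin n → A} {a b : Fin n} (h : a ≠ b)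
    (h0 : ∀ c, c ≠ a → c ≠ b → f c = 0) : ∑ c, f c = f a + f b :=
  Finset.sum_eq_add a b h (fun c _ hc => h0 c hc.1 hc.2) (by simp) (by simp)

lemma sum_Ici {n : ℕ} {A : Type*} [AddCommMonoid A] (f : Fin n → A) (j : Fin n) :
    ∑ k ∈ Finset.Ici j, f k = ∑ k, if j ≤ k then f k else 0 := by
  rw [← Finset.sum_filter]; congr 1; ext; simp
lemma sum_Iic {n : ℕ} {A : Type*} [AddCommMonoid A] (f : Fin n → A) (j : Fin n) :
    ∑ k ∈ Finset.Iic j, f k = ∑ k, if k ≤ j then f k else 0 := by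
  rw [← Finset.sum_filter]; congr 1; ext; simp
lemma sum_Ioi {n : ℕ} {A : Type*} [AddCommMonoid A] (f : Fin n → A) (j : Fin n) :
    ∑ k ∈ Finset.Ioi j, f k = ∑ k, if j < k then f k else 0 := by
  rw [← Finset.sum_filter]; congr 1; ext; simp
lemma sum_Iio {n : ℕ} {A : Type*} [AddCommMonoid A] (f : Fin n → A) (j : Fin n) :
    ∑ k ∈ Finset.Iio j, f k = ∑ k, if k < j then f k else 0 := by
  rw [← Finset.sum_filter]; congr 1; ext; simp

lemma lo_lt_hi {N : ℕ} (i : Fin (N - 1)) : (lo i : Fin N) < hi i := by simp [lo, hi, Fin.lt_def]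

lemma lt_hi_iff {N : ℕ} {i : Fin (N - 1)} {r : Fin N} : r < hi i ↔ r ≤ lo i := by
  simp only [lo, hi, Fin.lt_def, Fin.le_def]; omega

lemma lo_lt_iff {N : ℕ} {i : Fin (N - 1)} {r : Fin N} : lo i < r ↔ hi i ≤ r := by
  simp only [lo, hi, Fin.lt_def, Fin.le_def]; omega

lemma wtE_lo {N : ℕ} (i : Fin (N - 1)) : wtE (lo i : Fin N) i = 1 := by
  simp [wtE, (lo_lt_hi i).ne]
lemma wtE_hi {N : ℕ} (i : Fin (N - 1)) : wtE (hi i : Fin N) i = -1 := by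
  simp [wtE, (lo_lt_hi i).ne']
lemma wtE_ne {N : ℕ} {i : Fin (N - 1)} {r : Fin N} (h : r ≠ lo i) (h' : r ≠ hi i) :
    wtE r i = 0 := by
  simp [wtE, h, h']

variable {X : Fin M → Fin N → R}

lemma map_mon {φ : R →ₐ[Kq] R} {s : Fin M → Fin N → ℤ} (hφ : ∀ r c, φ (X r c) = q ^ s r c • X r c)
    (a : Fin M → Fin N → ℕ) : φ (mon X a) = q ^ (∑ r, ∑ c, s r c * a r c) • mon X a := by
  rw [mon_eq_monL, map_monL (X := onCells X) (s := onCells s) (fun y => hφ _ _), sum_cells]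
  rfl

/-- `F_i` turns a cell `(lo, j)` into `(hi, j)`, which comes later. On the way it meets cells `(lo,
k)` with `k ≥ j` and `(hi, k)` with `k < j`: it commutes with the former for `k > j`, costs `q⁻¹`
for the others, and never meets a diagonal relation. At the cell itself `u = 0` and `s + e = -1 -
1`, whence `w = -1`. -/
lemma f_mon (hX : IsQMat X) (i : Fin (M - 1)) {f : R →ₗ[Kq] R} {kinv : R →ₐ[Kq] R}
    (hf : IsTwDer f kinv (AlgHom.id Kq R))
    (hfX : ∀ r s, f (X r s) = if r = lo i then X (hi i) s else 0)
    (hk : ∀ r s, kinv (X r s) = q ^ (-wtE r i) • X r s) (a : Fin M → Fin N → ℕ) :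
    f (mon X a) = ∑ j, (q ^ (∑ k ∈ Finset.Ici j, ((a (hi i) k : ℤ) - a (lo i) k) + 1) *
      qInt (a (lo i) j)) • mon X (mshift a (lo i) j (hi i) j) := by
  have hlh := lo_lt_hi i
  rw [mon_eq_monL, hf.map_monL_right (X := onCells X) (s := fun c => -wtE (ofLex c).1 i) (u := fun _ => 0)
    (dom := fun c => (ofLex c).1 = lo i) (g := fun c => toLex (hi i, (ofLex c).2)) (w := -1)
    (e := fun z y => if (ofLex y).1 = (ofLex z).1 ∨ (ofLex y).2 = (ofLex z).2 then -1 else 0)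
    (fun y => hk _ _) (fun y => by simp) (fun y hy => by simp [onCells, hfX, hy])
    (fun y hy => by simp [onCells, hfX, hy]) ?_ ?_ (cells_pairwise M N) ?_ (onCells a), sum_cells]
  · rw [Finset.sum_eq_single (lo i) (fun r _ hr => by simp [hr]) (by simp)]
    refine Finset.sum_congr rfl fun j _ => ?_
    rw [if_pos (by simp), mon_eq_monL, onCells_mshift, sum_cells]
    congr 3
    rw [sum_two hlh.ne, sum_Ici, ← Finset.sum_add_distrib]
    · have e1 : (a (lo i) j : ℤ) = ∑ k, if k = j then (a (lo i) k : ℤ) else 0 := by simp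
      rw [onCells_toLex, mul_sub, mul_one, sub_neg_eq_add, add_right_comm, e1, Finset.mul_sum,
        ← Finset.sum_add_distrib]
      congr 1
      refine Finset.sum_congr rfl fun k _ => ?_
      rcases lt_trichotomy k j with h | rfl | h
      · simp [Prod.Lex.toLex_lt_toLex, wtE_hi, h, h.ne, h.not_ge, hlh, hlh.ne', hlh.not_gt,
          h.not_gt]
      · simp [Prod.Lex.toLex_lt_toLex, wtE_hi, hlh, hlh.ne', hlh.not_gt]
        ring
      · simp [Prod.Lex.toLex_lt_toLex, wtE_lo, wtE_hi, h, h.ne', h.le, hlh, hlh.ne, hlh.ne',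
          hlh.not_gt, h.not_gt]
        ring
    · intro r h1 h2
      refine Finset.sum_eq_zero fun s _ => ?_
      rcases lt_or_gt_of_ne h1 with h | h
      · simp [Prod.Lex.toLex_lt_toLex, h]
      · have h3 : hi i < r := lt_of_le_of_ne (lo_lt_iff.mp h) (Ne.symm h2)
        simp [Prod.Lex.toLex_lt_toLex, h, h.not_gt, h3.not_gt, h2, h1, h1.symm, wtE_ne h1 h2]
  · rintro ⟨x1, x2⟩ hx ⟨y1, y2⟩ hxy hyg
    change x1 = lo i at hx
    subst hx
    change X (hi i) x2 * X y1 y2 = q ^ (if y1 = hi i ∨ y2 = x2 then (-1 : ℤ) else 0) • (X y1 y2 * X (hi i) x2)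
    replace hxy := Prod.Lex.toLex_le_toLex.mp hxy
    replace hyg := Prod.Lex.toLex_lt_toLex.mp hyg
    simp only at hxy hyg
    have inv : ∀ {u v : R}, u = q • v → v = q ^ (-1 : ℤ) • u := by
      rintro u v rfl; rw [smul_smul, zpow_neg_one, inv_mul_cancel₀ q_ne_zero, one_smul]
    rcases hyg with h1 | ⟨h1, h2⟩
    · obtain rfl : y1 = lo i := by
        rcases hxy with h3 | ⟨h3, _⟩
        · exact absurd (lo_lt_iff.mp h3) h1.not_ge
        · exact h3.symm
      rcases eq_or_ne y2 x2 with rfl | hne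
      · simp only [or_true, if_true]
        exact inv (hX.col _ _ _ hlh)
      · have : x2 < y2 := by
          rcases hxy with h3 | ⟨_, h3⟩
          · exact absurd h3 (lt_irrefl _)
          · exact lt_of_le_of_ne h3 hne.symm
        simp only [hlh.ne, hne, or_self, if_false, zpow_zero, one_smul]
        exact (hX.anti _ _ _ _ hlh this).symm
    · subst h1
      simp only [true_or, if_true]
      exact inv (hX.row _ _ _ h2)
  · rintro ⟨x1, x2⟩ hx
    change x1 = lo i at hx
    subst hx
    change (0 : ℤ) = _ ∧ -wtE (lo i) i + (if lo i = hi i ∨ x2 = x2 then (-1 : ℤ) else 0) = _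
    simp [wtE_lo]
  · rintro ⟨x1, x2⟩ _ hx
    change x1 = lo i at hx
    subst hx
    exact ⟨Prod.Lex.toLex_lt_toLex.mpr (Or.inl hlh), mem_cells _⟩

/-- `E_i` turns `(hi, j)` into the earlier cell `(lo, j)`, so the new generator travels leftwards,
again only through commuting or `q`-commuting cells. Here `s = 0` and `u - e = -1 - 1`, so `w = -1`
as for `F_i`. -/
lemma e_mon (hX : IsQMat X) (i : Fin (M - 1)) {f : R →ₗ[Kq] R} {k : R →ₐ[Kq] R}
    (hf : IsTwDer f (AlgHom.id Kq R) k)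
    (hfX : ∀ r s, f (X r s) = if r = hi i then X (lo i) s else 0)
    (hk : ∀ r s, k (X r s) = q ^ wtE r i • X r s) (a : Fin M → Fin N → ℕ) :
    f (mon X a) = ∑ j, (q ^ (∑ k ∈ Finset.Iic j, ((a (lo i) k : ℤ) - a (hi i) k) + 1) *
      qInt (a (hi i) j)) • mon X (mshift a (hi i) j (lo i) j) := by
  have hlh := lo_lt_hi i
  rw [mon_eq_monL, hf.map_monL_left (X := onCells X) (u := fun c => wtE (ofLex c).1 i)
    (s := fun _ => 0)
    (dom := fun c => (ofLex c).1 = hi i) (g := fun c => toLex (lo i, (ofLex c).2)) (w := -1)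
    (e := fun z y => if (ofLex y).1 = (ofLex z).1 ∨ (ofLex y).2 = (ofLex z).2 then 1 else 0)
    (fun y => by simp) (fun y => hk _ _) (fun y hy => by simp [onCells, hfX, hy])
    (fun y hy => by simp [onCells, hfX, hy]) ?_ ?_ (cells_pairwise M N) ?_ (onCells a), sum_cells]
  · rw [Finset.sum_eq_single (hi i) (fun r _ hr => by simp [hr]) (by simp)]
    refine Finset.sum_congr rfl fun j _ => ?_
    rw [if_pos (by simp), mon_eq_monL, onCells_mshift, sum_cells]
    congr 3
    rw [sum_two hlh.ne, sum_Iic, ← Finset.sum_add_distrib]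
    · have e1 : (a (hi i) j : ℤ) = ∑ k, if k = j then (a (hi i) k : ℤ) else 0 := by simp
      rw [onCells_toLex, mul_sub, mul_one, sub_neg_eq_add, add_right_comm, e1, Finset.mul_sum,
        ← Finset.sum_add_distrib]
      congr 1
      refine Finset.sum_congr rfl fun k _ => ?_
      rcases lt_trichotomy k j with h | rfl | h
      · simp [Prod.Lex.toLex_lt_toLex, wtE_lo, wtE_hi, h, h.ne, h.le, hlh, hlh.ne', hlh.not_gt,
          h.not_gt]
        ring
      · simp [Prod.Lex.toLex_lt_toLex, wtE_lo, hlh, hlh.not_gt]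
        ring
      · simp [Prod.Lex.toLex_lt_toLex, wtE_lo, h, h.ne', h.not_ge, hlh, hlh.not_gt, h.not_gt]
    · intro r h1 h2
      refine Finset.sum_eq_zero fun s _ => ?_
      rcases lt_or_gt_of_ne h2 with h | h
      · have h3 : r < lo i := lt_of_le_of_ne (lt_hi_iff.mp h) h1
        simp [Prod.Lex.toLex_lt_toLex, h, h.not_gt, h3.not_gt, h2, h1.symm, h2.symm, wtE_ne h1 h2]
      · simp [Prod.Lex.toLex_lt_toLex, h]
  · rintro ⟨x1, x2⟩ hx ⟨y1, y2⟩ hxy hyg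
    change x1 = hi i at hx
    subst hx
    change X (lo i) x2 * X y1 y2 =
      q ^ (if y1 = lo i ∨ y2 = x2 then (1 : ℤ) else 0) • (X y1 y2 * X (lo i) x2)
    replace hxy := Prod.Lex.toLex_le_toLex.mp hxy
    replace hyg := Prod.Lex.toLex_lt_toLex.mp hyg
    simp only at hxy hyg
    rcases hyg with h1 | ⟨h1, h2⟩
    · obtain rfl : y1 = hi i := by
        rcases hxy with h3 | ⟨h3, _⟩
        · exact absurd (lt_hi_iff.mp h3) h1.not_ge
        · exact h3
      rcases eq_or_ne y2 x2 with rfl | hne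
      · simp only [or_true, if_true, zpow_one]
        exact hX.col _ _ _ hlh
      · have : y2 < x2 := by
          rcases hxy with h3 | ⟨_, h3⟩
          · exact absurd h3 (lt_irrefl _)
          · exact lt_of_le_of_ne h3 hne
        simp only [hlh.ne', hne, or_self, if_false, zpow_zero, one_smul]
        exact hX.anti _ _ _ _ hlh this
    · subst h1
      simp only [true_or, if_true, zpow_one]
      exact hX.row _ _ _ h2
  · rintro ⟨x1, x2⟩ hx
    change x1 = hi i at hx
    subst hx
    change (0 : ℤ) = _ ∧ wtE (hi i) i - (if hi i = lo i ∨ x2 = x2 then (1 : ℤ) else 0) = _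
    simp [wtE_hi]
  · rintro ⟨x1, x2⟩ _ hx
    change x1 = hi i at hx
    subst hx
    exact ⟨Prod.Lex.toLex_lt_toLex.mpr (Or.inl hlh), mem_cells _⟩

/-- The right action moves a unit between neighbouring columns of one row. No other cell lies
between the old and the new one, so the only commutation needed is the row relation with the old
generator, and `w = 0`. -/
lemma rf_mon (hX : IsQMat X) (i : Fin (N - 1)) {f : R →ₗ[Kq] R} {kinv : R →ₐ[Kq] R}
    (hf : IsTwDer f kinv (AlgHom.id Kq R))
    (hfX : ∀ r s, f (X r s) = if s = hi i then X r (lo i) else 0)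
    (hk : ∀ r s, kinv (X r s) = q ^ (-wtE s i) • X r s) (a : Fin M → Fin N → ℕ) :
    f (mon X a) = ∑ r, (q ^ (∑ k ∈ Finset.Ioi r, ((a k (hi i) : ℤ) - a k (lo i))) *
      qInt (a r (hi i))) • mon X (mshift a r (hi i) r (lo i)) := by
  have hlh := lo_lt_hi i
  rw [mon_eq_monL, hf.map_monL_left (X := onCells X) (s := fun c => -wtE (ofLex c).2 i)
    (u := fun _ => 0)
    (dom := fun c => (ofLex c).2 = hi i) (g := fun c => toLex ((ofLex c).1, lo i)) (w := 0)
    (e := fun z y => 1)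
    (fun y => hk _ _) (fun y => by simp) (fun y hy => by simp [onCells, hfX, hy])
    (fun y hy => by simp [onCells, hfX, hy]) ?_ ?_ (cells_pairwise M N) ?_ (onCells a), sum_cells]
  · refine Finset.sum_congr rfl fun r _ => ?_
    rw [Finset.sum_eq_single (hi i) (fun r _ hr => by simp [hr]) (by simp)]
    rw [if_pos (by simp), mon_eq_monL, onCells_mshift, sum_cells]
    congr 3
    rw [zero_mul, zero_add, sum_Ioi]
    refine Finset.sum_congr rfl fun k _ => ?_
    rw [sum_two hlh.ne]
    · rcases lt_trichotomy k r with h | rfl | h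
      · simp [Prod.Lex.toLex_lt_toLex, h, h.not_gt, h.ne']
      · simp [Prod.Lex.toLex_lt_toLex, hlh, hlh.not_gt]
      · simp [Prod.Lex.toLex_lt_toLex, h, wtE_lo, wtE_hi]
        ring
    · intro s h1 h2
      rcases lt_trichotomy k r with h | rfl | h
      · simp [Prod.Lex.toLex_lt_toLex, h, h.not_gt, h.ne']
      · rcases lt_or_gt_of_ne h2 with h | h
        · have h3 : s < lo i := lt_of_le_of_ne (lt_hi_iff.mp h) h1
          simp [Prod.Lex.toLex_lt_toLex, h, h.not_gt, h3.not_gt]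
        · simp [Prod.Lex.toLex_lt_toLex, h, wtE_ne h1 h2]
      · simp [Prod.Lex.toLex_lt_toLex, h, wtE_ne h1 h2]
  · rintro ⟨x1, x2⟩ hx ⟨y1, y2⟩ hxy hyg
    change x2 = hi i at hx
    subst hx
    change X x1 (lo i) * X y1 y2 = q ^ (1 : ℤ) • (X y1 y2 * X x1 (lo i))
    replace hxy := Prod.Lex.toLex_le_toLex.mp hxy
    replace hyg := Prod.Lex.toLex_lt_toLex.mp hyg
    simp only at hxy hyg
    rw [zpow_one]
    rcases hyg with h1 | ⟨rfl, h2⟩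
    · rcases hxy with h3 | ⟨h3, _⟩
      · exact absurd h3 h1.not_gt
      · exact absurd h3 h1.ne'
    · exact hX.row _ _ _ h2
  · rintro ⟨x1, x2⟩ hx
    change x2 = hi i at hx
    subst hx
    change -wtE (hi i) i = _ ∧ _
    simp [wtE_hi]
  · rintro ⟨x1, x2⟩ _ hx
    change x2 = hi i at hx
    subst hx
    exact ⟨Prod.Lex.toLex_lt_toLex.mpr (Or.inr ⟨rfl, hlh⟩), mem_cells _⟩

/-- As for the right action of `F_i`, the old and new cells are adjacent in lexicographic order; the
new one now comes second. -/
lemma re_mon (hX : IsQMat X) (i : Fin (N - 1)) {f : R →ₗ[Kq] R} {k : R →ₐ[Kq] R}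
    (hf : IsTwDer f (AlgHom.id Kq R) k)
    (hfX : ∀ r s, f (X r s) = if s = lo i then X r (hi i) else 0)
    (hk : ∀ r s, k (X r s) = q ^ wtE s i • X r s) (a : Fin M → Fin N → ℕ) :
    f (mon X a) = ∑ r, (q ^ (∑ k ∈ Finset.Iio r, ((a k (lo i) : ℤ) - a k (hi i))) *
      qInt (a r (lo i))) • mon X (mshift a r (lo i) r (hi i)) := by
  have hlh := lo_lt_hi i
  have inv : ∀ {u v : R}, u = q • v → v = q ^ (-1 : ℤ) • u := by
    rintro u v rfl; rw [smul_smul, zpow_neg_one, inv_mul_cancel₀ q_ne_zero, one_smul]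
  rw [mon_eq_monL, hf.map_monL_right (X := onCells X) (u := fun c => wtE (ofLex c).2 i)
    (s := fun _ => 0)
    (dom := fun c => (ofLex c).2 = lo i) (g := fun c => toLex ((ofLex c).1, hi i)) (w := 0)
    (e := fun z y => -1)
    (fun y => by simp) (fun y => hk _ _) (fun y hy => by simp [onCells, hfX, hy])
    (fun y hy => by simp [onCells, hfX, hy]) ?_ ?_ (cells_pairwise M N) ?_ (onCells a), sum_cells]
  · refine Finset.sum_congr rfl fun r _ => ?_
    rw [Finset.sum_eq_single (lo i) (fun r _ hr => by simp [hr]) (by simp)]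
    rw [if_pos (by simp), mon_eq_monL, onCells_mshift, sum_cells]
    congr 3
    rw [zero_mul, zero_add, sum_Iio]
    refine Finset.sum_congr rfl fun k _ => ?_
    rw [sum_two hlh.ne]
    · rcases lt_trichotomy k r with h | rfl | h
      · simp [Prod.Lex.toLex_lt_toLex, h, wtE_lo, wtE_hi]
        ring
      · simp [Prod.Lex.toLex_lt_toLex, hlh, hlh.not_gt]
      · simp [Prod.Lex.toLex_lt_toLex, h, h.not_gt, h.ne']
    · intro s h1 h2
      rcases lt_trichotomy k r with h | rfl | h
      · simp [Prod.Lex.toLex_lt_toLex, h, wtE_ne h1 h2]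
      · rcases lt_or_gt_of_ne h1 with h | h
        · simp [Prod.Lex.toLex_lt_toLex, h, wtE_ne h1 h2]
        · have h3 : hi i < s := lt_of_le_of_ne (lo_lt_iff.mp h) (Ne.symm h2)
          simp [Prod.Lex.toLex_lt_toLex, h, h.not_gt, h3.not_gt]
      · simp [Prod.Lex.toLex_lt_toLex, h, h.not_gt, h.ne']
  · rintro ⟨x1, x2⟩ hx ⟨y1, y2⟩ hxy hyg
    change x2 = lo i at hx
    subst hx
    change X x1 (hi i) * X y1 y2 = q ^ (-1 : ℤ) • (X y1 y2 * X x1 (hi i))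
    replace hxy := Prod.Lex.toLex_le_toLex.mp hxy
    replace hyg := Prod.Lex.toLex_lt_toLex.mp hyg
    simp only at hxy hyg
    rcases hyg with h1 | ⟨rfl, h2⟩
    · rcases hxy with h3 | ⟨h3, _⟩
      · exact absurd h3 h1.not_gt
      · exact absurd h3 h1.ne'
    · exact inv (hX.row _ _ _ h2)
  · rintro ⟨x1, x2⟩ hx
    change x2 = lo i at hx
    subst hx
    change wtE (lo i) i = _ ∧ _
    simp [wtE_lo]
  · rintro ⟨x1, x2⟩ _ hx
    change x2 = lo i at hx
    subst hx
    exact ⟨Prod.Lex.toLex_lt_toLex.mpr (Or.inr ⟨rfl, hlh⟩), mem_cells _⟩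

/-- Insertion of a generator into a monomial, when all earlier rows have their entries weakly to
the right of it. -/
lemma gen_mul_mon (hX : IsQMat X) (a : Fin M → Fin N → ℕ) (i : Fin M) (j : Fin N)
    (h : ∀ r s, r < i → a r s ≠ 0 → j ≤ s) :
    X i j * mon X a = q ^ (-(∑ s ∈ Finset.Iio j, (a i s : ℤ)) - ∑ r ∈ Finset.Iio i, (a r j : ℤ)) •
      mon X (mincr a i j) := by
  have inv : ∀ {u v : R}, u = q • v → v = q ^ (-1 : ℤ) • u := by
    rintro u v rfl; rw [smul_smul, zpow_neg_one, inv_mul_cancel₀ q_ne_zero, one_smul]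
  rw [mon_eq_monL, mon_eq_monL, onCells_mincr, show X i j = onCells X (toLex (i, j)) from rfl,
    gen_mul_monL (e := fun y => if (ofLex y).1 = i ∨ (ofLex y).2 = j then -1 else 0)
      (cells_pairwise M N) (mem_cells _) (onCells a), sum_cells]
  · congr 2
    rw [sum_Iio, sum_Iio, ← Finset.sum_neg_distrib, sub_eq_add_neg, ← Finset.sum_neg_distrib,
      ← Finset.add_sum_erase _ _ (Finset.mem_univ i)]
    congr 1
    · refine Finset.sum_congr rfl fun s _ => ?_
      by_cases hs : s < j <;> simp [Prod.Lex.toLex_lt_toLex, hs]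
    · rw [← Finset.add_sum_erase _ _ (Finset.mem_univ i), if_neg (lt_irrefl _), neg_zero, zero_add]
      refine Finset.sum_congr rfl fun r hr => ?_
      have hr := Finset.ne_of_mem_erase hr
      rw [Finset.sum_eq_single j (fun s _ hs => by simp [hr, hs]) (by simp)]
      by_cases h' : r < i <;> simp [Prod.Lex.toLex_lt_toLex, h', hr]
  · rintro ⟨y1, y2⟩ _ hy h0
    replace hy := Prod.Lex.toLex_lt_toLex.mp hy
    simp only at hy
    change X i j * X y1 y2 =
      q ^ (if y1 = i ∨ y2 = j then (-1 : ℤ) else 0) • (X y1 y2 * X i j)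
    rcases hy with h1 | ⟨rfl, h2⟩
    · have h3 := h y1 y2 h1 h0
      rcases eq_or_lt_of_le h3 with rfl | h4
      · simp only [or_true, if_true]
        exact inv (hX.col _ _ _ h1)
      · simp only [h1.ne, h4.ne', or_self, if_false, zpow_zero, one_smul]
        exact (hX.anti _ _ _ _ h1 h4).symm
    · simp only [true_or, if_true]
      exact inv (hX.row _ _ _ h2)

lemma mon_zero : mon X 0 = 1 := by
  rw [mon_eq_monL]
  unfold monL
  apply List.prod_eq_one
  intro x hx
  obtain ⟨y, _, rfl⟩ := List.mem_map.mp hx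
  simp [onCells]

end

/-! ### The action of the iquantum group on the quotient -/

section Index
variable {N : ℕ}

lemma lo_rev (i : Fin (N - 1)) : (lo i.rev : Fin N) = (hi i).rev := by
  ext; simp only [lo, hi, Fin.val_rev]; omega
lemma hi_rev (i : Fin (N - 1)) : (hi i.rev : Fin N) = (lo i).rev := by
  ext; simp only [lo, hi, Fin.val_rev]; omega
lemma wtE_rev (r : Fin N) (i : Fin (N - 1)) : wtE r.rev i.rev = -wtE r i := by
  simp only [wtE, lo_rev, hi_rev, Fin.rev_inj]; ring
lemma isPos_rev_iff (r : Fin N) : IsPos r.rev ↔ r < r.rev := by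
  simp [IsPos]
lemma isZero_rev_iff (r : Fin N) : IsZero r.rev ↔ IsZero r := by
  simp [IsZero, eq_comm]
lemma not_isPos_rev {r : Fin N} (h : IsPos r) : ¬ IsPos r.rev := by
  rw [isPos_rev_iff]; exact h.not_gt
lemma not_isZero_of_isPos {r : Fin N} (h : IsPos r) : ¬ IsZero r := h.ne
lemma isPos_or (r : Fin N) : IsPos r ∨ IsZero r ∨ IsPos r.rev := by
  rw [isPos_rev_iff]; exact lt_trichotomy _ _
lemma IsZero.unique {r s : Fin N} (hr : IsZero r) (hs : IsZero s) : r = s := by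
  have h1 := congrArg Fin.val hr
  have h2 := congrArg Fin.val hs
  simp only [Fin.val_rev] at h1 h2
  ext; omega

end Index

namespace T
variable {P : ℕ}

/-- The left action of `B_i` in type `ı`. -/
def bI (i : Fin (P - 1)) : T P →ₗ[Kq] T P :=
  if IsZero i then
    fOp i + q⁻¹ • (eOp i ∘ₗ (kinvOp i).toLinearMap) + (kinvOp i).toLinearMap
  else fOp i + eOp i.rev ∘ₗ (kinvOp i).toLinearMap

/-- The left action of `B_i` in type `ȷ`. -/
def bJ (i : Fin (P - 1)) : T P →ₗ[Kq] T P :=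
  if IsPos i then fOp i + eOp i.rev ∘ₗ (kinvOp i).toLinearMap
  else fOp i + (kinvOp i).toLinearMap ∘ₗ eOp i.rev

lemma bI_of_isZero {i : Fin (P - 1)} (h : IsZero i) :
    bI i = fOp i + q⁻¹ • (eOp i ∘ₗ (kinvOp i).toLinearMap) + (kinvOp i).toLinearMap := if_pos h
lemma bI_of_not {i : Fin (P - 1)} (h : ¬ IsZero i) :
    bI i = fOp i + eOp i.rev ∘ₗ (kinvOp i).toLinearMap := if_neg h
lemma bJ_of_isPos {i : Fin (P - 1)} (h : IsPos i) :
    bJ i = fOp i + eOp i.rev ∘ₗ (kinvOp i).toLinearMap := if_pos h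
lemma bJ_of_not {i : Fin (P - 1)} (h : ¬ IsPos i) :
    bJ i = fOp i + (kinvOp i).toLinearMap ∘ₗ eOp i.rev := if_neg h

/-- The exponents by which `d_r` acts on the rows. -/
def dWt (r s : Fin P) : ℤ :=
  (if s = r then 1 else 0) + if IsZero r then 0 else if s = r.rev then 1 else 0

/-- The span of the generators of the right ideal. -/
def linRel (P : ℕ) : Submodule Kq (T P) := Submodule.span Kq (idealGens P)

lemma mul_mem_rightIdeal {x : T P} (hx : x ∈ linRel P) (y : T P) : x * y ∈ rightIdeal P := by
  have : linRel P ≤ (rightIdeal P).comap (LinearMap.mulRight Kq y) := by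
    refine Submodule.span_le.mpr fun z hz => Submodule.subset_span ⟨z, hz, y, rfl⟩
  exact this hx

lemma rel_diag {i j : Fin P} (hi : IsPos i) (hj : IsPos j) :
    t i j - t i.rev j.rev - (q - q⁻¹) • t i j.rev ∈ linRel P :=
  Submodule.subset_span (Or.inl ⟨i, j, hi, hj, Or.inl rfl⟩)
lemma rel_anti {i j : Fin P} (hi : IsPos i) (hj : IsPos j) :
    t i j.rev - t i.rev j ∈ linRel P :=
  Submodule.subset_span (Or.inl ⟨i, j, hi, hj, Or.inr rfl⟩)
lemma rel_col {i z : Fin P} (hi : IsPos i) (hz : IsZero z) :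
    t i z - q • t i.rev z ∈ linRel P :=
  Submodule.subset_span (Or.inr ⟨i, z, hi, hz, Or.inl rfl⟩)
lemma rel_row {i z : Fin P} (hi : IsPos i) (hz : IsZero z) :
    t z i - q • t z i.rev ∈ linRel P :=
  Submodule.subset_span (Or.inr ⟨i, z, hi, hz, Or.inr rfl⟩)

lemma linRel_le {S : Submodule Kq (T P)} {L : T P →ₗ[Kq] T P}
    (h1 : ∀ i j : Fin P, IsPos i → IsPos j →
      L (t i j) - L (t i.rev j.rev) - (q - q⁻¹) • L (t i j.rev) ∈ S)
    (h2 : ∀ i j : Fin P, IsPos i → IsPos j → L (t i j.rev) - L (t i.rev j) ∈ S)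
    (h3 : ∀ i z : Fin P, IsPos i → IsZero z → L (t i z) - q • L (t i.rev z) ∈ S)
    (h4 : ∀ i z : Fin P, IsPos i → IsZero z → L (t z i) - q • L (t z i.rev) ∈ S) :
    linRel P ≤ S.comap L := by
  refine Submodule.span_le.mpr ?_
  rintro x (⟨i, j, hi, hj, rfl | rfl⟩ | ⟨i, z, hi, hz, rfl | rfl⟩)
  · simpa using h1 i j hi hj
  · simpa using h2 i j hi hj
  · simpa using h3 i z hi hz
  · simpa using h4 i z hi hz

lemma diagOp_linRel {χ : Fin P → ℤ} (hχ : ∀ r, χ r.rev = χ r) :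
    linRel P ≤ (linRel P).comap (diagOp χ).toLinearMap := by
  refine linRel_le ?_ ?_ ?_ ?_ <;> intro i j hi hj <;>
    simp only [AlgHom.toLinearMap_apply, diagOp_t, hχ]
  · have := Submodule.smul_mem _ (q ^ χ i) (rel_diag hi hj)
    convert this using 1
    module
  · have := Submodule.smul_mem _ (q ^ χ i) (rel_anti hi hj)
    convert this using 1
    module
  · have := Submodule.smul_mem _ (q ^ χ i) (rel_col hi hj)
    convert this using 1
    module
  · have := Submodule.smul_mem _ (q ^ χ j) (rel_row hi hj)
    convert this using 1
    module

/-- The generators with a zero label are exchanged in pairs. The first family is reproduced only up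
to a multiple of the second, because transposing turns `t_{i,-j}` into `t_{-j,i}`. -/
lemma transp_linRel : linRel P ≤ (linRel P).comap transp.toLinearMap := by
  refine linRel_le ?_ ?_ ?_ ?_ <;> intro i j hi hj <;>
    simp only [AlgHom.toLinearMap_apply, transp_t]
  · have := Submodule.add_mem _ (rel_diag hj hi) (Submodule.smul_mem _ (q - q⁻¹) (rel_anti hj hi))
    convert this using 1
    module
  · rw [← neg_sub]
    exact Submodule.neg_mem _ (rel_anti hj hi)
  · exact rel_row hi hj
  · exact rel_col hi hj

lemma rightIdeal_le_of_mul {L : T P →ₗ[Kq] T P}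
    (h : ∀ x ∈ linRel P, ∀ y, L (x * y) ∈ rightIdeal P) :
    rightIdeal P ≤ (rightIdeal P).comap L := by
  refine Submodule.span_le.mpr ?_
  rintro _ ⟨x, hx, y, rfl⟩
  exact h x (Submodule.subset_span hx) y

lemma diagOp_rightIdeal {χ : Fin P → ℤ} (hχ : ∀ r, χ r.rev = χ r) :
    rightIdeal P ≤ (rightIdeal P).comap (diagOp χ).toLinearMap :=
  rightIdeal_le_of_mul fun x hx y => by
    rw [AlgHom.toLinearMap_apply, map_mul]
    exact mul_mem_rightIdeal (diagOp_linRel hχ hx) _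

lemma transp_rightIdeal : rightIdeal P ≤ (rightIdeal P).comap transp.toLinearMap :=
  rightIdeal_le_of_mul fun x hx y => by
    rw [AlgHom.toLinearMap_apply, map_mul]
    exact mul_mem_rightIdeal (transp_linRel hx) _

lemma kOp_rev_kinvOp (i : Fin (P - 1)) (x : T P) :
    kOp i.rev (kinvOp i x) = diagOp (fun r => wtE r i.rev + -wtE r i) x :=
  diagOp_diagOp _ _ _

lemma kinvOp_kOp_rev (i : Fin (P - 1)) (x : T P) :
    kinvOp i (kOp i.rev x) = diagOp (fun r => wtE r i.rev + -wtE r i) x := by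
  rw [kinvOp, kOp, diagOp_diagOp]; simp only [add_comm]

lemma wt_symm (i : Fin (P - 1)) (r : Fin P) :
    wtE r.rev i.rev + -wtE r.rev i = wtE r i.rev + -wtE r i := by
  have h := wtE_rev r i.rev
  rw [Fin.rev_rev] at h
  rw [wtE_rev, h]; ring

/-- The relations have the same shape for every positive row. An operator carrying the rows `±a` to
the rows `±b`, with signs respected, and killing all others therefore sends each relation to a
relation of the same kind or to zero. -/
lemma linRel_le_of_pair {L : T P →ₗ[Kq] T P} {a b : Fin P} (ha : ¬ IsZero a)
    (hab : IsPos a → IsPos b) (hab' : IsPos a.rev → IsPos b.rev)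
    (hL : ∀ r s, L (t r s) = (if r = a then t b s else 0) + if r = a.rev then t b.rev s else 0) :
    linRel P ≤ (linRel P).comap L := by
  have hne : a ≠ a.rev := fun h => ha h.symm
  have key : ∀ r, IsPos r → (∀ s, L (t r s) = 0 ∧ L (t r.rev s) = 0) ∨
      ∃ r', IsPos r' ∧ ∀ s, L (t r s) = t r' s ∧ L (t r.rev s) = t r'.rev s := by
    intro r hr
    by_cases h1 : r = a
    · subst h1
      exact Or.inr ⟨b, hab hr, fun s => by simp [hL, hne, hne.symm]⟩
    · by_cases h2 : r = a.rev
      · subst h2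
        exact Or.inr ⟨b.rev, hab' hr, fun s => by simp [hL, hne, hne.symm]⟩
      · have h3 : r.rev ≠ a := fun h => h2 (by rw [← h, Fin.rev_rev])
        exact Or.inl fun s => by simp [hL, h1, h2, h3, Fin.rev_inj]
  refine linRel_le ?_ ?_ ?_ ?_
  · intro i j hi hj
    rcases key i hi with h | ⟨r', hr', h⟩
    · simp [h]
    · simpa [h] using rel_diag hr' hj
  · intro i j hi hj
    rcases key i hi with h | ⟨r', hr', h⟩
    · simp [h]
    · simpa [h] using rel_anti hr' hj
  · intro i j hi hj
    rcases key i hi with h | ⟨r', hr', h⟩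
    · simp [h]
    · simpa [h] using rel_col hr' hj
  · intro i z hi hz
    have h1 : z ≠ a := fun h => ha (h ▸ hz)
    have h2 : z ≠ a.rev := fun h => ha (by rw [h, isZero_rev_iff] at hz; exact hz)
    simp [hL, h1, h2]

/-- For `i ≠ 0`, `F_i` and `E_{-i}` act on opposite rows, and `K_i⁻¹` is trivial on the row on which
`E_{-i}` acts, so `B_i` merely carries one pair of opposite rows to another. For `i = 0` the two
rows `lo i`, `hi i` are opposite and are mixed; all other rows are fixed by `K_0⁻¹`. -/
lemma bI_linRel (hP : Even P) (i : Fin (P - 1)) : linRel P ≤ (linRel P).comap (bI i) := by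
  obtain ⟨p, rfl⟩ := hP
  have hlh := lo_lt_hi i
  by_cases hi0 : IsZero i
  · have hr : (lo i).rev = hi i := by rw [← hi_rev, hi0]
    have hr' : (hi i).rev = lo i := by rw [← hr, Fin.rev_rev]
    have hhi : ∀ s, bI i (t (hi i) s) = t (lo i) s + q • t (hi i) s := fun s => by
      simp [bI_of_isZero hi0, hlh.ne', wtE_hi, smul_smul, q_ne_zero]
    have hlo : ∀ s, bI i (t (lo i) s) = t (hi i) s + q⁻¹ • t (lo i) s := fun s => by
      simp [bI_of_isZero hi0, hlh.ne, wtE_lo]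
    have hne : ∀ r s, r ≠ lo i → r ≠ hi i → bI i (t r s) = t r s := fun r s h1 h2 => by
      simp [bI_of_isZero hi0, h1, h2, wtE_ne h1 h2]
    have hz : ∀ z : Fin (p + p), ¬ IsZero z := fun z h => by
      have := congrArg Fin.val h
      simp only [Fin.val_rev] at this; omega
    have hcase : ∀ r : Fin (p + p), IsPos r → r = hi i ∨ (r ≠ lo i ∧ r ≠ hi i ∧ r.rev ≠ lo i ∧
        r.rev ≠ hi i) := by
      intro r hp
      by_cases h : r = hi i
      · exact Or.inl h
      · refine Or.inr ⟨?_, h, ?_, ?_⟩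
        · rintro rfl; rw [IsPos, hr] at hp; exact hp.not_gt hlh
        · intro h'; exact h (by rw [← hr, ← h', Fin.rev_rev])
        · intro h'
          have : r = lo i := by rw [← hr', ← h', Fin.rev_rev]
          subst this; rw [IsPos, hr] at hp; exact hp.not_gt hlh
    refine linRel_le ?_ ?_ (fun _ z _ h => absurd h (hz z)) (fun _ z _ h => absurd h (hz z))
    · intro r j hrp hj
      rcases hcase r hrp with rfl | ⟨h1, h2, h3, h4⟩
      · have e1 := rel_diag hrp hj
        have e2 := rel_anti hrp hj
        rw [hr'] at e1 e2 ⊢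
        simp only [hhi, hlo]
        -- `B_0` acts on the span of the two relations by `e1 ↦ q e1 - e2` and `e2 ↦ q⁻¹ e2 - e1`.
        have := Submodule.sub_mem _ (Submodule.smul_mem _ q e1) e2
        convert this using 1
        module
      · simpa [hne, h1, h2, h3, h4] using rel_diag hrp hj
    · intro r j hrp hj
      rcases hcase r hrp with rfl | ⟨h1, h2, h3, h4⟩
      · have e1 := rel_diag hrp hj
        have e2 := rel_anti hrp hj
        rw [hr'] at e1 e2 ⊢
        simp only [hhi, hlo]
        have := Submodule.sub_mem _ (Submodule.smul_mem _ q⁻¹ e2) e1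
        convert this using 1
        module
      · simpa [hne, h1, h2, h3, h4] using rel_anti hrp hj
  · have hi0' : ¬ (i : ℕ) + i + 2 = p + p := by
      intro h; apply hi0; ext; simp only [Fin.val_rev]; omega
    refine linRel_le_of_pair (a := lo i) (b := hi i) ?_ ?_ ?_ ?_
    · intro h; have := congrArg Fin.val h; simp only [lo, Fin.val_rev] at this; omega
    · simp only [IsPos, lo, hi, Fin.lt_def, Fin.val_rev]; omega
    · rw [isPos_rev_iff, isPos_rev_iff]
      simp only [lo, hi, Fin.lt_def, Fin.val_rev]; omega
    · intro r s
      have hw : wtE ((lo i).rev) i = 0 := by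
        apply wtE_ne <;> · simp only [lo, hi, ne_eq, Fin.ext_iff, Fin.val_rev]; omega
      by_cases hr : r = (lo i).rev
      · subst hr; simp [bI_of_not hi0, hi_rev, lo_rev, hw]
      · simp [bI_of_not hi0, hi_rev, lo_rev, hr]

/-- Away from the zero row this is again a transport of opposite rows. If `lo i` is the zero row,
the relation `t_{0,j} - q t_{0,-j}` is sent to a combination of the two relations in the rows `±hi
i`. If `hi i` is the zero row, the rows `lo i` and `-lo i` both map to it, with ratio `q`, and the
relations become multiples of the zero-row relation or vanish. -/
lemma bJ_linRel (hP : Odd P) (i : Fin (P - 1)) : linRel P ≤ (linRel P).comap (bJ i) := by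
  obtain ⟨p, rfl⟩ := hP
  have hlh := lo_lt_hi i
  have hiv := i.isLt
  by_cases hp : IsPos i
  · have hp' : p ≤ (i : ℕ) := by simp only [IsPos, Fin.lt_def, Fin.val_rev] at hp; omega
    by_cases hz : IsZero (lo i)
    · have hlz : ∀ s, bJ i (t (lo i) s) = t (hi i) s + q⁻¹ • t (hi i).rev s := fun s => by
        simp [bJ, hp, hlh.ne, wtE_lo, hi_rev, lo_rev, show (lo i).rev = lo i from hz]
      have hne : ∀ r s, r ≠ lo i → bJ i (t r s) = 0 := fun r s h => by
        simp [bJ, hp, h, hi_rev, show (lo i).rev = lo i from hz]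
      have hpne : ∀ r, IsPos r → r ≠ lo i ∧ r.rev ≠ lo i := fun r hr =>
        ⟨fun h => not_isZero_of_isPos hr (h ▸ hz),
          fun h => not_isZero_of_isPos hr (by rw [← isZero_rev_iff, h]; exact hz)⟩
      refine linRel_le ?_ ?_ ?_ ?_
      · intro r j hr hj; simp [hne, hpne r hr]
      · intro r j hr hj; simp [hne, hpne r hr]
      · intro r j hr hj; simp [hne, hpne r hr]
      · intro j z hj hz'
        obtain rfl := IsZero.unique hz hz'
        have hhp : IsPos (hi i) := by
          simp only [IsPos, hi, Fin.lt_def, Fin.val_rev]; omega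
        have e1 := rel_diag hhp hj
        have e2 := rel_anti hhp hj
        rw [hlz, hlz]
        have := Submodule.sub_mem _ e1 (Submodule.smul_mem _ q⁻¹ e2)
        convert this using 1
        match_scalars <;> simp [q_ne_zero]
    · have hz' : ¬ (i : ℕ) = p := by
        intro h; apply hz; ext; simp only [lo, Fin.val_rev]; omega
      refine linRel_le_of_pair (a := lo i) (b := hi i) hz ?_ ?_ ?_
      · simp only [IsPos, lo, hi, Fin.lt_def, Fin.val_rev]; omega
      · rw [isPos_rev_iff, isPos_rev_iff]
        simp only [lo, hi, Fin.lt_def, Fin.val_rev]; omega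
      · intro r s
        have hw : wtE ((lo i).rev) i = 0 := by
          apply wtE_ne <;> · simp only [lo, hi, ne_eq, Fin.ext_iff, Fin.val_rev]; omega
        by_cases hr : r = (lo i).rev
        · subst hr; simp [bJ, hp, hi_rev, lo_rev, hw]
        · simp [bJ, hp, hi_rev, lo_rev, hr]
  · have hp' : (i : ℕ) < p := by simp only [IsPos, Fin.lt_def, Fin.val_rev] at hp; omega
    have hlo : IsPos (lo i).rev := by
      rw [isPos_rev_iff]; simp only [lo, Fin.lt_def, Fin.val_rev]; omega
    have hne0 : lo i ≠ (lo i).rev := (by rw [isPos_rev_iff] at hlo; exact hlo.ne)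
    by_cases hz : IsZero (hi i)
    · have h1 : ∀ s, bJ i (t (lo i) s) = t (hi i) s := fun s => by
        simp [bJ, hp, hi_rev, lo_rev, hne0]
      -- The factor `q` appears because, for `i < 0`, `K_i⁻¹` is applied after `E_{-i}`, hence to
      -- the zero row just created.
      have h2 : ∀ s, bJ i (t (lo i).rev s) = q • t (hi i) s := fun s => by
        simp [bJ, hp, hi_rev, lo_rev, hne0.symm, show (hi i).rev = hi i from hz, wtE_hi]
      have h3 : ∀ r s, r ≠ lo i → r ≠ (lo i).rev → bJ i (t r s) = 0 := fun r s h h' => by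
        simp [bJ, hp, hi_rev, h, h']
      have hcase : ∀ r, IsPos r → r = (lo i).rev ∨ ((∀ s, bJ i (t r s) = 0) ∧
          ∀ s, bJ i (t r.rev s) = 0) := by
        intro r hr
        by_cases h : r = (lo i).rev
        · exact Or.inl h
        · have h4 : r ≠ lo i := by
            rintro rfl; exact not_isPos_rev hr hlo
          refine Or.inr ⟨fun s => h3 _ _ h4 h, fun s => h3 _ _ ?_ ?_⟩
          · intro h'; exact h (by rw [← h', Fin.rev_rev])
          · rw [ne_eq, Fin.rev_inj]; exact h4
      refine linRel_le ?_ ?_ ?_ ?_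
      · intro r j hr hj
        rcases hcase r hr with rfl | ⟨e1, e2⟩
        · rw [Fin.rev_rev, h2, h2, h1]
          have := Submodule.smul_mem _ q (rel_row hj hz)
          convert this using 1
          match_scalars
          · simp
          · simp [sub_mul, q_ne_zero]
            ring
        · simp [e1, e2]
      · intro r j hr hj
        rcases hcase r hr with rfl | ⟨e1, e2⟩
        · rw [Fin.rev_rev, h2, h1]
          have := Submodule.neg_mem _ (rel_row hj hz)
          convert this using 1
          module
        · simp [e1, e2]
      · intro r j hr hj
        rcases hcase r hr with rfl | ⟨e1, e2⟩
        · rw [Fin.rev_rev, h2, h1, sub_self]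
          exact Submodule.zero_mem _
        · simp [e1, e2]
      · intro j z hj hz'
        obtain rfl := IsZero.unique hz hz'
        have e1 : hi i ≠ (lo i).rev := fun h => not_isZero_of_isPos hlo (h ▸ hz)
        simp [h3, hlh.ne', e1]
    · have hz' : ¬ (i : ℕ) + 1 = p := by
        intro h; apply hz; ext; simp only [hi, Fin.val_rev]; omega
      refine linRel_le_of_pair (a := lo i) (b := hi i) ?_ ?_ ?_ ?_
      · exact fun h => hne0 h.symm
      · simp only [IsPos, lo, hi, Fin.lt_def, Fin.val_rev]; omega
      · rw [isPos_rev_iff, isPos_rev_iff]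
        simp only [lo, hi, Fin.lt_def, Fin.val_rev]; omega
      · intro r s
        have hw : wtE ((hi i).rev) i = 0 := by
          apply wtE_ne <;> · simp only [lo, hi, ne_eq, Fin.ext_iff, Fin.val_rev]; omega
        by_cases hr : r = (lo i).rev
        · subst hr; simp [bJ, hp, hi_rev, lo_rev, hw]
        · simp [bJ, hp, hi_rev, lo_rev, hr]

/-- This is the coideal property. In the expansion of `B_i (x y)` the operators reaching `x` are
`B_i`, the identity and, for `i ≠ 0`, the diagonal operator `K_{-i} K_i⁻¹`, which treats opposite
rows alike. For `i = 0` the last one collapses to the identity. Each keeps `x` in the span of the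
relations. -/
lemma bI_rightIdeal (hP : Even P) (i : Fin (P - 1)) :
    rightIdeal P ≤ (rightIdeal P).comap (bI i) := by
  refine rightIdeal_le_of_mul fun x hx y => ?_
  have hb := bI_linRel hP i hx
  rw [Submodule.mem_comap] at hb
  by_cases hi0 : IsZero i
  · have e : bI i (x * y) = bI i x * kinvOp i y + x * (fOp i y + q⁻¹ • eOp i (kinvOp i y)) := by
      have e2 : kOp i (kinvOp i x) = x := by
        rw [kOp, kinvOp, diagOp_diagOp]
        simpa using diagOp_zero x
      simp only [bI_of_isZero hi0, LinearMap.add_apply, LinearMap.smul_apply,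
        LinearMap.comp_apply, AlgHom.toLinearMap_apply, fOp_mul, map_mul, eOp_mul, e2, mul_add,
        add_mul, smul_add, smul_mul_assoc, mul_smul_comm]
      abel
    rw [e]
    exact Submodule.add_mem _ (mul_mem_rightIdeal hb _) (mul_mem_rightIdeal hx _)
  · have e : bI i (x * y) = bI i x * kinvOp i y + x * fOp i y +
        diagOp (fun r => wtE r i.rev + -wtE r i) x * eOp i.rev (kinvOp i y) := by
      simp only [bI_of_not hi0, LinearMap.add_apply,
        LinearMap.comp_apply, AlgHom.toLinearMap_apply, fOp_mul, map_mul, eOp_mul, add_mul,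
        kOp_rev_kinvOp]
      abel
    rw [e]
    exact Submodule.add_mem _ (Submodule.add_mem _ (mul_mem_rightIdeal hb _)
      (mul_mem_rightIdeal hx _)) (mul_mem_rightIdeal (diagOp_linRel (wt_symm i) hx) _)

lemma bJ_rightIdeal (hP : Odd P) (i : Fin (P - 1)) :
    rightIdeal P ≤ (rightIdeal P).comap (bJ i) := by
  refine rightIdeal_le_of_mul fun x hx y => ?_
  have hb := bJ_linRel hP i hx
  rw [Submodule.mem_comap] at hb
  by_cases hi0 : IsPos i
  · have e : bJ i (x * y) = bJ i x * kinvOp i y + x * fOp i y +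
        diagOp (fun r => wtE r i.rev + -wtE r i) x * eOp i.rev (kinvOp i y) := by
      simp only [bJ, hi0, if_true, LinearMap.add_apply,
        LinearMap.comp_apply, AlgHom.toLinearMap_apply, fOp_mul, map_mul, eOp_mul, add_mul,
        kOp_rev_kinvOp]
      abel
    rw [e]
    exact Submodule.add_mem _ (Submodule.add_mem _ (mul_mem_rightIdeal hb _)
      (mul_mem_rightIdeal hx _)) (mul_mem_rightIdeal (diagOp_linRel (wt_symm i) hx) _)
  · have e : bJ i (x * y) = bJ i x * kinvOp i y + x * fOp i y +
        diagOp (fun r => wtE r i.rev + -wtE r i) x * kinvOp i (eOp i.rev y) := by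
      simp only [bJ, hi0, if_false, LinearMap.add_apply,
        LinearMap.comp_apply, AlgHom.toLinearMap_apply, fOp_mul, map_mul, map_add, eOp_mul, add_mul,
        kinvOp_kOp_rev]
      abel
    rw [e]
    exact Submodule.add_mem _ (Submodule.add_mem _ (mul_mem_rightIdeal hb _)
      (mul_mem_rightIdeal hx _)) (mul_mem_rightIdeal (diagOp_linRel (wt_symm i) hx) _)

lemma dWt_rev (r s : Fin P) : dWt r s.rev = dWt r s := by
  by_cases h : IsZero r
  · have h' : r.rev = r := h
    have : s.rev = r ↔ s = r := by rw [← h', Fin.rev_inj, h']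
    simp [dWt, h, this]
  · have : s.rev = r ↔ s = r.rev := by
      rw [← Fin.rev_inj, Fin.rev_rev]
    simp only [dWt, h, if_false, this, Fin.rev_inj]
    ring

end T

/-! ### An anti-automorphism of `U(gl_N)` -/

namespace U
variable {N : ℕ}

/-- Moving all `k` and `l` to the right in `aabl`-type monomials produces the same total power of
`q` for each of the three orders of `a, a, b`, because the exponents `-2, 1, 1` cancel. The relation
is thus the original one times `k k l`. -/
lemma serre_mul_group {A : Type*} [Ring A] [Algebra Kq A] {a b k l : A}
    (hka : k * a = q ^ (-2 : ℤ) • (a * k)) (hkb : k * b = q ^ (1 : ℤ) • (b * k))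
    (hla : l * a = q ^ (1 : ℤ) • (a * l)) (hkl : l * k = k * l)
    (h : (qInt 2)⁻¹ • a ^ 2 * b + b * ((qInt 2)⁻¹ • a ^ 2) = a * b * a) :
    (qInt 2)⁻¹ • (a * k) ^ 2 * (b * l) + (b * l) * ((qInt 2)⁻¹ • (a * k) ^ 2)
      = (a * k) * (b * l) * (a * k) := by
  have hka' (z : A) : k * (a * z) = q ^ (-2 : ℤ) • (a * (k * z)) := by
    rw [← mul_assoc, hka, smul_mul_assoc, mul_assoc]
  have hkb' (z : A) : k * (b * z) = q ^ (1 : ℤ) • (b * (k * z)) := by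
    rw [← mul_assoc, hkb, smul_mul_assoc, mul_assoc]
  have hla' (z : A) : l * (a * z) = q ^ (1 : ℤ) • (a * (l * z)) := by
    rw [← mul_assoc, hla, smul_mul_assoc, mul_assoc]
  have hkl' (z : A) : l * (k * z) = k * (l * z) := by
    rw [← mul_assoc, hkl, mul_assoc]
  have e := congrArg (· * (k * (k * l))) h
  have hq := q_ne_zero
  simp only [pow_two, add_mul, mul_smul_comm,
    smul_mul_assoc, smul_smul, mul_assoc, hkl, hka', hkb', hla', hkl'] at e ⊢
  have e1 : q ^ (-2 : ℤ) * (q ^ (1 : ℤ) * q ^ (1 : ℤ)) = 1 := by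
    rw [← zpow_add₀ hq, ← zpow_add₀ hq]; rfl
  convert e using 1
  · congr 2
    · linear_combination (qInt 2)⁻¹ * e1
    · linear_combination (qInt 2)⁻¹ * e1
  · rw [show q ^ (1 : ℤ) * (q ^ (1 : ℤ) * q ^ (-2 : ℤ)) = 1 by rw [← e1]; ring, one_smul]

open MulOpposite in
-- In the commutator relation the two factors `q⁻¹` cancel the `q²` obtained from moving `K_i^{±1}`
-- past `E_i` or `F_i`. The Serre relations read the same in reversed order, and multiplying by
-- group-like elements preserves them by `serre_mul_group`.
lemma isURep_anti : IsURep (N := N) (A := (U N)ᵐᵒᵖ) (fun i => op (q⁻¹ • (F i * K i)))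
    (fun i => op (q⁻¹ • (E i * Kinv i))) (fun a => op (D a)) (fun a => op (Dinv a)) where
  D_Dinv a := by rw [← op_mul, isURep.Dinv_D]; rfl
  Dinv_D a := by rw [← op_mul, isURep.D_Dinv]; rfl
  D_D a b := by rw [← op_mul, isURep.D_D]; rfl
  D_Dinv_comm a b := by rw [← op_mul, ← isURep.D_Dinv_comm]; rfl
  Dinv_Dinv a b := by rw [← op_mul, isURep.Dinv_Dinv]; rfl
  D_E a i := by
    have hK : Commute (D a) (K i) :=
      Commute.mul_right (isURep.D_D a (lo i)) (isURep.D_Dinv_comm a (hi i))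
    rw [← op_mul, ← op_mul, ← op_smul]
    congr 1
    have e : D a * (F i * K i) = q ^ (-wtE a i) • (F i * K i * D a) := by
      rw [← mul_assoc, isURep.D_F, smul_mul_assoc, mul_assoc, hK.eq, mul_assoc]
    rw [mul_smul_comm, e, smul_mul_assoc, smul_comm q⁻¹, smul_smul, ← zpow_add₀ q_ne_zero]
    simp
  D_F a i := by
    have hK : Commute (D a) (Kinv i) :=
      Commute.mul_right (isURep.D_D a (hi i)) (isURep.D_Dinv_comm a (lo i))
    rw [← op_mul, ← op_mul, ← op_smul]
    congr 1
    have e : D a * (E i * Kinv i) = q ^ (wtE a i) • (E i * Kinv i * D a) := by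
      rw [← mul_assoc, isURep.D_E, smul_mul_assoc, mul_assoc, hK.eq, mul_assoc]
    rw [mul_smul_comm, e, smul_mul_assoc, smul_comm q⁻¹, smul_smul, ← zpow_add₀ q_ne_zero]
    simp
  E_F i := by
    rw [← op_mul, ← op_mul, ← op_mul, ← op_mul, ← op_sub, ← op_sub, ← op_smul]
    congr 1
    have h := isURep.E_F (N := N) i
    have e1 : E i * Kinv i * (F i * K i) = q ^ (2 : ℤ) • (E i * F i * (Kinv i * K i)) := by
      rw [mul_assoc, ← mul_assoc (Kinv i), Kinv_F, cart_self, smul_mul_assoc, mul_smul_comm,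
        mul_assoc, mul_assoc]
    have e2 : F i * K i * (E i * Kinv i) = q ^ (2 : ℤ) • (F i * E i * (K i * Kinv i)) := by
      rw [mul_assoc, ← mul_assoc (K i), K_E, cart_self, smul_mul_assoc, mul_smul_comm,
        mul_assoc, mul_assoc]
    have c1 : K i * Kinv i = 1 := by
      have h1 : Dinv (hi i) * D (hi i) = (1 : U N) := isURep.Dinv_D _
      rw [K, Kinv, mul_assoc, ← mul_assoc (Dinv _), h1, one_mul]
      exact isURep.D_Dinv _
    have c2 : Kinv i * K i = 1 := by
      have h1 : Dinv (lo i) * D (lo i) = (1 : U N) := isURep.Dinv_D _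
      rw [K, Kinv, mul_assoc, ← mul_assoc (Dinv _), h1, one_mul]
      exact isURep.D_Dinv _
    have c3 : (q⁻¹ * q⁻¹) * q ^ (2 : ℤ) = 1 := by
      have := q_ne_zero
      field_simp
    rw [smul_mul_smul_comm, smul_mul_smul_comm, e1, e2, c1, c2, smul_smul, smul_smul, c3, one_smul,
      one_smul, mul_one, mul_one, h, ← isURep.D_Dinv_comm, ← isURep.D_Dinv_comm]
  E_F_ne i j hij := by
    rw [← op_mul, ← op_mul, ← op_sub, op_eq_zero_iff]
    have h := sub_eq_zero.mp (isURep.E_F_ne (N := N) j i hij.symm)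
    have e1 : E j * Kinv j * (F i * K i) = q ^ cart i j • (E j * F i * (Kinv j * K i)) := by
      rw [mul_assoc, ← mul_assoc (Kinv j), Kinv_F, smul_mul_assoc, mul_smul_comm,
        mul_assoc, mul_assoc, cart_comm]
    have e2 : F i * K i * (E j * Kinv j) = q ^ cart i j • (F i * E j * (K i * Kinv j)) := by
      rw [mul_assoc, ← mul_assoc (K i), K_E, smul_mul_assoc, mul_smul_comm,
        mul_assoc, mul_assoc]
    have hD : ∀ a, Commute (D a) (K i) := fun a =>
      Commute.mul_right (isURep.D_D a (lo i)) (isURep.D_Dinv_comm a (hi i))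
    have hD' : ∀ a, Commute (Dinv a) (K i) := fun a =>
      Commute.mul_right (isURep.D_Dinv_comm _ _).symm (isURep.Dinv_Dinv _ _)
    have hK : Kinv j * K i = K i * Kinv j := ((hD _).mul_left (hD' _))
    rw [smul_mul_smul_comm, smul_mul_smul_comm, e1, e2, hK, h, sub_self]
  E_E i j h h' := by
    rw [← op_mul, ← op_mul]
    congr 1
    have h1 := isURep.F_F (N := N) i j h h'
    have e1 : ∀ i j : Fin (N - 1), i ≠ j → ¬ Adjacent i j →
        F i * K i * (F j * K j) = F i * F j * (K i * K j) := by
      intro i j h h'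
      rw [mul_assoc, ← mul_assoc (K i), K_F, cart_far h h']
      simp [mul_assoc]
    rw [smul_mul_smul_comm, smul_mul_smul_comm, e1 _ _ h h', e1 _ _ h.symm
      (fun hh => h' (Or.symm hh)), h1, K_K]
  F_F i j h h' := by
    rw [← op_mul, ← op_mul]
    congr 1
    have h1 := isURep.E_E (N := N) i j h h'
    have e1 : ∀ i j : Fin (N - 1), i ≠ j → ¬ Adjacent i j →
        E i * Kinv i * (E j * Kinv j) = E i * E j * (Kinv i * Kinv j) := by
      intro i j h h'
      rw [mul_assoc, ← mul_assoc (Kinv i), Kinv_E, cart_far h h']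
      simp [mul_assoc]
    rw [smul_mul_smul_comm, smul_mul_smul_comm, e1 _ _ h h', e1 _ _ h.symm
      (fun hh => h' (Or.symm hh)), h1, Kinv_Kinv]
  serreE i j h := by
    apply unop_injective
    have := serre_mul_group (k := q⁻¹ • K i) (l := q⁻¹ • K j) (a := F i) (b := F j)
      (by rw [smul_mul_assoc, K_F, cart_self, smul_comm, mul_smul_comm])
      (by rw [smul_mul_assoc, K_F, cart_adj h, smul_comm, mul_smul_comm, neg_neg])
      (by rw [smul_mul_assoc, K_F, cart_comm, cart_adj h, smul_comm, mul_smul_comm, neg_neg])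
      (by rw [smul_mul_smul_comm, smul_mul_smul_comm, K_K]) (isURep.serreF i j h)
    rw [show F i * (q⁻¹ • K i) = q⁻¹ • (F i * K i) from mul_smul_comm _ _ _,
      show F j * (q⁻¹ • K j) = q⁻¹ • (F j * K j) from mul_smul_comm _ _ _] at this
    simp only [unop_add, unop_mul, unop_smul, unop_pow, unop_op]
    rw [add_comm]
    simpa only [mul_assoc] using this
  serreF i j h := by
    apply unop_injective
    have := serre_mul_group (k := q⁻¹ • Kinv i) (l := q⁻¹ • Kinv j) (a := E i) (b := E j)
      (by rw [smul_mul_assoc, Kinv_E, cart_self, smul_comm, mul_smul_comm])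
      (by rw [smul_mul_assoc, Kinv_E, cart_adj h, smul_comm, mul_smul_comm, neg_neg])
      (by rw [smul_mul_assoc, Kinv_E, cart_comm, cart_adj h, smul_comm, mul_smul_comm, neg_neg])
      (by rw [smul_mul_smul_comm, smul_mul_smul_comm, Kinv_Kinv]) (isURep.serreE i j h)
    rw [show E i * (q⁻¹ • Kinv i) = q⁻¹ • (E i * Kinv i) from mul_smul_comm _ _ _,
      show E j * (q⁻¹ • Kinv j) = q⁻¹ • (E j * Kinv j) from mul_smul_comm _ _ _] at this
    simp only [unop_add, unop_mul, unop_smul, unop_pow, unop_op]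
    rw [add_comm]
    simpa only [mul_assoc] using this

/-- The anti-automorphism `E_i ↦ q⁻¹ F_i K_i`, `F_i ↦ q⁻¹ E_i K_i⁻¹`, `D_a ↦ D_a`. -/
def anti (N : ℕ) : (U N)ᵐᵒᵖ →ₐ[Kq] U N := AlgHom.opComm (lift isURep_anti)

lemma anti_op (x : U N) : anti N (.op x) = (lift isURep_anti x).unop := rfl

@[simp] lemma anti_E (i : Fin (N - 1)) : anti N (.op (E i)) = q⁻¹ • (F i * K i) := by
  simp [anti_op]
@[simp] lemma anti_F (i : Fin (N - 1)) : anti N (.op (F i)) = q⁻¹ • (E i * Kinv i) := by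
  simp [anti_op]
@[simp] lemma anti_D (a : Fin N) : anti N (.op (D a)) = D a := by
  simp [anti_op]
@[simp] lemma anti_Dinv (a : Fin N) : anti N (.op (Dinv a)) = Dinv a := by
  simp [anti_op]
@[simp] lemma anti_Kinv (i : Fin (N - 1)) : anti N (.op (Kinv i)) = Kinv i := by
  rw [Kinv, MulOpposite.op_mul, map_mul, anti_D, anti_Dinv]
  exact (isURep.D_Dinv_comm _ _).symm

end U

/-! ### The right operators -/

namespace T
variable {P : ℕ}

lemma diagOp_fOp (χ : Fin P → ℤ) (i : Fin (P - 1)) (x : T P) :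
    diagOp χ (fOp i x) = q ^ (χ (hi i) - χ (lo i)) • fOp i (diagOp χ x) := by
  induction x using T.induction with
  | algebraMap r => simp [Algebra.algebraMap_eq_smul_one]
  | gen r s =>
    by_cases h : r = lo i
    · subst h; simp [smul_smul, ← zpow_add₀ q_ne_zero]
    · simp [h]
  | mul a b ha hb =>
    have : diagOp χ (kinvOp i b) = kinvOp i (diagOp χ b) := by
      simp only [kinvOp, diagOp_diagOp, add_comm]
    simp only [fOp_mul, map_mul, map_add, ha, hb, smul_add, smul_mul_assoc, mul_smul_comm, this]
  | add a b ha hb => simp only [map_add, ha, hb, smul_add]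

lemma diagOp_eOp (χ : Fin P → ℤ) (i : Fin (P - 1)) (x : T P) :
    diagOp χ (eOp i x) = q ^ (χ (lo i) - χ (hi i)) • eOp i (diagOp χ x) := by
  induction x using T.induction with
  | algebraMap r => simp [Algebra.algebraMap_eq_smul_one]
  | gen r s =>
    by_cases h : r = hi i
    · subst h; simp [smul_smul, ← zpow_add₀ q_ne_zero]
    · simp [h]
  | mul a b ha hb =>
    have : diagOp χ (kOp i a) = kOp i (diagOp χ a) := by
      simp only [kOp, diagOp_diagOp, add_comm]
    simp only [eOp_mul, map_mul, map_add, ha, hb, smul_add, smul_mul_assoc, mul_smul_comm, this]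
  | add a b ha hb => simp only [map_add, ha, hb, smul_add]

/-- The right action of `F_i`, transposed. -/
def fT (i : Fin (P - 1)) : T P →ₗ[Kq] T P := q⁻¹ • (eOp i ∘ₗ (kinvOp i).toLinearMap)
/-- The right action of `E_i`, transposed. -/
def eT (i : Fin (P - 1)) : T P →ₗ[Kq] T P := q⁻¹ • (fOp i ∘ₗ (kOp i).toLinearMap)

/-- The right action of `B_i` in type `ı`, transposed. -/
def bIT (i : Fin (P - 1)) : T P →ₗ[Kq] T P :=
  if IsZero i then fT i + q⁻¹ • ((kinvOp i).toLinearMap ∘ₗ eT i) + (kinvOp i).toLinearMap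
  else fT i + (kinvOp i).toLinearMap ∘ₗ eT i.rev

/-- The right action of `B_i` in type `ȷ`, transposed. -/
def bJT (i : Fin (P - 1)) : T P →ₗ[Kq] T P :=
  if IsPos i then fT i + (kinvOp i).toLinearMap ∘ₗ eT i.rev
  else fT i + eT i.rev ∘ₗ (kinvOp i).toLinearMap

lemma bIT_of_isZero {i : Fin (P - 1)} (h : IsZero i) :
    bIT i = fT i + q⁻¹ • ((kinvOp i).toLinearMap ∘ₗ eT i) + (kinvOp i).toLinearMap := if_pos h
lemma bIT_of_not {i : Fin (P - 1)} (h : ¬ IsZero i) :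
    bIT i = fT i + (kinvOp i).toLinearMap ∘ₗ eT i.rev := if_neg h
lemma bJT_of_isPos {i : Fin (P - 1)} (h : IsPos i) :
    bJT i = fT i + (kinvOp i).toLinearMap ∘ₗ eT i.rev := if_pos h
lemma bJT_of_not {i : Fin (P - 1)} (h : ¬ IsPos i) :
    bJT i = fT i + eT i.rev ∘ₗ (kinvOp i).toLinearMap := if_neg h

lemma kinvOp_fOp (i j : Fin (P - 1)) (x : T P) :
    kinvOp j (fOp i x) = q ^ U.cart i j • fOp i (kinvOp j x) := by
  rw [kinvOp, diagOp_fOp]; congr 2; simp only [U.cart]; ring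
lemma kinvOp_eOp (i j : Fin (P - 1)) (x : T P) :
    kinvOp j (eOp i x) = q ^ (-U.cart i j) • eOp i (kinvOp j x) := by
  rw [kinvOp, diagOp_eOp]; congr 2; simp only [U.cart]; ring
lemma kOp_kinvOp (i : Fin (P - 1)) (x : T P) : kOp i (kinvOp i x) = x := by
  rw [kOp, kinvOp, diagOp_diagOp]; simpa using diagOp_zero x
lemma kinvOp_kOp (i : Fin (P - 1)) (x : T P) : kinvOp i (kOp i x) = x := by
  rw [kOp, kinvOp, diagOp_diagOp]; simpa using diagOp_zero x
lemma kinvOp_kOp_comm (i j : Fin (P - 1)) (x : T P) : kinvOp i (kOp j x) = kOp j (kinvOp i x) := by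
  rw [kOp, kinvOp, diagOp_diagOp, diagOp_diagOp]; simp only [add_comm]

/-- The anti-automorphism exchanges the roles of `F_i` and `E_i`, so the image of `B_i` is
proportional to `B_{-i}` times `K_{-i} K_i⁻¹`. This transfers the stability of the right ideal from
the left action to the right action. For `i ≠ 0` the labels `i` and `-i` are not adjacent when `P`
is even, so no power of `q` arises in commuting `K_i⁻¹` with `F_{-i}`. -/
lemma bIT_eq (hP : Even P) (i : Fin (P - 1)) :
    ∃ c : Kq, ∀ x, bIT i x = c • bI i.rev (kOp i.rev (kinvOp i x)) := by
  obtain ⟨p, rfl⟩ := hP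
  by_cases h : IsZero i
  · refine ⟨1, fun x => ?_⟩
    have h' : IsZero i.rev := by rwa [isZero_rev_iff]
    have h2 : q⁻¹ * (q⁻¹ * q ^ (2 : ℤ)) = 1 := by
      have := q_ne_zero
      field_simp
    rw [bIT_of_isZero h, bI_of_isZero h', show i.rev = i from h]
    simp only [fT, eT, LinearMap.add_apply, LinearMap.smul_apply, LinearMap.comp_apply, map_smul,
      AlgHom.toLinearMap_apply, kinvOp_fOp, kOp_kinvOp, kinvOp_kOp, U.cart_self, smul_smul, h2,
      one_smul]
    abel
  · refine ⟨q⁻¹, fun x => ?_⟩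
    have h' : ¬ IsZero i.rev := by rwa [isZero_rev_iff]
    have hc : U.cart i.rev i = 0 := by
      have : ¬ (i : ℕ) + i + 2 = p + p := by
        intro hh; apply h; ext; simp only [Fin.val_rev]; omega
      have := i.isLt
      apply U.cart_far
      · rw [ne_eq, Fin.ext_iff, Fin.val_rev]; omega
      · unfold Adjacent; rw [Fin.val_rev]; omega
    rw [bIT_of_not h, bI_of_not h', Fin.rev_rev]
    simp only [fT, eT, LinearMap.add_apply, LinearMap.smul_apply, LinearMap.comp_apply, map_smul,
      AlgHom.toLinearMap_apply, kinvOp_fOp, kinvOp_kOp, hc, zpow_zero, one_smul, smul_add,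
      kinvOp_kOp_comm i]
    abel

lemma isPos_rev_of_not (hP : Odd P) {i : Fin (P - 1)} (h : ¬ IsPos i) : IsPos i.rev := by
  obtain ⟨p, rfl⟩ := hP
  rcases isPos_or i with h1 | h1 | h1
  · exact absurd h1 h
  · have := congrArg Fin.val h1
    simp only [Fin.val_rev] at this
    have := i.isLt
    omega
  · exact h1

/-- The labels `i` and `-i` can be adjacent here, namely for `i = ±1/2`, which is why the scalar
involves the Cartan integer when `i > 0`. -/
lemma bJT_eq (hP : Odd P) (i : Fin (P - 1)) :
    ∃ c : Kq, ∀ x, bJT i x = c • bJ i.rev (kOp i.rev (kinvOp i x)) := by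
  by_cases h : IsPos i
  · refine ⟨q⁻¹ * q ^ U.cart i.rev i, fun x => ?_⟩
    have h' := not_isPos_rev h
    rw [bJT_of_isPos h, bJ_of_not h', Fin.rev_rev]
    have hq : q ^ U.cart i.rev i ≠ 0 := zpow_ne_zero _ q_ne_zero
    simp only [fT, eT, LinearMap.add_apply, LinearMap.smul_apply, LinearMap.comp_apply, map_smul,
      AlgHom.toLinearMap_apply, kinvOp_fOp, kinvOp_eOp, kinvOp_kOp, smul_add, smul_smul,
      kinvOp_kOp_comm i, U.cart_comm i i.rev, zpow_neg]
    rw [mul_assoc, mul_inv_cancel₀ hq, mul_one]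
    abel
  · refine ⟨q⁻¹, fun x => ?_⟩
    rw [bJT_of_not h, bJ_of_isPos (isPos_rev_of_not hP h), Fin.rev_rev]
    simp only [fT, eT, LinearMap.add_apply, LinearMap.smul_apply, LinearMap.comp_apply,
      AlgHom.toLinearMap_apply, kinvOp_kOp, smul_add]
    abel

lemma kOp_kinvOp_rightIdeal (i : Fin (P - 1)) {x : T P} (hx : x ∈ rightIdeal P) :
    kOp i.rev (kinvOp i x) ∈ rightIdeal P := by
  rw [kOp_rev_kinvOp]
  exact diagOp_rightIdeal (wt_symm i) hx

lemma bIT_rightIdeal (hP : Even P) (i : Fin (P - 1)) :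
    rightIdeal P ≤ (rightIdeal P).comap (bIT i) := by
  obtain ⟨c, hc⟩ := bIT_eq hP i
  intro x hx
  rw [Submodule.mem_comap, hc]
  exact Submodule.smul_mem _ _ (bI_rightIdeal hP _ (kOp_kinvOp_rightIdeal i hx))

lemma bJT_rightIdeal (hP : Odd P) (i : Fin (P - 1)) :
    rightIdeal P ≤ (rightIdeal P).comap (bJT i) := by
  obtain ⟨c, hc⟩ := bJT_eq hP i
  intro x hx
  rw [Submodule.mem_comap, hc]
  exact Submodule.smul_mem _ _ (bJ_rightIdeal hP _ (kOp_kinvOp_rightIdeal i hx))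

end T

/-! ### The pairing of tensor powers with values in the quantum coordinate ring -/

/-- Inclusion of labels `𝕀_{M-1} ⊆ 𝕀_{P-1}`. -/
def embI {M P : ℕ} (h : M ≤ P) (i : Fin (M - 1)) : Fin (P - 1) := ⟨i + (P - M) / 2, by omega⟩

section Pairing
variable {M N P : ℕ} (h : M ≤ P) (h' : N ≤ P)

/-- `v ⊗ w ↦ ∑ v_i w_j t_{ij}`. -/
def pair : (Fin M → Kq) →ₗ[Kq] (Fin N → Kq) →ₗ[Kq] T P :=
  LinearMap.mk₂ Kq (fun v w => ∑ i, ∑ j, (v i * w j) • t (emb h i) (emb h' j))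
    (fun _ _ _ => by simp [add_mul, add_smul, Finset.sum_add_distrib])
    (fun _ _ _ => by simp [Finset.smul_sum, smul_smul, mul_assoc])
    (fun _ _ _ => by simp [mul_add, add_smul, Finset.sum_add_distrib])
    (fun _ _ _ => by simp [Finset.smul_sum, smul_smul, mul_left_comm])

lemma pair_apply (v : Fin M → Kq) (w : Fin N → Kq) :
    pair h h' v w = ∑ i, ∑ j, (v i * w j) • t (emb h i) (emb h' j) := rfl

lemma pair_single (i : Fin M) (j : Fin N) :
    pair h h' (Pi.single i 1) (Pi.single j 1) = t (emb h i) (emb h' j) := by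
  simp only [pair_apply, Pi.single_apply, ite_mul, one_mul, zero_mul, ite_smul, one_smul, zero_smul]
  simp

lemma transp_pair (v : Fin M → Kq) (w : Fin N → Kq) :
    T.transp (pair h h' v w) = pair h' h w v := by
  simp only [pair_apply, map_sum, map_smul, T.transp_t]
  rw [Finset.sum_comm]
  simp only [mul_comm]

/-- The map `v₁ ⊗ ⋯ ⊗ vₙ ⊗ (w₁ ⊗ ⋯ ⊗ wₙ) ↦ ∏ (vₖ, wₖ)`. -/
def tpair (n : ℕ) : (⨂[Kq]^n (Fin M → Kq)) →ₗ[Kq] (⨂[Kq]^n (Fin N → Kq)) →ₗ[Kq] T P :=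
  (PiTensorProduct.map₂ fun _ => pair h h').compr₂
    (PiTensorProduct.lift (MultilinearMap.mkPiAlgebraFin Kq n (T P)))

lemma tpair_tprod {n : ℕ} (x : Fin n → Fin M → Kq) (y : Fin n → Fin N → Kq) :
    tpair h h' n (PiTensorProduct.tprod Kq x) (PiTensorProduct.tprod Kq y) =
      (List.ofFn fun k => pair h h' (x k) (y k)).prod := by
  simp [tpair, PiTensorProduct.map₂_tprod_tprod]

lemma tpair_vLam {n : ℕ} (lam : Fin n → Fin M) (mu : Fin n → Fin N) :
    tpair h h' n (vLam lam) (vLam mu) =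
      (List.ofFn fun k => t (emb h (lam k)) (emb h' (mu k))).prod := by
  simp only [vLam, tpair_tprod, pair_single]

lemma U.snocEquiv_tprod {n : ℕ} (x : Fin n → Fin M → Kq) (v : Fin M → Kq) :
    U.snocEquiv _ n (PiTensorProduct.tprod Kq x ⊗ₜ v) =
      PiTensorProduct.tprod Kq (Fin.snoc x v : Fin (n + 1) → Fin M → Kq) := by
  have h1 : (PiTensorProduct.subsingletonEquiv (R := Kq) (s := fun _ : Fin 1 => Fin M → Kq)
      0).symm v = PiTensorProduct.tprod Kq fun _ : Fin 1 => v := by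
    rw [LinearEquiv.symm_apply_eq, PiTensorProduct.subsingletonEquiv_apply_tprod]
  have h2 := TensorPower.tprod_mul_tprod Kq x (fun _ : Fin 1 => v)
  rw [TensorPower.gMul_def] at h2
  simp only [U.snocEquiv, LinearEquiv.trans_apply, TensorProduct.congr_tmul, h1,
    LinearEquiv.refl_apply]
  rw [h2]
  congr 1
  rw [Fin.append_right_eq_snoc]

/-- Splitting off the last tensor factor matches splitting off the last letter of a word; this
allows the comultiplication to be compared with the Leibniz rule by induction. -/
lemma tpair_snoc {n : ℕ} (a : ⨂[Kq]^n (Fin M → Kq)) (b : ⨂[Kq]^n (Fin N → Kq))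
    (v : Fin M → Kq) (w : Fin N → Kq) :
    tpair h h' (n + 1) (U.snocEquiv _ n (a ⊗ₜ v)) (U.snocEquiv _ n (b ⊗ₜ w)) =
      tpair h h' n a b * pair h h' v w := by
  induction a using PiTensorProduct.induction_on with
  | smul_tprod r x =>
    induction b using PiTensorProduct.induction_on with
    | smul_tprod r y =>
      simp only [← TensorProduct.smul_tmul', map_smul, LinearMap.smul_apply, smul_mul_assoc,
        U.snocEquiv_tprod, tpair_tprod, List.ofFn_succ', List.concat_eq_append,
        List.prod_append, List.prod_singleton, Fin.snoc_castSucc, Fin.snoc_last]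
    | add x y hx hy => simp only [TensorProduct.add_tmul, map_add, add_mul, hx, hy]
  | add x y hx hy =>
    simp only [TensorProduct.add_tmul, map_add, LinearMap.add_apply, add_mul, hx, hy]

lemma tpair_zero (a : ⨂[Kq]^0 (Fin M → Kq)) (b : ⨂[Kq]^0 (Fin N → Kq)) :
    ∃ c : Kq, tpair h h' 0 a b = algebraMap Kq _ c := by
  induction a using PiTensorProduct.induction_on with
  | smul_tprod r x =>
    induction b using PiTensorProduct.induction_on with
    | smul_tprod s y =>
      exact ⟨s * r, by simp [tpair_tprod, Algebra.algebraMap_eq_smul_one, smul_smul]⟩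
    | add x y hx hy =>
      obtain ⟨c, hc⟩ := hx
      obtain ⟨c', hc'⟩ := hy
      exact ⟨c + c', by rw [map_add, hc, hc', map_add]⟩
  | add x y hx hy =>
    obtain ⟨c, hc⟩ := hx
    obtain ⟨c', hc'⟩ := hy
    exact ⟨c + c', by rw [map_add, LinearMap.add_apply, hc, hc', map_add]⟩

lemma tpair_induction {n : ℕ} {p : (⨂[Kq]^(n + 1) (Fin M → Kq)) → (⨂[Kq]^(n + 1) (Fin N → Kq)) →
    Prop} (h0 : ∀ a b v w, p (U.snocEquiv _ n (a ⊗ₜ v)) (U.snocEquiv _ n (b ⊗ₜ w)))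
    (hz : ∀ b, p 0 b) (hz' : ∀ a, p a 0)
    (hl : ∀ a a' b, p a b → p a' b → p (a + a') b)
    (hr : ∀ a b b', p a b → p a b' → p a (b + b')) (a b) : p a b := by
  obtain ⟨a, rfl⟩ := (U.snocEquiv _ n).surjective a
  obtain ⟨b, rfl⟩ := (U.snocEquiv _ n).surjective b
  induction a with
  | zero => simpa using hz _
  | tmul a v =>
    induction b with
    | zero => simpa using hz' _
    | tmul b w => exact h0 a b v w
    | add x y hx hy => rw [map_add]; exact hr _ _ _ hx hy
  | add x y hx hy => rw [map_add]; exact hl _ _ _ hx hy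

lemma transp_tpair (n : ℕ) (a : ⨂[Kq]^n (Fin M → Kq)) (b : ⨂[Kq]^n (Fin N → Kq)) :
    T.transp (tpair h h' n a b) = tpair h' h n b a := by
  induction a using PiTensorProduct.induction_on with
  | smul_tprod r x =>
    induction b using PiTensorProduct.induction_on with
    | smul_tprod s y =>
      simp only [map_smul, LinearMap.smul_apply, tpair_tprod, map_list_prod, List.map_ofFn,
        Function.comp_def, transp_pair]
      rw [smul_comm]
    | add x y hx hy => simp only [map_add, LinearMap.add_apply, hx, hy]
  | add x y hx hy => simp only [map_add, LinearMap.add_apply, hx, hy]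

lemma lo_embI (i : Fin (M - 1)) : lo (embI h i) = emb h (lo i) := rfl
lemma hi_embI (i : Fin (M - 1)) : hi (embI h i) = emb h (hi i) := by
  ext; simp only [hi, emb, embI]; omega
lemma emb_strictMono : StrictMono (emb h) := fun a b hab => by
  simp only [emb, Fin.lt_def] at *; omega
lemma emb_inj {a b : Fin M} : emb h a = emb h b ↔ a = b := (emb_strictMono h).injective.eq_iff


lemma natural_E (i : Fin (M - 1)) (v : Fin M → Kq) :
    U.natural M (U.E i) v = Pi.single (lo i) (v (hi i)) := by
  ext r
  simp [U.natural, Matrix.mulVec, dotProduct, Matrix.single_apply, Pi.single_apply, ite_and, eq_comm]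
lemma natural_F (i : Fin (M - 1)) (v : Fin M → Kq) :
    U.natural M (U.F i) v = Pi.single (hi i) (v (lo i)) := by
  ext r
  simp [U.natural, Matrix.mulVec, dotProduct, Matrix.single_apply, Pi.single_apply, ite_and, eq_comm]
lemma natural_D (a : Fin M) (v : Fin M → Kq) (r : Fin M) :
    U.natural M (U.D a) v r = q ^ (if r = a then 1 else 0 : ℤ) * v r := by
  by_cases h : r = a <;> simp [U.natural, Matrix.mulVec_diagonal, h]
lemma natural_Dinv (a : Fin M) (v : Fin M → Kq) (r : Fin M) :
    U.natural M (U.Dinv a) v r = q ^ (if r = a then -1 else 0 : ℤ) * v r := by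
  by_cases h : r = a <;> simp [U.natural, Matrix.mulVec_diagonal, h]

lemma pair_E (i : Fin (M - 1)) (v : Fin M → Kq) (w : Fin N → Kq) :
    pair h h' (U.natural M (U.E i) v) w = T.eOp (embI h i) (pair h h' v w) := by
  rw [natural_E, pair_apply, pair_apply]
  simp only [map_sum, map_smul, T.eOp_t, hi_embI, lo_embI, emb_inj, Pi.single_apply, ite_mul,
    zero_mul, ite_smul, zero_smul, smul_ite, smul_zero]
  rw [Finset.sum_comm]
  conv_rhs => rw [Finset.sum_comm]
  simp
lemma pair_F (i : Fin (M - 1)) (v : Fin M → Kq) (w : Fin N → Kq) :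
    pair h h' (U.natural M (U.F i) v) w = T.fOp (embI h i) (pair h h' v w) := by
  rw [natural_F, pair_apply, pair_apply]
  simp only [map_sum, map_smul, T.fOp_t, hi_embI, lo_embI, emb_inj, Pi.single_apply, ite_mul,
    zero_mul, ite_smul, zero_smul, smul_ite, smul_zero]
  rw [Finset.sum_comm]
  conv_rhs => rw [Finset.sum_comm]
  simp
lemma pair_D (a : Fin M) (v : Fin M → Kq) (w : Fin N → Kq) :
    pair h h' (U.natural M (U.D a) v) w =
      T.diagOp (fun r => if r = emb h a then 1 else 0) (pair h h' v w) := by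
  simp only [pair_apply, natural_D, map_sum, map_smul, T.diagOp_t, emb_inj, smul_smul]
  simp only [mul_assoc, mul_comm, mul_left_comm]
lemma pair_Dinv (a : Fin M) (v : Fin M → Kq) (w : Fin N → Kq) :
    pair h h' (U.natural M (U.Dinv a) v) w =
      T.diagOp (fun r => if r = emb h a then -1 else 0) (pair h h' v w) := by
  simp only [pair_apply, natural_Dinv, map_sum, map_smul, T.diagOp_t, emb_inj, smul_smul]
  simp only [mul_assoc, mul_comm, mul_left_comm]

lemma tensorPow_succ {n : ℕ} (g : U M) (a : (⨂[Kq]^n (Fin M → Kq)) ⊗[Kq] (Fin M → Kq)) :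
    U.tensorPow (U.natural M) (n + 1) g (U.snocEquiv _ n a) =
      U.snocEquiv _ n (U.tensorRep (U.tensorPow (U.natural M) n) (U.natural M) g a) := by
  simp [U.tensorPow, LinearEquiv.conjAlgEquiv, LinearEquiv.conj_apply]

lemma tensorRep_E {n : ℕ} (i : Fin (M - 1)) (a : ⨂[Kq]^n (Fin M → Kq)) (v : Fin M → Kq) :
    U.tensorRep (U.tensorPow (U.natural M) n) (U.natural M) (U.E i) (a ⊗ₜ v) =
      (U.tensorPow (U.natural M) n (U.E i) a) ⊗ₜ v +
        (U.tensorPow (U.natural M) n (U.K i) a) ⊗ₜ (U.natural M (U.E i) v) := by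
  simp [U.tensorRep, U.comul, Module.endTensorEndAlgHom_apply]
lemma tensorRep_F {n : ℕ} (i : Fin (M - 1)) (a : ⨂[Kq]^n (Fin M → Kq)) (v : Fin M → Kq) :
    U.tensorRep (U.tensorPow (U.natural M) n) (U.natural M) (U.F i) (a ⊗ₜ v) =
      (U.tensorPow (U.natural M) n (U.F i) a) ⊗ₜ (U.natural M (U.Kinv i) v) +
        a ⊗ₜ (U.natural M (U.F i) v) := by
  simp [U.tensorRep, U.comul, Module.endTensorEndAlgHom_apply]
lemma tensorRep_D {n : ℕ} (r : Fin M) (a : ⨂[Kq]^n (Fin M → Kq)) (v : Fin M → Kq) :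
    U.tensorRep (U.tensorPow (U.natural M) n) (U.natural M) (U.D r) (a ⊗ₜ v) =
      (U.tensorPow (U.natural M) n (U.D r) a) ⊗ₜ (U.natural M (U.D r) v) := by
  simp [U.tensorRep, U.comul, Module.endTensorEndAlgHom_apply]
lemma tensorRep_Dinv {n : ℕ} (r : Fin M) (a : ⨂[Kq]^n (Fin M → Kq)) (v : Fin M → Kq) :
    U.tensorRep (U.tensorPow (U.natural M) n) (U.natural M) (U.Dinv r) (a ⊗ₜ v) =
      (U.tensorPow (U.natural M) n (U.Dinv r) a) ⊗ₜ (U.natural M (U.Dinv r) v) := by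
  simp [U.tensorRep, U.comul, Module.endTensorEndAlgHom_apply]

lemma tensorPow_zero (g : U M) (a : ⨂[Kq]^0 (Fin M → Kq)) :
    U.tensorPow (U.natural M) 0 g a = U.counit M g • a := by
  simp [U.tensorPow, Algebra.ofId_apply, Algebra.algebraMap_eq_smul_one]

lemma tpair_D (n : ℕ) (r : Fin M) (a : ⨂[Kq]^n (Fin M → Kq)) (b : ⨂[Kq]^n (Fin N → Kq)) :
    tpair h h' n (U.tensorPow (U.natural M) n (U.D r) a) b =
      T.diagOp (fun s => if s = emb h r then 1 else 0) (tpair h h' n a b) := by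
  induction n with
  | zero =>
    obtain ⟨c, hc⟩ := tpair_zero h h' a b
    rw [tensorPow_zero, map_smul, LinearMap.smul_apply, hc]
    simp [U.counit]
  | succ n ih =>
    refine tpair_induction (p := fun a b =>
      tpair h h' (n + 1) (U.tensorPow (U.natural M) (n + 1) (U.D r) a) b = T.diagOp (fun s => if s = emb h r then 1 else 0) (tpair h h' (n + 1) a b))
      (fun a b v w => ?_) (by simp) (by simp)
      (fun a a' b e e' => by simp only [map_add, LinearMap.add_apply, e, e'])
      (fun a b b' e e' => by simp only [map_add, e, e']) a b
    rw [tensorPow_succ, tensorRep_D, tpair_snoc, tpair_snoc, ih, pair_D, map_mul]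

lemma tpair_Dinv (n : ℕ) (r : Fin M) (a : ⨂[Kq]^n (Fin M → Kq)) (b : ⨂[Kq]^n (Fin N → Kq)) :
    tpair h h' n (U.tensorPow (U.natural M) n (U.Dinv r) a) b =
      T.diagOp (fun s => if s = emb h r then -1 else 0) (tpair h h' n a b) := by
  induction n with
  | zero =>
    obtain ⟨c, hc⟩ := tpair_zero h h' a b
    rw [tensorPow_zero, map_smul, LinearMap.smul_apply, hc]
    simp [U.counit]
  | succ n ih =>
    refine tpair_induction (p := fun a b =>
      tpair h h' (n + 1) (U.tensorPow (U.natural M) (n + 1) (U.Dinv r) a) b = T.diagOp (fun s => if s = emb h r then -1 else 0) (tpair h h' (n + 1) a b))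
      (fun a b v w => ?_) (by simp) (by simp)
      (fun a a' b e e' => by simp only [map_add, LinearMap.add_apply, e, e'])
      (fun a b b' e e' => by simp only [map_add, e, e']) a b
    rw [tensorPow_succ, tensorRep_Dinv, tpair_snoc, tpair_snoc, ih, pair_Dinv, map_mul]

lemma tpair_K (n : ℕ) (i : Fin (M - 1)) (a : ⨂[Kq]^n (Fin M → Kq)) (b : ⨂[Kq]^n (Fin N → Kq)) :
    tpair h h' n (U.tensorPow (U.natural M) n (U.K i) a) b =
      T.kOp (embI h i) (tpair h h' n a b) := by
  rw [U.K, map_mul, Module.End.mul_apply, tpair_D, tpair_Dinv, T.diagOp_diagOp, T.kOp]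
  congr 2
  funext r
  simp only [wtE, lo_embI, hi_embI]
  split_ifs <;> simp_all
lemma tpair_Kinv (n : ℕ) (i : Fin (M - 1)) (a : ⨂[Kq]^n (Fin M → Kq))
    (b : ⨂[Kq]^n (Fin N → Kq)) :
    tpair h h' n (U.tensorPow (U.natural M) n (U.Kinv i) a) b =
      T.kinvOp (embI h i) (tpair h h' n a b) := by
  rw [U.Kinv, map_mul, Module.End.mul_apply, tpair_D, tpair_Dinv, T.diagOp_diagOp, T.kinvOp]
  congr 2
  funext r
  simp only [wtE, lo_embI, hi_embI]
  split_ifs <;> simp_all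
lemma pair_Kinv (i : Fin (M - 1)) (v : Fin M → Kq) (w : Fin N → Kq) :
    pair h h' (U.natural M (U.Kinv i) v) w = T.kinvOp (embI h i) (pair h h' v w) := by
  rw [U.Kinv, map_mul, Module.End.mul_apply, pair_D, pair_Dinv, T.diagOp_diagOp, T.kinvOp]
  congr 2
  funext r
  simp only [wtE, lo_embI, hi_embI]
  split_ifs <;> simp_all

/-- On a split tensor, `Δ(E_i) = E_i ⊗ 1 + K_i ⊗ E_i` is the twisted Leibniz rule `T.eOp_mul`; in
degree zero the counit and the derivation both vanish on scalars. -/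
lemma tpair_E (n : ℕ) (i : Fin (M - 1)) (a : ⨂[Kq]^n (Fin M → Kq)) (b : ⨂[Kq]^n (Fin N → Kq)) :
    tpair h h' n (U.tensorPow (U.natural M) n (U.E i) a) b =
      T.eOp (embI h i) (tpair h h' n a b) := by
  induction n with
  | zero =>
    obtain ⟨c, hc⟩ := tpair_zero h h' a b
    rw [tensorPow_zero, map_smul, LinearMap.smul_apply, hc]
    simp [U.counit, Algebra.algebraMap_eq_smul_one]
  | succ n ih =>
    refine tpair_induction (p := fun a b =>
      tpair h h' (n + 1) (U.tensorPow (U.natural M) (n + 1) (U.E i) a) b = T.eOp (embI h i) (tpair h h' (n + 1) a b))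
      (fun a b v w => ?_) (by simp) (by simp)
      (fun a a' b e e' => by simp only [map_add, LinearMap.add_apply, e, e'])
      (fun a b b' e e' => by simp only [map_add, e, e']) a b
    rw [tensorPow_succ, tensorRep_E, map_add, map_add, LinearMap.add_apply, tpair_snoc, tpair_snoc,
      tpair_snoc, ih, tpair_K, pair_E, T.eOp_mul]

lemma tpair_F (n : ℕ) (i : Fin (M - 1)) (a : ⨂[Kq]^n (Fin M → Kq)) (b : ⨂[Kq]^n (Fin N → Kq)) :
    tpair h h' n (U.tensorPow (U.natural M) n (U.F i) a) b =
      T.fOp (embI h i) (tpair h h' n a b) := by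
  induction n with
  | zero =>
    obtain ⟨c, hc⟩ := tpair_zero h h' a b
    rw [tensorPow_zero, map_smul, LinearMap.smul_apply, hc]
    simp [U.counit, Algebra.algebraMap_eq_smul_one]
  | succ n ih =>
    refine tpair_induction (p := fun a b =>
      tpair h h' (n + 1) (U.tensorPow (U.natural M) (n + 1) (U.F i) a) b = T.fOp (embI h i) (tpair h h' (n + 1) a b))
      (fun a b v w => ?_) (by simp) (by simp)
      (fun a a' b e e' => by simp only [map_add, LinearMap.add_apply, e, e'])
      (fun a b b' e e' => by simp only [map_add, e, e']) a b
    rw [tensorPow_succ, tensorRep_F, map_add, map_add, LinearMap.add_apply, tpair_snoc, tpair_snoc,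
      tpair_snoc, ih, pair_Kinv, pair_F, T.fOp_mul]

end Pairing

/-! ### Exponents of the monomials `t^{(A)}` -/

section Exponents
variable {M N : ℕ} {A : Matrix (Fin M) (Fin N) ℕ}

lemma isPos_of_rev {n : ℕ} {r : Fin n} (h : IsPos r.rev) : ¬ IsPos r ∧ ¬ IsZero r := by
  have := not_isPos_rev h
  have h2 := not_isZero_of_isPos h
  rw [Fin.rev_rev] at this
  rw [isZero_rev_iff] at h2
  exact ⟨this, h2⟩

lemma tExp_of_isPos {r : Fin M} (h : IsPos r) (c : Fin N) : tExp A r c = A r c :=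
  if_pos (Or.inl h)
lemma tExp_of_neg {r : Fin M} (h : IsPos r.rev) (c : Fin N) : tExp A r c = 0 := by
  simp [tExp, isPos_of_rev h]
lemma tExp_zero_pos {r : Fin M} {c : Fin N} (h : IsZero r) (hc : IsPos c) :
    tExp A r c = A r c := if_pos (Or.inr ⟨h, hc⟩)
lemma tExp_zero_neg {r : Fin M} {c : Fin N} (h : IsZero r) (hc : IsPos c.rev) :
    tExp A r c = 0 := by
  have h1 : ¬ IsPos r := fun h2 => not_isZero_of_isPos h2 h
  simp [tExp, isPos_of_rev hc, h1]
lemma tExp_zero_zero {r : Fin M} {c : Fin N} (h : IsZero r) (hc : IsZero c) :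
    tExp A r c = (A r c - 1) / 2 := by
  have h1 : ¬ IsPos r := fun h2 => not_isZero_of_isPos h2 h
  have h2 : ¬ IsPos c := fun h2 => not_isZero_of_isPos h2 hc
  simp [tExp, h, hc, h1, h2]

/-- `a_{ij} = a_{-i,-j}`, and `a_{00}` is odd. -/
structure IsSymm (A : Matrix (Fin M) (Fin N) ℕ) : Prop where
  rev : ∀ i j, A i.rev j.rev = A i j
  odd : ∀ i j, IsZero i → IsZero j → A i j = 2 * tExp A i j + 1

lemma sum_split {n : ℕ} {B : Type*} [AddCommMonoid B] (f : Fin n → B) :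
    ∑ k, f k = (∑ k, if IsPos k then f k + f k.rev else 0) + ∑ k, if IsZero k then f k else 0 := by
  have h1 : ∀ k, f k = (if IsPos k then f k else 0) + (if IsPos k.rev then f k else 0) +
      if IsZero k then f k else 0 := by
    intro k
    rcases isPos_or k with h | h | h
    · rw [if_pos h, if_neg (not_isPos_rev h), if_neg (not_isZero_of_isPos h), add_zero, add_zero]
    · have h2 : ¬ IsPos k := fun h2 => not_isZero_of_isPos h2 h
      have h3 : ¬ IsPos k.rev := by rwa [show k.rev = k from h]
      rw [if_neg h2, if_neg h3, if_pos h, zero_add, zero_add]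
    · rw [if_pos h, if_neg (isPos_of_rev h).1, if_neg (isPos_of_rev h).2, zero_add, add_zero]
  rw [Finset.sum_congr rfl fun k _ => h1 k, Finset.sum_add_distrib, Finset.sum_add_distrib]
  congr 1
  rw [← Equiv.sum_comp Fin.revPerm (fun k => if IsPos k.rev then f k else 0),
    ← Finset.sum_add_distrib]
  refine Finset.sum_congr rfl fun k _ => ?_
  simp only [Fin.revPerm_apply, Fin.rev_rev]
  by_cases h : IsPos k
  · simp only [if_pos h]
  · simp only [if_neg h, add_zero]

lemma sum_isZero {n : ℕ} {B : Type*} [AddCommMonoid B] (f : Fin n → B) {z : Fin n} (hz : IsZero z) :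
    (∑ k, if IsZero k then f k else 0) = f z := by
  rw [Finset.sum_eq_single z, if_pos hz]
  · intro b _ hb
    rw [if_neg]
    exact fun h => hb (IsZero.unique h hz)
  · simp

lemma sum_isZero_of_even {n : ℕ} {B : Type*} [AddCommMonoid B] (f : Fin n → B) (hn : Even n) :
    (∑ k, if IsZero k then f k else 0) = 0 := by
  refine Finset.sum_eq_zero fun k _ => if_neg fun h => ?_
  obtain ⟨p, rfl⟩ := hn
  have := congrArg Fin.val h
  simp only [Fin.val_rev] at this
  omega

lemma sum_Ici_rev {n : ℕ} {B : Type*} [AddCommMonoid B] (f : Fin n → B) (j : Fin n) :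
    ∑ k ∈ Finset.Ici j, f k = ∑ k ∈ Finset.Iic j.rev, f k.rev := by
  rw [sum_Ici, sum_Iic, ← Equiv.sum_comp Fin.revPerm]
  refine Finset.sum_congr rfl fun k _ => ?_
  have : j ≤ k.rev ↔ k ≤ j.rev := by simp only [Fin.le_def, Fin.val_rev]; omega
  simp only [Fin.revPerm_apply, this]
lemma sum_Ioi_rev {n : ℕ} {B : Type*} [AddCommMonoid B] (f : Fin n → B) (j : Fin n) :
    ∑ k ∈ Finset.Ioi j, f k = ∑ k ∈ Finset.Iio j.rev, f k.rev := by
  rw [sum_Ioi, sum_Iio, ← Equiv.sum_comp Fin.revPerm]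
  refine Finset.sum_congr rfl fun k _ => ?_
  have : j < k.rev ↔ k < j.rev := by simp only [Fin.lt_def, Fin.val_rev]; omega
  simp only [Fin.revPerm_apply, this]

lemma isPos_of_lt {n : ℕ} {j k : Fin n} (hj : ¬ IsPos j.rev) (h : j < k) : IsPos k := by
  simp only [IsPos, Fin.lt_def, Fin.val_rev, not_lt] at *
  omega

/-- The cells that occur in the monomials. -/
def Std (r : Fin M) (c : Fin N) : Prop := IsPos r ∨ IsZero r ∧ ¬ IsPos c.rev

lemma not_std {r : Fin M} {c : Fin N} (h : Std r c) (h0 : ¬ (IsZero r ∧ IsZero c)) :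
    ¬ Std r.rev c.rev := by
  rintro (h1 | ⟨h1, h2⟩)
  · rcases h with h | h
    · exact not_isPos_rev h h1
    · exact not_isZero_of_isPos h1 ((isZero_rev_iff r).mpr h.1)
  · rw [isZero_rev_iff] at h1
    rw [Fin.rev_rev] at h2
    rcases h with h | h
    · exact not_isZero_of_isPos h h1
    · rcases isPos_or c with h3 | h3 | h3
      · exact h2 h3
      · exact h0 ⟨h1, h3⟩
      · exact h.2 h3

lemma tExp_of_not_std {r : Fin M} {c : Fin N} (h : ¬ Std r c) : tExp A r c = 0 := by
  simp only [Std, not_or, not_and, not_not] at h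
  rcases isPos_or r with h1 | h1 | h1
  · exact absurd h1 h.1
  · exact tExp_zero_neg h1 (h.2 h1)
  · exact tExp_of_neg h1 c

lemma tExp_of_std {r : Fin M} {c : Fin N} (h : Std r c) (h0 : ¬ (IsZero r ∧ IsZero c)) :
    tExp A r c = A r c := by
  rcases h with h | ⟨h, h'⟩
  · exact tExp_of_isPos h c
  · rcases isPos_or c with h1 | h1 | h1
    · exact tExp_zero_pos h h1
    · exact absurd ⟨h, h1⟩ h0
    · exact absurd h1 h'

lemma Eθ_rev (r : Fin M) (c : Fin N) : Eθ r.rev c.rev = Eθ r c := by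
  simp [Eθ, add_comm]

lemma Eθ_apply (r : Fin M) (c : Fin N) (i : Fin M) (j : Fin N) :
    Eθ r c i j = (if i = r ∧ j = c then 1 else 0) + if i.rev = r ∧ j.rev = c then 1 else 0 := by
  have h1 : ∀ {n} (a b : Fin n), a.rev = b ↔ b.rev = a := fun a b => by
    rw [← Fin.rev_inj, Fin.rev_rev, eq_comm]
  simp only [Eθ, Matrix.add_apply, Matrix.single_apply, h1 i r, h1 j c]
  simp only [eq_comm]

/-- The cells satisfying `Std` meet each orbit of `(i,j) ↦ (-i,-j)` once, so on them `E^θ` changes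
an entry by one. At the centre it changes the entry by two, which the exponent `(a_{00} - 1)/2`
turns back into one. The hypothesis `hne` matters for truncated subtraction: the matrix adds first,
while `mshift` subtracts first. -/
lemma tExp_move (hA : IsSymm A) {r r' : Fin M} {c c' : Fin N} (hs : Std r c) (hs' : Std r' c')
    (hne : ¬ (r = r' ∧ c = c')) :
    tExp (A + Eθ r' c' - Eθ r c) = mshift (tExp A) r c r' c' := by
  funext i j
  by_cases h : Std i j
  · by_cases h0 : IsZero i ∧ IsZero j
    · have h1 := hA.odd i j h0.1 h0.2
      rw [tExp_zero_zero h0.1 h0.2, Matrix.sub_apply, Matrix.add_apply, Eθ_apply, Eθ_apply, mshift,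
        show i.rev = i from h0.1, show j.rev = j from h0.2]
      by_cases e1 : i = r ∧ j = c
      · have e2 : ¬ (i = r' ∧ j = c') := fun e2 =>
          hne ⟨e1.1.symm.trans e2.1, e1.2.symm.trans e2.2⟩
        simp only [if_pos e1, if_neg e2]
        omega
      · simp only [if_neg e1]
        split_ifs <;> omega
    · have h2 := not_std h h0
      have e3 : ¬ (i.rev = r ∧ j.rev = c) := by rintro ⟨rfl, rfl⟩; exact h2 hs
      have e4 : ¬ (i.rev = r' ∧ j.rev = c') := by rintro ⟨rfl, rfl⟩; exact h2 hs'
      rw [tExp_of_std h h0, Matrix.sub_apply, Matrix.add_apply, Eθ_apply, Eθ_apply, mshift,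
        tExp_of_std h h0, if_neg e3, if_neg e4]
      by_cases e1 : i = r ∧ j = c
      · have e2 : ¬ (i = r' ∧ j = c') := fun e2 =>
          hne ⟨e1.1.symm.trans e2.1, e1.2.symm.trans e2.2⟩
        simp only [if_pos e1, if_neg e2]
        omega
      · simp only [if_neg e1]
        omega
  · have e1 : ¬ (i = r ∧ j = c) := by rintro ⟨rfl, rfl⟩; exact h hs
    have e2 : ¬ (i = r' ∧ j = c') := by rintro ⟨rfl, rfl⟩; exact h hs'
    rw [tExp_of_not_std h, mshift, tExp_of_not_std h, if_neg e1, if_neg e2]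

lemma A_rev_left (hA : IsSymm A) (i : Fin M) (j : Fin N) : A i.rev j = A i j.rev := by
  rw [← hA.rev i j.rev, Fin.rev_rev]

/-- Sums over the rows beyond a nonnegative one. -/
lemma sum_Ioi_tExp {r : Fin M} (hr : ¬ IsPos r.rev) (c : Fin N) :
    ∑ k ∈ Finset.Ioi r, (A k c : ℤ) = ∑ k ∈ Finset.Ioi r, (tExp A k c : ℤ) :=
  Finset.sum_congr rfl fun k hk => by
    rw [tExp_of_isPos (isPos_of_lt hr (Finset.mem_Ioi.mp hk))]

/-- Sums over the rows beyond a nonpositive one. -/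
lemma sum_Ioi_rev_tExp (hMN : M % 2 = N % 2) (hA : IsSymm A) {r : Fin M} (hr : IsPos r)
    (c : Fin N) :
    ∑ k ∈ Finset.Ioi r.rev, (A k c : ℤ) = ∑ k ∈ Finset.Iio r, (tExp A k c.rev : ℤ) +
      ∑ k, (tExp A k c : ℤ) + if IsZero c then 1 else 0 := by
  rw [sum_Ioi, sum_Iio, ← Finset.sum_add_distrib, sum_split, sum_split (fun k => _ + _), add_assoc]
  congr 1
  · refine Finset.sum_congr rfl fun k _ => ?_
    by_cases hk : IsPos k
    · have hk' : IsPos k.rev.rev := by rwa [Fin.rev_rev]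
      have h1 : r.rev < k := by
        simp only [IsPos, Fin.lt_def, Fin.val_rev] at *; omega
      have h2 : k.rev < r := by
        simp only [IsPos, Fin.lt_def, Fin.val_rev] at *; omega
      rw [if_pos hk, if_pos hk, if_pos h1, if_pos h2, tExp_of_isPos hk, tExp_of_isPos hk,
        tExp_of_neg hk', tExp_of_neg hk', A_rev_left hA]
      simp only [Fin.rev_lt_rev]
      push_cast
      ring
    · rw [if_neg hk, if_neg hk]
  · by_cases hM : Even M
    · rw [sum_isZero_of_even _ hM, sum_isZero_of_even _ hM, if_neg]; · rfl
      intro h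
      obtain ⟨p, rfl⟩ := hM
      have := congrArg Fin.val h
      simp only [Fin.val_rev] at this
      omega
    · have hM' : M % 2 = 1 := Nat.not_even_iff.mp hM
      obtain ⟨z, hz⟩ : ∃ z : Fin M, IsZero z :=
        ⟨⟨M / 2, by omega⟩, by ext; simp only [Fin.val_rev]; omega⟩
      rw [sum_isZero _ hz, sum_isZero _ hz]
      have h1 : r.rev < z := by
        have := congrArg Fin.val hz
        simp only [IsPos, Fin.lt_def, Fin.val_rev] at *; omega
      have h2 : z < r := by
        have := congrArg Fin.val hz
        simp only [IsPos, Fin.lt_def, Fin.val_rev] at *; omega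
      rw [if_pos h1, if_pos h2]
      rcases isPos_or c with h | h | h
      · have h' : IsPos c.rev.rev := by rwa [Fin.rev_rev]
        rw [tExp_zero_pos hz h, tExp_zero_neg hz h', if_neg (not_isZero_of_isPos h)]
        simp
      · rw [if_pos h, show c.rev = c from h, hA.odd z c hz h]
        push_cast
        ring
      · rw [tExp_zero_pos hz h, tExp_zero_neg hz h, if_neg (isPos_of_rev h).2, ← A_rev_left hA,
          show z.rev = z from hz]
        simp

/-- Sums over the zero row. -/
lemma sum_Ici_zero_tExp (hA : IsSymm A) {z : Fin M} (hz : IsZero z) {z' : Fin N} (hz' : IsZero z')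
    {c : Fin N} (hc : ¬ IsPos c.rev) :
    ∑ k ∈ Finset.Ici c.rev, (A z k : ℤ) = ∑ k ∈ Finset.Iic c, (tExp A z k : ℤ) +
      ∑ k, (tExp A z k : ℤ) + 1 := by
  rw [sum_Ici, sum_Iic, ← Finset.sum_add_distrib, sum_split, sum_split (fun k => _ + _), add_assoc,
    sum_isZero _ hz', sum_isZero _ hz']
  congr 1
  · refine Finset.sum_congr rfl fun k _ => ?_
    by_cases hk : IsPos k
    · have hk' : IsPos k.rev.rev := by rwa [Fin.rev_rev]
      have h1 : c.rev ≤ k := by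
        simp only [IsPos, Fin.lt_def, Fin.le_def, Fin.val_rev] at *; omega
      have h2 : k.rev ≤ c := by
        simp only [IsPos, Fin.lt_def, Fin.le_def, Fin.val_rev] at *; omega
      rw [if_pos hk, if_pos hk, if_pos h1, if_pos h2, tExp_zero_pos hz hk,
        tExp_zero_neg hz hk', ← A_rev_left hA, show z.rev = z from hz]
      simp only [Fin.rev_le_rev]
      push_cast
      ring
    · rw [if_neg hk, if_neg hk]
  · have h1 : c.rev ≤ z' := by
      have := congrArg Fin.val hz'
      simp only [IsPos, Fin.lt_def, Fin.le_def, Fin.val_rev] at *; omega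
    have h2 : z' ≤ c := by
      have := congrArg Fin.val hz'
      simp only [IsPos, Fin.lt_def, Fin.le_def, Fin.val_rev] at *; omega
    rw [if_pos h1, if_pos h2, hA.odd z z' hz hz']
    push_cast
    ring

end Exponents

/-! ### The left operators on the monomials `t^{(A)}` -/

/-- The class of an element of the quantum coordinate ring. -/
def TQuot.mk {P : ℕ} : T P →ₗ[Kq] TQuot P := (rightIdeal P).mkQ

section Cells
variable {M N P : ℕ} (h : M ≤ P) (h' : N ≤ P)

/-- The generators with labels in `𝕀_M × 𝕀_N`. -/
def cell (i : Fin M) (j : Fin N) : T P := t (emb h i) (emb h' j)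

lemma isQMat_cell : IsQMat (cell h h') := (isQMat_t P).comp (emb_strictMono h) (emb_strictMono h')

lemma emb_rev (hp : M % 2 = P % 2) (k : Fin M) : emb h k.rev = (emb h k).rev := by
  ext; simp only [emb, Fin.val_rev]; omega
lemma embI_rev (hp : M % 2 = P % 2) (i : Fin (M - 1)) : embI h i.rev = (embI h i).rev := by
  have := i.isLt
  ext; simp only [embI, Fin.val_rev]; omega
lemma isPos_emb (hp : M % 2 = P % 2) (k : Fin M) : IsPos (emb h k) ↔ IsPos k := by
  rw [IsPos, ← emb_rev h hp, (emb_strictMono h).lt_iff_lt]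
lemma isZero_emb (hp : M % 2 = P % 2) (k : Fin M) : IsZero (emb h k) ↔ IsZero k := by
  rw [IsZero, ← emb_rev h hp, emb_inj]
lemma isPos_embI (hp : M % 2 = P % 2) (i : Fin (M - 1)) : IsPos (embI h i) ↔ IsPos i := by
  rw [IsPos, ← embI_rev h hp]; simp [embI, Fin.lt_def, IsPos]
lemma isZero_embI (hp : M % 2 = P % 2) (i : Fin (M - 1)) : IsZero (embI h i) ↔ IsZero i := by
  rw [IsZero, ← embI_rev h hp]; simp [embI, Fin.ext_iff, IsZero]

/-- Only a right ideal is divided out, so a relation may be applied to the leftmost factor of a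
product and nowhere else. The straightening lemmas below therefore all carry a trailing factor. -/
lemma TQuot.mk_eq_of_sub {x y : T P} (hxy : x - y ∈ T.linRel P) (z : T P) :
    TQuot.mk (x * z) = TQuot.mk (y * z) := by
  have := T.mul_mem_rightIdeal hxy z
  rw [sub_mul] at this
  exact (Submodule.Quotient.eq _).mpr this



lemma mk_cell_anti (hM : M % 2 = P % 2) (hN : N % 2 = P % 2) {i : Fin M} {j : Fin N}
    (hi : IsPos i) (hj : IsPos j) (y : T P) :
    TQuot.mk (cell h h' i.rev j * y) = TQuot.mk (cell h h' i j.rev * y) := by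
  have := T.rel_anti ((isPos_emb h hM i).mpr hi) ((isPos_emb h' hN j).mpr hj)
  rw [← emb_rev h hM, ← emb_rev h' hN] at this
  exact (TQuot.mk_eq_of_sub this y).symm

lemma mk_cell_diag (hM : M % 2 = P % 2) (hN : N % 2 = P % 2) {i : Fin M} {j : Fin N}
    (hi : IsPos i) (hj : IsPos j) (y : T P) :
    TQuot.mk (cell h h' i.rev j.rev * y) =
      TQuot.mk (cell h h' i j * y) - (q - q⁻¹) • TQuot.mk (cell h h' i j.rev * y) := by
  have := T.rel_diag ((isPos_emb h hM i).mpr hi) ((isPos_emb h' hN j).mpr hj)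
  rw [← emb_rev h hM, ← emb_rev h' hN, sub_right_comm] at this
  have := TQuot.mk_eq_of_sub this y
  rw [sub_mul, smul_mul_assoc, map_sub, map_smul] at this
  exact this.symm

lemma mk_cell_col (hM : M % 2 = P % 2) (hN : N % 2 = P % 2) {i : Fin M} {z : Fin N}
    (hi : IsPos i) (hz : IsZero z) (y : T P) :
    TQuot.mk (cell h h' i.rev z * y) = q⁻¹ • TQuot.mk (cell h h' i z * y) := by
  have := T.rel_col ((isPos_emb h hM i).mpr hi) ((isZero_emb h' hN z).mpr hz)
  rw [← emb_rev h hM] at this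
  have := TQuot.mk_eq_of_sub this y
  rw [cell, cell, this, smul_mul_assoc, map_smul, smul_smul, inv_mul_cancel₀ q_ne_zero, one_smul]

lemma mk_cell_row (hM : M % 2 = P % 2) (hN : N % 2 = P % 2) {z : Fin M} {j : Fin N}
    (hz : IsZero z) (hj : IsPos j) (y : T P) :
    TQuot.mk (cell h h' z j.rev * y) = q⁻¹ • TQuot.mk (cell h h' z j * y) := by
  have := T.rel_row ((isPos_emb h' hN j).mpr hj) ((isZero_emb h hM z).mpr hz)
  rw [← emb_rev h' hN] at this
  have := TQuot.mk_eq_of_sub this y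
  rw [cell, cell, this, smul_mul_assoc, map_smul, smul_smul, inv_mul_cancel₀ q_ne_zero, one_smul]

lemma fOp_mon (i : Fin (M - 1)) (a : Fin M → Fin N → ℕ) :
    T.fOp (embI h i) (mon (cell h h') a) =
      ∑ j, (q ^ (∑ k ∈ Finset.Ici j, ((a (hi i) k : ℤ) - a (lo i) k) + 1) *
        qInt (a (lo i) j)) • mon (cell h h') (mshift a (lo i) j (hi i) j) :=
  f_mon (isQMat_cell h h') i (kinv := T.kinvOp (embI h i)) (T.fOp_mul _)
    (fun r s => by simp [cell, lo_embI, hi_embI, emb_inj])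
    (fun r s => by simp [cell, wtE, lo_embI, hi_embI, emb_inj]) a

lemma eOp_mon (i : Fin (M - 1)) (a : Fin M → Fin N → ℕ) :
    T.eOp (embI h i) (mon (cell h h') a) =
      ∑ j, (q ^ (∑ k ∈ Finset.Iic j, ((a (lo i) k : ℤ) - a (hi i) k) + 1) *
        qInt (a (hi i) j)) • mon (cell h h') (mshift a (hi i) j (lo i) j) :=
  e_mon (isQMat_cell h h') i (k := T.kOp (embI h i)) (T.eOp_mul _)
    (fun r s => by simp [cell, lo_embI, hi_embI, emb_inj])
    (fun r s => by simp [cell, wtE, lo_embI, hi_embI, emb_inj]) a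

lemma kinvOp_mon (i : Fin (M - 1)) (a : Fin M → Fin N → ℕ) :
    T.kinvOp (embI h i) (mon (cell h h') a) =
      q ^ (∑ k, ((a (hi i) k : ℤ) - a (lo i) k)) • mon (cell h h') a := by
  rw [map_mon (s := fun r _ => -wtE r i)
    (fun r s => by simp [cell, wtE, lo_embI, hi_embI, emb_inj])]
  congr 2
  rw [sum_two (lo_lt_hi i).ne (fun r h1 h2 => by simp [wtE_ne h1 h2]), wtE_lo, wtE_hi,
    ← Finset.sum_add_distrib]
  refine Finset.sum_congr rfl fun k _ => ?_
  ring

/-- The class of the monomial `t^{(A)}`. -/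
def tau (A : Matrix (Fin M) (Fin N) ℕ) : TQuot P := TQuot.mk (mon (cell h h') (tExp A))

lemma tau_move {A : Matrix (Fin M) (Fin N) ℕ} (hA : IsSymm A) {r r' : Fin M} {c c' : Fin N}
    (hs : Std r c) (hs' : Std r' c') (hne : ¬ (r = r' ∧ c = c')) :
    TQuot.mk (mon (cell h h') (mshift (tExp A) r c r' c')) = tau h h' (A + Eθ r' c' - Eθ r c) := by
  rw [tau, tExp_move hA hs hs' hne]

/-- For even `M` a monomial `t^{(A)}` involves positive rows only, so just one summand of `B_i`
acts: `F_i` if `i > 0`, and `E_{-i} K_i⁻¹` with trivial `K_i⁻¹` if `i < 0`. No straightening is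
needed. -/
lemma mk_bI_of_ne (hM : M % 2 = P % 2) (hMe : Even M)
    {A : Matrix (Fin M) (Fin N) ℕ} (hA : IsSymm A) {i : Fin (M - 1)}
    (hi0 : ¬ IsZero i) :
    TQuot.mk (T.bI (embI h i) (mon (cell h h') (tExp A))) =
      ∑ j, (q ^ (∑ k ∈ Finset.Ici j, ((A (hi i) k : ℤ) - A (lo i) k) + 1) * qInt (A (lo i) j)) •
        tau h h' (A + Eθ (hi i) j - Eθ (lo i) j) := by
  obtain ⟨p, rfl⟩ := hMe
  have hlh := (lo_lt_hi i).ne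
  rw [T.bI_of_not (by rwa [isZero_embI h hM]), LinearMap.add_apply, LinearMap.comp_apply,
    AlgHom.toLinearMap_apply, fOp_mon, kinvOp_mon, map_smul, ← embI_rev h hM, eOp_mon, map_add,
    map_smul, map_sum, map_sum]
  simp only [map_smul]
  by_cases hp : IsPos i
  · have h1 : IsPos (lo i) := by simp only [IsPos, lo, Fin.lt_def, Fin.val_rev] at *; omega
    have h2 : IsPos (hi i) := by simp only [IsPos, hi, Fin.lt_def, Fin.val_rev] at *; omega
    have h3 : ∀ k, tExp A (hi i.rev) k = 0 := fun k => by
      rw [hi_rev]; exact tExp_of_neg (by rwa [Fin.rev_rev]) k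
    simp only [h3, qInt_zero, mul_zero, zero_smul, Finset.sum_const_zero, smul_zero, add_zero]
    refine Finset.sum_congr rfl fun j _ => ?_
    simp only [tExp_of_isPos h1, tExp_of_isPos h2]
    rw [tau_move h h' hA (Or.inl h1) (Or.inl h2) (fun e => hlh e.1)]
  · have h0 : IsPos i.rev := by
      rcases isPos_or i with h1 | h1 | h1
      · exact absurd h1 hp
      · exact absurd h1 hi0
      · exact h1
    have h1 : IsPos (lo i).rev := by
      simp only [IsPos, lo, Fin.lt_def, Fin.val_rev] at *; omega
    have h2 : IsPos (hi i).rev := by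
      simp only [IsPos, hi, Fin.lt_def, Fin.val_rev] at *; omega
    have h3 : ∀ k, tExp A (lo i) k = 0 := tExp_of_neg h1
    have h4 : ∀ k, tExp A (hi i) k = 0 := tExp_of_neg h2
    simp only [h3, h4, qInt_zero, mul_zero, zero_smul, Finset.sum_const_zero, zero_add, sub_self,
      Nat.cast_zero, zpow_zero, one_smul, lo_rev, hi_rev, tExp_of_isPos h1, tExp_of_isPos h2,
      A_rev_left hA]
    -- By symmetry of `A`, the rows `lo i`, `hi i` are the opposite rows read backwards.
    rw [← Equiv.sum_comp Fin.revPerm]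
    refine Finset.sum_congr rfl fun j _ => ?_
    rw [Fin.revPerm_apply, Fin.rev_rev, tau_move h h' hA (Or.inl h1) (Or.inl h2)
      (fun e => hlh (Fin.rev_inj.mp e.1)), Eθ_rev, Eθ_rev, sum_Ici_rev]

end Cells

/-! ### Partial sums of exponents and identities for `q`-integers. -/

section Sums
variable {n : ℕ}

lemma sum_Ici_add_Iio (f : Fin n → ℤ) (j : Fin n) :
    ∑ k ∈ Finset.Ici j, f k = ∑ k, f k - ∑ k ∈ Finset.Iio j, f k := by
  rw [sum_Ici, sum_Iio, ← Finset.sum_sub_distrib]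
  refine Finset.sum_congr rfl fun k _ => ?_
  rcases lt_or_ge k j with h | h
  · rw [if_neg h.not_ge, if_pos h, sub_self]
  · rw [if_pos h, if_neg h.not_gt, sub_zero]

lemma sum_Ioi_add_Iic (f : Fin n → ℤ) (j : Fin n) :
    ∑ k ∈ Finset.Ioi j, f k = ∑ k, f k - ∑ k ∈ Finset.Iic j, f k := by
  rw [sum_Ioi, sum_Iic, ← Finset.sum_sub_distrib]
  refine Finset.sum_congr rfl fun k _ => ?_
  rcases lt_or_ge j k with h | h
  · rw [if_neg h.not_ge, if_pos h, sub_zero]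
  · rw [if_pos h, if_neg h.not_gt, sub_self]

lemma sum_Iic_eq_Iio (f : Fin n → ℤ) (j : Fin n) :
    ∑ k ∈ Finset.Iic j, f k = ∑ k ∈ Finset.Iio j, f k + f j := by
  have : f j = ∑ k, if k = j then f k else 0 := by simp
  rw [this, sum_Iic, sum_Iio, ← Finset.sum_add_distrib]
  refine Finset.sum_congr rfl fun k _ => ?_
  rcases lt_trichotomy k j with h | h | h
  · rw [if_pos h.le, if_pos h, if_neg h.ne, add_zero]
  · rw [if_pos h.le, if_neg h.not_lt, if_pos h, zero_add]
  · rw [if_neg h.not_ge, if_neg h.not_gt, if_neg h.ne', add_zero]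

lemma q_sub_mul_qInt (e : ℤ) (a : ℕ) :
    (q - q⁻¹) * (q ^ e * qInt a) = q ^ (e + a) - q ^ (e - a) := by
  have h := q_sub_inv_ne_zero
  rw [qInt, mul_left_comm, mul_div_cancel₀ _ h, mul_sub, ← zpow_add₀ q_ne_zero,
    ← zpow_add₀ q_ne_zero, sub_eq_add_neg e]

/-- In type ȷ the entry `a_{00}` corresponds to the exponent `a = (a_{00} - 1)/2`, and the cell
`(0,0)` contributes through both summands of `B_{±1/2}`; this identity merges the two into `[a_{00}
- 1]`. -/
lemma qInt_double (a : ℕ) (e : ℤ) :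
    q ^ e * qInt (2 * a) = q ^ (e + a) * qInt a + q ^ (e - a) * qInt a := by
  have h := q_sub_inv_ne_zero
  apply mul_left_cancel₀ h
  rw [mul_add, q_sub_mul_qInt, q_sub_mul_qInt, q_sub_mul_qInt]
  push_cast
  ring_nf

/-- In the action of `B_0` the power of `q` from `K_0⁻¹` comes together with correction terms from
straightening, one for each negative column. Their total is the coefficient of `t^{(A)}` in the
stated formula. -/
lemma sum_telescope (hn : Even n) (f : Fin n → ℕ) :
    q ^ (∑ k, (f k : ℤ)) - ∑ j, (if IsPos j.rev then (q - q⁻¹) * (q ^ (∑ k ∈ Finset.Ioi j, (f k : ℤ) -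
      ∑ k ∈ Finset.Iio j, (f k : ℤ)) * qInt (f j)) else 0) =
      q ^ (∑ k with IsPos k, ((f k : ℤ) - f k.rev)) := by
  obtain ⟨p, rfl⟩ := hn
  -- In the exponent of `G c` the first `c` summands have their sign reversed. Since `(q - q⁻¹) q^e
  -- [a] = q^{e+a} - q^{e-a}`, the correction at position `j` is `G j - G (j+1)`. The sum over the
  -- lower half leaves `G 0 - G p`.
  set G : ℕ → Kq := fun c => q ^ (∑ k : Fin (p + p), if (k : ℕ) < c then -(f k : ℤ) else f k) with hG
  have h1 : ∀ j : Fin (p + p), (if IsPos j.rev then (q - q⁻¹) * (q ^ (∑ k ∈ Finset.Ioi j, (f k : ℤ) -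
      ∑ k ∈ Finset.Iio j, (f k : ℤ)) * qInt (f j)) else 0) =
      (fun c => if c < p then G c - G (c + 1) else 0) (j : ℕ) := by
    intro j
    have hj : IsPos j.rev ↔ (j : ℕ) < p := by
      simp only [IsPos, Fin.lt_def, Fin.val_rev]; omega
    by_cases h : (j : ℕ) < p
    · simp only [if_pos h, if_pos (hj.mpr h), q_sub_mul_qInt, hG]
      have e1 : (f j : ℤ) = ∑ k, if k = j then (f k : ℤ) else 0 := by simp
      congr 2
      · rw [sum_Ioi, sum_Iio, e1, ← Finset.sum_sub_distrib, ← Finset.sum_add_distrib]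
        refine Finset.sum_congr rfl fun k _ => ?_
        simp only [Fin.lt_def, Fin.ext_iff]
        split_ifs <;> omega
      · rw [sum_Ioi, sum_Iio, e1, ← Finset.sum_sub_distrib, ← Finset.sum_sub_distrib]
        refine Finset.sum_congr rfl fun k _ => ?_
        simp only [Fin.lt_def, Fin.ext_iff]
        split_ifs <;> omega
    · simp only [if_neg h, if_neg (fun h2 => h (hj.mp h2))]
  rw [Finset.sum_congr rfl fun j _ => h1 j, Fin.sum_univ_eq_sum_range
    (fun c => if c < p then G c - G (c + 1) else 0), Finset.sum_range_add,
    Finset.sum_congr rfl (fun c hc => if_pos (Finset.mem_range.mp hc)), Finset.sum_range_sub',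
    Finset.sum_eq_zero (s := Finset.range p) (fun c _ => if_neg (by omega)), add_zero]
  have h0 : G 0 = q ^ (∑ k, (f k : ℤ)) := by simp [hG]
  rw [h0, sub_sub_cancel]
  simp only [hG]
  congr 1
  rw [Finset.sum_filter, sum_split, sum_isZero_of_even _ ⟨p, rfl⟩, add_zero]
  refine Finset.sum_congr rfl fun k _ => ?_
  by_cases h : IsPos k
  · rw [if_pos h, if_pos h, if_neg, if_pos]
    · ring
    · simp only [IsPos, Fin.lt_def, Fin.val_rev] at h ⊢; omega
    · simp only [IsPos, Fin.lt_def, Fin.val_rev] at h ⊢; omega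
  · rw [if_neg h, if_neg h]

end Sums

/-! ### Straightening, and the left action of `B_0` in type ı. -/

section Cells
variable {M N P : ℕ} (h : M ≤ P) (h' : N ≤ P)

/-- Exponents decreased by one at `(i, j)`. -/
def mdecr (a : Fin M → Fin N → ℕ) (i : Fin M) (j : Fin N) : Fin M → Fin N → ℕ :=
  fun r s => a r s - if r = i ∧ s = j then 1 else 0

lemma mshift_eq (a : Fin M → Fin N → ℕ) (i : Fin M) (j : Fin N) (k : Fin M) (l : Fin N) :
    mshift a i j k l = mincr (mdecr a i j) k l := rfl

lemma mincr_mdecr {a : Fin M → Fin N → ℕ} {i : Fin M} {j : Fin N} (h : a i j ≠ 0) :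
    mincr (mdecr a i j) i j = a := by
  funext r s
  by_cases hc : r = i ∧ s = j
  · simp only [mincr, mdecr, if_pos hc]
    rw [hc.1, hc.2]; omega
  · simp only [mincr, mdecr, if_neg hc]; rfl

lemma mdecr_eq_zero {a : Fin M → Fin N → ℕ} {r : Fin M} {s : Fin N} (h : a r s = 0) (i : Fin M)
    (j : Fin N) : mdecr a i j r s = 0 := by
  simp [mdecr, h]

lemma mdecr_cast {a : Fin M → Fin N → ℕ} {i : Fin M} {j : Fin N} (h : a i j ≠ 0) (r : Fin M)
    (s : Fin N) : (mdecr a i j r s : ℤ) = a r s - if r = i ∧ s = j then 1 else 0 := by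
  by_cases hc : r = i ∧ s = j
  · simp only [mdecr, if_pos hc]
    rw [hc.1, hc.2]; omega
  · simp only [mdecr, if_neg hc]; simp

lemma sum_Iio_mdecr {a : Fin M → Fin N → ℕ} {i : Fin M} {j : Fin N} (h : a i j ≠ 0) (c : Fin N) :
    ∑ s ∈ Finset.Iio c, (mdecr a i j i s : ℤ) =
      ∑ s ∈ Finset.Iio c, (a i s : ℤ) - if j < c then 1 else 0 := by
  simp only [mdecr_cast h, Finset.sum_sub_distrib, true_and]
  congr 1
  simp

/-- A generator preceding every occupied cell can be split off at no cost. Read backwards, this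
exposes a generator on the left, where the relations of the ideal apply. -/
lemma cell_mul_mon_low {a : Fin M → Fin N → ℕ} {i : Fin M} {j : Fin N}
    (h1 : ∀ r s, r < i → a r s = 0) (h2 : ∀ s, s < j → a i s = 0) :
    cell h h' i j * mon (cell h h') a = mon (cell h h') (mincr a i j) := by
  rw [gen_mul_mon (isQMat_cell h h') a i j (fun r s hr h0 => absurd (h1 r s hr) h0),
    Finset.sum_eq_zero (fun s hs => by simp [h2 s (Finset.mem_Iio.mp hs)]),
    Finset.sum_eq_zero (fun r hr => by simp [h1 r j (Finset.mem_Iio.mp hr)])]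
  simp

lemma cell_mul_mon_row {a : Fin M → Fin N → ℕ} {i : Fin M} (j : Fin N)
    (h1 : ∀ r s, r < i → a r s ≠ 0 → j < s) :
    cell h h' i j * mon (cell h h') a =
      q ^ (-∑ s ∈ Finset.Iio j, (a i s : ℤ)) • mon (cell h h') (mincr a i j) := by
  rw [gen_mul_mon (isQMat_cell h h') a i j (fun r s hr h0 => (h1 r s hr h0).le)]
  congr 2
  rw [Finset.sum_eq_zero (s := Finset.Iio i) (fun r hr => ?_), sub_zero]
  by_contra h0
  exact lt_irrefl _ (h1 r j (Finset.mem_Iio.mp hr) (by exact_mod_cast h0))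

lemma isPos_rev_of_lt {n : ℕ} (hn : Even n) {r : Fin n} {i : Fin (n - 1)} (hz : IsZero i)
    (hr : r < hi i) : IsPos r.rev := by
  obtain ⟨m, rfl⟩ := hn
  have := congrArg Fin.val hz
  simp only [IsPos, hi, Fin.lt_def, Fin.val_rev] at *
  omega

/-- The summand `E_0 K_0⁻¹` moves a unit from row `hi i` to the opposite row, which is not used by
the monomials `t^{(A)}`. In a positive column the new generator is congruent to the one with both
signs changed. In a negative column `-l` it is congruent to `t_{hi,l} - (q - q⁻¹) t_{hi,-l}`, and
the second term puts back the unit removed, giving a multiple of `t^{(A)}`. -/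
lemma mk_bI_of_isZero_term (hM : M % 2 = P % 2) (hN : N % 2 = P % 2) (hMe : Even M) (hNe : Even N)
    {A : Matrix (Fin M) (Fin N) ℕ} (hA : IsSymm A) {i : Fin (M - 1)} (hi0 : IsZero i) (j : Fin N) :
    (q⁻¹ * (q ^ (∑ k, (tExp A (hi i) k : ℤ)) * (q ^ (-∑ k ∈ Finset.Iic j, (tExp A (hi i) k : ℤ) + 1) *
        qInt (tExp A (hi i) j)))) •
        TQuot.mk (mon (cell h h') (mshift (tExp A) (hi i) j (lo i) j)) =
      (q ^ (∑ k ∈ Finset.Ici j.rev, ((A (hi i) k : ℤ) - A (lo i) k) + if IsPos j.rev then 1 else 0) *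
        qInt (A (lo i) j.rev)) • tau h h' (A + Eθ (hi i) j.rev - Eθ (lo i) j.rev) -
      (if IsPos j.rev then (q - q⁻¹) * (q ^ (∑ k ∈ Finset.Ioi j, (tExp A (hi i) k : ℤ) -
        ∑ k ∈ Finset.Iio j, (tExp A (hi i) k : ℤ)) * qInt (tExp A (hi i) j)) else 0) •
        tau h h' A := by
  have hlo : lo i = (hi i).rev := by rw [← lo_rev, show i.rev = i from hi0]
  have hp : IsPos (hi i) := by
    rw [IsPos, ← hlo]; exact lo_lt_hi i
  have hneg : ∀ r, r < hi i → IsPos r.rev := fun r hr => isPos_rev_of_lt hMe hi0 hr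
  have hA1 : ∀ k, A (hi i) k = tExp A (hi i) k := fun k => (tExp_of_isPos hp k).symm
  have hA2 : ∀ k, A (lo i) k = tExp A (hi i) k.rev := fun k => by
    rw [hlo, A_rev_left hA, tExp_of_isPos hp]
  have hS : ∑ k ∈ Finset.Ici j.rev, (tExp A (hi i) k.rev : ℤ) =
      ∑ k ∈ Finset.Iic j, (tExp A (hi i) k : ℤ) := by
    rw [sum_Ici_rev]; simp only [Fin.rev_rev]
  rcases eq_or_ne (tExp A (hi i) j) 0 with h0 | h0
  · rw [hA2]; simp only [Fin.rev_rev, h0, qInt_zero]; simp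
  have hlow : ∀ r s, r < hi i → mdecr (tExp A) (hi i) j r s = 0 := fun r s hr =>
    mdecr_eq_zero (tExp_of_neg (hneg r hr) s) _ _
  have hins : ∀ l, cell h h' (hi i) l * mon (cell h h') (mdecr (tExp A) (hi i) j) =
      q ^ (-(∑ s ∈ Finset.Iio l, (tExp A (hi i) s : ℤ) - if j < l then 1 else 0)) •
        mon (cell h h') (mshift (tExp A) (hi i) j (hi i) l) := fun l => by
    rw [cell_mul_mon_row h h' l (fun r s hr h1 => absurd (hlow r s hr) h1), sum_Iio_mdecr h0]
    rfl
  have hlohi := lo_lt_hi i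
  -- All rows before `hi i` are empty, so the new generator of row `lo i` is the leftmost factor.
  rw [mshift_eq _ _ _ (lo i), ← cell_mul_mon_low h h' (fun r s hr => hlow r s (hr.trans hlohi))
    (fun s _ => hlow _ s hlohi)]
  have htau : ∀ l, j ≠ l → TQuot.mk (mon (cell h h') (mshift (tExp A) (hi i) j (hi i) l)) =
      tau h h' (A + Eθ (hi i) l - Eθ (hi i) j) := fun l hl =>
    tau_move h h' hA (Or.inl hp) (Or.inl hp) (fun e => hl e.2)
  have hq := q_ne_zero
  have hE : A + Eθ (hi i) j.rev - Eθ (lo i) j.rev = A + Eθ (hi i) j.rev - Eθ (hi i) j := by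
    rw [hlo, Eθ_rev]
  simp only [hE, hA1, hA2, Fin.rev_rev, Finset.sum_sub_distrib, hS, sum_Ici_add_Iio,
    sum_Ioi_add_Iic]
  rcases isPos_or j with hj | hj | hj
  · have hj' := not_isPos_rev hj
    rw [hlo, mk_cell_anti h h' hM hN hp hj, hins, map_smul, htau _ (fun e => not_isZero_of_isPos hj e.symm),
      if_neg hj', if_neg hj', zero_smul, sub_zero, smul_smul]
    congr 1
    rw [if_neg (show ¬ j < j.rev from hj.not_gt), ← zpow_neg_one]
    simp only [← mul_assoc, ← zpow_add₀ hq]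
    rw [mul_right_comm, ← zpow_add₀ hq]
    congr 2
    ring
  · exfalso
    obtain ⟨p, rfl⟩ := hNe
    have := congrArg Fin.val hj
    simp only [Fin.val_rev] at this
    omega
  · obtain ⟨l, rfl⟩ : ∃ l, j = Fin.rev l := ⟨j.rev, by rw [Fin.rev_rev]⟩
    rw [Fin.rev_rev] at hj
    have hj' : l.rev < l := hj
    rw [hlo, mk_cell_diag h h' hM hN hp hj, hins, hins, map_smul, map_smul, Fin.rev_rev,
      htau _ hj'.ne, if_pos hj, if_pos hj, if_neg (lt_irrefl _), mshift_eq,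
      mincr_mdecr h0, smul_sub, smul_smul, smul_smul, smul_smul]
    have e1 : q⁻¹ = q ^ (-1 : ℤ) := (zpow_neg_one q).symm
    congr 2
    · rw [e1]
      simp only [← mul_assoc, ← zpow_add₀ hq]
      rw [mul_right_comm, ← zpow_add₀ hq]
      congr 2
      ring
    · generalize ∑ k, (tExp A (hi i) k : ℤ) = x
      generalize ∑ k ∈ Finset.Iic l.rev, (tExp A (hi i) k : ℤ) = y
      generalize ∑ k ∈ Finset.Iio l.rev, (tExp A (hi i) k : ℤ) = z
      rw [show x - y - z = -1 + x + (-y + 1) + -(z - 0) by ring, zpow_add₀ hq _ (-(z - 0)),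
        zpow_add₀ hq _ (-y + 1), zpow_add₀ hq _ x, e1]
      ring

/-- `F_0` contributes nothing, as row `lo i` is negative. The terms of `q⁻¹ E_0 K_0⁻¹` give the sum,
after `j ↦ -j`, together with corrections proportional to `t^{(A)}`; these combine with `K_0⁻¹` by
`sum_telescope`. -/
lemma mk_bI_of_isZero (hM : M % 2 = P % 2) (hN : N % 2 = P % 2) (hMe : Even M) (hNe : Even N)
    {A : Matrix (Fin M) (Fin N) ℕ} (hA : IsSymm A) {i : Fin (M - 1)} (hi0 : IsZero i) :
    TQuot.mk (T.bI (embI h i) (mon (cell h h') (tExp A))) =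
      ∑ j, (q ^ (∑ k ∈ Finset.Ici j, ((A (hi i) k : ℤ) - A (lo i) k) + if IsPos j then 1 else 0) *
        qInt (A (lo i) j)) • tau h h' (A + Eθ (hi i) j - Eθ (lo i) j) +
      q ^ (∑ j with IsPos j, ((A (hi i) j : ℤ) - A (lo i) j)) • tau h h' A := by
  have hlo : lo i = (hi i).rev := by rw [← lo_rev, show i.rev = i from hi0]
  have hp : IsPos (hi i) := by
    rw [IsPos, ← hlo]; exact lo_lt_hi i
  have h3 : ∀ k, tExp A (lo i) k = 0 := tExp_of_neg (by rwa [hlo, Fin.rev_rev])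
  have hA1 : ∀ k, A (hi i) k = tExp A (hi i) k := fun k => (tExp_of_isPos hp k).symm
  have hA2 : ∀ k, A (lo i) k = tExp A (hi i) k.rev := fun k => by
    rw [hlo, A_rev_left hA, tExp_of_isPos hp]
  have key := sum_telescope hNe (tExp A (hi i))
  rw [sub_eq_iff_eq_add] at key
  rw [T.bI_of_isZero (by rwa [isZero_embI h hM]), LinearMap.add_apply, LinearMap.add_apply,
    LinearMap.smul_apply, LinearMap.comp_apply,
    AlgHom.toLinearMap_apply, fOp_mon, kinvOp_mon, map_smul, eOp_mon]
  simp only [h3, qInt_zero, mul_zero, zero_smul, Finset.sum_const_zero, zero_add, Nat.cast_zero,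
    sub_zero, zero_sub, Finset.sum_neg_distrib]
  rw [map_add, map_smul, map_smul, map_smul, map_sum, Finset.smul_sum, Finset.smul_sum]
  simp only [map_smul, smul_smul, mk_bI_of_isZero_term h h' hM hN hMe hNe hA hi0]
  rw [Finset.sum_sub_distrib, ← Finset.sum_smul, ← tau, key, add_smul]
  rw [← Equiv.sum_comp Fin.revPerm]
  simp only [Fin.revPerm_apply, Fin.rev_rev, hA1, hA2]
  abel

end Cells

/-! ### The left action in type ȷ. -/

section Cells
variable {M N P : ℕ} (h : M ≤ P) (h' : N ≤ P)

lemma sum_Ici_zero_of_isPos {A : Matrix (Fin M) (Fin N) ℕ} {z : Fin M} (hz : IsZero z) {c : Fin N}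
    (hc : IsPos c) : ∑ k ∈ Finset.Ici c, (A z k : ℤ) = ∑ k ∈ Finset.Ici c, (tExp A z k : ℤ) :=
  Finset.sum_congr rfl fun k hk => by
    rw [tExp_zero_pos hz]
    have := Finset.mem_Ici.mp hk
    simp only [IsPos, Fin.lt_def, Fin.le_def, Fin.val_rev] at *
    omega

lemma sum_Iic_zero {A : Matrix (Fin M) (Fin N) ℕ} (hA : IsSymm A) {z : Fin M} (hz : IsZero z)
    (c : Fin N) : ∑ k ∈ Finset.Iic c, (A z k : ℤ) = ∑ k ∈ Finset.Ici c.rev, (A z k : ℤ) := by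
  rw [sum_Ici_rev, Fin.rev_rev]
  simp only [← A_rev_left hA, show z.rev = z from hz]

/-- Both rows are positive, so `E_{-i}` would have to act on a negative row, which is empty; only
`F_i` remains. -/
lemma mk_bJ_far (hM : M % 2 = P % 2) {A : Matrix (Fin M) (Fin N) ℕ} (hA : IsSymm A)
    {i : Fin (M - 1)} (hi0 : IsPos i) (hlo : IsPos (lo i)) :
    TQuot.mk (T.bJ (embI h i) (mon (cell h h') (tExp A))) =
      ∑ j, (q ^ (∑ k ∈ Finset.Ici j, ((A (hi i) k : ℤ) - A (lo i) k) + 1) * qInt (A (lo i) j)) •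
        tau h h' (A + Eθ (hi i) j - Eθ (lo i) j) := by
  have hlh := (lo_lt_hi i).ne
  rw [T.bJ_of_isPos (by rwa [isPos_embI h hM]), LinearMap.add_apply, LinearMap.comp_apply,
    AlgHom.toLinearMap_apply, fOp_mon, kinvOp_mon, map_smul, ← embI_rev h hM, eOp_mon, map_add,
    map_smul, map_sum, map_sum]
  simp only [map_smul]
  have h2 : IsPos (hi i) := by simp only [IsPos, lo, hi, Fin.lt_def, Fin.val_rev] at *; omega
  have h3 : ∀ k, tExp A (hi i.rev) k = 0 := fun k => by
    rw [hi_rev]; exact tExp_of_neg (by rwa [Fin.rev_rev]) k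
  simp only [h3, qInt_zero, mul_zero, zero_smul, Finset.sum_const_zero, smul_zero, add_zero]
  refine Finset.sum_congr rfl fun j _ => ?_
  simp only [tExp_of_isPos hlo, tExp_of_isPos h2]
  rw [tau_move h h' hA (Or.inl hlo) (Or.inl h2) (fun e => hlh e.1)]

/-- Only `E_i` contributes, and `K_{-i}⁻¹` acts trivially because it weighs negative rows, which
stay empty. -/
lemma mk_bJ_rev_far (hM : M % 2 = P % 2) {A : Matrix (Fin M) (Fin N) ℕ} (hA : IsSymm A)
    {i : Fin (M - 1)} (hi0 : IsPos i) (hlo : IsPos (lo i)) :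
    TQuot.mk (T.bJ (embI h i.rev) (mon (cell h h') (tExp A))) =
      ∑ j, (q ^ (∑ k ∈ Finset.Iic j, ((A (lo i) k : ℤ) - A (hi i) k) + 1) * qInt (A (hi i) j)) •
        tau h h' (A + Eθ (lo i) j - Eθ (hi i) j) := by
  have hlh := (lo_lt_hi i).ne
  have h2 : IsPos (hi i) := by simp only [IsPos, lo, hi, Fin.lt_def, Fin.val_rev] at *; omega
  have h3 : ∀ k, tExp A (hi i).rev k = 0 := fun k => tExp_of_neg (by rwa [Fin.rev_rev]) k
  have h4 : ∀ k, tExp A (lo i).rev k = 0 := fun k => tExp_of_neg (by rwa [Fin.rev_rev]) k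
  rw [T.bJ_of_not (by rw [isPos_embI h hM]; exact not_isPos_rev hi0), LinearMap.add_apply,
    LinearMap.comp_apply, AlgHom.toLinearMap_apply, fOp_mon, ← embI_rev h hM, Fin.rev_rev, eOp_mon]
  simp only [map_add, map_sum, map_smul, lo_rev, hi_rev, h3, qInt_zero, mul_zero, zero_smul, Finset.sum_const_zero,
    zero_add]
  refine Finset.sum_congr rfl fun j _ => ?_
  simp only [tExp_of_isPos hlo, tExp_of_isPos h2]
  rw [kinvOp_mon, map_smul, ← tau_move h h' hA (Or.inl h2) (Or.inl hlo) (fun e => hlh e.1.symm),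
    lo_rev, hi_rev]
  have e1 : ∀ r, IsPos r → ∀ k, mshift (tExp A) (hi i) j (lo i) j r.rev k = 0 := by
    intro r hr k
    have e2 : r.rev ≠ hi i := fun e => not_isPos_rev hr (e ▸ h2)
    have e3 : r.rev ≠ lo i := fun e => not_isPos_rev hr (e ▸ hlo)
    have e4 : tExp A r.rev k = 0 := tExp_of_neg (by rwa [Fin.rev_rev]) k
    simp [mshift, e2, e3, e4]
  simp only [e1 _ hlo, e1 _ h2]
  simp

/-- Facts on the rows around the zero row. -/
lemma neg_of_lt_zero {z r : Fin M} (hz : IsZero z) (hr : r < z) : IsPos r.rev := by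
  have := congrArg Fin.val hz
  simp only [IsPos, Fin.lt_def, Fin.val_rev] at *
  omega

/-- For `i = 1/2` the summand `E_{-i} K_i⁻¹` moves a unit from the zero row to the negative row `-hi
i`, where it is the leftmost factor. For `j > 0` it is replaced by `t_{hi,-j}`, and for `j = 0` by
`q⁻¹ t_{hi,0}`. The cells of the zero row in negative columns are empty. -/
lemma mk_bJ_near_term (hM : M % 2 = P % 2) (hN : N % 2 = P % 2)
    {A : Matrix (Fin M) (Fin N) ℕ} (hA : IsSymm A) {i : Fin (M - 1)} (hi0 : IsPos i)
    (hz : IsZero (lo i)) {z' : Fin N} (hz' : IsZero z') (j : Fin N) :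
    (q ^ (∑ k, ((tExp A (hi i) k : ℤ) - tExp A (lo i) k)) *
      (q ^ (-∑ k ∈ Finset.Iic j, (tExp A (lo i) k : ℤ) + 1) * qInt (tExp A (lo i) j))) •
        TQuot.mk (mon (cell h h') (mshift (tExp A) (lo i) j (hi i).rev j)) =
      if IsPos j then
        (q ^ (∑ k ∈ Finset.Ici j.rev, ((A (hi i) k : ℤ) - A (lo i) k) + 1 + 1) *
          qInt (A (lo i) j.rev)) • tau h h' (A + Eθ (hi i) j.rev - Eθ (lo i) j.rev)
      else if IsZero j then
        (q ^ (∑ k ∈ Finset.Ici j, ((A (hi i) k : ℤ) - A (lo i) k) + 1 + 1 - tExp A (lo i) j) *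
          qInt (tExp A (lo i) j)) • tau h h' (A + Eθ (hi i) j - Eθ (lo i) j)
      else 0 := by
  have hlh := lo_lt_hi i
  have hp : IsPos (hi i) := by
    have := congrArg Fin.val hz
    simp only [IsPos, lo, hi, Fin.lt_def, Fin.val_rev] at *; omega
  have hnp : (hi i).rev < lo i := by
    have := congrArg Fin.val hz
    simp only [IsPos, lo, hi, Fin.lt_def, Fin.val_rev] at *; omega
  have hq := q_ne_zero
  rcases eq_or_ne (tExp A (lo i) j) 0 with h0 | h0
  · simp only [h0, qInt_zero, mul_zero, zero_smul, ite_self]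
    split_ifs with hj
    · rw [← A_rev_left hA, show (lo i).rev = lo i from hz, ← tExp_zero_pos (A := A) hz hj, h0]
      simp [qInt_zero]
    · rfl
  have hA1 : ∀ k, A (hi i) k = tExp A (hi i) k := fun k => (tExp_of_isPos hp k).symm
  have hneg : ∀ r s, r < lo i → mdecr (tExp A) (lo i) j r s = 0 := fun r s hr =>
    mdecr_eq_zero (tExp_of_neg (neg_of_lt_zero hz hr) s) _ _
  have hrow : ∀ s, mdecr (tExp A) (lo i) j (hi i) s = tExp A (hi i) s := fun s => by
    simp [mdecr, hlh.ne']
  rw [mshift_eq, ← cell_mul_mon_low h h' (fun r s hr => hneg r s (hr.trans hnp))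
    (fun s _ => hneg _ s hnp)]
  rcases isPos_or j with hj | hj | hj
  · rw [if_pos hj, mk_cell_anti h h' hM hN hp hj, cell_mul_mon_row h h', map_smul, ← mshift_eq,
      tau_move h h' hA (Or.inr ⟨hz, not_isPos_rev hj⟩) (Or.inl hp) (fun e => hlh.ne e.1),
      smul_smul, ← A_rev_left hA, show (lo i).rev = lo i from hz, tExp_zero_pos hz hj]
    · have e1 : Eθ (lo i) j.rev = Eθ (lo i) j := by
        have := Eθ_rev (lo i) j
        rwa [show (lo i).rev = lo i from hz] at this
      rw [e1]
      congr 1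
      rw [Finset.sum_sub_distrib, Finset.sum_sub_distrib, sum_Ici_zero_tExp hA hz hz'
        (not_isPos_rev hj)]
      simp only [hrow, hA1, sum_Ici_add_Iio]
      rw [← mul_assoc, mul_right_comm, ← zpow_add₀ hq, ← zpow_add₀ hq]
      congr 2
      ring
    · intro r s hr h1
      have hr' : r = lo i := by
        by_contra hne
        exact h1 (hneg r s (lt_of_le_of_ne (lt_hi_iff.mp hr) hne))
      subst hr'
      by_contra hjs
      apply h1
      apply mdecr_eq_zero
      apply tExp_zero_neg hz
      simp only [IsPos, Fin.lt_def, Fin.val_rev] at *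
      omega
  · have hj2 : ¬ IsPos j := fun e => not_isZero_of_isPos e hj
    have hj3 : ¬ IsPos j.rev := fun e => (isPos_of_rev e).2 hj
    rw [if_neg hj2, if_pos hj, mk_cell_col h h' hM hN hp hj, gen_mul_mon (isQMat_cell h h'),
      map_smul, ← mshift_eq,
      tau_move h h' hA (Or.inr ⟨hz, hj3⟩) (Or.inl hp) (fun e => hlh.ne e.1), smul_smul, smul_smul]
    · congr 1
      have e2 := sum_Ici_zero_tExp hA hz hz' hj3
      rw [show j.rev = j from hj] at e2
      rw [Finset.sum_sub_distrib, Finset.sum_sub_distrib, e2]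
      have e3 : ∑ r ∈ Finset.Iio (hi i), (mdecr (tExp A) (lo i) j r j : ℤ) =
          tExp A (lo i) j - 1 := by
        rw [Finset.sum_eq_single (lo i)]
        · rw [mdecr_cast h0, if_pos ⟨rfl, rfl⟩]
        · intro r hr hne
          rw [hneg r j (lt_of_le_of_ne (lt_hi_iff.mp (Finset.mem_Iio.mp hr)) hne)]
          rfl
        · intro hn
          exact absurd (Finset.mem_Iio.mpr hlh) hn
      rw [e3]
      simp only [hrow, hA1, sum_Ici_add_Iio]
      generalize ∑ k, (tExp A (hi i) k : ℤ) = x1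
      generalize ∑ k, (tExp A (lo i) k : ℤ) = x2
      generalize ∑ k ∈ Finset.Iic j, (tExp A (lo i) k : ℤ) = x3
      generalize ∑ k ∈ Finset.Iio j, (tExp A (hi i) k : ℤ) = x4
      have e4 : q ^ (x1 - x4 - (x3 + x2 + 1) + 1 + 1 - (tExp A (lo i) j : ℤ)) =
          q ^ (x1 - x2) * q ^ (-x3 + 1) * q ^ (-1 : ℤ) * q ^ (-x4 - ((tExp A (lo i) j : ℤ) - 1)) := by
        rw [← zpow_add₀ hq, ← zpow_add₀ hq, ← zpow_add₀ hq]
        congr 1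
        ring
      rw [e4, zpow_neg_one]
      simp only [mul_comm, mul_left_comm, mul_assoc]
    · intro r s hr h1
      have hr' : r = lo i := by
        by_contra hne
        exact h1 (hneg r s (lt_of_le_of_ne (lt_hi_iff.mp hr) hne))
      subst hr'
      by_contra hjs
      apply h1
      apply mdecr_eq_zero
      apply tExp_zero_neg hz
      have := congrArg Fin.val hj
      simp only [IsPos, Fin.lt_def, Fin.le_def, Fin.val_rev] at *
      omega
  · exact absurd (tExp_zero_neg hz hj) h0

/-- `F_i` accounts for the columns `j ≥ 0` and `E_{-i} K_i⁻¹`, after straightening, for the columns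
`j ≤ 0`; they overlap at `j = 0`. -/
lemma mk_bJ_near (hM : M % 2 = P % 2) (hN : N % 2 = P % 2) {z' : Fin N} (hz' : IsZero z')
    {A : Matrix (Fin M) (Fin N) ℕ} (hA : IsSymm A) {i : Fin (M - 1)} (hi0 : IsPos i)
    (hz : IsZero (lo i)) :
    TQuot.mk (T.bJ (embI h i) (mon (cell h h') (tExp A))) =
      ∑ j with ¬ IsPos j ∧ A (lo i) j > (if IsZero j then 1 else 0),
        (q ^ (∑ k ∈ Finset.Ici j, ((A (hi i) k : ℤ) - A (lo i) k) + 1 + 1) *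
          qInt (A (lo i) j - if IsZero j then 1 else 0)) •
          tau h h' (A + Eθ (hi i) j - Eθ (lo i) j) +
      ∑ j with IsPos j,
        (q ^ (∑ k ∈ Finset.Ici j, ((A (hi i) k : ℤ) - A (lo i) k) + 1) * qInt (A (lo i) j)) •
        tau h h' (A + Eθ (hi i) j - Eθ (lo i) j) := by
  have hlh := lo_lt_hi i
  have hp : IsPos (hi i) := by
    have := congrArg Fin.val hz
    simp only [IsPos, lo, hi, Fin.lt_def, Fin.val_rev] at *; omega
  have h3 : ∀ k, tExp A (hi i).rev k = 0 := fun k => tExp_of_neg (by rwa [Fin.rev_rev]) k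
  have hA1 : ∀ k, A (hi i) k = tExp A (hi i) k := fun k => (tExp_of_isPos hp k).symm
  rw [T.bJ_of_isPos (by rwa [isPos_embI h hM]), LinearMap.add_apply, LinearMap.comp_apply,
    AlgHom.toLinearMap_apply, fOp_mon, kinvOp_mon, map_smul, ← embI_rev h hM, eOp_mon, map_add,
    map_smul, map_sum, map_sum, Finset.smul_sum]
  simp only [map_smul, lo_rev, hi_rev, show (lo i).rev = lo i from hz, h3, Nat.cast_zero, zero_sub,
    Finset.sum_neg_distrib, smul_smul, mk_bJ_near_term h h' hM hN hA hi0 hz hz']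
  rw [← Equiv.sum_comp Fin.revPerm (fun j => if IsPos j then _ else _)]
  rw [Finset.sum_filter, Finset.sum_filter, ← Finset.sum_add_distrib, ← Finset.sum_add_distrib]
  refine Finset.sum_congr rfl fun j _ => ?_
  simp only [Fin.revPerm_apply]
  rcases isPos_or j with hj | hj | hj
  · rw [if_neg (not_isPos_rev hj), if_neg (fun e => not_isZero_of_isPos hj ((isZero_rev_iff j).mp e)),
      if_neg (fun e => e.1 hj), if_pos hj, add_zero, zero_add,
      tau_move h h' hA (Or.inr ⟨hz, not_isPos_rev hj⟩) (Or.inl hp) (fun e => hlh.ne e.1),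
      tExp_zero_pos hz hj, Finset.sum_sub_distrib, Finset.sum_sub_distrib,
      ← sum_Ici_zero_of_isPos hz hj]
    simp only [hA1]
  · have hj2 : ¬ IsPos j := fun e => not_isZero_of_isPos e hj
    have hj3 : ¬ IsPos j.rev := fun e => (isPos_of_rev e).2 hj
    have hjz := (isZero_rev_iff j).mpr hj
    have e2 := sum_Ici_zero_tExp hA hz hz' hj3
    have ho := hA.odd _ _ hz hj
    rw [if_neg hj3, if_pos hjz, if_neg hj2, add_zero]
    simp only [if_pos hj]
    have hjj : j.rev = j := hj
    rw [hjj] at e2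
    simp only [hjj]
    rw [tau_move h h' hA (Or.inr ⟨hz, hj3⟩) (Or.inl hp) (fun e => hlh.ne e.1), ← add_smul,
      Finset.sum_sub_distrib, Finset.sum_sub_distrib, e2]
    simp only [hA1]
    have e3 : ∑ k, (tExp A (lo i) k : ℤ) = ∑ k ∈ Finset.Ici j, (tExp A (lo i) k : ℤ) := by
      rw [sum_Ici_add_Iio, Finset.sum_eq_zero (s := Finset.Iio j), sub_zero]
      intro k hk
      rw [tExp_zero_neg hz (neg_of_lt_zero hj (Finset.mem_Iio.mp hk))]
      rfl
    have e4 : ∑ k ∈ Finset.Iic j, (tExp A (lo i) k : ℤ) = tExp A (lo i) j := by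
      rw [sum_Iic_eq_Iio, Finset.sum_eq_zero (s := Finset.Iio j), zero_add]
      intro k hk
      rw [tExp_zero_neg hz (neg_of_lt_zero hj (Finset.mem_Iio.mp hk))]
      rfl
    rcases eq_or_ne (tExp A (lo i) j) 0 with h0 | h0
    · rw [if_neg (by omega), h0, qInt_zero, mul_zero, mul_zero, add_zero, zero_smul]
    -- The two contributions at `j = 0` differ from the common exponent by plus and minus the
    -- exponent of `t_{00}`, exactly as `qInt_double` requires.
    · rw [if_pos ⟨hj2, by omega⟩, show A (lo i) j - 1 = 2 * tExp A (lo i) j by omega, qInt_double,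
        e3, e4]
      congr 4 <;> ring
  · rw [if_pos hj, if_neg (isPos_of_rev hj).1, add_zero, tExp_zero_neg hz hj, qInt_zero, mul_zero,
      zero_smul, zero_add]
    simp only [Fin.rev_rev, if_neg (isPos_of_rev hj).2, Nat.sub_zero]
    split_ifs with hc
    · rfl
    · have : A (lo i) j = 0 := by
        by_contra hne
        exact hc ⟨(isPos_of_rev hj).1, Nat.pos_of_ne_zero hne⟩
      rw [this, qInt_zero, mul_zero, zero_smul]

/-- `E_i` moves a unit from row `hi i` into the zero row. In a column `-l < 0` the new generator
lies outside the standard cells but comes first, so it may be replaced by `q⁻¹ t_{0,l}` and then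
carried to its place in the zero row. -/
lemma mk_bJ_rev_near (hM : M % 2 = P % 2) (hN : N % 2 = P % 2) {z' : Fin N} (hz' : IsZero z')
    {A : Matrix (Fin M) (Fin N) ℕ} (hA : IsSymm A) {i : Fin (M - 1)} (hi0 : IsPos i)
    (hz : IsZero (lo i)) :
    TQuot.mk (T.bJ (embI h i.rev) (mon (cell h h') (tExp A))) =
      ∑ j, (q ^ (∑ k ∈ Finset.Iic j, ((A (lo i) k : ℤ) - A (hi i) k) + 1) * qInt (A (hi i) j)) •
        tau h h' (A + Eθ (lo i) j - Eθ (hi i) j) := by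
  have hlh := lo_lt_hi i
  have hq := q_ne_zero
  have hp : IsPos (hi i) := by
    have := congrArg Fin.val hz
    simp only [IsPos, lo, hi, Fin.lt_def, Fin.val_rev] at *; omega
  have hnp : (hi i).rev < lo i := by
    have := congrArg Fin.val hz
    simp only [IsPos, lo, hi, Fin.lt_def, Fin.val_rev] at *; omega
  have h3 : ∀ k, tExp A (hi i).rev k = 0 := fun k => tExp_of_neg (by rwa [Fin.rev_rev]) k
  have hA1 : ∀ k, A (hi i) k = tExp A (hi i) k := fun k => (tExp_of_isPos hp k).symm
  rw [T.bJ_of_not (by rw [isPos_embI h hM]; exact not_isPos_rev hi0), LinearMap.add_apply,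
    LinearMap.comp_apply, AlgHom.toLinearMap_apply, fOp_mon, ← embI_rev h hM, Fin.rev_rev, eOp_mon]
  simp only [map_add, map_sum, map_smul, lo_rev, hi_rev, h3, qInt_zero, mul_zero, zero_smul, Finset.sum_const_zero,
    zero_add]
  refine Finset.sum_congr rfl fun j _ => ?_
  rw [kinvOp_mon, map_smul, lo_rev, hi_rev, show (lo i).rev = lo i from hz, hA1 j]
  rcases eq_or_ne (tExp A (hi i) j) 0 with h0 | h0
  · rw [h0]; simp [qInt_zero]
  -- `K_{-i}⁻¹` is applied after `E_i`, hence sees one more unit in the zero row.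
  have hk : ∑ k, ((mshift (tExp A) (hi i) j (lo i) j (lo i) k : ℤ) -
      mshift (tExp A) (hi i) j (lo i) j (hi i).rev k) = ∑ k, (tExp A (lo i) k : ℤ) + 1 := by
    have e1 : ∀ k, ((mshift (tExp A) (hi i) j (lo i) j (lo i) k : ℤ) -
      mshift (tExp A) (hi i) j (lo i) j (hi i).rev k) =
        (tExp A (lo i) k : ℤ) + if k = j then 1 else 0 := by
      intro k
      have e2 : (hi i).rev ≠ hi i := fun e => not_isZero_of_isPos hp e
      simp [mshift, hlh.ne, hnp.ne, e2, h3]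
    simp only [e1, Finset.sum_add_distrib]
    simp
  rw [hk, Finset.sum_sub_distrib, Finset.sum_sub_distrib, sum_Iic_zero hA hz]
  simp only [hA1]
  by_cases hj : IsPos j.rev
  · obtain ⟨l, rfl⟩ : ∃ l, j = Fin.rev l := ⟨j.rev, by rw [Fin.rev_rev]⟩
    rw [Fin.rev_rev] at hj
    have hneg : ∀ r s, r < lo i → mdecr (tExp A) (hi i) l.rev r s = 0 := fun r s hr =>
      mdecr_eq_zero (tExp_of_neg (neg_of_lt_zero hz hr) s) _ _
    have hrow : ∀ s, mdecr (tExp A) (hi i) l.rev (lo i) s = tExp A (lo i) s := fun s => by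
      simp [mdecr, hlh.ne]
    have hneg2 : ∀ s, s < l.rev → IsPos s.rev := by
      intro s hs
      simp only [IsPos, Fin.lt_def, Fin.val_rev] at *
      omega
    have e1 : Eθ (lo i) l.rev = Eθ (lo i) l := by
      have := Eθ_rev (lo i) l
      rwa [show (lo i).rev = lo i from hz] at this
    rw [mshift_eq, ← cell_mul_mon_low h h' hneg (fun s hs => by
      rw [hrow]; exact tExp_zero_neg hz (hneg2 s hs)), mk_cell_row h h' hM hN hz hj,
      cell_mul_mon_row h h' l (fun r s hr h1 => absurd (hneg r s hr) h1), map_smul, ← mshift_eq,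
      tau_move h h' hA (Or.inl hp) (Or.inr ⟨hz, not_isPos_rev hj⟩) (fun e => hlh.ne e.1.symm), e1,
      smul_smul, smul_smul, smul_smul, Fin.rev_rev, sum_Ici_zero_of_isPos hz hj, sum_Ici_add_Iio]
    have e2 : ∑ k ∈ Finset.Iic l.rev, (tExp A (lo i) k : ℤ) = 0 := by
      refine Finset.sum_eq_zero fun k hk => ?_
      rw [tExp_zero_neg hz]
      · rfl
      · have := Finset.mem_Iic.mp hk
        simp only [IsPos, Fin.lt_def, Fin.le_def, Fin.val_rev] at *
        omega
    simp only [hrow]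
    congr 1
    rw [e2, ← zpow_neg_one, mul_assoc, mul_assoc, mul_right_comm, ← zpow_add₀ hq, ← zpow_add₀ hq,
      ← zpow_add₀ hq]
    congr 2
    ring
  · rw [tau_move h h' hA (Or.inl hp) (Or.inr ⟨hz, hj⟩) (fun e => hlh.ne e.1.symm),
      sum_Ici_zero_tExp hA hz hz' hj, smul_smul, mul_right_comm, ← zpow_add₀ hq]
    congr 3
    ring

end Cells

/-! ### The right action of the generators as twisted derivations. -/

namespace T
variable {P : ℕ}

lemma fT_mul (i : Fin (P - 1)) (a b : T P) : fT i (a * b) = fT i a * kinvOp i b + a * fT i b := by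
  simp only [fT, LinearMap.smul_apply, LinearMap.comp_apply, AlgHom.toLinearMap_apply, map_mul]
  rw [eOp_mul, kOp_kinvOp, smul_add, smul_mul_assoc, mul_smul_comm]

lemma eT_mul (i : Fin (P - 1)) (a b : T P) : eT i (a * b) = eT i a * b + kOp i a * eT i b := by
  simp only [eT, LinearMap.smul_apply, LinearMap.comp_apply, AlgHom.toLinearMap_apply, map_mul]
  rw [fOp_mul, kinvOp_kOp, smul_add, smul_mul_assoc, mul_smul_comm]

/-- The right action of `F_i`. -/
def rF (i : Fin (P - 1)) : T P →ₗ[Kq] T P := transp.toLinearMap ∘ₗ fT i ∘ₗ transp.toLinearMap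
/-- The right action of `E_i`. -/
def rE (i : Fin (P - 1)) : T P →ₗ[Kq] T P := transp.toLinearMap ∘ₗ eT i ∘ₗ transp.toLinearMap
/-- The right action of `K_i`. -/
def rK (i : Fin (P - 1)) : T P →ₐ[Kq] T P := transp.comp ((kOp i).comp transp)
/-- The right action of `K_i⁻¹`. -/
def rKinv (i : Fin (P - 1)) : T P →ₐ[Kq] T P := transp.comp ((kinvOp i).comp transp)

lemma isTwDer_rF (i : Fin (P - 1)) : IsTwDer (rF i) (rKinv i) (AlgHom.id Kq (T P)) := fun a b => by
  simp [rF, rKinv, fT_mul]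
lemma isTwDer_rE (i : Fin (P - 1)) : IsTwDer (rE i) (AlgHom.id Kq (T P)) (rK i) := fun a b => by
  simp [rE, rK, eT_mul]

lemma transp_bIT_of_isZero {i : Fin (P - 1)} (h : IsZero i) (x : T P) :
    transp (bIT i (transp x)) = rF i x + q⁻¹ • rKinv i (rE i x) + rKinv i x := by
  rw [bIT_of_isZero h]; simp [rF, rE, rKinv]
lemma transp_bIT_of_not {i : Fin (P - 1)} (h : ¬ IsZero i) (x : T P) :
    transp (bIT i (transp x)) = rF i x + rKinv i (rE i.rev x) := by
  rw [bIT_of_not h]; simp [rF, rE, rKinv]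
lemma transp_bJT_of_isPos {i : Fin (P - 1)} (h : IsPos i) (x : T P) :
    transp (bJT i (transp x)) = rF i x + rKinv i (rE i.rev x) := by
  rw [bJT_of_isPos h]; simp [rF, rE, rKinv]
lemma transp_bJT_of_not {i : Fin (P - 1)} (h : ¬ IsPos i) (x : T P) :
    transp (bJT i (transp x)) = rF i x + rE i.rev (rKinv i x) := by
  rw [bJT_of_not h]; simp [rF, rE, rKinv]

end T

/-! ### The right action on monomials in type ı, and of `B_i`, `i > 0`, in type ȷ. -/

section Cells
variable {M N P : ℕ} (h : M ≤ P) (h' : N ≤ P)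

lemma rF_mon (i : Fin (N - 1)) (a : Fin M → Fin N → ℕ) :
    T.rF (embI h' i) (mon (cell h h') a) =
      ∑ r, (q ^ (∑ k ∈ Finset.Ioi r, ((a k (hi i) : ℤ) - a k (lo i))) *
        qInt (a r (hi i))) • mon (cell h h') (mshift a r (hi i) r (lo i)) :=
  rf_mon (isQMat_cell h h') i (T.isTwDer_rF _)
    (fun r s => by
      simp only [T.rF, T.fT, cell, lo_embI, hi_embI, emb_inj, LinearMap.comp_apply,
        AlgHom.toLinearMap_apply, T.transp_t, LinearMap.smul_apply, T.kinvOp_t, map_smul, T.eOp_t,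
        hi_embI, emb_inj]
      split_ifs with hs
      · subst hs
        rw [T.transp_t, smul_smul, wtE, lo_embI, hi_embI]
        simp [emb_inj, (lo_lt_hi i).ne', q_ne_zero]
      · simp)
    (fun r s => by simp [T.rKinv, cell, wtE, lo_embI, hi_embI, emb_inj]) a

lemma rE_mon (i : Fin (N - 1)) (a : Fin M → Fin N → ℕ) :
    T.rE (embI h' i) (mon (cell h h') a) =
      ∑ r, (q ^ (∑ k ∈ Finset.Iio r, ((a k (lo i) : ℤ) - a k (hi i))) *
        qInt (a r (lo i))) • mon (cell h h') (mshift a r (lo i) r (hi i)) :=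
  re_mon (isQMat_cell h h') i (T.isTwDer_rE _)
    (fun r s => by
      simp only [T.rE, T.eT, cell, lo_embI, hi_embI, emb_inj, LinearMap.comp_apply,
        AlgHom.toLinearMap_apply, T.transp_t, LinearMap.smul_apply, T.kOp_t, map_smul, T.fOp_t,
        lo_embI, emb_inj]
      split_ifs with hs
      · subst hs
        rw [T.transp_t, smul_smul, wtE, lo_embI, hi_embI]
        simp [emb_inj, (lo_lt_hi i).ne, q_ne_zero]
      · simp)
    (fun r s => by simp [T.rK, cell, wtE, lo_embI, hi_embI, emb_inj]) a

lemma rKinv_mon (i : Fin (N - 1)) (a : Fin M → Fin N → ℕ) :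
    T.rKinv (embI h' i) (mon (cell h h') a) =
      q ^ (∑ k, ((a k (hi i) : ℤ) - a k (lo i))) • mon (cell h h') a := by
  rw [map_mon (s := fun _ r => -wtE r i)
    (fun r s => by simp [T.rKinv, cell, wtE, lo_embI, hi_embI, emb_inj])]
  congr 2
  refine Finset.sum_congr rfl fun k _ => ?_
  rw [sum_two (lo_lt_hi i).ne (fun r h1 h2 => by simp [wtE_ne h1 h2]), wtE_lo, wtE_hi]
  ring

lemma rF_term {A : Matrix (Fin M) (Fin N) ℕ} (hA : IsSymm A) {c c' : Fin N} (hc : c ≠ c')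
    (hz : ∀ r : Fin M, IsZero r → IsPos c ∧ ¬ IsPos c'.rev) {r : Fin M} (hr : ¬ IsPos r.rev) :
    (q ^ (∑ k ∈ Finset.Ioi r, ((tExp A k c : ℤ) - tExp A k c')) * qInt (tExp A r c)) •
        TQuot.mk (mon (cell h h') (mshift (tExp A) r c r c')) =
      (q ^ (∑ k ∈ Finset.Ioi r, ((A k c : ℤ) - A k c')) * qInt (A r c)) •
        tau h h' (A + Eθ r c' - Eθ r c) := by
  rw [Finset.sum_sub_distrib, Finset.sum_sub_distrib, ← sum_Ioi_tExp hr, ← sum_Ioi_tExp hr]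
  rcases isPos_or r with h1 | h1 | h1
  · rw [tExp_of_isPos h1, tau_move h h' hA (Or.inl h1) (Or.inl h1) (fun e => hc e.2)]
  · obtain ⟨h2, h3⟩ := hz r h1
    rw [tExp_zero_pos h1 h2, tau_move h h' hA (Or.inr ⟨h1, not_isPos_rev h2⟩) (Or.inr ⟨h1, h3⟩)
      (fun e => hc e.2)]
  · exact absurd h1 hr

/-- Right operators move units inside a row, so the standard positive rows are never left. `F_i`
yields the terms of rows `j ≥ 0`; `E_{-i}` acting in row `r > 0` on the columns `-hi`, `-lo` yields
the term of row `-r`, by symmetry of `A`. The hypothesis `hz` says that, if a zero row exists, both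
columns `lo`, `hi` are nonnegative, so that row also stays standard. -/
lemma mk_right_pos (hM : M % 2 = N % 2) {A : Matrix (Fin M) (Fin N) ℕ} (hA : IsSymm A)
    (hP : N % 2 = P % 2) {i : Fin (N - 1)} (h1 : (hi i).rev ≠ hi i) (h2 : (hi i).rev ≠ lo i)
    (hz : ∀ r : Fin M, IsZero r → IsPos (hi i)) :
    TQuot.mk (T.rF (embI h' i) (mon (cell h h') (tExp A)) +
      T.rKinv (embI h' i) (T.rE (embI h' i).rev (mon (cell h h') (tExp A)))) =
      ∑ j, (q ^ (∑ k ∈ Finset.Ioi j, ((A k (hi i) : ℤ) - A k (lo i))) * qInt (A j (hi i))) •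
        tau h h' (A + Eθ j (lo i) - Eθ j (hi i)) := by
  have hlh := (lo_lt_hi i).ne
  have h2' : (lo i).rev ≠ hi i := fun e => h2 (by rw [← e, Fin.rev_rev])
  rw [← embI_rev h' hP, rF_mon, rE_mon, map_add, map_sum, map_sum, map_sum]
  simp only [map_smul, rKinv_mon, lo_rev, hi_rev]
  rw [← Equiv.sum_comp Fin.revPerm (fun r => (_ * qInt (tExp A r (hi i).rev)) • _),
    ← Finset.sum_add_distrib]
  refine Finset.sum_congr rfl fun j _ => ?_
  rw [Fin.revPerm_apply]
  by_cases hj : IsPos j.rev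
  · obtain ⟨r, rfl⟩ : ∃ r, j = Fin.rev r := ⟨j.rev, by rw [Fin.rev_rev]⟩
    rw [tExp_of_neg hj, qInt_zero, mul_zero, zero_smul, zero_add]
    rw [Fin.rev_rev] at hj ⊢
    rw [Finset.sum_sub_distrib (f := fun k => (A k (hi i) : ℤ)), sum_Ioi_rev_tExp hM hA hj,
      sum_Ioi_rev_tExp hM hA hj, if_neg h1,
      tau_move h h' hA (Or.inl hj) (Or.inl hj) (fun e => hlh (Fin.rev_inj.mp e.2).symm), smul_smul,
      tExp_of_isPos hj, A_rev_left hA, mul_right_comm, ← zpow_add₀ q_ne_zero]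
    have e1 := Eθ_rev r (lo i).rev
    have e2 := Eθ_rev r (hi i).rev
    rw [Fin.rev_rev] at e1 e2
    rw [e1, e2]
    congr 3
    -- If `lo i` is the zero column, it coincides with `-lo i` and receives the moved unit. This is
    -- the summand `1` for the zero column in `sum_Ioi_rev_tExp`.
    have e3 : ∀ k, ((mshift (tExp A) r (hi i).rev r (lo i).rev k (hi i) : ℤ) -
        mshift (tExp A) r (hi i).rev r (lo i).rev k (lo i)) =
        tExp A k (hi i) - tExp A k (lo i) - if k = r then (if IsZero (lo i) then 1 else 0) else 0 := by
      intro k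
      have h3 : (lo i = (lo i).rev) ↔ IsZero (lo i) := eq_comm
      have e4 : mshift (tExp A) r (hi i).rev r (lo i).rev k (hi i) = tExp A k (hi i) := by
        simp [mshift, h1.symm, h2'.symm]
      have e5 : mshift (tExp A) r (hi i).rev r (lo i).rev k (lo i) =
          tExp A k (lo i) + if k = r then (if IsZero (lo i) then 1 else 0) else 0 := by
        by_cases hk : k = r
        · simp only [mshift, h2.symm, hk, and_false, true_and, if_true, if_false, h3, Nat.sub_zero]
        · simp [mshift, hk]
      rw [e4, e5]
      push_cast
      ring
    simp only [e3, Finset.sum_sub_distrib]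
    simp only [Finset.sum_ite_eq', Finset.mem_univ, if_true]
    ring
  · have h0 : tExp A j.rev (hi i).rev = 0 := by
      rcases isPos_or j with hj' | hj' | hj'
      · exact tExp_of_neg (by rwa [Fin.rev_rev]) _
      · have := hz j hj'
        exact tExp_zero_neg ((isZero_rev_iff j).mpr hj') (by rwa [Fin.rev_rev])
      · exact absurd hj' hj
    rw [h0, qInt_zero, mul_zero, zero_smul, add_zero]
    refine rF_term h h' hA hlh.symm (fun r hr => ?_) hj
    refine ⟨hz r hr, fun e => ?_⟩
    have h3 := hz r hr
    simp only [IsPos, lo, hi, Fin.lt_def, Fin.val_rev, ne_eq, Fin.ext_iff] at *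
    omega

/-- The columns `lo i` and `hi i` are opposite, so `F_0` gives the terms of positive rows and `E_0`
those of negative rows, while `K_0⁻¹` gives the multiple of `t^{(A)}` directly. In contrast to the
left action, nothing has to be straightened. -/
lemma mk_right_zero (hM : M % 2 = N % 2) (hMe : Even M) {A : Matrix (Fin M) (Fin N) ℕ}
    (hA : IsSymm A) {i : Fin (N - 1)} (hi0 : IsZero i) :
    TQuot.mk (T.rF (embI h' i) (mon (cell h h') (tExp A)) +
      q⁻¹ • T.rKinv (embI h' i) (T.rE (embI h' i) (mon (cell h h') (tExp A))) +
        T.rKinv (embI h' i) (mon (cell h h') (tExp A))) =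
      ∑ j, (q ^ (∑ k ∈ Finset.Ioi j, ((A k (hi i) : ℤ) - A k (lo i)) +
        if j < j.rev then 1 else 0) * qInt (A j (hi i))) •
        tau h h' (A + Eθ j (lo i) - Eθ j (hi i)) +
      q ^ (∑ j with IsPos j, ((A j (hi i) : ℤ) - A j (lo i))) • tau h h' A := by
  have hlh := (lo_lt_hi i).ne
  have hq := q_ne_zero
  have hnz : ∀ r : Fin M, ¬ IsZero r := fun r hr => by
    obtain ⟨p, rfl⟩ := hMe
    have := congrArg Fin.val hr
    simp only [Fin.val_rev] at this
    omega
  have hlr : (lo i).rev = hi i := by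
    rw [← hi_rev, show i.rev = i from hi0]
  have hhr : (hi i).rev = lo i := by rw [← hlr, Fin.rev_rev]
  have hzl : ¬ IsZero (lo i) := fun e => hlh (by rw [← hlr]; exact e.symm)
  have hzh : ¬ IsZero (hi i) := fun e => hlh (by rw [← hhr]; exact e)
  rw [rF_mon, rE_mon, map_add, map_add, map_sum, map_smul, map_sum, map_sum]
  simp only [map_smul, rKinv_mon]
  rw [Finset.smul_sum, ← Equiv.sum_comp Fin.revPerm (fun r => q⁻¹ • (_ * qInt (tExp A r (lo i))) • _),
    ← Finset.sum_add_distrib]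
  congr 1
  · refine Finset.sum_congr rfl fun j _ => ?_
    rw [Fin.revPerm_apply]
    by_cases hj : IsPos j.rev
    · obtain ⟨r, rfl⟩ : ∃ r, j = Fin.rev r := ⟨j.rev, by rw [Fin.rev_rev]⟩
      rw [tExp_of_neg hj, qInt_zero, mul_zero, zero_smul, zero_add]
      rw [Fin.rev_rev] at hj ⊢
      rw [if_pos hj]
      rw [Finset.sum_sub_distrib (f := fun k => (A k (hi i) : ℤ)), sum_Ioi_rev_tExp hM hA hj,
        sum_Ioi_rev_tExp hM hA hj, if_neg hzl, if_neg hzh, hlr, hhr,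
        tau_move h h' hA (Or.inl hj) (Or.inl hj) (fun e => hlh e.2), smul_smul,
        A_rev_left hA, hhr, smul_smul]
      have e1 := Eθ_rev r (hi i)
      have e2 := Eθ_rev r (lo i)
      rw [hhr] at e1
      rw [hlr] at e2
      rw [e1, e2, tExp_of_isPos hj]
      rcases eq_or_ne (A r (lo i)) 0 with h0 | h0
      · simp [h0, qInt_zero]
      congr 1
      -- `K_0⁻¹` is applied after the move from column `lo i` to column `hi i`, so the exponent
      -- grows by two. With the prefactor `q⁻¹` this leaves the extra `q` of the negative rows.
      have e3 : ∑ k, ((mshift (tExp A) r (lo i) r (hi i) k (hi i) : ℤ) -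
          mshift (tExp A) r (lo i) r (hi i) k (lo i)) =
          ∑ k, (tExp A k (hi i) : ℤ) - ∑ k, (tExp A k (lo i) : ℤ) + 2 := by
        have e4 : ∀ k, ((mshift (tExp A) r (lo i) r (hi i) k (hi i) : ℤ) -
          mshift (tExp A) r (lo i) r (hi i) k (lo i)) =
          tExp A k (hi i) - tExp A k (lo i) + if k = r then 2 else 0 := by
          intro k
          by_cases hk : k = r
          · subst hk
            rw [← tExp_of_isPos (A := A) hj] at h0
            simp only [mshift, hlh, hlh.symm, and_false, true_and, if_true, if_false, Nat.sub_zero]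
            push_cast [Nat.one_le_iff_ne_zero.mpr h0]
            ring
          · simp [mshift, hk]
        simp only [e4, Finset.sum_add_distrib, Finset.sum_sub_distrib, Finset.sum_ite_eq',
          Finset.mem_univ, if_true]
      rw [e3, ← zpow_neg_one, ← mul_assoc, mul_right_comm, ← zpow_add₀ hq, ← zpow_add₀ hq,
        Finset.sum_sub_distrib]
      congr 2
      ring
    · have hj' : IsPos j := by
        rcases isPos_or j with h1 | h1 | h1
        · exact h1
        · exact absurd h1 (hnz j)
        · exact absurd h1 hj
      have h0 : tExp A j.rev (lo i) = 0 := tExp_of_neg (by rwa [Fin.rev_rev]) _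
      rw [h0, qInt_zero, mul_zero, zero_smul, smul_zero, add_zero, if_neg (not_lt.mpr hj'.le), add_zero]
      exact rF_term h h' hA hlh.symm (fun r hr => absurd hr (hnz r)) hj
  · congr 2
    rw [Finset.sum_filter]
    refine Finset.sum_congr rfl fun k _ => ?_
    rcases isPos_or k with h1 | h1 | h1
    · rw [if_pos h1, tExp_of_isPos h1, tExp_of_isPos h1]
    · exact absurd h1 (hnz k)
    · rw [if_neg (isPos_of_rev h1).1, tExp_of_neg h1, tExp_of_neg h1]; simp

end Cells

/-! ### The right action of `B_{-i}`, `i > 0`, in type ȷ. -/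

section Cells
variable {M N P : ℕ} (h : M ≤ P) (h' : N ≤ P)

lemma sum_Iio_tExp {A : Matrix (Fin M) (Fin N) ℕ} (hA : IsSymm A) {r : Fin M} (hr : ¬ IsPos r.rev)
    (c : Fin N) :
    ∑ k ∈ Finset.Iio r.rev, (A k c : ℤ) = ∑ k ∈ Finset.Ioi r, (tExp A k c.rev : ℤ) := by
  rw [← sum_Ioi_tExp hr, sum_Ioi_rev]
  simp only [A_rev_left hA, Fin.rev_rev]

lemma sum_Iio_tExp_of_isPos (hMN : M % 2 = N % 2) {A : Matrix (Fin M) (Fin N) ℕ} (hA : IsSymm A)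
    {r : Fin M} (hr : IsPos r) (c : Fin N) :
    ∑ k ∈ Finset.Iio r, (A k c : ℤ) = ∑ k ∈ Finset.Iio r, (tExp A k c : ℤ) +
      ∑ k, (tExp A k c.rev : ℤ) + if IsZero c then 1 else 0 := by
  have h2 := sum_Ioi_rev_tExp hMN hA hr c.rev
  rw [sum_Ioi_rev, Fin.rev_rev] at h2
  simp only [A_rev_left hA, Fin.rev_rev, isZero_rev_iff] at h2
  exact h2

lemma sum_tExp_of_zero {A : Matrix (Fin M) (Fin N) ℕ} {z : Fin M} (hz : IsZero z) (c : Fin N) :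
    ∑ k, (tExp A k c : ℤ) = ∑ k ∈ Finset.Ioi z, (tExp A k c : ℤ) + tExp A z c := by
  rw [sum_Ioi_add_Iic, sum_Iic_eq_Iio, Finset.sum_eq_zero (s := Finset.Iio z)]
  · ring
  · intro k hk
    rw [tExp_of_neg (neg_of_lt_zero hz (Finset.mem_Iio.mp hk))]
    rfl

lemma rF_rev_term {A : Matrix (Fin M) (Fin N) ℕ} (hA : IsSymm A) {c c' : Fin N} (hc : c ≠ c')
    {r : Fin M} (hr : IsPos r) :
    (q ^ (∑ k ∈ Finset.Ioi r, ((tExp A k c.rev : ℤ) - tExp A k c'.rev)) *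
      qInt (tExp A r c.rev)) •
        TQuot.mk (mon (cell h h') (mshift (tExp A) r c.rev r c'.rev)) =
      (q ^ (∑ k ∈ Finset.Iio r.rev, ((A k c : ℤ) - A k c')) * qInt (A r.rev c)) •
        tau h h' (A + Eθ r.rev c' - Eθ r.rev c) := by
  have e1 := Eθ_rev r c.rev
  have e2 := Eθ_rev r c'.rev
  rw [Fin.rev_rev] at e1 e2
  rw [Finset.sum_sub_distrib, Finset.sum_sub_distrib, sum_Iio_tExp hA (not_isPos_rev hr),
    sum_Iio_tExp hA (not_isPos_rev hr), A_rev_left hA, tExp_of_isPos hr, e1, e2,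
    tau_move h h' hA (Or.inl hr) (Or.inl hr) (fun e => hc (Fin.rev_inj.mp e.2))]

lemma rE_term (hM : M % 2 = N % 2) {A : Matrix (Fin M) (Fin N) ℕ} (hA : IsSymm A) {c c' : Fin N}
    (hc : c ≠ c') (hz' : ¬ IsZero c') {r : Fin M} (hr : IsPos r) :
    (q ^ (∑ k, ((tExp A k c.rev : ℤ) - tExp A k c'.rev)) *
      (q ^ (∑ k ∈ Finset.Iio r, ((tExp A k c : ℤ) - tExp A k c')) * qInt (tExp A r c))) •
        TQuot.mk (mon (cell h h') (mshift (tExp A) r c r c')) =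
      (q ^ (∑ k ∈ Finset.Iio r, ((A k c : ℤ) - A k c') - if IsZero c then 1 else 0) *
        qInt (A r c)) • tau h h' (A + Eθ r c' - Eθ r c) := by
  rw [tau_move h h' hA (Or.inl hr) (Or.inl hr) (fun e => hc e.2), tExp_of_isPos hr,
    Finset.sum_sub_distrib, Finset.sum_sub_distrib, Finset.sum_sub_distrib,
    sum_Iio_tExp_of_isPos hM hA hr, sum_Iio_tExp_of_isPos hM hA hr, if_neg hz', ← mul_assoc,
    ← zpow_add₀ q_ne_zero]
  congr 3
  ring

/-- The operator of `F_{-i}`, read through the symmetry of `A`, gives the rows `j < 0`; that of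
`E_i` after `K_{-i}⁻¹` gives the rows `j ≥ 0`, where in the zero row only positive columns are
touched. -/
lemma mk_right_neg_far (hM : M % 2 = N % 2) (hP : N % 2 = P % 2) {A : Matrix (Fin M) (Fin N) ℕ}
    (hA : IsSymm A) {i : Fin (N - 1)} (hlo : IsPos (lo i)) :
    TQuot.mk (T.rF (embI h' i).rev (mon (cell h h') (tExp A)) +
      T.rE (embI h' i) (T.rKinv (embI h' i).rev (mon (cell h h') (tExp A)))) =
      ∑ j, (q ^ (∑ k ∈ Finset.Iio j, ((A k (lo i) : ℤ) - A k (hi i))) * qInt (A j (lo i))) •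
        tau h h' (A + Eθ j (hi i) - Eθ j (lo i)) := by
  have hlh := (lo_lt_hi i).ne
  have hp : IsPos (hi i) := by simp only [IsPos, lo, hi, Fin.lt_def, Fin.val_rev] at *; omega
  rw [← embI_rev h' hP, rF_mon, rKinv_mon, map_smul, rE_mon, map_add, map_sum, map_smul, map_sum,
    Finset.smul_sum]
  simp only [map_smul, lo_rev, hi_rev, smul_smul]
  rw [← Equiv.sum_comp Fin.revPerm (fun r => (_ * qInt (tExp A r (lo i).rev)) • _),
    ← Finset.sum_add_distrib]
  refine Finset.sum_congr rfl fun j _ => ?_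
  rw [Fin.revPerm_apply]
  rcases isPos_or j with hj | hj | hj
  · rw [tExp_of_neg (r := j.rev) (by rwa [Fin.rev_rev]), qInt_zero, mul_zero, zero_smul, zero_add,
      rE_term h h' hM hA hlh (not_isZero_of_isPos hp) hj, if_neg (not_isZero_of_isPos hlo), sub_zero]
  · have hjj : j.rev = j := hj
    have e1 : tExp A j (lo i).rev = 0 := tExp_zero_neg hj (by rwa [Fin.rev_rev])
    have e2 : tExp A j (hi i).rev = 0 := tExp_zero_neg hj (by rwa [Fin.rev_rev])
    have hj3 : ¬ IsPos j.rev := fun e => (isPos_of_rev e).2 hj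
    have e3 := sum_Iio_tExp hA hj3 (lo i)
    have e4 := sum_Iio_tExp hA hj3 (hi i)
    have e5 : ∀ c, ∑ k ∈ Finset.Iio j, (tExp A k c : ℤ) = 0 := fun c =>
      Finset.sum_eq_zero fun k hk => by
        rw [tExp_of_neg (neg_of_lt_zero hj (Finset.mem_Iio.mp hk))]; rfl
    rw [hjj] at e3 e4
    rw [hjj, e1, qInt_zero, mul_zero, zero_smul, zero_add, tExp_zero_pos hj hlo,
      tau_move h h' hA (Or.inr ⟨hj, not_isPos_rev hlo⟩) (Or.inr ⟨hj, not_isPos_rev hp⟩)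
        (fun e => hlh e.2), Finset.sum_sub_distrib, Finset.sum_sub_distrib, Finset.sum_sub_distrib,
      e3, e4, e5, e5, sum_tExp_of_zero hj, sum_tExp_of_zero hj, e1, e2, ← mul_assoc,
      ← zpow_add₀ q_ne_zero]
    congr 3
    simp
  · obtain ⟨r, rfl⟩ : ∃ r, j = Fin.rev r := ⟨j.rev, by rw [Fin.rev_rev]⟩
    rw [tExp_of_neg hj, qInt_zero, mul_zero, mul_zero, zero_smul, add_zero]
    rw [Fin.rev_rev] at hj ⊢
    exact rF_rev_term h h' hA hlh hj

/-- Here `lo i` is the zero column and the exceptional row is the zero row. `F_{-i}` moves a unit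
from the cell `(0,0)` to a negative column, which straightens to the same monomial that `E_i`
produces; the two coefficients merge by `qInt_double`. -/
lemma mk_right_neg_near (hM : M % 2 = N % 2) (hP : N % 2 = P % 2) {A : Matrix (Fin M) (Fin N) ℕ}
    (hA : IsSymm A) {i : Fin (N - 1)} (hz : IsZero (lo i)) :
    TQuot.mk (T.rF (embI h' i).rev (mon (cell h h') (tExp A)) +
      T.rE (embI h' i) (T.rKinv (embI h' i).rev (mon (cell h h') (tExp A)))) =
      ∑ j with ¬ IsPos j ∧ A j (lo i) > (if IsZero j then 1 else 0),
        (q ^ (∑ k ∈ Finset.Iio j, ((A k (lo i) : ℤ) - A k (hi i))) *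
          qInt (A j (lo i) - if IsZero j then 1 else 0)) • tau h h' (A + Eθ j (hi i) - Eθ j (lo i)) +
      ∑ j with IsPos j,
        (q ^ (∑ k ∈ Finset.Iio j, ((A k (lo i) : ℤ) - A k (hi i)) - 1) * qInt (A j (lo i))) •
          tau h h' (A + Eθ j (hi i) - Eθ j (lo i)) := by
  have hlh := (lo_lt_hi i)
  have hq := q_ne_zero
  have hp : IsPos (hi i) := by
    have := congrArg Fin.val hz
    simp only [IsPos, lo, hi, Fin.lt_def, Fin.val_rev] at *; omega
  have hzz : (lo i).rev = lo i := hz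
  rw [← embI_rev h' hP, rF_mon, rKinv_mon, map_smul, rE_mon, map_add, map_sum, map_smul, map_sum,
    Finset.smul_sum]
  simp only [map_smul, lo_rev, hi_rev, smul_smul]
  rw [← Equiv.sum_comp Fin.revPerm (fun r => (_ * qInt (tExp A r (lo i).rev)) • _),
    ← Finset.sum_add_distrib, Finset.sum_filter, Finset.sum_filter, ← Finset.sum_add_distrib]
  refine Finset.sum_congr rfl fun j _ => ?_
  rw [Fin.revPerm_apply]
  rcases isPos_or j with hj | hj | hj
  · rw [tExp_of_neg (r := j.rev) (by rwa [Fin.rev_rev]), qInt_zero, mul_zero, zero_smul, zero_add,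
      rE_term h h' hM hA hlh.ne (not_isZero_of_isPos hp) hj, if_pos hz,
      if_neg (fun e => e.1 hj), if_pos hj, zero_add]
  · have hjj : j.rev = j := hj
    have hj2 : ¬ IsPos j := fun e => not_isZero_of_isPos e hj
    have hj3 : ¬ IsPos j.rev := fun e => (isPos_of_rev e).2 hj
    have e2 : tExp A j (hi i).rev = 0 := tExp_zero_neg hj (by rwa [Fin.rev_rev])
    have e3 := sum_Iio_tExp hA hj3 (lo i)
    have e4 := sum_Iio_tExp hA hj3 (hi i)
    have e5 : ∀ c, ∑ k ∈ Finset.Iio j, (tExp A k c : ℤ) = 0 := fun c =>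
      Finset.sum_eq_zero fun k hk => by
        rw [tExp_of_neg (neg_of_lt_zero hj (Finset.mem_Iio.mp hk))]; rfl
    have ho := hA.odd _ _ hj hz
    rw [hjj] at e3 e4
    rw [if_neg hj2, add_zero]
    simp only [if_pos hj, hjj, hzz]
    rcases eq_or_ne (tExp A j (lo i)) 0 with h0 | h0
    · rw [if_neg (by omega), h0, qInt_zero, mul_zero, zero_smul, zero_add, mul_zero, mul_zero,
        zero_smul]
    · have hneg : ∀ r s, r < j → mdecr (tExp A) j (lo i) r s = 0 := fun r s hr =>
        mdecr_eq_zero (tExp_of_neg (neg_of_lt_zero hj hr) s) _ _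
      have hneg2 : ∀ s, s < lo i → IsPos s.rev := fun s hs => neg_of_lt_zero hz hs
      have hlt : (hi i).rev < lo i := by
        have := congrArg Fin.val hz
        simp only [IsPos, lo, hi, Fin.lt_def, Fin.val_rev] at *; omega
      have hrow : ∀ s, s < lo i → mdecr (tExp A) j (lo i) j s = 0 := fun s hs =>
        mdecr_eq_zero (tExp_zero_neg hj (hneg2 s hs)) _ _
      have hsum : ∑ s ∈ Finset.Iio (hi i), (mdecr (tExp A) j (lo i) j s : ℤ) =
          tExp A j (lo i) - 1 := by
        rw [Finset.sum_eq_single (lo i)]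
        · rw [mdecr_cast h0, if_pos ⟨rfl, rfl⟩]
        · intro s hs hne
          rw [hrow s (lt_of_le_of_ne (lt_hi_iff.mp (Finset.mem_Iio.mp hs)) hne)]
          rfl
        · intro hn
          exact absurd (Finset.mem_Iio.mpr hlh) hn
      -- The cell `(0, -hi)` comes first. Replacing it by `(0, hi)` costs `q⁻¹`, and passing the
      -- remaining factors `t_{00}` costs `q⁻¹` each, so the total is `q` to minus the original
      -- exponent of `t_{00}`.
      have hconv : TQuot.mk (mon (cell h h') (mshift (tExp A) j (lo i) j (hi i).rev)) =
          q ^ (-(tExp A j (lo i) : ℤ)) • tau h h' (A + Eθ j (hi i) - Eθ j (lo i)) := by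
        rw [mshift_eq, ← cell_mul_mon_low h h' hneg (fun s hs => hrow s (hs.trans hlt)),
          mk_cell_row h h' (hM.trans hP) hP hj hp,
          cell_mul_mon_row h h' (hi i) (fun r s hr h1 => absurd (hneg r s hr) h1), map_smul,
          ← mshift_eq, tau_move h h' hA (Or.inr ⟨hj, by rw [hzz]; exact fun e => not_isZero_of_isPos e hz⟩)
            (Or.inr ⟨hj, not_isPos_rev hp⟩) (fun e => hlh.ne e.2), hsum, smul_smul, ← zpow_neg_one,
          ← zpow_add₀ hq]
        congr 2
        ring
      rw [hconv, if_pos ⟨hj2, by omega⟩, show A j (lo i) - 1 = 2 * tExp A j (lo i) by omega,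
        qInt_double, tau_move h h' hA
          (Or.inr ⟨hj, by rw [hzz]; exact fun e => not_isZero_of_isPos e hz⟩)
          (Or.inr ⟨hj, not_isPos_rev hp⟩) (fun e => hlh.ne e.2), smul_smul, ← add_smul]
      simp only [Finset.sum_sub_distrib]
      rw [e3, e4, e5, e5, sum_tExp_of_zero hj, sum_tExp_of_zero hj, e2, mul_right_comm,
        ← zpow_add₀ hq, ← mul_assoc, ← zpow_add₀ hq, add_comm, hzz]
      congr 3
      · congr 1
        push_cast
        ring
  · obtain ⟨r, rfl⟩ : ∃ r, j = Fin.rev r := ⟨j.rev, by rw [Fin.rev_rev]⟩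
    have hj0 := (isPos_of_rev hj)
    rw [tExp_of_neg hj, qInt_zero, mul_zero, mul_zero, zero_smul, add_zero, if_neg hj0.1, add_zero]
    rw [Fin.rev_rev] at hj
    simp only [if_neg hj0.2, Nat.sub_zero, Fin.rev_rev r]
    rw [rF_rev_term h h' hA hlh.ne hj]
    split_ifs with hc
    · rfl
    · have : A r.rev (lo i) = 0 := by
        by_contra hne
        exact hc ⟨hj0.1, Nat.pos_of_ne_zero hne⟩
      rw [this, qInt_zero, mul_zero, zero_smul]

end Cells

/-! ### Row and column sums, the degree, and membership in `Ξ`. -/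

section Sums
variable {M N : ℕ} {A : Matrix (Fin M) (Fin N) ℕ}

lemma not_isZero_of_even {n : ℕ} (hn : n % 2 = 0) (c : Fin n) : ¬ IsZero c := fun h => by
  have := congrArg Fin.val h
  simp only [Fin.val_rev] at this
  omega

lemma exists_isZero {n : ℕ} (hn : n % 2 = 1) : ∃ z : Fin n, IsZero z :=
  ⟨⟨n / 2, by omega⟩, by ext; simp only [Fin.val_rev]; omega⟩

/-- Entries of a column in negative rows are entries of the opposite column in positive rows, so
both columns of exponents enter; the final `1` is the odd part of `a_{00}`. -/
lemma col_sum_tExp (hMN : M % 2 = N % 2) (hA : IsSymm A) (c : Fin N) :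
    ∑ k, A k c = ∑ k, tExp A k c + ∑ k, tExp A k c.rev + if IsZero c then 1 else 0 := by
  rw [← Finset.sum_add_distrib, sum_split, sum_split (fun k => _ + _), add_assoc]
  congr 1
  · refine Finset.sum_congr rfl fun k _ => ?_
    by_cases hk : IsPos k
    · have hk' : IsPos k.rev.rev := by rwa [Fin.rev_rev]
      rw [if_pos hk, if_pos hk, tExp_of_isPos hk, tExp_of_isPos hk,
        tExp_of_neg hk', tExp_of_neg hk', A_rev_left hA]
      ring
    · rw [if_neg hk, if_neg hk]
  · rcases Nat.mod_two_eq_zero_or_one M with hM | hM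
    · have hM' : Even M := Nat.even_iff.mpr hM
      rw [sum_isZero_of_even _ hM', sum_isZero_of_even _ hM', if_neg (not_isZero_of_even (hMN ▸ hM) c), add_zero]
    · obtain ⟨z, hz⟩ := exists_isZero hM
      rw [sum_isZero _ hz, sum_isZero _ hz]
      rcases isPos_or c with h | h | h
      · have h' : IsPos c.rev.rev := by rwa [Fin.rev_rev]
        rw [tExp_zero_pos hz h, tExp_zero_neg hz h', if_neg (not_isZero_of_isPos h)]
        simp
      · rw [if_pos h, show c.rev = c from h, hA.odd z c hz h]
        ring
      · rw [tExp_zero_pos hz h, tExp_zero_neg hz h, if_neg (isPos_of_rev h).2, ← A_rev_left hA,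
          show z.rev = z from hz]
        simp

lemma row_sum_tExp (hMN : M % 2 = N % 2) (hA : IsSymm A) (r : Fin M) :
    ∑ k, A r k = ∑ k, tExp A r k + ∑ k, tExp A r.rev k + if IsZero r then 1 else 0 := by
  rcases isPos_or r with hr | hr | hr
  · simp only [tExp_of_isPos hr, tExp_of_neg (A := A) (r := r.rev) (by rwa [Fin.rev_rev]),
      if_neg (not_isZero_of_isPos hr), Finset.sum_const_zero, add_zero]
  · have hM : M % 2 = 1 := by
      rcases Nat.mod_two_eq_zero_or_one M with hM | hM
      · exact absurd hr (not_isZero_of_even hM r)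
      · exact hM
    obtain ⟨z, hz⟩ := exists_isZero (hMN ▸ hM)
    rw [if_pos hr, show r.rev = r from hr, ← Finset.sum_add_distrib, sum_split,
      sum_split (fun k => _ + _), add_assoc, sum_isZero _ hz, sum_isZero _ hz]
    congr 1
    · refine Finset.sum_congr rfl fun k _ => ?_
      by_cases hk : IsPos k
      · have hk' : IsPos k.rev.rev := by rwa [Fin.rev_rev]
        rw [if_pos hk, if_pos hk, tExp_zero_pos hr hk, tExp_zero_neg hr hk', ← A_rev_left hA,
          show r.rev = r from hr]
        ring
      · rw [if_neg hk, if_neg hk]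
    · rw [hA.odd r z hr hz]
      ring
  · simp only [tExp_of_isPos hr, tExp_of_neg (A := A) hr, if_neg (isPos_of_rev hr).2,
      Finset.sum_const_zero, add_zero, zero_add, A_rev_left hA]
    exact (Equiv.sum_comp Fin.revPerm _).symm

lemma dExp_col (hMN : M % 2 = N % 2) (hA : IsSymm A) (c : Fin N) :
    dExp c (∑ k, A k c) = ∑ k, tExp A k c + if IsZero c then 0 else ∑ k, tExp A k c.rev := by
  rw [col_sum_tExp hMN hA, dExp]
  split_ifs with h
  · have hcc : c.rev = c := h
    rw [hcc]
    omega
  · omega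

lemma dExp_row (hMN : M % 2 = N % 2) (hA : IsSymm A) (r : Fin M) :
    dExp r (∑ k, A r k) = ∑ k, tExp A r k + if IsZero r then 0 else ∑ k, tExp A r.rev k := by
  rw [row_sum_tExp hMN hA, dExp]
  split_ifs with h
  · have hcc : r.rev = r := h
    rw [hcc]
    omega
  · omega

/-- The degree of `t^{(A)}`. -/
lemma sum_tExp (hMN : M % 2 = N % 2) (hA : IsSymm A) {d : ℕ}
    (hd : ∑ i, ∑ j, A i j = 2 * d + M % 2) : ∑ i, ∑ j, tExp A i j = d := by
  simp only [row_sum_tExp hMN hA, Finset.sum_add_distrib] at hd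
  have e := Equiv.sum_comp Fin.revPerm (fun i => ∑ k, tExp A i k)
  simp only [Fin.revPerm_apply] at e
  rw [e] at hd
  have : ∑ i : Fin M, (if IsZero i then 1 else 0) = M % 2 := by
    rcases Nat.mod_two_eq_zero_or_one M with hM | hM
    · rw [hM, Finset.sum_eq_zero fun i _ => if_neg (not_isZero_of_even hM i)]
    · obtain ⟨z, hz⟩ := exists_isZero hM
      rw [hM, sum_isZero (fun _ => 1) hz]
  omega

/-- All entries other than `a_{00}` occur in equal pairs, so when the total is odd `a_{00}` is odd.
The parity is passed first through the row sums, then through the entries of the zero row. -/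
lemma isSymm_of_mem_Xi (hMN : M % 2 = N % 2) {d : ℕ} (hA : A ∈ Xi M N (2 * d + M % 2)) :
    IsSymm A where
  rev i j := (hA.1 i j).symm
  odd i j hi hj := by
    have hM : M % 2 = 1 := by
      rcases Nat.mod_two_eq_zero_or_one M with hM | hM
      · exact absurd hi (not_isZero_of_even hM i)
      · exact hM
    have key : ∀ {n : ℕ} (f : Fin n → ℕ) (z : Fin n), IsZero z → (∀ k, f k.rev = f k) →
        ∃ e, ∑ k, f k = 2 * e + f z := by
      intro n f z hz hf
      rw [sum_split, sum_isZero f hz]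
      refine ⟨∑ k, if IsPos k then f k else 0, ?_⟩
      rw [Finset.mul_sum]
      congr 1
      refine Finset.sum_congr rfl fun k _ => ?_
      split_ifs
      · rw [hf]; ring
      · rfl
    have h1 : ∀ k, ∑ l, A k.rev l = ∑ l, A k l := fun k => by
      rw [← Equiv.sum_comp Fin.revPerm]
      exact Finset.sum_congr rfl fun l _ => (hA.1 k l).symm
    obtain ⟨e, he⟩ := key (fun k => ∑ l, A k l) i hi h1
    obtain ⟨e', he'⟩ := key (fun l => A i l) j hj fun k => by
      rw [hA.1 i k, show i.rev = i from hi]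
    have h2 := hA.2
    rw [tExp_zero_zero hi hj]
    omega

lemma mem_Xi_move {s : ℕ} (hA : A ∈ Xi M N s) {r r' : Fin M} {c c' : Fin N}
    (h0 : ∀ i j, Eθ r c i j ≤ A i j) : A + Eθ r' c' - Eθ r c ∈ Xi M N s := by
  have hs : ∀ (r : Fin M) (c : Fin N), ∑ i, ∑ j, Eθ r c i j = 2 := by
    intro r c
    simp [Eθ, Matrix.add_apply, Finset.sum_add_distrib, Matrix.single_apply, ite_and]
  refine ⟨fun i j => ?_, ?_⟩
  · have e : ∀ (r : Fin M) (c : Fin N), Eθ r c i.rev j.rev = Eθ r c i j := fun r c => by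
      rw [Eθ_apply, Eθ_apply, Fin.rev_rev, Fin.rev_rev, add_comm]
    rw [Matrix.sub_apply, Matrix.sub_apply, Matrix.add_apply, Matrix.add_apply, e, e, ← hA.1]
  · have h1 : ∑ i, ∑ j, (A + Eθ r' c' - Eθ r c) i j + ∑ i, ∑ j, Eθ r c i j =
        ∑ i, ∑ j, A i j + ∑ i, ∑ j, Eθ r' c' i j := by
      simp only [← Finset.sum_add_distrib]
      refine Finset.sum_congr rfl fun i _ => Finset.sum_congr rfl fun j _ => ?_
      have := h0 i j
      rw [Matrix.sub_apply, Matrix.add_apply]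
      omega
    rw [hs, hs, hA.2] at h1
    omega

/-- At the centre `E^θ` has the entry two rather than one, hence the extra hypothesis there. The
inequality makes the truncated subtraction in `A + E^θ - E^θ` exact. -/
lemma Eθ_le (hA : ∀ i j, A i j = A i.rev j.rev) {r : Fin M} {c : Fin N} (h0 : A r c ≠ 0)
    (h1 : IsZero r → IsZero c → 2 ≤ A r c) (i : Fin M) (j : Fin N) : Eθ r c i j ≤ A i j := by
  rw [Eθ_apply]
  by_cases h2 : i = r ∧ j = c
  · obtain ⟨rfl, rfl⟩ := h2
    by_cases h3 : i.rev = i ∧ j.rev = j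
    · have := h1 h3.1 h3.2
      rw [if_pos ⟨rfl, rfl⟩, if_pos h3]; omega
    · rw [if_pos ⟨rfl, rfl⟩, if_neg h3]; omega
  · rw [if_neg h2]
    by_cases h3 : i.rev = r ∧ j.rev = c
    · rw [if_pos h3, hA, h3.1, h3.2]; omega
    · rw [if_neg h3]; omega

end Sums

/-! ### The action of the `d_r`, and monomials as words. -/

section Cells
variable {M N P : ℕ} (h : M ≤ P) (h' : N ≤ P)

lemma sum_dWt {n : ℕ} (r : Fin n) (f : Fin n → ℤ) :
    ∑ s, T.dWt r s * f s = f r + if IsZero r then 0 else f r.rev := by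
  simp only [T.dWt, add_mul, Finset.sum_add_distrib]
  congr 1
  · simp
  · split_ifs with hr <;> simp

lemma dWt_emb (hM : M % 2 = P % 2) (r s : Fin M) : T.dWt (emb h r) (emb h s) = T.dWt r s := by
  simp only [T.dWt, emb_inj, isZero_emb h hM, ← emb_rev h hM]

lemma mk_d_left (hM : M % 2 = P % 2) (hMN : M % 2 = N % 2) {A : Matrix (Fin M) (Fin N) ℕ}
    (hA : IsSymm A) (r : Fin M) :
    TQuot.mk (T.diagOp (T.dWt (emb h r)) (mon (cell h h') (tExp A))) =
      q ^ dExp r (∑ k, A r k) • tau h h' A := by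
  rw [map_mon (s := fun s _ => T.dWt r s) (fun s c => by simp [cell, dWt_emb h hM]), map_smul,
    ← zpow_natCast, dExp_row hMN hA]
  simp only [← Finset.mul_sum, sum_dWt]
  congr 2
  push_cast
  split_ifs <;> simp

lemma mk_d_right (hN : N % 2 = P % 2) (hMN : M % 2 = N % 2) {A : Matrix (Fin M) (Fin N) ℕ}
    (hA : IsSymm A) (c : Fin N) :
    TQuot.mk (T.transp (T.diagOp (T.dWt (emb h' c)) (T.transp (mon (cell h h') (tExp A))))) =
      q ^ dExp c (∑ k, A k c) • tau h h' A := by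
  rw [show T.transp (T.diagOp (T.dWt (emb h' c)) (T.transp (mon (cell h h') (tExp A)))) =
    (T.transp.comp ((T.diagOp (T.dWt (emb h' c))).comp T.transp)) (mon (cell h h') (tExp A)) from rfl,
    map_mon (s := fun _ s => T.dWt c s) (fun s c => by simp [cell, dWt_emb h' hN]), map_smul,
    ← zpow_natCast, dExp_col hMN hA, Finset.sum_comm]
  simp only [← Finset.mul_sum, sum_dWt]
  congr 2
  push_cast
  split_ifs <;> simp

/-- A monomial of degree `d` is a product of `d` generators. -/
lemma exists_word_monomial {R ι : Type*} [Monoid R] (X : ι → R) (l : List ι) (a : ι → ℕ) :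
    ∃ w : List ι, w.length = (l.map a).sum ∧ (w.map X).prod = (l.map fun y => X y ^ a y).prod := by
  refine ⟨l.flatMap fun y => List.replicate (a y) y, ?_, ?_⟩
  · simp [List.length_flatMap]
  · induction l with
    | nil => simp
    | cons y l ih => simp [List.flatMap_cons, ih]

/-- Repeating each cell as often as its exponent writes a monomial of degree `d` as the value of the
pairing on a pure tensor; this is how the classes `t^{(A)}` are lifted to tensor powers. -/
lemma exists_word {a : Fin M → Fin N → ℕ} {d : ℕ} (hd : ∑ i, ∑ j, a i j = d) :
    ∃ lam : Fin d → Fin M, ∃ mu : Fin d → Fin N,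
      mon (cell h h') a = (List.ofFn fun k => t (emb h (lam k)) (emb h' (mu k))).prod := by
  obtain ⟨w, hw, hp⟩ := exists_word_monomial (onCells (cell h h')) (cells M N) (onCells a)
  rw [sum_cells] at hw
  simp only [onCells_toLex, hd] at hw
  subst hw
  refine ⟨fun k => (ofLex (w.get k)).1, fun k => (ofLex (w.get k)).2, ?_⟩
  rw [mon_eq_monL, monL, ← hp]
  congr 1
  apply List.ext_get
  · simp
  · intro k h1 h2
    simp [onCells, cell]

end Cells

/-! ### Representations on a subspace of a quotient -/

section Compat
variable {Y Q : Type*} [AddCommMonoid Y] [Module Kq Y] [AddCommGroup Q] [Module Kq Q]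

/-- The endomorphisms of `Y` that are covered by an endomorphism of `Q` stabilizing `S`. -/
def compat (p : Y →ₗ[Kq] Q) (S : Submodule Kq Q) : Subalgebra Kq (Module.End Kq Y) where
  carrier := {x | ∃ β : Module.End Kq Q, (∀ y, β (p y) = p (x y)) ∧ ∀ v ∈ S, β v ∈ S}
  mul_mem' := by
    rintro x x' ⟨β, h1, h2⟩ ⟨β', h1', h2'⟩
    exact ⟨β * β', fun y => by simp [h1, h1'], fun v hv => h2 _ (h2' _ hv)⟩
  add_mem' := by
    rintro x x' ⟨β, h1, h2⟩ ⟨β', h1', h2'⟩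
    exact ⟨β + β', fun y => by simp [h1, h1'], fun v hv => S.add_mem (h2 _ hv) (h2' _ hv)⟩
  algebraMap_mem' r := ⟨algebraMap Kq _ r, fun y => by simp [Module.algebraMap_end_apply],
    fun v hv => by simpa [Module.algebraMap_end_apply] using S.smul_mem r hv⟩

variable {p : Y →ₗ[Kq] Q} {S : Submodule Kq Q}

/-- An endomorphism of `S` covered by `x`. -/
def compatEnd (x : compat p S) : Module.End Kq S :=
  (x.2.choose).restrict x.2.choose_spec.2

lemma compatEnd_apply (x : compat p S) (y : Y) (hy : p y ∈ S) :
    (compatEnd x ⟨p y, hy⟩ : Q) = p (x.1 y) := x.2.choose_spec.1 y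

/-- The action on `S`. -/
def compatAct (hS : S ≤ LinearMap.range p) : compat p S →ₐ[Kq] Module.End Kq S :=
  -- Since `S` lies in the range of `p`, an endomorphism of `S` is determined by its values on
  -- vectors `p y`. Hence the chosen endomorphisms are forced, and depend multiplicatively and
  -- linearly on `x`.
  have key : ∀ {f g : Module.End Kq S}, (∀ y (hy : p y ∈ S), (f ⟨p y, hy⟩ : Q) = g ⟨p y, hy⟩) →
      f = g := fun {f g} hfg => by
    refine LinearMap.ext fun v => Subtype.ext ?_
    obtain ⟨v, hv⟩ := v
    obtain ⟨y, rfl⟩ := hS hv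
    exact hfg y hv
  AlgHom.ofLinearMap
    { toFun := compatEnd
      map_add' := fun x x' => key fun y hy => by
        simp [compatEnd_apply]
      map_smul' := fun r x => key fun y hy => by
        simp [compatEnd_apply] }
    (key fun y hy => by simp [compatEnd_apply])
    (fun x x' => key fun y hy => by
      have hy' : p (x'.1 y) ∈ S := by
        rw [← compatEnd_apply x' y hy]; exact Subtype.property _
      have e : compatEnd x' ⟨p y, hy⟩ = ⟨p (x'.1 y), hy'⟩ := Subtype.ext (compatEnd_apply x' y hy)
      simp only [LinearMap.coe_mk, AddHom.coe_mk, compatEnd_apply, Module.End.mul_apply, e]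
      rfl)

lemma compatAct_apply (hS : S ≤ LinearMap.range p) (x : compat p S) (y : Y) (hy : p y ∈ S) :
    (compatAct hS x ⟨p y, hy⟩ : Q) = p (x.1 y) := compatEnd_apply x y hy

lemma compatAct_eq (hS : S ≤ LinearMap.range p) (x : compat p S) {β : Module.End Kq Q}
    (hβ : ∀ y, β (p y) = p (x.1 y)) (v : S) : (compatAct hS x v : Q) = β v := by
  obtain ⟨v, hv⟩ := v
  obtain ⟨y, rfl⟩ := hS hv
  rw [compatAct_apply, hβ]

lemma compatAct_comm (hS : S ≤ LinearMap.range p) (x y : compat p S) (h : Commute x.1 y.1) (v : S) :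
    compatAct hS x (compatAct hS y v) = compatAct hS y (compatAct hS x v) := by
  have : x * y = y * x := Subtype.ext h
  rw [← Module.End.mul_apply, ← map_mul, this, map_mul, Module.End.mul_apply]

end Compat

/-! ### The bimodule of tensor powers and its projection to the quotient. -/

section Actions
variable (M N d : ℕ)

/-- The projection of `V^{⊗d} ⊗ W^{⊗d}` to the classes of degree `d`. -/
def proj : (⨂[Kq]^d (Fin M → Kq)) ⊗[Kq] (⨂[Kq]^d (Fin N → Kq)) →ₗ[Kq] TQuot (max M N) :=
  TensorProduct.lift ((tpair (le_max_left M N) (le_max_right M N) d).compr₂ TQuot.mk)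

/-- The left action upstairs. -/
def actL : U M →ₐ[Kq]
    Module.End Kq ((⨂[Kq]^d (Fin M → Kq)) ⊗[Kq] (⨂[Kq]^d (Fin N → Kq))) :=
  (Module.End.rTensorAlgHom Kq _ _).comp (U.tensorPow (U.natural M) d)

/-- The right action upstairs. -/
def actR : (U N)ᵐᵒᵖ →ₐ[Kq]
    Module.End Kq ((⨂[Kq]^d (Fin M → Kq)) ⊗[Kq] (⨂[Kq]^d (Fin N → Kq))) :=
  (Module.End.lTensorAlgHom Kq _ _).comp ((U.tensorPow (U.natural N) d).comp (U.anti N))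

variable {M N d}

@[simp] lemma proj_tmul (a : ⨂[Kq]^d (Fin M → Kq)) (b : ⨂[Kq]^d (Fin N → Kq)) :
    proj M N d (a ⊗ₜ b) = TQuot.mk (tpair (le_max_left M N) (le_max_right M N) d a b) := rfl

@[simp] lemma actL_tmul (x : U M) (a : ⨂[Kq]^d (Fin M → Kq)) (b : ⨂[Kq]^d (Fin N → Kq)) :
    actL M N d x (a ⊗ₜ b) = (U.tensorPow (U.natural M) d x a) ⊗ₜ b := rfl

@[simp] lemma actR_tmul (x : (U N)ᵐᵒᵖ) (a : ⨂[Kq]^d (Fin M → Kq)) (b : ⨂[Kq]^d (Fin N → Kq)) :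
    actR M N d x (a ⊗ₜ b) = a ⊗ₜ (U.tensorPow (U.natural N) d (U.anti N x) b) := rfl

/-- The two algebras act on different tensor factors. The bimodule property downstairs is inherited
from this. -/
lemma actL_actR (x : U M) (y : (U N)ᵐᵒᵖ) : Commute (actL M N d x) (actR M N d y) := by
  refine TensorProduct.ext' fun a b => ?_
  simp

lemma tA_eq_tau (A : Matrix (Fin M) (Fin N) ℕ) :
    tA A = tau (le_max_left M N) (le_max_right M N) A := rfl

lemma V_le_range (hMN : M % 2 = N % 2) : V M N (2 * d + M % 2) ≤ LinearMap.range (proj M N d) := by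
  refine Submodule.span_le.mpr ?_
  rintro _ ⟨A, hA, rfl⟩
  have hd := sum_tExp hMN (isSymm_of_mem_Xi hMN hA) hA.2
  obtain ⟨lam, mu, e⟩ := exists_word (le_max_left M N) (le_max_right M N) hd
  exact ⟨vLam lam ⊗ₜ vLam mu, by rw [proj_tmul, tpair_vLam, ← e]; rfl⟩

/-- The descent of an operator to the quotient. -/
def TQuot.op {P : ℕ} {g : T P →ₗ[Kq] T P} (hg : rightIdeal P ≤ (rightIdeal P).comap g) :
    Module.End Kq (TQuot P) := Submodule.mapQ _ _ g hg

@[simp] lemma TQuot.op_mk {P : ℕ} {g : T P →ₗ[Kq] T P}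
    (hg : rightIdeal P ≤ (rightIdeal P).comap g) (x : T P) :
    TQuot.op hg (TQuot.mk x) = TQuot.mk (g x) := rfl

/-- `g` induces on the left the action of `x`. -/
structure CoversL (x : U M) (g : T (max M N) →ₗ[Kq] T (max M N)) : Prop where
  le : rightIdeal (max M N) ≤ (rightIdeal (max M N)).comap g
  tpair : ∀ (d : ℕ) (a : ⨂[Kq]^d (Fin M → Kq)) (b : ⨂[Kq]^d (Fin N → Kq)),
    tpair (le_max_left M N) (le_max_right M N) d (U.tensorPow (U.natural M) d x a) b =
      g (tpair (le_max_left M N) (le_max_right M N) d a b)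

/-- `g` induces, transposed, the right action of `x`. -/
structure CoversR (x : U N) (g : T (max M N) →ₗ[Kq] T (max M N)) : Prop where
  le : rightIdeal (max M N) ≤ (rightIdeal (max M N)).comap g
  tpair : ∀ (d : ℕ) (b : ⨂[Kq]^d (Fin N → Kq)) (a : ⨂[Kq]^d (Fin M → Kq)),
    tpair (le_max_right M N) (le_max_left M N) d
      (U.tensorPow (U.natural N) d (U.anti N (.op x)) b) a =
      g (tpair (le_max_right M N) (le_max_left M N) d b a)

lemma CoversL.proj {x : U M} {g : T (max M N) →ₗ[Kq] T (max M N)} (h : CoversL x g) (y) :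
    TQuot.op h.le (proj M N d y) = IHowe.proj M N d (actL M N d x y) := by
  induction y with
  | zero => simp
  | add a b ha hb => simp only [map_add, ha, hb]
  | tmul a b => rw [actL_tmul, proj_tmul, proj_tmul, h.tpair, TQuot.op_mk]

lemma transp_comp_le {P : ℕ} {g : T P →ₗ[Kq] T P} (hg : rightIdeal P ≤ (rightIdeal P).comap g) :
    rightIdeal P ≤ (rightIdeal P).comap
      (T.transp.toLinearMap ∘ₗ g ∘ₗ T.transp.toLinearMap) := fun _ hx =>
  T.transp_rightIdeal (hg (T.transp_rightIdeal hx))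

lemma CoversR.proj {x : U N} {g : T (max M N) →ₗ[Kq] T (max M N)} (h : CoversR x g) (y) :
    TQuot.op (transp_comp_le h.le) (proj M N d y) = IHowe.proj M N d (actR M N d (.op x) y) := by
  induction y with
  | zero => simp
  | add a b ha hb => simp only [map_add, ha, hb]
  | tmul a b =>
    rw [actR_tmul, proj_tmul, proj_tmul, TQuot.op_mk, LinearMap.comp_apply, LinearMap.comp_apply,
      AlgHom.toLinearMap_apply, AlgHom.toLinearMap_apply, transp_tpair, ← h.tpair, transp_tpair]

lemma CoversL.mem_compat {x : U M} {g : T (max M N) →ₗ[Kq] T (max M N)} (h : CoversL x g) {s : ℕ}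
    (hS : ∀ A ∈ Xi M N s,
      TQuot.mk (g (mon (cell (le_max_left M N) (le_max_right M N)) (tExp A))) ∈ V M N s) :
    actL M N d x ∈ compat (IHowe.proj M N d) (V M N s) := by
  refine ⟨TQuot.op h.le, h.proj, fun v hv => ?_⟩
  induction hv using Submodule.span_induction with
  | mem v hv =>
    obtain ⟨A, hA, rfl⟩ := hv
    exact hS A hA
  | zero => simp
  | add a b _ _ ha hb => rw [map_add]; exact add_mem ha hb
  | smul r a _ ha => rw [map_smul]; exact Submodule.smul_mem _ _ ha

lemma CoversR.mem_compat {x : U N} {g : T (max M N) →ₗ[Kq] T (max M N)} (h : CoversR x g) {s : ℕ}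
    (hS : ∀ A ∈ Xi M N s,
      TQuot.mk (T.transp (g (T.transp
        (mon (cell (le_max_left M N) (le_max_right M N)) (tExp A))))) ∈ V M N s) :
    actR M N d (.op x) ∈ compat (IHowe.proj M N d) (V M N s) := by
  refine ⟨TQuot.op (transp_comp_le h.le), h.proj, fun v hv => ?_⟩
  induction hv using Submodule.span_induction with
  | mem v hv =>
    obtain ⟨A, hA, rfl⟩ := hv
    exact hS A hA
  | zero => simp
  | add a b _ _ ha hb => rw [map_add]; exact add_mem ha hb
  | smul r a _ ha => rw [map_smul]; exact Submodule.smul_mem _ _ ha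

/-- Terms whose matrix would leave `Ξ` through truncated subtraction carry the coefficient `[0] =
0`. -/
lemma smul_tA_mem {s : ℕ} {A : Matrix (Fin M) (Fin N) ℕ} (hA : A ∈ Xi M N s) (e : Kq) {x : ℕ}
    {r r' : Fin M} {c c' : Fin N}
    (hx : x ≠ 0 → A r c ≠ 0 ∧ (IsZero r → IsZero c → 2 ≤ A r c)) :
    (e * qInt x) • tA (A + Eθ r' c' - Eθ r c) ∈ V M N s := by
  rcases eq_or_ne x 0 with rfl | h0
  · simp [qInt_zero]
  · exact Submodule.smul_mem _ _ (Submodule.subset_span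
      ⟨_, mem_Xi_move hA (Eθ_le hA.1 (hx h0).1 (hx h0).2), rfl⟩)

lemma tA_mem {s : ℕ} {A : Matrix (Fin M) (Fin N) ℕ} (hA : A ∈ Xi M N s) : tA A ∈ V M N s :=
  Submodule.subset_span ⟨A, hA, rfl⟩

lemma mk_diagOp_mem {s : ℕ} {A : Matrix (Fin M) (Fin N) ℕ} (hA : A ∈ Xi M N s)
    (χ : Fin (max M N) → ℤ) :
    TQuot.mk (T.diagOp χ (mon (cell (le_max_left M N) (le_max_right M N)) (tExp A))) ∈ V M N s := by
  rw [map_mon (s := fun r _ => χ (emb (le_max_left M N) r)) (fun r s => by simp [cell]), map_smul]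
  exact Submodule.smul_mem _ _ (tA_mem hA)

lemma mk_transp_diagOp_mem {s : ℕ} {A : Matrix (Fin M) (Fin N) ℕ} (hA : A ∈ Xi M N s)
    (χ : Fin (max M N) → ℤ) :
    TQuot.mk (T.transp (T.diagOp χ (T.transp
      (mon (cell (le_max_left M N) (le_max_right M N)) (tExp A))))) ∈ V M N s := by
  rw [show T.transp (T.diagOp χ (T.transp
      (mon (cell (le_max_left M N) (le_max_right M N)) (tExp A)))) =
    (T.transp.comp ((T.diagOp χ).comp T.transp))
      (mon (cell (le_max_left M N) (le_max_right M N)) (tExp A)) from rfl,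
    map_mon (s := fun _ r => χ (emb (le_max_right M N) r)) (fun r s => by simp [cell]), map_smul]
  exact Submodule.smul_mem _ _ (tA_mem hA)

lemma neg_dWt_rev {P : ℕ} (r s : Fin P) : -T.dWt r s.rev = -T.dWt r s := by rw [T.dWt_rev]

section Generators
variable {P : ℕ} (h : M ≤ P) (h' : N ≤ P)

lemma tpair_d (hM : M % 2 = P % 2) (r : Fin M) (a : ⨂[Kq]^d (Fin M → Kq))
    (b : ⨂[Kq]^d (Fin N → Kq)) :
    tpair h h' d (U.tensorPow (U.natural M) d (U.d r) a) b =
      T.diagOp (T.dWt (emb h r)) (tpair h h' d a b) := by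
  rw [U.d]
  split_ifs with hr
  · rw [tpair_D]
    congr 2
    funext s
    rw [T.dWt, if_pos ((isZero_emb h hM r).mpr hr), add_zero]
  · rw [map_mul, Module.End.mul_apply, tpair_D, tpair_D, T.diagOp_diagOp]
    congr 2
    funext s
    rw [T.dWt, if_neg (fun e => hr ((isZero_emb h hM r).mp e)), emb_rev h hM]

lemma tpair_dinv (hM : M % 2 = P % 2) (r : Fin M) (a : ⨂[Kq]^d (Fin M → Kq))
    (b : ⨂[Kq]^d (Fin N → Kq)) :
    tpair h h' d (U.tensorPow (U.natural M) d (U.dinv r) a) b =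
      T.diagOp (fun s => -T.dWt (emb h r) s) (tpair h h' d a b) := by
  rw [U.dinv]
  split_ifs with hr
  · rw [tpair_Dinv]
    congr 2
    funext s
    rw [T.dWt, if_pos ((isZero_emb h hM r).mpr hr), add_zero]
    split_ifs <;> rfl
  · rw [map_mul, Module.End.mul_apply, tpair_Dinv, tpair_Dinv, T.diagOp_diagOp]
    congr 2
    funext s
    rw [T.dWt, if_neg (fun e => hr ((isZero_emb h hM r).mp e)), emb_rev h hM]
    split_ifs <;> rfl

lemma anti_d (r : Fin N) : U.anti N (.op (U.d r)) = U.d r := by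
  rw [U.d]
  split_ifs with hr
  · rw [U.anti_D]
  · rw [MulOpposite.op_mul, map_mul, U.anti_D, U.anti_D]
    exact U.isURep.D_D _ _

lemma anti_dinv (r : Fin N) : U.anti N (.op (U.dinv r)) = U.dinv r := by
  rw [U.dinv]
  split_ifs with hr
  · rw [U.anti_Dinv]
  · rw [MulOpposite.op_mul, map_mul, U.anti_Dinv, U.anti_Dinv]
    exact U.isURep.Dinv_Dinv _ _

lemma tpair_Bi (hM : M % 2 = P % 2) (i : Fin (M - 1)) (a : ⨂[Kq]^d (Fin M → Kq))
    (b : ⨂[Kq]^d (Fin N → Kq)) :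
    tpair h h' d (U.tensorPow (U.natural M) d (U.Bi i) a) b =
      T.bI (embI h i) (tpair h h' d a b) := by
  rw [U.Bi]
  split_ifs with hi0
  · rw [T.bI_of_isZero ((isZero_embI h hM i).mpr hi0)]
    simp [tpair_F, tpair_E, tpair_Kinv]
  · rw [T.bI_of_not (fun e => hi0 ((isZero_embI h hM i).mp e)), ← embI_rev h hM]
    simp [tpair_F, tpair_E, tpair_Kinv]

lemma tpair_Bj (hM : M % 2 = P % 2) (i : Fin (M - 1)) (a : ⨂[Kq]^d (Fin M → Kq))
    (b : ⨂[Kq]^d (Fin N → Kq)) :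
    tpair h h' d (U.tensorPow (U.natural M) d (U.Bj i) a) b =
      T.bJ (embI h i) (tpair h h' d a b) := by
  rw [U.Bj]
  split_ifs with hi0
  · rw [T.bJ_of_isPos ((isPos_embI h hM i).mpr hi0), ← embI_rev h hM]
    simp [tpair_F, tpair_E, tpair_Kinv]
  · rw [T.bJ_of_not (fun e => hi0 ((isPos_embI h hM i).mp e)), ← embI_rev h hM]
    simp [tpair_F, tpair_E, tpair_Kinv]

lemma tpair_anti_Bi (hM : M % 2 = P % 2) (i : Fin (M - 1)) (a : ⨂[Kq]^d (Fin M → Kq))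
    (b : ⨂[Kq]^d (Fin N → Kq)) :
    tpair h h' d (U.tensorPow (U.natural M) d (U.anti M (.op (U.Bi i))) a) b =
      T.bIT (embI h i) (tpair h h' d a b) := by
  rw [U.Bi]
  split_ifs with hi0
  · rw [T.bIT_of_isZero ((isZero_embI h hM i).mpr hi0)]
    simp [tpair_F, tpair_E, tpair_Kinv, tpair_K, T.fT, T.eT]
  · rw [T.bIT_of_not (fun e => hi0 ((isZero_embI h hM i).mp e)), ← embI_rev h hM]
    simp [tpair_F, tpair_E, tpair_Kinv, tpair_K, T.fT, T.eT]

lemma tpair_anti_Bj (hM : M % 2 = P % 2) (i : Fin (M - 1)) (a : ⨂[Kq]^d (Fin M → Kq))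
    (b : ⨂[Kq]^d (Fin N → Kq)) :
    tpair h h' d (U.tensorPow (U.natural M) d (U.anti M (.op (U.Bj i))) a) b =
      T.bJT (embI h i) (tpair h h' d a b) := by
  rw [U.Bj]
  split_ifs with hi0
  · rw [T.bJT_of_isPos ((isPos_embI h hM i).mpr hi0), ← embI_rev h hM]
    simp [tpair_F, tpair_E, tpair_Kinv, tpair_K, T.fT, T.eT]
  · rw [T.bJT_of_not (fun e => hi0 ((isPos_embI h hM i).mp e)), ← embI_rev h hM]
    simp [tpair_F, tpair_E, tpair_Kinv, tpair_K, T.fT, T.eT]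

end Generators

end Actions

/-! ### The homomorphisms from the iquantum groups and the operators covering their generators. -/

section Homs
variable {M N d s : ℕ}

/-- The left action of a subalgebra. -/
def leftHom (hS : V M N s ≤ LinearMap.range (proj M N d)) {A : Subalgebra Kq (U M)}
    (hA : ∀ x ∈ A, actL M N d x ∈ compat (proj M N d) (V M N s)) :
    A →ₐ[Kq] Module.End Kq (V M N s) :=
  (compatAct hS).comp (((actL M N d).comp A.val).codRestrict _ fun x => hA x.1 x.2)

/-- The right action of a subalgebra. -/
def rightHom (hS : V M N s ≤ LinearMap.range (proj M N d)) {A : Subalgebra Kq (U N)}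
    (hA : ∀ x ∈ A, actR M N d (.op x) ∈ compat (proj M N d) (V M N s)) :
    Aᵐᵒᵖ →ₐ[Kq] Module.End Kq (V M N s) :=
  (compatAct hS).comp (((actR M N d).comp (AlgHom.op A.val)).codRestrict _
    fun x => hA x.unop.1 x.unop.2)

variable (hS : V M N s ≤ LinearMap.range (proj M N d))

lemma leftHom_proj {A : Subalgebra Kq (U M)}
    (hA : ∀ x ∈ A, actL M N d x ∈ compat (proj M N d) (V M N s)) (x : A) (y)
    (hy : proj M N d y ∈ V M N s) :
    (leftHom hS hA x ⟨proj M N d y, hy⟩ : TQuot (max M N)) = proj M N d (actL M N d x.1 y) :=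
  compatAct_apply hS _ y hy

lemma leftHom_tVec {A : Subalgebra Kq (U M)}
    (hA : ∀ x ∈ A, actL M N d x ∈ compat (proj M N d) (V M N s)) {x : A}
    {g : T (max M N) →ₗ[Kq] T (max M N)} (hg : CoversL x.1 g) (B) (hB : B ∈ Xi M N s) :
    (leftHom hS hA x (tVec B hB) : TQuot (max M N)) =
      TQuot.mk (g (mon (cell (le_max_left M N) (le_max_right M N)) (tExp B))) :=
  compatAct_eq hS _ (β := TQuot.op hg.le) (fun y => hg.proj y) _

lemma rightHom_tVec {A : Subalgebra Kq (U N)}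
    (hA : ∀ x ∈ A, actR M N d (.op x) ∈ compat (proj M N d) (V M N s)) {x : A}
    {g : T (max M N) →ₗ[Kq] T (max M N)} (hg : CoversR x.1 g) (B) (hB : B ∈ Xi M N s) :
    (rightHom hS hA (.op x) (tVec B hB) : TQuot (max M N)) =
      TQuot.mk (T.transp (g (T.transp
        (mon (cell (le_max_left M N) (le_max_right M N)) (tExp B))))) :=
  compatAct_eq hS _ (β := TQuot.op (transp_comp_le hg.le)) (fun y => hg.proj y) _

lemma leftHom_rightHom {A : Subalgebra Kq (U M)} {B : Subalgebra Kq (U N)}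
    (hA : ∀ x ∈ A, actL M N d x ∈ compat (proj M N d) (V M N s))
    (hB : ∀ x ∈ B, actR M N d (.op x) ∈ compat (proj M N d) (V M N s)) (x : A) (y : Bᵐᵒᵖ) (v) :
    leftHom hS hA x (rightHom hS hB y v) = rightHom hS hB y (leftHom hS hA x v) :=
  compatAct_comm hS _ _ (actL_actR _ _) v

lemma actL_mem_of_adjoin {S : Set (U M)}
    (h : ∀ x ∈ S, actL M N d x ∈ compat (proj M N d) (V M N s)) :
    ∀ x ∈ Algebra.adjoin Kq S, actL M N d x ∈ compat (proj M N d) (V M N s) := by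
  have : Algebra.adjoin Kq S ≤ (compat (proj M N d) (V M N s)).comap (actL M N d) :=
    Algebra.adjoin_le h
  exact fun x hx => this hx

lemma actR_mem_of_adjoin {S : Set (U N)}
    (h : ∀ x ∈ S, actR M N d (.op x) ∈ compat (proj M N d) (V M N s)) :
    ∀ x ∈ Algebra.adjoin Kq S, actR M N d (.op x) ∈ compat (proj M N d) (V M N s) := by
  intro x hx
  induction hx using Algebra.adjoin_induction with
  | mem x hx => exact h x hx
  | algebraMap r =>
    rw [show MulOpposite.op (algebraMap Kq (U N) r) = algebraMap Kq (U N)ᵐᵒᵖ r from rfl,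
      AlgHom.commutes]
    exact Subalgebra.algebraMap_mem _ r
  | add x y _ _ hx hy => rw [MulOpposite.op_add, map_add]; exact add_mem hx hy
  | mul x y _ _ hx hy => rw [MulOpposite.op_mul, map_mul]; exact mul_mem hy hx

variable (hMN : M % 2 = N % 2)

lemma mod_max (hMN : M % 2 = N % 2) : M % 2 = max M N % 2 := by
  rcases max_choice M N with h | h <;> rw [h]
  exact hMN

lemma mod_max' (hMN : M % 2 = N % 2) : N % 2 = max M N % 2 := by
  rw [← hMN]; exact mod_max hMN

lemma coversL_d (hMN : M % 2 = N % 2) (r : Fin M) : CoversL (N := N) (U.d r)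
    (T.diagOp (T.dWt (emb (le_max_left M N) r))).toLinearMap where
  le _ hx := T.diagOp_rightIdeal (T.dWt_rev _) hx
  tpair d a b := tpair_d _ _ (mod_max hMN) r a b

lemma coversL_dinv (hMN : M % 2 = N % 2) (r : Fin M) : CoversL (N := N) (U.dinv r)
    (T.diagOp (fun s => -T.dWt (emb (le_max_left M N) r) s)).toLinearMap where
  le _ hx := T.diagOp_rightIdeal (neg_dWt_rev _) hx
  tpair d a b := tpair_dinv _ _ (mod_max hMN) r a b

lemma coversR_d (hMN : M % 2 = N % 2) (r : Fin N) : CoversR (M := M) (U.d r)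
    (T.diagOp (T.dWt (emb (le_max_right M N) r))).toLinearMap where
  le _ hx := T.diagOp_rightIdeal (T.dWt_rev _) hx
  tpair d a b := by rw [anti_d]; exact tpair_d _ _ (mod_max' hMN) r a b

lemma coversR_dinv (hMN : M % 2 = N % 2) (r : Fin N) : CoversR (M := M) (U.dinv r)
    (T.diagOp (fun s => -T.dWt (emb (le_max_right M N) r) s)).toLinearMap where
  le _ hx := T.diagOp_rightIdeal (neg_dWt_rev _) hx
  tpair d a b := by rw [anti_dinv]; exact tpair_dinv _ _ (mod_max' hMN) r a b

lemma coversL_Bi (hMN : M % 2 = N % 2) (hM : Even M) (i : Fin (M - 1)) :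
    CoversL (N := N) (U.Bi i) (T.bI (embI (le_max_left M N) i)) where
  le := T.bI_rightIdeal (by rw [Nat.even_iff, ← mod_max hMN, ← Nat.even_iff]; exact hM) _
  tpair d a b := tpair_Bi _ _ (mod_max hMN) i a b

lemma coversL_Bj (hMN : M % 2 = N % 2) (hM : Odd M) (i : Fin (M - 1)) :
    CoversL (N := N) (U.Bj i) (T.bJ (embI (le_max_left M N) i)) where
  le := T.bJ_rightIdeal (by rw [Nat.odd_iff, ← mod_max hMN, ← Nat.odd_iff]; exact hM) _
  tpair d a b := tpair_Bj _ _ (mod_max hMN) i a b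

lemma coversR_Bi (hMN : M % 2 = N % 2) (hM : Even M) (i : Fin (N - 1)) :
    CoversR (M := M) (U.Bi i) (T.bIT (embI (le_max_right M N) i)) where
  le := T.bIT_rightIdeal (by rw [Nat.even_iff, ← mod_max hMN, ← Nat.even_iff]; exact hM) _
  tpair d a b := tpair_anti_Bi _ _ (mod_max' hMN) i a b

lemma coversR_Bj (hMN : M % 2 = N % 2) (hM : Odd M) (i : Fin (N - 1)) :
    CoversR (M := M) (U.Bj i) (T.bJT (embI (le_max_right M N) i)) where
  le := T.bJT_rightIdeal (by rw [Nat.odd_iff, ← mod_max hMN, ← Nat.odd_iff]; exact hM) _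
  tpair d a b := tpair_anti_Bj _ _ (mod_max' hMN) i a b

end Homs

/-! ### Type `ı` -/

section TypeI
variable {m n d : ℕ}

lemma isSymm_of_mem_Xi_I {A : Matrix (Fin (2 * m)) (Fin (2 * n)) ℕ} (hA : A ∈ Xi (2 * m) (2 * n) (2 * d)) :
    IsSymm A := isSymm_of_mem_Xi (d := d) (by omega) (by simpa using hA)

lemma mk_leftBi {A : Matrix (Fin (2 * m)) (Fin (2 * n)) ℕ} (hA : A ∈ Xi (2 * m) (2 * n) (2 * d))
    (i : Fin (2 * m - 1)) :
    TQuot.mk (T.bI (embI (le_max_left (2 * m) (2 * n)) i)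
      (mon (cell (le_max_left _ _) (le_max_right _ _)) (tExp A))) = leftBi i A := by
  have hMN : 2 * m % 2 = 2 * n % 2 := by omega
  rw [leftBi]
  split_ifs with hi0
  · exact mk_bI_of_isZero _ _ (mod_max hMN) (mod_max' hMN) (even_two_mul m) (even_two_mul n)
      (isSymm_of_mem_Xi_I hA) hi0
  · exact mk_bI_of_ne _ _ (mod_max hMN) (even_two_mul m) (isSymm_of_mem_Xi_I hA) hi0

lemma mk_rightBi {A : Matrix (Fin (2 * m)) (Fin (2 * n)) ℕ} (hA : A ∈ Xi (2 * m) (2 * n) (2 * d))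
    (i : Fin (2 * n - 1)) :
    TQuot.mk (T.transp (T.bIT (embI (le_max_right (2 * m) (2 * n)) i) (T.transp
      (mon (cell (le_max_left _ _) (le_max_right _ _)) (tExp A))))) = rightBi i A := by
  have hMN : 2 * m % 2 = 2 * n % 2 := by omega
  rw [rightBi]
  split_ifs with hi0
  · rw [T.transp_bIT_of_isZero ((isZero_embI _ (mod_max' hMN) i).mpr hi0)]
    exact mk_right_zero _ _ hMN (even_two_mul m) (isSymm_of_mem_Xi_I hA) hi0
  · rw [T.transp_bIT_of_not (fun e => hi0 ((isZero_embI _ (mod_max' hMN) i).mp e))]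
    have h2 : (hi i).rev ≠ lo i := fun e => hi0 (by
      have := congrArg Fin.val e
      ext
      have := i.isLt
      simp only [lo, hi, Fin.val_rev] at *
      omega)
    exact mk_right_pos _ _ hMN (isSymm_of_mem_Xi_I hA) (mod_max' hMN)
      (not_isZero_of_even (by omega) (hi i)) h2
      (fun r hr => absurd hr (not_isZero_of_even (by omega) r))

lemma leftBi_mem {A : Matrix (Fin (2 * m)) (Fin (2 * n)) ℕ} (hA : A ∈ Xi (2 * m) (2 * n) (2 * d))
    (i : Fin (2 * m - 1)) : leftBi i A ∈ Vi m n d := by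
  have hz : ∀ r : Fin (2 * m), ¬ IsZero r := not_isZero_of_even (by omega)
  rw [leftBi]
  split_ifs with hi0
  · exact add_mem (sum_mem fun j _ => smul_tA_mem hA _ fun h => ⟨h, fun e => absurd e (hz _)⟩)
      (Submodule.smul_mem _ _ (tA_mem hA))
  · exact sum_mem fun j _ => smul_tA_mem hA _ fun h => ⟨h, fun e => absurd e (hz _)⟩

lemma rightBi_mem {A : Matrix (Fin (2 * m)) (Fin (2 * n)) ℕ} (hA : A ∈ Xi (2 * m) (2 * n) (2 * d))
    (i : Fin (2 * n - 1)) : rightBi i A ∈ Vi m n d := by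
  have hz : ∀ r : Fin (2 * m), ¬ IsZero r := not_isZero_of_even (by omega)
  rw [rightBi]
  split_ifs with hi0
  · exact add_mem (sum_mem fun j _ => smul_tA_mem hA _ fun h => ⟨h, fun e => absurd e (hz _)⟩)
      (Submodule.smul_mem _ _ (tA_mem hA))
  · exact sum_mem fun j _ => smul_tA_mem hA _ fun h => ⟨h, fun e => absurd e (hz _)⟩

variable (m n d)

lemma Vi_le_range : Vi m n d ≤ LinearMap.range (proj (2 * m) (2 * n) d) := by
  have := V_le_range (M := 2 * m) (N := 2 * n) (d := d) (by omega)
  simpa using this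

lemma actL_Ui_mem : ∀ x ∈ Ui m, actL (2 * m) (2 * n) d x ∈
    compat (proj (2 * m) (2 * n) d) (Vi m n d) := by
  have hMN : 2 * m % 2 = 2 * n % 2 := by omega
  refine actL_mem_of_adjoin ?_
  rintro x ((⟨i, rfl⟩ | ⟨r, rfl⟩) | ⟨r, rfl⟩)
  · exact (coversL_Bi hMN (even_two_mul m) i).mem_compat fun A hA => by
      rw [mk_leftBi hA]; exact leftBi_mem hA i
  · exact (coversL_d hMN r).mem_compat fun A hA => mk_diagOp_mem hA _
  · exact (coversL_dinv hMN r).mem_compat fun A hA => mk_diagOp_mem hA _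

lemma actR_Ui_mem : ∀ x ∈ Ui n, actR (2 * m) (2 * n) d (.op x) ∈
    compat (proj (2 * m) (2 * n) d) (Vi m n d) := by
  have hMN : 2 * m % 2 = 2 * n % 2 := by omega
  refine actR_mem_of_adjoin ?_
  rintro x ((⟨i, rfl⟩ | ⟨r, rfl⟩) | ⟨r, rfl⟩)
  · exact (coversR_Bi hMN (even_two_mul m) i).mem_compat fun A hA => by
      rw [mk_rightBi hA]; exact rightBi_mem hA i
  · exact (coversR_d hMN r).mem_compat fun A hA => mk_transp_diagOp_mem hA _
  · exact (coversR_dinv hMN r).mem_compat fun A hA => mk_transp_diagOp_mem hA _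

/-- The left action of `U^ı_m`. -/
def PhiI : Ui m →ₐ[Kq] Module.End Kq (Vi m n d) := leftHom (Vi_le_range m n d) (actL_Ui_mem m n d)
/-- The right action of `U^ı_n`. -/
def PsiI : (Ui n)ᵐᵒᵖ →ₐ[Kq] Module.End Kq (Vi m n d) :=
  rightHom (Vi_le_range m n d) (actR_Ui_mem m n d)

lemma isLeftActionI : IsLeftActionI (PhiI m n d) where
  map_d r A hA := by
    have hMN : 2 * m % 2 = 2 * n % 2 := by omega
    rw [PhiI, leftHom_tVec _ _ (coversL_d hMN r)]
    exact mk_d_left _ _ (mod_max hMN) hMN (isSymm_of_mem_Xi_I hA) r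
  map_B i A hA := by
    have hMN : 2 * m % 2 = 2 * n % 2 := by omega
    rw [PhiI, leftHom_tVec _ _ (coversL_Bi hMN (even_two_mul m) i)]
    exact mk_leftBi hA i

lemma isRightActionI : IsRightActionI (PsiI m n d) where
  map_d r A hA := by
    have hMN : 2 * m % 2 = 2 * n % 2 := by omega
    rw [PsiI, rightHom_tVec _ _ (coversR_d hMN r)]
    exact mk_d_right _ _ (mod_max' hMN) hMN (isSymm_of_mem_Xi_I hA) r
  map_B i A hA := by
    have hMN : 2 * m % 2 = 2 * n % 2 := by omega
    rw [PsiI, rightHom_tVec _ _ (coversR_Bi hMN (even_two_mul m) i)]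
    exact mk_rightBi hA i

end TypeI

/-! ### Type `ȷ` -/

section TypeJ
variable {m n d : ℕ}

lemma isSymm_of_mem_Xi_J {A : Matrix (Fin (2 * m + 1)) (Fin (2 * n + 1)) ℕ}
    (hA : A ∈ Xi (2 * m + 1) (2 * n + 1) (2 * d + 1)) : IsSymm A :=
  isSymm_of_mem_Xi (d := d) (by omega) (by
    rwa [show 2 * d + (2 * m + 1) % 2 = 2 * d + 1 by omega])

lemma isPos_lo_or {k : ℕ} {i : Fin (2 * k + 1 - 1)} (hi0 : IsPos i) :
    IsPos (lo i) ∨ IsZero (lo i) := by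
  rcases isPos_or (lo i) with h | h | h
  · exact Or.inl h
  · exact Or.inr h
  · have := i.isLt
    simp only [IsPos, lo, Fin.lt_def, Fin.val_rev] at *
    omega

lemma isPos_hi_of {k : ℕ} {i : Fin (2 * k + 1 - 1)} (hi0 : IsPos i) : IsPos (hi i) := by
  have := i.isLt
  simp only [IsPos, hi, Fin.lt_def, Fin.val_rev] at *
  omega

lemma sum_pos_add_sum_nonpos {k : ℕ} {B : Type*} [AddCommMonoid B] (f : Fin k → B) :
    ∑ j with ¬ IsPos j, f j + ∑ j with IsPos j, f j = ∑ j, f j := by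
  rw [add_comm]
  exact Finset.sum_filter_add_sum_filter_not _ _ _

lemma mk_leftBjPos {A : Matrix (Fin (2 * m + 1)) (Fin (2 * n + 1)) ℕ}
    (hA : A ∈ Xi (2 * m + 1) (2 * n + 1) (2 * d + 1)) {i : Fin (2 * m + 1 - 1)} (hi0 : IsPos i) :
    TQuot.mk (T.bJ (embI (le_max_left (2 * m + 1) (2 * n + 1)) i)
      (mon (cell (le_max_left _ _) (le_max_right _ _)) (tExp A))) = leftBjPos i A := by
  have hMN : (2 * m + 1) % 2 = (2 * n + 1) % 2 := by omega
  obtain ⟨z', hz'⟩ := exists_isZero (n := 2 * n + 1) (by omega)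
  rcases isPos_lo_or hi0 with h1 | h1
  · rw [mk_bJ_far _ _ (mod_max hMN) (isSymm_of_mem_Xi_J hA) hi0 h1, leftBjPos]
    simp only [if_neg (not_isZero_of_isPos h1), ite_self, Nat.cast_zero, add_zero, Nat.sub_zero]
    rw [← sum_pos_add_sum_nonpos]
    congr 1
    rw [← Finset.filter_filter]
    -- The condition on the entries discards only terms with coefficient `[0]`.
    refine (Finset.sum_filter_of_ne fun j _ hj => ?_).symm
    refine Nat.pos_of_ne_zero fun h0 => hj ?_
    rw [h0, qInt_zero, mul_zero, zero_smul]
  · rw [mk_bJ_near _ _ (mod_max hMN) (mod_max' hMN) hz' (isSymm_of_mem_Xi_J hA) hi0 h1, leftBjPos]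
    simp only [if_pos h1, Nat.cast_one]
    rfl

lemma mk_leftBjNeg {A : Matrix (Fin (2 * m + 1)) (Fin (2 * n + 1)) ℕ}
    (hA : A ∈ Xi (2 * m + 1) (2 * n + 1) (2 * d + 1)) {i : Fin (2 * m + 1 - 1)} (hi0 : IsPos i) :
    TQuot.mk (T.bJ (embI (le_max_left (2 * m + 1) (2 * n + 1)) i.rev)
      (mon (cell (le_max_left _ _) (le_max_right _ _)) (tExp A))) = leftBjNeg i A := by
  have hMN : (2 * m + 1) % 2 = (2 * n + 1) % 2 := by omega
  obtain ⟨z', hz'⟩ := exists_isZero (n := 2 * n + 1) (by omega)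
  rcases isPos_lo_or hi0 with h1 | h1
  · exact mk_bJ_rev_far _ _ (mod_max hMN) (isSymm_of_mem_Xi_J hA) hi0 h1
  · exact mk_bJ_rev_near _ _ (mod_max hMN) (mod_max' hMN) hz' (isSymm_of_mem_Xi_J hA) hi0 h1

lemma mk_rightBjPos {A : Matrix (Fin (2 * m + 1)) (Fin (2 * n + 1)) ℕ}
    (hA : A ∈ Xi (2 * m + 1) (2 * n + 1) (2 * d + 1)) {i : Fin (2 * n + 1 - 1)} (hi0 : IsPos i) :
    TQuot.mk (T.transp (T.bJT (embI (le_max_right (2 * m + 1) (2 * n + 1)) i) (T.transp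
      (mon (cell (le_max_left _ _) (le_max_right _ _)) (tExp A))))) = rightBjPos i A := by
  have hMN : (2 * m + 1) % 2 = (2 * n + 1) % 2 := by omega
  have hp := isPos_hi_of hi0
  rw [T.transp_bJT_of_isPos ((isPos_embI _ (mod_max' hMN) i).mpr hi0)]
  refine mk_right_pos _ _ hMN (isSymm_of_mem_Xi_J hA) (mod_max' hMN) (not_isZero_of_isPos hp) ?_
    (fun _ _ => hp)
  intro e
  have := congrArg Fin.val e
  simp only [IsPos, lo, hi, Fin.lt_def, Fin.val_rev] at *
  omega

lemma mk_rightBjNeg {A : Matrix (Fin (2 * m + 1)) (Fin (2 * n + 1)) ℕ}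
    (hA : A ∈ Xi (2 * m + 1) (2 * n + 1) (2 * d + 1)) {i : Fin (2 * n + 1 - 1)} (hi0 : IsPos i) :
    TQuot.mk (T.transp (T.bJT (embI (le_max_right (2 * m + 1) (2 * n + 1)) i.rev) (T.transp
      (mon (cell (le_max_left _ _) (le_max_right _ _)) (tExp A))))) = rightBjNeg i A := by
  have hMN : (2 * m + 1) % 2 = (2 * n + 1) % 2 := by omega
  rw [T.transp_bJT_of_not
    (fun e => not_isPos_rev hi0 ((isPos_embI _ (mod_max' hMN) i.rev).mp e)),
    embI_rev _ (mod_max' hMN), Fin.rev_rev]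
  rcases isPos_lo_or hi0 with h1 | h1
  · rw [mk_right_neg_far _ _ hMN (mod_max' hMN) (isSymm_of_mem_Xi_J hA) h1, rightBjNeg]
    simp only [if_neg (not_isZero_of_isPos h1), ite_self, Nat.cast_zero, sub_zero, Nat.sub_zero]
    rw [← sum_pos_add_sum_nonpos]
    congr 1
    rw [← Finset.filter_filter]
    refine (Finset.sum_filter_of_ne fun j _ hj => ?_).symm
    refine Nat.pos_of_ne_zero fun h0 => hj ?_
    rw [h0, qInt_zero, mul_zero, zero_smul]
  · rw [mk_right_neg_near _ _ hMN (mod_max' hMN) (isSymm_of_mem_Xi_J hA) h1, rightBjNeg]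
    simp only [if_pos h1, Nat.cast_one]
    rfl

/-- At the centre the coefficient is `[a_{00} - 1]`; if it is nonzero then `a_{00} ≥ 2`, so the move
is legitimate. -/
lemma leftBjPos_mem {A : Matrix (Fin (2 * m + 1)) (Fin (2 * n + 1)) ℕ}
    (hA : A ∈ Xi (2 * m + 1) (2 * n + 1) (2 * d + 1)) {i : Fin (2 * m + 1 - 1)} (hi0 : IsPos i) :
    leftBjPos i A ∈ Vj m n d := by
  rw [leftBjPos]
  refine add_mem (sum_mem fun j _ => smul_tA_mem hA _ fun h => ⟨by omega, fun e e' => ?_⟩)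
    (sum_mem fun j hj => smul_tA_mem hA _ fun h => ⟨h, fun e e' => ?_⟩)
  · simp only [if_pos e, if_pos e'] at h
    omega
  · exact absurd e' (not_isZero_of_isPos (Finset.mem_filter.mp hj).2)

lemma leftBjNeg_mem {A : Matrix (Fin (2 * m + 1)) (Fin (2 * n + 1)) ℕ}
    (hA : A ∈ Xi (2 * m + 1) (2 * n + 1) (2 * d + 1)) {i : Fin (2 * m + 1 - 1)} (hi0 : IsPos i) :
    leftBjNeg i A ∈ Vj m n d :=
  sum_mem fun j _ => smul_tA_mem hA _ fun h =>
    ⟨h, fun e e' => absurd e (not_isZero_of_isPos (isPos_hi_of hi0))⟩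

lemma rightBjPos_mem {A : Matrix (Fin (2 * m + 1)) (Fin (2 * n + 1)) ℕ}
    (hA : A ∈ Xi (2 * m + 1) (2 * n + 1) (2 * d + 1)) {i : Fin (2 * n + 1 - 1)} (hi0 : IsPos i) :
    rightBjPos i A ∈ Vj m n d :=
  sum_mem fun j _ => smul_tA_mem hA _ fun h =>
    ⟨h, fun e e' => absurd e' (not_isZero_of_isPos (isPos_hi_of hi0))⟩

lemma rightBjNeg_mem {A : Matrix (Fin (2 * m + 1)) (Fin (2 * n + 1)) ℕ}
    (hA : A ∈ Xi (2 * m + 1) (2 * n + 1) (2 * d + 1)) {i : Fin (2 * n + 1 - 1)} (hi0 : IsPos i) :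
    rightBjNeg i A ∈ Vj m n d := by
  rw [rightBjNeg]
  refine add_mem (sum_mem fun j _ => smul_tA_mem hA _ fun h => ⟨by omega, fun e e' => ?_⟩)
    (sum_mem fun j hj => smul_tA_mem hA _ fun h => ⟨h, fun e e' => ?_⟩)
  · simp only [if_pos e, if_pos e'] at h
    omega
  · exact absurd e (not_isZero_of_isPos (Finset.mem_filter.mp hj).2)

variable (m n d)

lemma Vj_le_range : Vj m n d ≤ LinearMap.range (proj (2 * m + 1) (2 * n + 1) d) := by
  have := V_le_range (M := 2 * m + 1) (N := 2 * n + 1) (d := d) (by omega)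
  rwa [show 2 * d + (2 * m + 1) % 2 = 2 * d + 1 by omega] at this

lemma isPos_or_rev {k : ℕ} (i : Fin (2 * k + 1 - 1)) : IsPos i ∨ ∃ j, IsPos j ∧ i = Fin.rev j := by
  by_cases h : IsPos i
  · exact Or.inl h
  · exact Or.inr ⟨i.rev, T.isPos_rev_of_not (odd_two_mul_add_one k) h, by rw [Fin.rev_rev]⟩

lemma actL_Uj_mem : ∀ x ∈ Uj m, actL (2 * m + 1) (2 * n + 1) d x ∈
    compat (proj (2 * m + 1) (2 * n + 1) d) (Vj m n d) := by
  have hMN : (2 * m + 1) % 2 = (2 * n + 1) % 2 := by omega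
  refine actL_mem_of_adjoin ?_
  rintro x ((⟨i, rfl⟩ | ⟨r, rfl⟩) | ⟨r, rfl⟩)
  · refine (coversL_Bj hMN (odd_two_mul_add_one m) i).mem_compat fun A hA => ?_
    rcases isPos_or_rev i with hi0 | ⟨j, hj, rfl⟩
    · rw [mk_leftBjPos hA hi0]; exact leftBjPos_mem hA hi0
    · rw [mk_leftBjNeg hA hj]; exact leftBjNeg_mem hA hj
  · exact (coversL_d hMN r).mem_compat fun A hA => mk_diagOp_mem hA _
  · exact (coversL_dinv hMN r).mem_compat fun A hA => mk_diagOp_mem hA _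

lemma actR_Uj_mem : ∀ x ∈ Uj n, actR (2 * m + 1) (2 * n + 1) d (.op x) ∈
    compat (proj (2 * m + 1) (2 * n + 1) d) (Vj m n d) := by
  have hMN : (2 * m + 1) % 2 = (2 * n + 1) % 2 := by omega
  refine actR_mem_of_adjoin ?_
  rintro x ((⟨i, rfl⟩ | ⟨r, rfl⟩) | ⟨r, rfl⟩)
  · refine (coversR_Bj hMN (odd_two_mul_add_one m) i).mem_compat fun A hA => ?_
    rcases isPos_or_rev i with hi0 | ⟨j, hj, rfl⟩
    · rw [mk_rightBjPos hA hi0]; exact rightBjPos_mem hA hi0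
    · rw [mk_rightBjNeg hA hj]; exact rightBjNeg_mem hA hj
  · exact (coversR_d hMN r).mem_compat fun A hA => mk_transp_diagOp_mem hA _
  · exact (coversR_dinv hMN r).mem_compat fun A hA => mk_transp_diagOp_mem hA _

/-- The left action of `U^ȷ_m`. -/
def PhiJ : Uj m →ₐ[Kq] Module.End Kq (Vj m n d) := leftHom (Vj_le_range m n d) (actL_Uj_mem m n d)
/-- The right action of `U^ȷ_n`. -/
def PsiJ : (Uj n)ᵐᵒᵖ →ₐ[Kq] Module.End Kq (Vj m n d) :=
  rightHom (Vj_le_range m n d) (actR_Uj_mem m n d)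

lemma isLeftActionJ : IsLeftActionJ (PhiJ m n d) where
  map_d r A hA := by
    have hMN : (2 * m + 1) % 2 = (2 * n + 1) % 2 := by omega
    rw [PhiJ, leftHom_tVec _ _ (coversL_d hMN r)]
    exact mk_d_left _ _ (mod_max hMN) hMN (isSymm_of_mem_Xi_J hA) r
  map_B_pos i hi0 A hA := by
    have hMN : (2 * m + 1) % 2 = (2 * n + 1) % 2 := by omega
    rw [PhiJ, leftHom_tVec _ _ (coversL_Bj hMN (odd_two_mul_add_one m) i)]
    exact mk_leftBjPos hA hi0
  map_B_neg i hi0 A hA := by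
    have hMN : (2 * m + 1) % 2 = (2 * n + 1) % 2 := by omega
    rw [PhiJ, leftHom_tVec _ _ (coversL_Bj hMN (odd_two_mul_add_one m) i.rev)]
    exact mk_leftBjNeg hA hi0

lemma isRightActionJ : IsRightActionJ (PsiJ m n d) where
  map_d r A hA := by
    have hMN : (2 * m + 1) % 2 = (2 * n + 1) % 2 := by omega
    rw [PsiJ, rightHom_tVec _ _ (coversR_d hMN r)]
    exact mk_d_right _ _ (mod_max' hMN) hMN (isSymm_of_mem_Xi_J hA) r
  map_B_pos i hi0 A hA := by
    have hMN : (2 * m + 1) % 2 = (2 * n + 1) % 2 := by omega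
    rw [PsiJ, rightHom_tVec _ _ (coversR_Bj hMN (odd_two_mul_add_one m) i)]
    exact mk_rightBjPos hA hi0
  map_B_neg i hi0 A hA := by
    have hMN : (2 * m + 1) % 2 = (2 * n + 1) % 2 := by omega
    rw [PsiJ, rightHom_tVec _ _ (coversR_Bj hMN (odd_two_mul_add_one m) i.rev)]
    exact mk_rightBjNeg hA hi0

end TypeJ

/-! ### Words and the functionals separating them -/

section Words
variable {P : ℕ}

/-- The word `∏ t_{μ_k, c_k}`. -/
def wd {n : ℕ} (μ c : Fin n → Fin P) : T P := (List.ofFn fun k => t (μ k) (c k)).prod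

lemma wd_succ {n : ℕ} (μ c : Fin (n + 1) → Fin P) :
    wd μ c = t (μ 0) (c 0) * wd (Fin.tail μ) (Fin.tail c) := by
  simp [wd, List.ofFn_succ, Fin.tail]

lemma diag_wd {σ : T P →ₐ[Kq] T P} {χ : Fin P → ℤ} (hσ : ∀ r s, σ (t r s) = q ^ χ r • t r s)
    {n : ℕ} (μ c : Fin n → Fin P) : ∃ e : ℤ, σ (wd μ c) = q ^ e • wd μ c := by
  induction n with
  | zero => exact ⟨0, by simp [wd]⟩
  | succ n ih =>
    obtain ⟨e, he⟩ := ih (Fin.tail μ) (Fin.tail c)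
    refine ⟨χ (μ 0) + e, ?_⟩
    rw [wd_succ, map_mul, hσ, he, smul_mul_smul_comm, zpow_add₀ q_ne_zero]

/-- `z` is a combination of the words obtained from `μ` by replacing one letter `y` by `x`, with
nonzero coefficients. -/
def Moves {n : ℕ} (μ c : Fin n → Fin P) (y x : Fin P) (z : T P) : Prop :=
  ∃ a : Fin n → Fin P → Kq, (∀ p x', a p x' ≠ 0 ↔ μ p = y ∧ x' = x) ∧
    z = ∑ p, ∑ x', a p x' • wd (Function.update μ p x') c

lemma Moves.smul {n : ℕ} {μ c : Fin n → Fin P} {y x : Fin P} {z : T P} (h : Moves μ c y x z)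
    {s : Kq} (hs : s ≠ 0) : Moves μ c y x (s • z) := by
  obtain ⟨a, ha, rfl⟩ := h
  refine ⟨fun p x' => s * a p x', fun p x' => ?_, ?_⟩
  · rw [← ha p x', mul_ne_zero_iff]; exact and_iff_right hs
  · simp only [Finset.smul_sum, smul_smul]

lemma Moves.map {n : ℕ} {μ c : Fin n → Fin P} {y x : Fin P} {z : T P} (h : Moves μ c y x z)
    {σ : T P →ₐ[Kq] T P} {χ : Fin P → ℤ} (hσ : ∀ r s, σ (t r s) = q ^ χ r • t r s) :
    Moves μ c y x (σ z) := by
  obtain ⟨a, ha, rfl⟩ := h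
  choose e he using fun μ' : Fin n → Fin P => diag_wd hσ μ' c
  refine ⟨fun p x' => a p x' * q ^ e (Function.update μ p x'), fun p x' => ?_, ?_⟩
  · rw [← ha p x', mul_ne_zero_iff]; exact and_iff_left (zpow_ne_zero _ q_ne_zero)
  · simp only [map_sum, map_smul, he, smul_smul]

/-- By the Leibniz rule each occurrence of `y` is replaced in turn, and the twists, being diagonal
on words, only contribute powers of `q`; hence no coefficient vanishes. -/
lemma moves_der {δ : T P →ₗ[Kq] T P} {σ τ : T P →ₐ[Kq] T P} {χ ψ : Fin P → ℤ}
    (hσ : ∀ r s, σ (t r s) = q ^ χ r • t r s) (hτ : ∀ r s, τ (t r s) = q ^ ψ r • t r s)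
    (h1 : δ 1 = 0) (hδ : ∀ a b, δ (a * b) = δ a * σ b + τ a * δ b) {y x : Fin P}
    (ht : ∀ r s, δ (t r s) = if r = y then t x s else 0) {n : ℕ} (μ c : Fin n → Fin P) :
    Moves μ c y x (δ (wd μ c)) := by
  suffices H : ∃ a : Fin n → Kq, (∀ p, a p ≠ 0) ∧ δ (wd μ c) =
      ∑ p, if μ p = y then a p • wd (Function.update μ p x) c else 0 by
    obtain ⟨a, ha, he⟩ := H
    refine ⟨fun p x' => if μ p = y ∧ x' = x then a p else 0, fun p x' => ?_, ?_⟩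
    · by_cases h : μ p = y ∧ x' = x
      · simp [h, ha]
      · show (if μ p = y ∧ x' = x then a p else 0) ≠ 0 ↔ _
        rw [if_neg h]; simp [h]
    · rw [he]
      refine Finset.sum_congr rfl fun p _ => ?_
      by_cases h : μ p = y
      · simp [h]
      · simp [h]
  induction n with
  | zero => exact ⟨fun _ => 1, by simp, by simp [wd, h1]⟩
  | succ n ih =>
    obtain ⟨a, ha, hs⟩ := ih (Fin.tail μ) (Fin.tail c)
    obtain ⟨e, he⟩ := diag_wd hσ (Fin.tail μ) (Fin.tail c)
    refine ⟨Fin.cons (q ^ e) fun p => q ^ ψ (μ 0) * a p, ?_, ?_⟩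
    · intro p
      refine Fin.cases ?_ (fun p => ?_) p
      · exact zpow_ne_zero _ q_ne_zero
      · exact mul_ne_zero (zpow_ne_zero _ q_ne_zero) (ha p)
    · rw [wd_succ, hδ, he, hτ, hs, ht, Fin.sum_univ_succ, Finset.mul_sum]
      congr 1
      · by_cases h : μ 0 = y
        · simp [h, wd_succ]
        · simp [h]
      · refine Finset.sum_congr rfl fun p _ => ?_
        by_cases h : μ p.succ = y
        · rw [if_pos h, if_pos (show Fin.tail μ p = y from h), Fin.cons_succ,
            smul_mul_smul_comm, wd_succ, Fin.tail_update_succ, Function.update_of_ne (Fin.succ_ne_zero p).symm]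
        · rw [if_neg h, if_neg (show ¬ Fin.tail μ p = y from h), mul_zero]

lemma moves_eOp (i : Fin (P - 1)) {n : ℕ} (μ c : Fin n → Fin P) :
    Moves μ c (hi i) (lo i) (T.eOp i (wd μ c)) :=
  moves_der (σ := AlgHom.id Kq _) (χ := fun _ => 0) (by simp) (T.kOp_t i) (T.eOp_one i)
    (T.eOp_mul i) (T.eOp_t i) μ c

lemma moves_fOp (i : Fin (P - 1)) {n : ℕ} (μ c : Fin n → Fin P) :
    Moves μ c (lo i) (hi i) (T.fOp i (wd μ c)) :=
  moves_der (τ := AlgHom.id Kq _) (ψ := fun _ => 0) (T.kinvOp_t i) (by simp) (T.fOp_one i)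
    (T.fOp_mul i) (T.fOp_t i) μ c

lemma moves_eOp_kinvOp (i i' : Fin (P - 1)) {n : ℕ} (μ c : Fin n → Fin P) :
    Moves μ c (hi i) (lo i) (T.eOp i (T.kinvOp i' (wd μ c))) := by
  obtain ⟨e, he⟩ := diag_wd (T.kinvOp_t i') μ c
  rw [he, map_smul]
  exact (moves_eOp i μ c).smul (zpow_ne_zero _ q_ne_zero)

/-- `B_i` turns the letter `y` into `x`. -/
def Step (i : Fin (P - 1)) (y x : Fin P) : Prop :=
  (y = lo i ∧ x = hi i) ∨ (y = (lo i).rev ∧ x = (hi i).rev)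

/-- The two replacements are never the same: otherwise `lo i` and `hi i` would both be the zero
label. No cancellation of coefficients is therefore possible. -/
lemma Moves.add {n : ℕ} {μ c : Fin n → Fin P} {i : Fin (P - 1)} {z w : T P}
    (hz : Moves μ c (lo i) (hi i) z) (hw : Moves μ c (lo i).rev (hi i).rev w) :
    ∃ a : Fin n → Fin P → Kq, (∀ p x, a p x ≠ 0 ↔ Step i (μ p) x) ∧
      z + w = ∑ p, ∑ x, a p x • wd (Function.update μ p x) c := by
  obtain ⟨a, ha, rfl⟩ := hz
  obtain ⟨b, hb, rfl⟩ := hw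
  refine ⟨fun p x => a p x + b p x, fun p x => ?_, ?_⟩
  · rw [Step, ← ha, ← hb]
    by_cases h1 : a p x = 0
    · simp [h1]
    · have h2 : b p x = 0 := by
        by_contra h2
        obtain ⟨u1, u2⟩ := (ha p x).mp h1
        obtain ⟨v1, v2⟩ := (hb p x).mp h2
        rw [u1] at v1; rw [u2] at v2
        have := congrArg Fin.val (IsZero.unique (N := P) v1.symm v2.symm)
        simp [lo, hi] at this
      simp [h1, h2]
  · simp only [add_smul, Finset.sum_add_distrib]

/-- The operator by which `B_i` acts on the left. -/
def bX (i : Fin (P - 1)) : T P →ₗ[Kq] T P := if Even P then T.bI i else T.bJ i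

lemma bX_rightIdeal (i : Fin (P - 1)) : rightIdeal P ≤ (rightIdeal P).comap (bX i) := by
  unfold bX
  split_ifs with h
  · exact T.bI_rightIdeal h i
  · exact T.bJ_rightIdeal (Nat.not_even_iff_odd.mp h) i

/-- The multiple of the word itself comes only from the summand `K_0⁻¹` in type ı. All other words
are produced by exactly one replacement of a letter, with a nonzero coefficient. -/
lemma bX_wd (i : Fin (P - 1)) {n : ℕ} (μ c : Fin n → Fin P) :
    ∃ (c0 : Kq) (a : Fin n → Fin P → Kq), (∀ p x, a p x ≠ 0 ↔ Step i (μ p) x) ∧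
      bX i (wd μ c) = c0 • wd μ c + ∑ p, ∑ x, a p x • wd (Function.update μ p x) c := by
  have hF := moves_fOp i μ c
  have hE := moves_eOp_kinvOp i.rev i μ c
  rw [lo_rev, hi_rev] at hE
  have hK := (moves_eOp i.rev μ c).map (T.kinvOp_t i)
  rw [lo_rev, hi_rev] at hK
  unfold bX
  split_ifs with h
  · by_cases hz : IsZero i
    · obtain ⟨e, he⟩ := diag_wd (T.kinvOp_t i) μ c
      have hE' := hE.smul (inv_ne_zero q_ne_zero)
      simp only [show i.rev = i from hz] at hE'
      obtain ⟨a, ha, hs⟩ := hF.add hE'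
      refine ⟨q ^ e, a, ha, ?_⟩
      rw [T.bI_of_isZero hz, ← hs, ← he, add_comm]
      rfl
    · obtain ⟨a, ha, hs⟩ := hF.add hE
      refine ⟨0, a, ha, ?_⟩
      rw [T.bI_of_not hz, ← hs, zero_smul, zero_add]
      rfl
  · by_cases hp : IsPos i
    · obtain ⟨a, ha, hs⟩ := hF.add hE
      refine ⟨0, a, ha, ?_⟩
      rw [T.bJ_of_isPos hp, ← hs, zero_smul, zero_add]
      rfl
    · obtain ⟨a, ha, hs⟩ := hF.add hK
      refine ⟨0, a, ha, ?_⟩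
      rw [T.bJ_of_not hp, ← hs, zero_smul, zero_add]
      rfl

/-- The functions on words induced by functionals on `TQuot P`. -/
def reps {n : ℕ} (c : Fin n → Fin P) : Submodule Kq ((Fin n → Fin P) → Kq) where
  carrier := {h | ∃ g : TQuot P →ₗ[Kq] Kq, ∀ μ, g (TQuot.mk (wd μ c)) = h μ}
  add_mem' := by
    rintro a b ⟨g, hg⟩ ⟨g', hg'⟩
    exact ⟨g + g', fun μ => by simp [hg, hg']⟩
  zero_mem' := ⟨0, fun μ => rfl⟩
  smul_mem' := by
    rintro s a ⟨g, hg⟩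
    exact ⟨s • g, fun μ => by simp [hg]⟩

/-- Triangularity: a representable function whose other support points are already separated can be
reduced to its value at `ν`. -/
lemma single_mem_reps_of {n : ℕ} {c : Fin n → Fin P} {h : (Fin n → Fin P) → Kq}
    (hh : h ∈ reps c) {ν : Fin n → Fin P} (hν : h ν ≠ 0)
    (H : ∀ ν', ν' ≠ ν → h ν' ≠ 0 → Pi.single ν' 1 ∈ reps c) :
    (Pi.single ν 1 : (Fin n → Fin P) → Kq) ∈ reps c := by
  have e : h = h ν • Pi.single ν 1 + ∑ ν' ∈ Finset.univ.erase ν, h ν' • Pi.single ν' 1 := by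
    rw [Finset.add_sum_erase _ (fun ν' => h ν' • (Pi.single ν' (1 : Kq) : (Fin n → Fin P) → Kq))
      (Finset.mem_univ ν)]
    funext μ
    simp [Finset.sum_apply, Pi.single_apply]
  have h2 : h ν • (Pi.single ν 1 : (Fin n → Fin P) → Kq) ∈ reps c := by
    rw [eq_sub_of_add_eq e.symm]
    refine Submodule.sub_mem _ hh (Submodule.sum_mem _ fun ν' hν' => ?_)
    by_cases h0 : h ν' = 0
    · rw [h0, zero_smul]; exact Submodule.zero_mem _
    · exact Submodule.smul_mem _ _ (H ν' (Finset.ne_of_mem_erase hν') h0)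
  exact (Submodule.smul_mem_iff _ hν).mp h2

/-- A functional detecting `ν` is composed with `B_i`. The result is supported on `ν` and on the
words that `B_i` can turn into `ν`. If all of these except one are already separated, the remaining
one is separated too. -/
lemma single_mem_reps_step {n : ℕ} {c : Fin n → Fin P} {ν : Fin n → Fin P}
    (hD : (Pi.single ν 1 : (Fin n → Fin P) → Kq) ∈ reps c) {i : Fin (P - 1)} {p : Fin n}
    {x : Fin P} (hS : Step i x (ν p))
    (H : ∀ p' x', Step i x' (ν p') → (p' = p → x' ≠ x) →
      (Pi.single (Function.update ν p' x') 1 : (Fin n → Fin P) → Kq) ∈ reps c) :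
    (Pi.single (Function.update ν p x) 1 : (Fin n → Fin P) → Kq) ∈ reps c := by
  obtain ⟨g, hg⟩ := id hD
  choose c0 a ha hb using fun μ : Fin n → Fin P => bX_wd i μ c
  -- The composite is still a functional on the quotient because `B_i` preserves the right ideal.
  set h : (Fin n → Fin P) → Kq := fun μ => g (TQuot.op (bX_rightIdeal i) (TQuot.mk (wd μ c)))
    with hh
  have hval : ∀ μ, h μ = c0 μ * (Pi.single ν 1 : (Fin n → Fin P) → Kq) μ +
      ∑ p, ∑ x, a μ p x * (Pi.single ν 1 : (Fin n → Fin P) → Kq) (Function.update μ p x) := by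
    intro μ
    simp only [hh, TQuot.op_mk, hb, map_add, map_smul, map_sum, hg, smul_eq_mul]
  have hne : ∀ i : Fin (P - 1), ∀ y, ¬ Step i y y := by
    rintro i y (⟨h1, h2⟩ | ⟨h1, h2⟩)
    · have := congrArg Fin.val (h1.symm.trans h2)
      simp [lo, hi] at this
    · have := congrArg Fin.val (Fin.rev_injective (h1.symm.trans h2))
      simp [lo, hi] at this
  have hxne : x ≠ ν p := fun e => hne i x (by nth_rewrite 2 [e]; exact hS)
  refine single_mem_reps_of (h := h) ⟨g ∘ₗ TQuot.op (bX_rightIdeal i), fun μ => rfl⟩ ?_ ?_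
  · rw [hval]
    set μ := Function.update ν p x with hμ
    have hμp : μ p = x := by simp [hμ]
    have h1 : (Pi.single ν 1 : (Fin n → Fin P) → Kq) μ = 0 := by
      rw [Pi.single_apply, if_neg]
      intro e
      exact hxne (hμp.symm.trans (congrFun e p))
    rw [h1, mul_zero, zero_add, Finset.sum_eq_single p, Finset.sum_eq_single (ν p)]
    · have : Function.update μ p (ν p) = ν := by simp [hμ]
      rw [this, Pi.single_eq_same, mul_one, ha, hμp]
      exact hS
    · intro y _ hy
      rw [Pi.single_apply, if_neg, mul_zero]
      intro e
      have := congrFun e p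
      rw [Function.update_self] at this
      exact hy this
    · simp
    · intro p' _ hp'
      refine Finset.sum_eq_zero fun y _ => ?_
      rw [Pi.single_apply, if_neg, mul_zero]
      intro e
      have := congrFun e p
      rw [Function.update_of_ne hp'.symm, hμp] at this
      exact hxne this
    · simp
  · intro μ hμ h0
    by_cases hμν : μ = ν
    · rw [hμν]; exact hD
    rw [hval, Pi.single_apply, if_neg hμν, mul_zero, zero_add] at h0
    obtain ⟨p', _, h1⟩ := Finset.exists_ne_zero_of_sum_ne_zero h0
    obtain ⟨y, _, h2⟩ := Finset.exists_ne_zero_of_sum_ne_zero h1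
    obtain ⟨h3, h4⟩ := mul_ne_zero_iff.mp h2
    rw [Pi.single_apply] at h4
    have h5 : Function.update μ p' y = ν := by
      by_contra hc
      exact h4 (if_neg hc)
    have h6 : μ = Function.update ν p' (μ p') := by simp [← h5]
    have h7 : ν p' = y := by simp [← h5]
    rw [h6]
    rw [ha, ← h7] at h3
    refine H p' (μ p') h3 fun e e' => hμ ?_
    rw [h6, e', e]

/-- The evaluation of `T P` at the unit matrix. -/
def counitT (P : ℕ) : T P →ₐ[Kq] Kq :=
  T.lift (X := fun i j : Fin P => if i = j then (1 : Kq) else 0) (by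
    constructor
    · intro i k j hik
      by_cases h : i = j
      · have : k ≠ j := fun e => hik.ne (h.trans e.symm)
        simp [this]
      · simp [h]
    · intro i j l hjl
      by_cases h : i = j
      · have : i ≠ l := fun e => hjl.ne (h.symm.trans e)
        simp [this]
      · simp [h]
    · intro i k j l hik hjl
      simp [mul_comm]
    · intro i k j l hik hjl
      by_cases h : i = l
      · have : k ≠ j := fun e => lt_asymm hik (by rw [h, e]; exact hjl)
        simp [this, mul_comm]
      · simp [h, mul_comm])

@[simp] lemma counitT_t (i j : Fin P) : counitT P (t i j) = if i = j then 1 else 0 := by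
  simp [counitT]

/-- At the unit matrix `t_{i,j}` and `t_{-i,-j}` agree, while every other term of the generators
lies off the diagonal. -/
lemma counitT_rightIdeal : rightIdeal P ≤ LinearMap.ker (counitT P).toLinearMap := by
  unfold rightIdeal
  rw [Submodule.span_le]
  rintro _ ⟨x, hx, y, rfl⟩
  have key : counitT P x = 0 := by
    rcases hx with ⟨i, j, hi', hj', rfl | rfl⟩ | ⟨i, z, hi', hz, rfl | rfl⟩
    · have h1 : i ≠ j.rev := by
        rintro rfl
        exact not_isPos_rev hj' hi'
      simp [h1]
    · have h1 : i ≠ j.rev := by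
        rintro rfl
        exact not_isPos_rev hj' hi'
      have h2 : i.rev ≠ j := by
        rintro rfl
        exact not_isPos_rev hi' hj'
      simp [h1, h2]
    · have h1 : i ≠ z := by
        rintro rfl
        exact not_isZero_of_isPos hi' hz
      have h2 : i.rev ≠ z := by
        rintro rfl
        exact not_isZero_of_isPos hi' ((isZero_rev_iff i).mp hz)
      simp [h1, h2]
    · have h1 : z ≠ i := by
        rintro rfl
        exact not_isZero_of_isPos hi' hz
      have h2 : z ≠ i.rev := by
        rintro rfl
        exact not_isZero_of_isPos hi' ((isZero_rev_iff i).mp hz)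
      simp [h1, h2]
  simp [key]

lemma counitT_wd {n : ℕ} (μ c : Fin n → Fin P) :
    counitT P (wd μ c) = (Pi.single c 1 : (Fin n → Fin P) → Kq) μ := by
  rw [wd, map_list_prod, List.map_ofFn, List.prod_ofFn, Pi.single_apply]
  simp only [Function.comp_apply, counitT_t]
  by_cases h : μ = c
  · simp [h]
  · rw [if_neg h]
    obtain ⟨k, hk⟩ := Function.ne_iff.mp h
    exact Finset.prod_eq_zero (Finset.mem_univ k) (if_neg hk)

lemma single_self_mem_reps {n : ℕ} (c : Fin n → Fin P) :
    (Pi.single c 1 : (Fin n → Fin P) → Kq) ∈ reps c :=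
  ⟨(rightIdeal P).liftQ (counitT P).toLinearMap counitT_rightIdeal, fun μ => counitT_wd μ c⟩

end Words

/-! ### All words are separated -/

section Levels
variable {P : ℕ}

/-- The label of sign `b` and level `ℓ`: the element `ℓ`, resp. `-ℓ`, of the index set, counted
from the middle. -/
def lab (hP : 0 < P) (b : Bool) (ℓ : ℕ) : Fin P :=
  if b then ⟨(ℓ + (P + 1) / 2 - 1) % P, Nat.mod_lt _ hP⟩
  else Fin.rev ⟨(ℓ + (P + 1) / 2 - 1) % P, Nat.mod_lt _ hP⟩

/-- The levels that occur. -/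
def IsLevel (P ℓ : ℕ) : Prop := ℓ ≤ P / 2 ∧ 1 ≤ ℓ + P % 2

lemma lab_val (hP : 0 < P) (b : Bool) {ℓ : ℕ} (h : IsLevel P ℓ) :
    (lab hP b ℓ : ℕ) = if b then ℓ + (P + 1) / 2 - 1 else P / 2 - ℓ := by
  obtain ⟨h1, h2⟩ := h
  have e : (ℓ + (P + 1) / 2 - 1) % P = ℓ + (P + 1) / 2 - 1 := Nat.mod_eq_of_lt (by omega)
  cases b
  · simp only [lab, Fin.val_rev, e, Bool.false_eq_true, if_false]; omega
  · simp only [lab, e, if_true]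

lemma lab_rev (hP : 0 < P) (b : Bool) (ℓ : ℕ) : (lab hP b ℓ).rev = lab hP (!b) ℓ := by
  cases b <;> simp [lab]

lemma lab_inj (hP : 0 < P) {b b' : Bool} {a a' : ℕ} (h : IsLevel P a) (h' : IsLevel P a')
    (e : lab hP b a = lab hP b' a') : a = a' ∧ (1 ≤ a → b = b') := by
  have e' := congrArg Fin.val e
  rw [lab_val hP b h, lab_val hP b' h'] at e'
  obtain ⟨h1, h2⟩ := h
  obtain ⟨h3, h4⟩ := h'
  cases b <;> cases b' <;> simp at e' ⊢ <;> omega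

lemma lab_zero (hP : 0 < P) (h : IsLevel P 0) (b b' : Bool) : lab hP b 0 = lab hP b' 0 := by
  apply Fin.ext
  rw [lab_val hP b h, lab_val hP b' h]
  obtain ⟨h1, h2⟩ := h
  cases b <;> cases b' <;> simp <;> omega

lemma exists_lab (hP : 0 < P) (x : Fin P) : ∃ b ℓ, IsLevel P ℓ ∧ x = lab hP b ℓ := by
  have hx := x.isLt
  by_cases h : P / 2 ≤ x
  · have hl : IsLevel P (x + 1 - (P + 1) / 2) := ⟨by omega, by omega⟩
    refine ⟨true, x + 1 - (P + 1) / 2, hl, Fin.ext ?_⟩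
    rw [lab_val hP _ hl]; simp; omega
  · have hl : IsLevel P (P / 2 - x) := ⟨by omega, by omega⟩
    refine ⟨false, P / 2 - x, hl, Fin.ext ?_⟩
    rw [lab_val hP _ hl]; simp; omega

/-- Both replacements made by `B_i` are covered by the free sign `e`; the exclusive or of `b` and
`b'` records whether `B_i` reverses signs. -/
lemma step_iff {hP : 0 < P} {i : Fin (P - 1)} {b b' : Bool} {a a' : ℕ} (h1 : lo i = lab hP b a')
    (h2 : hi i = lab hP b' a) (x y : Fin P) :
    Step i x y ↔ ∃ e : Bool, x = lab hP e a' ∧ y = lab hP (e ^^ (b ^^ b')) a := by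
  rw [Step, h1, h2, lab_rev, lab_rev]
  cases b <;> cases b' <;> simp [Bool.exists_bool, or_comm]

/-- Letters can be moved between neighbouring levels with the sign kept: one choice of `i` on each
side of the middle gives the two directions. -/
lemma exists_step_level (hP : 0 < P) {a a' : ℕ} (h : IsLevel P a) (h' : IsLevel P a')
    (haa : a' = a + 1 ∨ a = a' + 1) : ∃ i : Fin (P - 1), ∀ x y,
      Step i x y ↔ ∃ e : Bool, x = lab hP e a' ∧ y = lab hP e a := by
  have k1 := h.1
  have k2 := h.2
  have k3 := h'.1
  have k4 := h'.2
  rcases haa with e | e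
  · refine ⟨⟨P / 2 - a', by omega⟩, fun x y => ?_⟩
    rw [step_iff (hP := hP) (b := false) (b' := false) (a := a) (a' := a')]
    · simp
    · apply Fin.ext; rw [lab_val hP _ h']; simp [lo]
    · apply Fin.ext; rw [lab_val hP _ h]; simp [hi]; omega
  · refine ⟨⟨a' + (P + 1) / 2 - 1, by omega⟩, fun x y => ?_⟩
    rw [step_iff (hP := hP) (b := true) (b' := true) (a := a) (a' := a')]
    · simp
    · apply Fin.ext; rw [lab_val hP _ h']; simp [lo]
    · apply Fin.ext; rw [lab_val hP _ h]; simp [hi]; omega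

/-- For even `P` the two labels of level one are neighbours, joined by `B_0`, which reverses the
sign. -/
lemma exists_step_flip (hP : 0 < P) (hE : P % 2 = 0) : ∃ i : Fin (P - 1), ∀ x y,
      Step i x y ↔ ∃ e : Bool, x = lab hP e 1 ∧ y = lab hP (!e) 1 := by
  have hl : IsLevel P 1 := ⟨by omega, by omega⟩
  refine ⟨⟨P / 2 - 1, by omega⟩, fun x y => ?_⟩
  rw [step_iff (hP := hP) (b := false) (b' := true) (a := 1) (a' := 1)]
  · simp
  · apply Fin.ext; rw [lab_val hP _ hl]; simp [lo]
  · apply Fin.ext; rw [lab_val hP _ hl]; simp [hi]; omega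

variable {n : ℕ} {c : Fin n → Fin P} {hP : 0 < P}

/-- The word with given signs and levels. -/
def lword (hP : 0 < P) (s : Fin n → Bool) (ℓ : Fin n → ℕ) : Fin n → Fin P :=
  fun p => lab hP (s p) (ℓ p)

/-- The word with given signs and levels is separated from all the others. -/
def Sep (hP : 0 < P) (c : Fin n → Fin P) (s : Fin n → Bool) (ℓ : Fin n → ℕ) : Prop :=
  (Pi.single (lword hP s ℓ) 1 : (Fin n → Fin P) → Kq) ∈ reps c

lemma update_lword (s : Fin n → Bool) (ℓ : Fin n → ℕ) (p : Fin n) (a : ℕ) :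
    Function.update (lword hP s ℓ) p (lab hP (s p) a) = lword hP s (Function.update ℓ p a) := by
  funext k
  by_cases h : k = p
  · subst h; simp [lword]
  · simp [lword, h]

/-- Only letters at the level of `r` can compete with the move of `r`. At level zero the sign could
not be recovered from the label, hence `1 ≤ ℓ r`. -/
lemma Sep.move {s : Fin n → Bool} {ℓ : Fin n → ℕ} (hD : Sep hP c s ℓ)
    (hℓ : ∀ p, IsLevel P (ℓ p)) {r : Fin n} {a' : ℕ} (h' : IsLevel P a')
    (haa : a' = ℓ r + 1 ∨ ℓ r = a' + 1) (h1 : 1 ≤ ℓ r)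
    (H : ∀ p', p' ≠ r → ℓ p' = ℓ r → Sep hP c s (Function.update ℓ p' a')) :
    Sep hP c s (Function.update ℓ r a') := by
  obtain ⟨i, hi'⟩ := exists_step_level hP (hℓ r) h' haa
  unfold Sep
  rw [← update_lword]
  refine single_mem_reps_step hD ((hi' _ _).mpr ⟨s r, rfl, rfl⟩) fun p' x' hS hne => ?_
  obtain ⟨e, rfl, he⟩ := (hi' _ _).mp hS
  obtain ⟨e1, e2⟩ := lab_inj hP (hℓ p') (hℓ r) he
  rw [e1] at e2
  have e3 := e2 h1
  by_cases hp : p' = r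
  · subst hp
    exact absurd (by rw [e3]) (hne rfl)
  · rw [← e3, update_lword]
    exact H p' hp e1

/-- A letter alone at the lowest nonzero level can change its sign, since no other letter interferes
near the middle. -/
lemma Sep.flip {s : Fin n → Bool} {ℓ : Fin n → ℕ} (hD : Sep hP c s ℓ)
    (hℓ : ∀ p, IsLevel P (ℓ p)) {r : Fin n} (hr : ℓ r = 1) (h1 : ∀ p, p ≠ r → 1 < ℓ p) :
    Sep hP c (Function.update s r (!s r)) ℓ := by
  have hl : IsLevel P 1 := hr ▸ hℓ r
  have hw : lword hP (Function.update s r (!s r)) ℓ =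
      Function.update (lword hP s ℓ) r (lab hP (!s r) 1) := by
    funext k
    by_cases h : k = r
    · subst h; simp [lword, hr]
    · simp [lword, h]
  unfold Sep
  rw [hw]
  rcases Nat.mod_two_eq_zero_or_one P with hE | hO
  · obtain ⟨i, hi'⟩ := exists_step_flip hP hE
    refine single_mem_reps_step hD ((hi' _ _).mpr ⟨!s r, rfl, by simp [lword, hr]⟩)
      fun p' x' hS hne => ?_
    obtain ⟨e, rfl, he⟩ := (hi' _ _).mp hS
    obtain ⟨e1, e2⟩ := lab_inj hP (hℓ p') hl he
    have hp : p' = r := by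
      by_contra hp
      have := h1 p' hp
      omega
    subst hp
    rw [e2 (by omega), Bool.not_not] at hne
    exact absurd rfl (hne rfl)
  -- For odd `P` the letter passes through level zero, where the sign is forgotten, and comes back
  -- with the other sign. The competing word, with the old sign, is the one separated at the start.
  · have h0 : IsLevel P 0 := ⟨by omega, by omega⟩
    have hD0 : Sep hP c s (Function.update ℓ r 0) :=
      hD.move hℓ h0 (by omega) (by omega) fun p' hp' e => by
        have := h1 p' hp'
        omega
    obtain ⟨i, hi'⟩ := exists_step_level hP h0 hl (by omega)
    have hu : ∀ x, Function.update (lword hP s ℓ) r x =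
        Function.update (lword hP s (Function.update ℓ r 0)) r x := by
      intro x
      rw [← update_lword, Function.update_idem]
    rw [hu]
    refine single_mem_reps_step hD0 ((hi' _ _).mpr ⟨!s r, rfl, ?_⟩) fun p' x' hS hne => ?_
    · simp only [lword, Function.update_self]
      exact lab_zero hP h0 _ _
    obtain ⟨e, rfl, he⟩ := (hi' _ _).mp hS
    by_cases hp : p' = r
    · subst hp
      have he' : e = s p' := by
        by_contra hc
        refine hne rfl ?_
        rw [Bool.eq_not.mpr hc]
      rw [← hu, he', update_lword, ← hr, Function.update_eq_self]
      exact hD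
    · rw [lword, Function.update_of_ne hp] at he
      obtain ⟨e1, e2⟩ := lab_inj hP (hℓ p') h0 he
      have := h1 p' hp
      omega

/-- The levels given by a permutation. -/
def permLevel (σ : Equiv.Perm (Fin n)) : Fin n → ℕ := fun p => (σ p : ℕ) + 1

lemma isLevel_permLevel (hn : n ≤ P / 2) (σ : Equiv.Perm (Fin n)) (p : Fin n) :
    IsLevel P (permLevel σ p) := by
  have := (σ p).isLt
  exact ⟨by unfold permLevel; omega, by unfold permLevel; omega⟩

/-- Two letters at consecutive levels exchange places: the lower one is raised, then the upper one
is lowered. -/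
lemma Sep.swap (hn : n ≤ P / 2) {s : Fin n → Bool} {σ : Equiv.Perm (Fin n)}
    (hD : Sep hP c s (permLevel σ)) {x y : Fin n} (hxy : (y : ℕ) = x + 1) :
    Sep hP c s (permLevel (Equiv.swap x y * σ)) := by
  set p := σ.symm x with hp
  set r := σ.symm y with hr
  have ep : σ p = x := by simp [hp]
  have er : σ r = y := by simp [hr]
  have hne : x ≠ y := fun e => by rw [e] at hxy; omega
  have hpr : p ≠ r := fun e => hne (by rw [← ep, ← er, e])
  have hy := y.isLt
  have l1 : IsLevel P (x + 1) := ⟨by omega, by omega⟩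
  have l2 : IsLevel P (y + 1) := ⟨by omega, by omega⟩
  have hℓ := isLevel_permLevel (P := P) hn σ
  have D1 : Sep hP c s (Function.update (permLevel σ) p (y + 1)) := by
    refine hD.move hℓ l2 ?_ ?_ fun p' hp' e => ?_
    · left; rw [permLevel, ep, hxy]
    · simp [permLevel]
    · refine absurd (σ.injective (Fin.ext ?_)) hp'
      simpa [permLevel] using e
  -- Both letters now share a level. Lowering the wrong one gives back the initial word, which is
  -- separated by assumption.
  have D2 : Sep hP c s (Function.update (Function.update (permLevel σ) p (y + 1)) r (x + 1)) := by
    have hrr : Function.update (permLevel σ) p ((y : ℕ) + 1) r = y + 1 := by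
      rw [Function.update_of_ne hpr.symm, permLevel, er]
    refine D1.move ?_ l1 ?_ ?_ fun p' hp' e => ?_
    · intro k
      by_cases hk : k = p
      · rw [hk, Function.update_self]; exact l2
      · rw [Function.update_of_ne hk]; exact hℓ k
    · right; rw [hrr, hxy]
    · rw [hrr]; omega
    · by_cases hk : p' = p
      · rw [hk, Function.update_idem]
        have : Function.update (permLevel σ) p ((x : ℕ) + 1) = permLevel σ := by
          rw [← ep]; exact Function.update_eq_self _ _
        rw [this]
        exact hD
      · rw [hrr, Function.update_of_ne hk] at e
        refine absurd (σ.injective (Fin.ext ?_)) hp'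
        rw [er]
        simpa [permLevel] using e
  convert D2 using 1
  funext k
  by_cases hk : k = r
  · subst hk; simp [permLevel, er]
  · rw [Function.update_of_ne hk]
    by_cases hk' : k = p
    · subst hk'; simp [permLevel, ep]
    · rw [Function.update_of_ne hk', permLevel, Equiv.Perm.mul_apply, Equiv.swap_apply_of_ne_of_ne]
      · rfl
      · intro e; exact hk' (by rw [hp, ← e, Equiv.symm_apply_apply])
      · intro e; exact hk (by rw [hr, ← e, Equiv.symm_apply_apply])

lemma Sep.perm (hn : n ≤ P / 2) {s : Fin n → Bool} {σ : Equiv.Perm (Fin n)}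
    (hD : Sep hP c s (permLevel σ)) (σ' : Equiv.Perm (Fin n)) : Sep hP c s (permLevel σ') := by
  suffices H : ∀ π : Equiv.Perm (Fin n), ∀ σ, Sep hP c s (permLevel σ) →
      Sep hP c s (permLevel (π * σ)) by
    simpa using H (σ' * σ⁻¹) σ hD
  intro π
  cases n with
  | zero =>
    intro σ hσ
    rwa [Subsingleton.elim (π * σ) σ]
  | succ n =>
    have hπ : π ∈ Submonoid.closure (Set.range fun i : Fin n => Equiv.swap i.castSucc i.succ) := by
      rw [Equiv.Perm.mclosure_swap_castSucc_succ]; trivial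
    induction hπ using Submonoid.closure_induction with
    | mem x hx =>
      obtain ⟨i, rfl⟩ := hx
      intro σ hσ
      exact hσ.swap hn (by simp)
    | one => intro σ hσ; simpa using hσ
    | mul x y _ _ hx hy =>
      intro σ hσ
      rw [mul_assoc]
      exact hx _ (hy _ hσ)

/-- The starting word is `c` itself, with all signs positive. Signs are reversed one at a time: a
permutation brings the letter in question to level one, where `Sep.flip` applies, and another
permutation restores the order. -/
lemma sep_permLevel (hn : n ≤ P / 2) (hc : ∀ k : Fin n, c k = lab hP true (k + 1))
    (s : Fin n → Bool) (σ : Equiv.Perm (Fin n)) : Sep hP c s (permLevel σ) := by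
  suffices H : ∀ (F : Finset (Fin n)) (σ : Equiv.Perm (Fin n)),
      Sep hP c (fun p => decide (p ∉ F)) (permLevel σ) by
    have := H (Finset.univ.filter fun p => s p = false) σ
    convert this using 1
    funext p
    cases h : s p <;> simp [h]
  intro F
  induction F using Finset.induction_on with
  | empty =>
    intro σ
    refine Sep.perm hn (σ := 1) ?_ σ
    have : lword hP (fun p : Fin n => decide (p ∉ (∅ : Finset (Fin n)))) (permLevel 1) = c := by
      funext k
      simp [lword, permLevel, hc]
    rw [Sep, this]
    exact single_self_mem_reps c
  | insert a F ha ih =>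
    intro σ
    have h0 : 0 < n := a.pos
    refine Sep.perm hn (σ := Equiv.swap a ⟨0, h0⟩) ?_ σ
    have hs : (fun p => decide (p ∉ insert a F)) =
        Function.update (fun p => decide (p ∉ F)) a (!decide (a ∉ F)) := by
      funext p
      by_cases hp : p = a
      · subst hp; simp [ha]
      · simp [hp]
    rw [hs]
    refine (ih (Equiv.swap a ⟨0, h0⟩)).flip (isLevel_permLevel hn _) (by simp [permLevel])
      fun p hp => ?_
    have : Equiv.swap a ⟨0, h0⟩ p ≠ ⟨0, h0⟩ := by
      intro e
      apply hp
      have := congrArg (Equiv.swap a ⟨0, h0⟩) e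
      simpa using this
    have h2 : (Equiv.swap a ⟨0, h0⟩ p : ℕ) ≠ 0 := fun e => this (Fin.ext e)
    unfold permLevel
    omega

lemma update_comp_perm (τ : Fin n → ℕ) (σ : Equiv.Perm (Fin n)) (k : Fin n) (u v : ℕ)
    (hv : τ k = v) :
    Function.update (fun p => Function.update τ k u (σ p)) (σ.symm k) v = fun p => τ (σ p) := by
  funext p
  by_cases h : p = σ.symm k
  · subst h; simp [hv]
  · rw [Function.update_of_ne h, Function.update_of_ne]
    intro e; exact h (by rw [← e]; simp)

/-- Induction on the total distance of `τ` from the levels `1, …, n`. A suitable letter is moved one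
step closer, to a level occupied by no other letter; the closer word is separated by induction, and
moving that letter back separates the given one. -/
lemma sep_monotone (hn : n ≤ P / 2) (hc : ∀ k : Fin n, c k = lab hP true (k + 1))
    (s : Fin n → Bool) (σ : Equiv.Perm (Fin n)) (m : ℕ) (τ : Fin n → ℕ) (hτ : Monotone τ)
    (hl : ∀ k, IsLevel P (τ k)) (hm : ∑ k, ((τ k - (k + 1)) + (k + 1 - τ k)) = m) :
    Sep hP c s (fun p => τ (σ p)) := by
  induction m using Nat.strong_induction_on generalizing τ with
  | _ m ih =>
  have key : ∀ (k : Fin n) (u : ℕ), (∀ j < k, τ j < u) → (∀ j, k < j → u < τ j) → IsLevel P u →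
      1 ≤ u → (τ k = u + 1 ∨ u = τ k + 1) →
      (u - (k + 1)) + (k + 1 - u) < (τ k - (k + 1)) + (k + 1 - τ k) →
      Sep hP c s (fun p => τ (σ p)) := by
    intro k u hlt hgt hu h1 hadj hdec
    have hD : Sep hP c s (fun p => Function.update τ k u (σ p)) := by
      refine ih _ ?_ (Function.update τ k u) ?_ ?_ rfl
      · rw [← hm]
        refine Finset.sum_lt_sum (fun j _ => ?_) ⟨k, Finset.mem_univ k, ?_⟩
        · by_cases hj : j = k
          · subst hj; rw [Function.update_self]; exact hdec.le
          · rw [Function.update_of_ne hj]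
        · rw [Function.update_self]; exact hdec
      · intro i j hij
        by_cases hi' : i = k
        · subst hi'
          by_cases hj : j = i
          · rw [hj]
          · rw [Function.update_self, Function.update_of_ne hj]
            exact (hgt j (lt_of_le_of_ne hij (Ne.symm hj))).le
        · rw [Function.update_of_ne hi']
          by_cases hj : j = k
          · subst hj
            rw [Function.update_self]
            exact (hlt i (lt_of_le_of_ne hij hi')).le
          · rw [Function.update_of_ne hj]
            exact hτ hij
      · intro j
        by_cases hj : j = k
        · subst hj; rwa [Function.update_self]
        · rw [Function.update_of_ne hj]; exact hl j
    rw [← update_comp_perm τ σ k u (τ k) rfl]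
    have hk : Function.update τ k u (σ (σ.symm k)) = u := by simp
    refine hD.move (fun p => ?_) (hl k) ?_ ?_ fun p' hp' e => ?_
    · by_cases hj : σ p = k
      · rw [hj, Function.update_self]; exact hu
      · rw [Function.update_of_ne hj]; exact hl _
    · rw [hk]; exact hadj
    · rw [hk]; exact h1
    · have hj : σ p' ≠ k := fun e => hp' (by rw [← e, Equiv.symm_apply_apply])
      rw [hk, Function.update_of_ne hj] at e
      rcases lt_or_gt_of_ne hj with h | h
      · exact absurd e (hlt _ h).ne
      · exact absurd e (hgt _ h).ne'
  -- The first letter that is too high is lowered: earlier letters are strictly below the new level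
  -- by minimality, later ones strictly above it by monotonicity. Otherwise the last letter that is
  -- too low is raised, for the mirrored reason.
  by_cases hA : ∃ k : Fin n, (k : ℕ) + 1 < τ k
  · obtain ⟨k, hk, hmin⟩ := WellFounded.has_min (wellFounded_lt (α := Fin n))
      {k : Fin n | (k : ℕ) + 1 < τ k} hA
    have hk' : (k : ℕ) + 1 < τ k := hk
    refine key k (τ k - 1) (fun j hj => ?_) (fun j hj => ?_) ⟨?_, ?_⟩ ?_ ?_ ?_
    · have h1 : ¬ (j : ℕ) + 1 < τ j := fun h => hmin j h hj
      have : (j : ℕ) < k := hj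
      omega
    · have := hτ hj.le
      omega
    · have := (hl k).1
      omega
    all_goals omega
  · push Not at hA
    by_cases hB : ∃ k : Fin n, τ k < (k : ℕ) + 1
    · obtain ⟨k, hk, hmin⟩ := WellFounded.has_min (wellFounded_gt (α := Fin n))
        {k : Fin n | τ k < (k : ℕ) + 1} hB
      have hk' : τ k < (k : ℕ) + 1 := hk
      have hkn := k.isLt
      refine key k (τ k + 1) (fun j hj => ?_) (fun j hj => ?_) ⟨?_, ?_⟩ ?_ ?_ ?_
      · have := hτ hj.le
        omega
      · have h1 : ¬ τ j < (j : ℕ) + 1 := fun h => hmin j h hj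
        have : (k : ℕ) < j := hj
        omega
      all_goals omega
    · push Not at hB
      have : (fun p => τ (σ p)) = permLevel σ := by
        funext p
        exact le_antisymm (hA _) (hB _)
      rw [this]
      exact sep_permLevel hn hc s σ

/-- Sorting the levels of the letters makes them monotone; the sorting permutation is absorbed by
the permutation allowed in `sep_monotone`. -/
lemma single_mem_reps (hn : n ≤ P / 2) (hc : ∀ k : Fin n, c k = lab hP true (k + 1))
    (ν : Fin n → Fin P) : (Pi.single ν 1 : (Fin n → Fin P) → Kq) ∈ reps c := by
  choose s ℓ hl he using fun p => exists_lab hP (ν p)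
  have h := sep_monotone hn hc s (Tuple.sort ℓ)⁻¹ _ (ℓ ∘ Tuple.sort ℓ) (Tuple.monotone_sort ℓ)
    (fun k => hl _) rfl
  have : ν = lword hP s (fun p => (ℓ ∘ Tuple.sort ℓ) ((Tuple.sort ℓ)⁻¹ p)) := by
    funext p
    simp [lword, ← he]
  rw [this]
  exact h

end Levels

/-! ### The monomials of matrices with unit columns -/

section UnitColumns
variable {M N : ℕ}

/-- With at most one cell per column, taken in increasing column order, a generator only has to pass
cells of earlier rows and larger columns, and with these it commutes. Column order and row order
thus give the same product. -/
lemma prod_eq_mon {R : Type*} [Ring R] [Algebra Kq R] {X : Fin M → Fin N → R} (hX : IsQMat X)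
    (f : Fin N → Fin M) (L : List (Fin N)) (hL : L.Pairwise (· < ·)) :
    (L.map fun c => X (f c) c).prod = mon X fun i j => if j ∈ L ∧ f j = i then 1 else 0 := by
  induction L with
  | nil =>
    rw [List.map_nil, List.prod_nil, ← mon_zero (X := X)]
    congr 1
  | cons c L ih =>
    obtain ⟨hc, hL'⟩ := List.pairwise_cons.mp hL
    rw [List.map_cons, List.prod_cons, ih hL', gen_mul_mon hX]
    · have h1 : ∑ s ∈ Finset.Iio c, (((if s ∈ L ∧ f s = f c then 1 else 0 : ℕ)) : ℤ) = 0 := by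
        refine Finset.sum_eq_zero fun s hs => ?_
        rw [if_neg, Nat.cast_zero]
        rintro ⟨h, _⟩
        exact lt_asymm (hc s h) (Finset.mem_Iio.mp hs)
      have h2 : ∑ r ∈ Finset.Iio (f c), (((if c ∈ L ∧ f c = r then 1 else 0 : ℕ)) : ℤ) = 0 := by
        refine Finset.sum_eq_zero fun s hs => ?_
        rw [if_neg, Nat.cast_zero]
        rintro ⟨h, _⟩
        exact lt_irrefl _ (hc c h)
      rw [h1, h2, neg_zero, sub_zero, zpow_zero, one_smul]
      congr 1
      funext i j
      unfold mincr
      by_cases hj : j = c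
      · subst hj
        have : j ∉ L := fun h => lt_irrefl _ (hc j h)
        simp [this, eq_comm]
      · simp [hj]
    · intro r s _ hs
      by_contra h
      apply hs
      rw [if_neg]
      rintro ⟨h', _⟩
      exact h (hc s h').le

variable {n : ℕ}

/-- The positive labels, in increasing order. -/
def posLabel (hN : N = 2 * n + N % 2) (k : Fin n) : Fin N := ⟨n + N % 2 + k, by omega⟩

lemma isPos_posLabel (hN : N = 2 * n + N % 2) (k : Fin n) : IsPos (posLabel hN k) := by
  simp only [IsPos, posLabel, Fin.lt_def, Fin.val_rev]
  omega

lemma exists_posLabel (hN : N = 2 * n + N % 2) {c : Fin N} (hc : IsPos c) :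
    ∃ k, posLabel hN k = c := by
  have h1 := c.isLt
  simp only [IsPos, Fin.lt_def, Fin.val_rev] at hc
  exact ⟨⟨c - (n + N % 2), by omega⟩, Fin.ext (by simp only [posLabel]; omega)⟩

lemma isZero_apply {f : Fin N → Fin M} (hf : ∀ c, f c.rev = (f c).rev) {c : Fin N}
    (hc : IsZero c) : IsZero (f c) := by
  have := hf c
  rw [hc] at this
  exact this.symm

variable {P : ℕ} (h : M ≤ P) (h' : N ≤ P)

/-- The columns whose unit vector contributes to `t^{(A)}`. -/
def Kept (f : Fin N → Fin M) (c : Fin N) : Prop :=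
  ¬ IsPos (f c).rev ∧ (IsZero (f c) → IsPos c)

/-- The positive columns are processed in increasing order, and `pre` holds the sorted result so
far, with rows that are not negative. A column with a nonnegative row is appended on the right; one
with a negative row is moved to the far left and replaced by the opposite cell, whose column
precedes all those in `pre`. -/
lemma exists_sorted_word (hM : M % 2 = P % 2) (hN : N % 2 = P % 2) {f : Fin N → Fin M}
    (hf : ∀ c, f c.rev = (f c).rev) (ks pre : List (Fin N)) (hks : ks.Pairwise (· < ·))
    (hpre : pre.Pairwise (· < ·)) (hpos : ∀ k ∈ ks, IsPos k)
    (hfp : ∀ c ∈ pre, ¬ IsPos (f c).rev) (hb : ∀ c ∈ pre, ∀ k ∈ ks, k.rev < c ∧ c < k) :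
    ∃ L : List (Fin N), L.Pairwise (· < ·) ∧
      TQuot.mk ((pre.map fun c => cell h h' (f c) c).prod *
        (ks.map fun c => cell h h' (f c) c).prod) =
        TQuot.mk (L.map fun c => cell h h' (f c) c).prod ∧
      ∀ c, c ∈ L ↔ c ∈ pre ∨ (Kept f c ∧ (c ∈ ks ∨ c.rev ∈ ks)) := by
  induction ks generalizing pre with
  | nil => exact ⟨pre, hpre, by simp, by simp⟩
  | cons k ks ih =>
    obtain ⟨hk, hks'⟩ := List.pairwise_cons.mp hks
    have hkp : IsPos k := hpos k (by simp)
    by_cases hr : IsPos (f k).rev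
    · have hlt : f k < (f k).rev := by simpa [IsPos] using hr
      -- Each factor of `pre` has a larger row and a smaller column than the new cell, so they
      -- commute.
      have hcomm : (pre.map fun c => cell h h' (f c) c).prod * cell h h' (f k) k =
          cell h h' (f k) k * (pre.map fun c => cell h h' (f c) c).prod := by
        clear ih hpre
        induction pre with
        | nil => simp
        | cons c pre ihp =>
          have hc1 := hfp c (by simp)
          have hc2 := (hb c (by simp) k (by simp)).2
          have hlt2 : f k < f c := by
            simp only [IsPos, Fin.rev_rev, Fin.lt_def, Fin.val_rev] at hc1 hlt ⊢
            omega
          rw [List.map_cons, List.prod_cons, mul_assoc, ihp (fun c hc => hfp c (by simp [hc]))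
            (fun c hc => hb c (by simp [hc])), ← mul_assoc, ← mul_assoc]
          congr 1
          exact ((isQMat_cell h h').anti _ _ _ _ hlt2 hc2).symm
      -- Being leftmost, the cell may be replaced by its opposite without any scalar, as its row is
      -- negative and its column positive.
      have hflip : TQuot.mk ((pre.map fun c => cell h h' (f c) c).prod *
          ((k :: ks).map fun c => cell h h' (f c) c).prod) =
          TQuot.mk (((k.rev :: pre).map fun c => cell h h' (f c) c).prod *
            (ks.map fun c => cell h h' (f c) c).prod) := by
        rw [List.map_cons, List.prod_cons, ← mul_assoc, hcomm, mul_assoc, List.map_cons,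
          List.prod_cons, mul_assoc, hf]
        have := mk_cell_anti h h' hM hN hr hkp ((pre.map fun c => cell h h' (f c) c).prod *
            (ks.map fun c => cell h h' (f c) c).prod)
        simpa only [Fin.rev_rev] using this
      obtain ⟨L, hL1, hL2, hL3⟩ := ih (k.rev :: pre) hks' (List.pairwise_cons.mpr
        ⟨fun c hc => (hb c hc k (by simp)).1, hpre⟩) (fun c hc => hpos c (by simp [hc])) (by
          intro c hc
          rcases List.mem_cons.mp hc with rfl | hc
          · rw [hf]; exact not_isPos_rev hr
          · exact hfp c hc) (by
          intro c hc l hl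
          have hkl := hk l hl
          rcases List.mem_cons.mp hc with rfl | hc
          · exact ⟨Fin.rev_lt_rev.mpr hkl, hkp.trans hkl⟩
          · exact hb c hc l (by simp [hl]))
      refine ⟨L, hL1, hflip.trans hL2, fun c => ?_⟩
      rw [hL3]
      have e1 : Kept f k.rev := by
        refine ⟨by rw [hf]; exact not_isPos_rev hr, fun hz => ?_⟩
        rw [hf] at hz
        exact absurd hz (not_isZero_of_isPos hr)
      have e2 : ¬ Kept f k := fun e => e.1 hr
      constructor
      · rintro (hc | ⟨hc, hc'⟩)
        · rcases List.mem_cons.mp hc with rfl | hc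
          · exact Or.inr ⟨e1, Or.inr (by simp)⟩
          · exact Or.inl hc
        · exact Or.inr ⟨hc, hc'.imp (List.mem_cons_of_mem _) (List.mem_cons_of_mem _)⟩
      · rintro (hc | ⟨hc, hc' | hc'⟩)
        · exact Or.inl (List.mem_cons_of_mem _ hc)
        · rcases List.mem_cons.mp hc' with rfl | hc'
          · exact absurd hc e2
          · exact Or.inr ⟨hc, Or.inl hc'⟩
        · rcases List.mem_cons.mp hc' with rfl | hc'
          · exact Or.inl (by simp)
          · exact Or.inr ⟨hc, Or.inr hc'⟩
    · obtain ⟨L, hL1, hL2, hL3⟩ := ih (pre ++ [k]) hks' (List.pairwise_append.mpr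
        ⟨hpre, by simp, fun c hc l hl => by
          rw [List.mem_singleton.mp hl]; exact (hb c hc k (by simp)).2⟩)
        (fun c hc => hpos c (by simp [hc])) (by
          intro c hc
          rcases List.mem_append.mp hc with hc | hc
          · exact hfp c hc
          · rw [List.mem_singleton.mp hc]; exact hr) (by
          intro c hc l hl
          have hkl := hk l hl
          rcases List.mem_append.mp hc with hc | hc
          · exact hb c hc l (by simp [hl])
          · rw [List.mem_singleton.mp hc]
            exact ⟨(Fin.rev_lt_rev.mpr hkl).trans hkp, hkl⟩)
      refine ⟨L, hL1, ?_, fun c => ?_⟩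
      · rw [← hL2]
        simp [mul_assoc]
      rw [hL3]
      have e1 : Kept f k := ⟨hr, fun _ => hkp⟩
      have e2 : ¬ Kept f k.rev := by
        rintro ⟨e3, e4⟩
        rw [hf, Fin.rev_rev] at e3
        rw [hf] at e4
        rcases isPos_or (f k) with u | u | u
        · exact e3 u
        · exact not_isPos_rev hkp (e4 ((isZero_rev_iff _).mpr u))
        · exact hr u
      constructor
      · rintro (hc | ⟨hc, hc'⟩)
        · rcases List.mem_append.mp hc with hc | hc
          · exact Or.inl hc
          · rw [List.mem_singleton.mp hc]
            exact Or.inr ⟨e1, Or.inl (by simp)⟩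
        · exact Or.inr ⟨hc, hc'.imp (List.mem_cons_of_mem _) (List.mem_cons_of_mem _)⟩
      · rintro (hc | ⟨hc, hc' | hc'⟩)
        · exact Or.inl (by simp [hc])
        · rcases List.mem_cons.mp hc' with rfl | hc'
          · exact Or.inl (by simp)
          · exact Or.inr ⟨hc, Or.inl hc'⟩
        · rcases List.mem_cons.mp hc' with rfl | hc'
          · rw [Fin.rev_rev] at e2
            exact absurd hc e2
          · exact Or.inr ⟨hc, Or.inr hc'⟩

/-- The columns that survive straightening are exactly those whose unit entry is counted by `tExp`.
In odd type the central entry equals one, so its exponent `(1 - 1)/2` is zero and the zero column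
contributes nothing. -/
lemma mk_word_posLabel (hM : M % 2 = P % 2) (hNP : N % 2 = P % 2) (hN : N = 2 * n + N % 2)
    {f : Fin N → Fin M} (hf : ∀ c, f c.rev = (f c).rev) :
    TQuot.mk (List.ofFn fun k => cell h h' (f (posLabel hN k)) (posLabel hN k)).prod =
      tau h h' (unitColumns f) := by
  obtain ⟨L, hL1, hL2, hL3⟩ := exists_sorted_word h h' hM hNP hf (List.ofFn (posLabel hN)) []
    (by
      rw [List.pairwise_ofFn]
      intro i j hij
      exact Nat.add_lt_add_left (Fin.lt_def.mp hij) _) (by simp)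
    (by
      intro k hk
      obtain ⟨i, rfl⟩ := (List.mem_ofFn' _ _).mp hk
      exact isPos_posLabel hN i) (by simp) (by simp)
  rw [List.map_nil, List.prod_nil, one_mul, List.map_ofFn] at hL2
  refine hL2.trans ?_
  rw [prod_eq_mon (isQMat_cell h h') f L hL1, tau]
  congr 2
  funext i j
  have hj : j ∈ L ↔ Kept f j ∧ ¬ IsZero j := by
    rw [hL3]
    simp only [List.not_mem_nil, false_or]
    refine and_congr_right fun _ => ⟨?_, fun hz => ?_⟩
    · rintro (hk | hk) <;> obtain ⟨i, hi'⟩ := (List.mem_ofFn' _ _).mp hk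
      · rw [← hi']; exact not_isZero_of_isPos (isPos_posLabel hN i)
      · have := not_isZero_of_isPos (isPos_posLabel hN i)
        rw [hi'] at this
        exact fun hz => this ((isZero_rev_iff _).mpr hz)
    · rcases isPos_or j with hc | hc | hc
      · obtain ⟨k, hk⟩ := exists_posLabel hN hc
        exact Or.inl ((List.mem_ofFn' _ _).mpr ⟨k, hk⟩)
      · exact absurd hc hz
      · obtain ⟨k, hk⟩ := exists_posLabel hN hc
        exact Or.inr ((List.mem_ofFn' _ _).mpr ⟨k, hk⟩)
  unfold tExp unitColumns
  by_cases hi' : f j = i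
  · subst hi'
    rw [if_pos rfl]
    by_cases hk : IsPos (f j) ∨ IsZero (f j) ∧ IsPos j
    · rw [if_pos hk, if_pos]
      refine ⟨hj.mpr ⟨⟨?_, ?_⟩, ?_⟩, rfl⟩
      · rcases hk with hk | hk
        · exact not_isPos_rev hk
        · intro hp
          exact not_isZero_of_isPos hp ((isZero_rev_iff _).mpr hk.1)
      · intro hz
        rcases hk with hk | hk
        · exact absurd hz (not_isZero_of_isPos hk)
        · exact hk.2
      · intro hz
        rcases hk with hk | hk
        · exact not_isZero_of_isPos hk (isZero_apply hf hz)
        · exact not_isZero_of_isPos hk.2 hz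
    · rw [if_neg hk, if_neg]
      · split_ifs <;> rfl
      · rintro ⟨h1, _⟩
        obtain ⟨⟨h2, h3⟩, h4⟩ := hj.mp h1
        apply hk
        rcases isPos_or (f j) with u | u | u
        · exact Or.inl u
        · exact Or.inr ⟨u, h3 u⟩
        · exact absurd u h2
  · rw [if_neg (fun hc => hi' hc.2), if_neg hi']
    split_ifs <;> rfl

end UnitColumns

/-! ### Weight vectors -/

lemma q_pow_eq_one {k : ℕ} (h : q ^ k = 1) : k = 0 := by
  have h3 : (algebraMap (Polynomial ℚ) Kq) (Polynomial.X ^ k) = (algebraMap (Polynomial ℚ) Kq) 1 := by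
    rw [map_pow, map_one, RatFunc.algebraMap_X]; exact h
  have h4 := congrArg Polynomial.natDegree (RatFunc.algebraMap_injective ℚ h3)
  simpa using h4

lemma q_zpow_injective : Function.Injective fun k : ℤ => q ^ k := by
  intro a b hab
  have h : q ^ (a - b) = 1 := by
    rw [zpow_sub₀ q_ne_zero]
    exact (div_eq_one_iff_eq (zpow_ne_zero _ q_ne_zero)).mpr hab
  obtain ⟨k, hk | hk⟩ := (a - b).eq_nat_or_neg
  · rw [hk, zpow_natCast] at h
    have := q_pow_eq_one h
    omega
  · rw [hk, zpow_neg, zpow_natCast, inv_eq_one] at h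
    have := q_pow_eq_one h
    omega

/-- The operators are treated one at a time. The part of `v` spanned by vectors with another
eigenvalue lies both in the required eigenspace and in the sum of the others, hence vanishes. No
linear independence of the spanning family is used, which is essential since none is known for the
`t^{(A)}`. -/
lemma mem_span_of_weight {E ι R : Type*} [AddCommGroup E] [Module Kq E] [Finite R] {g : ι → E}
    {D : R → Module.End Kq E} {e : R → ι → ℤ} {μ : R → ℤ}
    (hD : ∀ r i, D r (g i) = q ^ e r i • g i) {v : E} (hv : v ∈ Submodule.span Kq (Set.range g))
    (hw : ∀ r, D r v = q ^ μ r • v) : v ∈ Submodule.span Kq (g '' {i | ∀ r, e r i = μ r}) := by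
  classical
  have := Fintype.ofFinite R
  suffices H : ∀ F : Finset R, v ∈ Submodule.span Kq (g '' {i | ∀ r ∈ F, e r i = μ r}) by
    simpa using H Finset.univ
  intro F
  induction F using Finset.induction_on with
  | empty => simpa using hv
  | insert r F hr ih =>
    have hsplit : g '' {i | ∀ s ∈ F, e s i = μ s} =
        g '' {i | ∀ s ∈ insert r F, e s i = μ s} ∪
          g '' {i | (∀ s ∈ F, e s i = μ s) ∧ e r i ≠ μ r} := by
      rw [← Set.image_union]
      congr 1
      ext i
      simp only [Set.mem_ofPred_eq, Set.mem_union, Finset.mem_insert, forall_eq_or_imp]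
      tauto
    rw [hsplit, Submodule.span_union] at ih
    obtain ⟨x, hx, y, hy, rfl⟩ := Submodule.mem_sup.mp ih
    have hxe : x ∈ (D r).eigenspace (q ^ μ r) := by
      refine Submodule.span_le.mpr ?_ hx
      rintro _ ⟨i, hi', rfl⟩
      rw [SetLike.mem_coe, Module.End.mem_eigenspace_iff, hD, hi' r (Finset.mem_insert_self r F)]
    have hye : y ∈ (D r).eigenspace (q ^ μ r) := by
      have := Submodule.sub_mem _ (Module.End.mem_eigenspace_iff.mpr (hw r)) hxe
      rwa [add_sub_cancel_left] at this
    have hyo : y ∈ ⨆ (ν : Kq) (_ : ν ≠ q ^ μ r), (D r).eigenspace ν := by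
      refine Submodule.span_le.mpr ?_ hy
      rintro _ ⟨i, hi', rfl⟩
      refine Submodule.mem_iSup_of_mem (q ^ e r i) (Submodule.mem_iSup_of_mem ?_ ?_)
      · exact fun h => hi'.2 (q_zpow_injective h)
      · exact Module.End.mem_eigenspace_iff.mpr (hD r i)
    have hy0 : y = 0 := by
      have := ((D r).eigenspaces_iSupIndep (q ^ μ r)).le_bot ⟨hye, hyo⟩
      simpa using this
    rw [hy0, add_zero]
    exact hx

/-! ### The isomorphism with the weight space. -/

section Lambda
variable {M N n : ℕ}

lemma unitColumns_mem_Xi {f : Fin N → Fin M} (hf : ∀ c, f c.rev = (f c).rev) :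
    unitColumns f ∈ Xi M N N := by
  refine ⟨fun i j => ?_, ?_⟩
  · simp only [unitColumns, hf, Fin.rev_inj]
  · change ∑ i, ∑ j, (if f j = i then 1 else 0) = N
    rw [Finset.sum_comm]
    simp

lemma dExp_unitColumns (f : Fin N → Fin M) (r : Fin N) :
    (dExp r (∑ k, unitColumns f k r) : ℤ) = iwt (rho N) r := by
  have h1 : ∑ k, unitColumns f k r = 1 := by simp [unitColumns]
  rw [h1]
  unfold dExp iwt rho
  by_cases hz : IsZero r
  · have : ¬ IsPos r := fun h => not_isZero_of_isPos h hz
    rw [if_pos hz, if_pos hz, if_neg this]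
    simp
  · rw [if_neg hz, if_neg hz]
    rcases isPos_or r with h | h | h
    · rw [if_pos h, if_neg (not_isPos_rev h)]; simp
    · exact absurd h hz
    · have : ¬ IsPos r := by
        have := not_isPos_rev h
        rwa [Fin.rev_rev] at this
      rw [if_pos h, if_neg this]; simp

/-- The weight fixes the sum of every nonzero column to be one. For the zero column it only says
that `(s - 1)/2 = 0`, and `s = 1` follows because that column sum is odd. Symmetry of `A` then makes
the positions of the ones symmetric. -/
lemma exists_unitColumns (hMN : M % 2 = N % 2) (hN : N = 2 * n + N % 2)
    {A : Matrix (Fin M) (Fin N) ℕ} (hA : A ∈ Xi M N N)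
    (hw : ∀ r, (dExp r (∑ k, A k r) : ℤ) = iwt (rho N) r) :
    ∃ f : Fin N → Fin M, (∀ c, f c.rev = (f c).rev) ∧ A = unitColumns f := by
  have hS : IsSymm A := isSymm_of_mem_Xi (d := n) hMN (by rw [hMN, ← hN]; exact hA)
  have hone : ∀ c, ∑ k, A k c = 1 := by
    intro c
    have h := hw c
    unfold dExp iwt rho at h
    by_cases hz : IsZero c
    · have hp : ¬ IsPos c := fun h => not_isZero_of_isPos h hz
      rw [if_pos hz, if_pos hz, if_neg hp] at h
      have hs := col_sum_tExp hMN hS c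
      rw [if_pos hz] at hs
      rw [show c.rev = c from hz] at hs
      have h' : (∑ k, A k c - 1) / 2 = 0 := by exact_mod_cast h
      omega
    · rw [if_neg hz, if_neg hz] at h
      rcases isPos_or c with hp | hp | hp
      · rw [if_pos hp, if_neg (not_isPos_rev hp)] at h
        exact_mod_cast h
      · exact absurd hp hz
      · have hp' : ¬ IsPos c := by
          have := not_isPos_rev hp
          rwa [Fin.rev_rev] at this
        rw [if_pos hp, if_neg hp'] at h
        exact_mod_cast h
  have hex : ∀ c, ∃ k, A k c ≠ 0 := by
    intro c
    obtain ⟨k, _, hk⟩ := Finset.exists_ne_zero_of_sum_ne_zero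
      (show ∑ k, A k c ≠ 0 by rw [hone]; exact one_ne_zero)
    exact ⟨k, hk⟩
  choose f hf using hex
  have hAf : A = unitColumns f := by
    funext k c
    have h1 := hone c
    rw [← Finset.add_sum_erase _ _ (Finset.mem_univ (f c))] at h1
    have h2 := hf c
    unfold unitColumns
    by_cases hk : f c = k
    · rw [if_pos hk, ← hk]
      omega
    · rw [if_neg hk]
      have h3 : ∑ x ∈ Finset.univ.erase (f c), A x c = 0 := by omega
      exact (Finset.sum_eq_zero_iff.mp h3) k (by simp [Ne.symm hk])
  refine ⟨f, fun c => ?_, hAf⟩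
  have h1 : A (f c).rev c.rev ≠ 0 := by rw [hS.rev]; exact hf c
  rw [hAf] at h1
  unfold unitColumns at h1
  by_contra h
  exact h1 (if_neg h)

/-- The map `v_{λ_1} ⊗ ⋯ ⊗ v_{λ_n} ↦ ∏ t_{λ_k, k}`, the columns being positive. -/
def lamMap (M : ℕ) (hN : N = 2 * n + N % 2) : (⨂[Kq]^n (Fin M → Kq)) →ₗ[Kq] TQuot (max M N) :=
  proj M N n ∘ₗ (TensorProduct.mk Kq _ _).flip (vLam (posLabel hN))

lemma lamMap_apply (hN : N = 2 * n + N % 2) (a : ⨂[Kq]^n (Fin M → Kq)) :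
    lamMap M hN a = proj M N n (a ⊗ₜ vLam (posLabel hN)) := rfl

lemma lamMap_vLam (hN : N = 2 * n + N % 2) (lam : Fin n → Fin M) :
    lamMap M hN (vLam lam) = TQuot.mk (wd (fun k => emb (le_max_left M N) (lam k))
      fun k => emb (le_max_right M N) (posLabel hN k)) := by
  rw [lamMap_apply, proj_tmul, tpair_vLam]
  rfl

lemma lamMap_vLam_eq (hMN : M % 2 = N % 2) (hN : N = 2 * n + N % 2) {f : Fin N → Fin M}
    (hf : ∀ c, f c.rev = (f c).rev) :
    lamMap M hN (vLam fun k => f (posLabel hN k)) = tA (unitColumns f) := by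
  rw [lamMap_vLam, tA_eq_tau, ← mk_word_posLabel _ _ (mod_max hMN) (mod_max' hMN) hN hf]
  rfl

/-- The basis of the vectors `v_λ`. -/
def vLamBasis (M n : ℕ) : Module.Basis (Fin n → Fin M) Kq (⨂[Kq]^n (Fin M → Kq)) :=
  Basis.piTensorProduct fun _ => Pi.basisFun Kq (Fin M)

lemma vLamBasis_apply (lam : Fin n → Fin M) : vLamBasis M n lam = vLam lam := by
  rw [vLamBasis, Basis.piTensorProduct_apply]
  simp [vLam]

/-- The words with positive columns are separated from each other by functionals on the quotient, so
each coordinate of a vector in the kernel vanishes. Separation applies since the columns are the `n`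
smallest positive labels in order, of levels `1, …, n`, and `n ≤ P / 2`. -/
lemma lamMap_injective (hMN : M % 2 = N % 2) (hN : N = 2 * n + N % 2) :
    Function.Injective (lamMap M hN) := by
  rw [← LinearMap.ker_eq_bot, LinearMap.ker_eq_bot']
  intro a ha
  refine (vLamBasis M n).ext_elem fun lam => ?_
  have hmax := mod_max' hMN
  have hle := le_max_right M N
  have hsep : (Pi.single (fun k => emb (le_max_left M N) (lam k)) 1 :
      (Fin n → Fin (max M N)) → Kq) ∈ reps fun k => emb hle (posLabel hN k) := by
    -- For `n = 0` the index set may be empty and labels by levels unavailable, but then there is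
    -- only the empty word.
    rcases Nat.eq_zero_or_pos n with rfl | hn
    · rw [Subsingleton.elim (fun k => emb (le_max_left M N) (lam k))
        fun k => emb hle (posLabel hN k)]
      exact single_self_mem_reps _
    · refine single_mem_reps (hP := by omega) (by omega) (fun k => ?_) _
      have hk := k.isLt
      apply Fin.ext
      rw [lab_val _ _ ⟨by omega, by omega⟩]
      simp only [emb, posLabel, if_true]
      omega
  obtain ⟨g, hg⟩ := hsep
  have h0 : g (lamMap M hN a) = 0 := by rw [ha, map_zero]
  rw [← (vLamBasis M n).sum_repr a] at h0
  simp only [map_sum, map_smul, vLamBasis_apply, lamMap_vLam, hg] at h0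
  rw [Finset.sum_eq_single lam] at h0
  · simpa using h0
  · intro lam' _ hne
    rw [Pi.single_apply, if_neg, smul_zero]
    intro e
    exact hne (funext fun k => (emb_inj _).mp (congrFun e k))
  · simp

lemma mem_span_tVec {s : ℕ} (v : V M N s) :
    v ∈ Submodule.span Kq (Set.range fun A : Xi M N s => tVec A.1 A.2) := by
  obtain ⟨v, hv⟩ := v
  unfold V at hv
  induction hv using Submodule.span_induction with
  | mem x hx =>
    obtain ⟨A, hA, rfl⟩ := hx
    exact Submodule.subset_span ⟨⟨A, hA⟩, rfl⟩
  | zero => exact Submodule.zero_mem _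
  | add x y hx hy h1 h2 => exact Submodule.add_mem _ h1 h2
  | smul c x hx h1 => exact Submodule.smul_mem _ c h1

/-- The tensor power is isomorphic to the weight space of weight `ρ`. -/
lemma exists_lamEquiv (hMN : M % 2 = N % 2) (hN : N = 2 * n + N % 2)
    {F : (Fin n → Fin M) → Fin N → Fin M} (hF : ∀ lam c, F lam c.rev = (F lam c).rev)
    (hFp : ∀ lam k, F lam (posLabel hN k) = lam k) {D : Fin N → Module.End Kq (V M N N)}
    (hD : ∀ r A (hA : A ∈ Xi M N N),
      (D r (tVec A hA) : TQuot (max M N)) = q ^ dExp r (∑ k, A k r) • tA A) :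
    ∃ Λ : ⨂[Kq]^n (Fin M → Kq) ≃ₗ[Kq]
        (⨅ r, (D r).eigenspace (q ^ iwt (rho N) r) : Submodule Kq (V M N N)),
      ∀ a, ((Λ a : V M N N) : TQuot (max M N)) = lamMap M hN a := by
  have hD' : ∀ r (A : Xi M N N), D r (tVec A.1 A.2) =
      q ^ (dExp r (∑ k, A.1 k r) : ℤ) • tVec A.1 A.2 := by
    intro r A
    apply Subtype.ext
    rw [hD, zpow_natCast]
    rfl
  have hlam : ∀ lam, lamMap M hN (vLam lam) = tA (unitColumns (F lam)) := by
    intro lam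
    have := lamMap_vLam_eq hMN hN (hF lam)
    simpa only [hFp] using this
  have hV : ∀ a, lamMap M hN a ∈ V M N N := by
    intro a
    rw [← (vLamBasis M n).sum_repr a, map_sum]
    refine Submodule.sum_mem _ fun lam _ => ?_
    rw [map_smul, vLamBasis_apply, hlam]
    exact Submodule.smul_mem _ _ (tA_mem (unitColumns_mem_Xi (hF lam)))
  set Λ0 : ⨂[Kq]^n (Fin M → Kq) →ₗ[Kq] V M N N := (lamMap M hN).codRestrict _ hV with hΛ0
  have hΛ0v : ∀ lam, Λ0 (vLam lam) = tVec _ (unitColumns_mem_Xi (hF lam)) := fun lam =>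
    Subtype.ext (hlam lam)
  set W : Submodule Kq (V M N N) := ⨅ r, (D r).eigenspace (q ^ iwt (rho N) r) with hWdef
  have hW : ∀ a, Λ0 a ∈ W := by
    intro a
    rw [← (vLamBasis M n).sum_repr a, map_sum]
    refine Submodule.sum_mem _ fun lam _ => ?_
    rw [map_smul, vLamBasis_apply, hΛ0v]
    refine Submodule.smul_mem _ _ ((Submodule.mem_iInf _).mpr fun r => ?_)
    rw [Module.End.mem_eigenspace_iff, hD' r ⟨_, unitColumns_mem_Xi (hF lam)⟩, dExp_unitColumns]
  have hsurj : Function.Surjective (Λ0.codRestrict W hW) := by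
    rintro ⟨v, hv⟩
    suffices h : v ∈ LinearMap.range Λ0 by
      obtain ⟨a, rfl⟩ := h
      exact ⟨a, rfl⟩
    have h := mem_span_of_weight (g := fun A : Xi M N N => tVec A.1 A.2) hD' (mem_span_tVec v)
      (μ := iwt (rho N)) fun r => Module.End.mem_eigenspace_iff.mp ((Submodule.mem_iInf _).mp hv r)
    refine Submodule.span_le.mpr ?_ h
    rintro _ ⟨⟨A, hA⟩, hAw, rfl⟩
    obtain ⟨f, hf, rfl⟩ := exists_unitColumns hMN hN hA hAw
    exact ⟨vLam fun k => f (posLabel hN k), Subtype.ext (lamMap_vLam_eq hMN hN hf)⟩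
  have hinj : Function.Injective (Λ0.codRestrict W hW) := fun a b hab =>
    lamMap_injective hMN hN (congrArg (fun w : W => ((w : V M N N) : TQuot (max M N))) hab)
  exact ⟨LinearEquiv.ofBijective _ ⟨hinj, hsurj⟩, fun a => rfl⟩

end Lambda

/-! ### The columns of `A_λ` -/

section Alam
variable {m n : ℕ}

/-- The rows of the nonzero entries of `A_λ`, type `ı`. -/
def alamRowI (lam : Fin n → Fin (2 * m)) : Fin (2 * n) → Fin (2 * m) := fun c =>
  if h : (c : ℕ) < n then (lam ⟨n - 1 - c, by omega⟩).rev else lam ⟨c - n, by omega⟩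

lemma alamRowI_rev (lam : Fin n → Fin (2 * m)) (c : Fin (2 * n)) :
    alamRowI lam c.rev = (alamRowI lam c).rev := by
  have hc := c.isLt
  unfold alamRowI
  by_cases h : (c : ℕ) < n
  · rw [dif_pos h, dif_neg (by rw [Fin.val_rev]; omega), Fin.rev_rev]
    congr 1
    apply Fin.ext
    simp only [Fin.val_rev]
    omega
  · rw [dif_neg h, dif_pos (by rw [Fin.val_rev]; omega)]
    congr 2
    apply Fin.ext
    simp only [Fin.val_rev]
    omega

lemma alamRowI_posLabel (hN : 2 * n = 2 * n + 2 * n % 2) (lam : Fin n → Fin (2 * m)) (k : Fin n) :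
    alamRowI lam (posLabel hN k) = lam k := by
  unfold alamRowI
  rw [dif_neg (by simp only [posLabel]; omega)]
  congr 1
  apply Fin.ext
  simp only [posLabel]
  omega

/-- The rows of the nonzero entries of `A_λ`, type `ȷ`. -/
def alamRowJ (lam : Fin n → Fin (2 * m + 1)) : Fin (2 * n + 1) → Fin (2 * m + 1) := fun c =>
  if h : (c : ℕ) < n then (lam ⟨n - 1 - c, by omega⟩).rev
  else if h' : (c : ℕ) = n then ⟨m, by omega⟩
  else lam ⟨c - n - 1, by omega⟩

lemma alamRowJ_rev (lam : Fin n → Fin (2 * m + 1)) (c : Fin (2 * n + 1)) :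
    alamRowJ lam c.rev = (alamRowJ lam c).rev := by
  have hc := c.isLt
  unfold alamRowJ
  by_cases h : (c : ℕ) < n
  · rw [dif_pos h, dif_neg (by rw [Fin.val_rev]; omega), dif_neg (by rw [Fin.val_rev]; omega),
      Fin.rev_rev]
    congr 1
    apply Fin.ext
    simp only [Fin.val_rev]
    omega
  · rw [dif_neg h]
    by_cases h' : (c : ℕ) = n
    · rw [dif_pos h', dif_neg (by rw [Fin.val_rev]; omega), dif_pos (by rw [Fin.val_rev]; omega)]
      apply Fin.ext
      simp only [Fin.val_rev]
      omega
    · rw [dif_neg h', dif_pos (by rw [Fin.val_rev]; omega)]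
      congr 2
      apply Fin.ext
      simp only [Fin.val_rev]
      omega

lemma alamRowJ_posLabel (hN : 2 * n + 1 = 2 * n + (2 * n + 1) % 2) (lam : Fin n → Fin (2 * m + 1))
    (k : Fin n) : alamRowJ lam (posLabel hN k) = lam k := by
  unfold alamRowJ
  rw [dif_neg (by simp only [posLabel]; omega), dif_neg (by simp only [posLabel]; omega)]
  congr 1
  apply Fin.ext
  simp only [posLabel]
  omega

/-- Equivariance is immediate upstairs: the map sends `w` to the class of `w` paired with a fixed
tensor, and the left action changes only `w`. -/
lemma bimodule_I (m n : ℕ) : ∃ (Φ : Ui m →ₐ[Kq] Module.End Kq (Vi m n n))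
        (Ψ : (Ui n)ᵐᵒᵖ →ₐ[Kq] Module.End Kq (Vi m n n)),
      IsLeftActionI Φ ∧ IsRightActionI Ψ ∧ (∀ x y v, Φ x (Ψ y v) = Ψ y (Φ x v)) ∧
      ∃ Λ : ⨂[Kq]^n (Fin (2 * m) → Kq) ≃ₗ[Kq] weightSpaceI Ψ (rho (2 * n)),
        (∀ lam : Fin n → Fin (2 * m),
          ((Λ (vLam lam) : Vi m n n) : TQuot (max (2 * m) (2 * n))) = tA (AlamI lam)) ∧
        (∀ (x : Ui m) (w : ⨂[Kq]^n (Fin (2 * m) → Kq)),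
          (Λ (U.tensorPow (U.natural (2 * m)) n x w) : Vi m n n) = Φ x (Λ w)) := by
  have hMN : 2 * m % 2 = 2 * n % 2 := by omega
  have hN : 2 * n = 2 * n + 2 * n % 2 := by omega
  obtain ⟨Λ, hΛ⟩ : ∃ Λ : ⨂[Kq]^n (Fin (2 * m) → Kq) ≃ₗ[Kq] weightSpaceI (PsiI m n n) (rho (2 * n)),
      ∀ a, ((Λ a : Vi m n n) : TQuot (max (2 * m) (2 * n))) = lamMap (2 * m) hN a :=
    exists_lamEquiv hMN hN (F := alamRowI) alamRowI_rev (alamRowI_posLabel hN)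
      (isRightActionI m n n).map_d
  refine ⟨PhiI m n n, PsiI m n n, isLeftActionI m n n, isRightActionI m n n,
    fun x y v => leftHom_rightHom _ _ _ x y v, Λ, fun lam => ?_, fun x w => ?_⟩
  · rw [hΛ]
    have := lamMap_vLam_eq hMN hN (alamRowI_rev lam)
    simp only [alamRowI_posLabel] at this
    exact this
  · apply Subtype.ext
    have hw : proj (2 * m) (2 * n) n (w ⊗ₜ vLam (posLabel hN)) ∈ Vi m n n := by
      rw [← lamMap_apply hN, ← hΛ]
      exact (Λ w : Vi m n n).2
    have e : (Λ w : Vi m n n) = ⟨_, hw⟩ := Subtype.ext (hΛ w)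
    rw [hΛ, e, PhiI, leftHom_proj, actL_tmul, lamMap_apply]

lemma bimodule_J (m n : ℕ) : ∃ (Φ : Uj m →ₐ[Kq] Module.End Kq (Vj m n n))
        (Ψ : (Uj n)ᵐᵒᵖ →ₐ[Kq] Module.End Kq (Vj m n n)),
      IsLeftActionJ Φ ∧ IsRightActionJ Ψ ∧ (∀ x y v, Φ x (Ψ y v) = Ψ y (Φ x v)) ∧
      ∃ Λ : ⨂[Kq]^n (Fin (2 * m + 1) → Kq) ≃ₗ[Kq] weightSpaceJ Ψ (rho (2 * n + 1)),
        (∀ lam : Fin n → Fin (2 * m + 1),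
          ((Λ (vLam lam) : Vj m n n) : TQuot (max (2 * m + 1) (2 * n + 1))) = tA (AlamJ lam)) ∧
        (∀ (x : Uj m) (w : ⨂[Kq]^n (Fin (2 * m + 1) → Kq)),
          (Λ (U.tensorPow (U.natural (2 * m + 1)) n x w) : Vj m n n) = Φ x (Λ w)) := by
  have hMN : (2 * m + 1) % 2 = (2 * n + 1) % 2 := by omega
  have hN : 2 * n + 1 = 2 * n + (2 * n + 1) % 2 := by omega
  obtain ⟨Λ, hΛ⟩ : ∃ Λ : ⨂[Kq]^n (Fin (2 * m + 1) → Kq) ≃ₗ[Kq] weightSpaceJ (PsiJ m n n) (rho (2 * n + 1)),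
      ∀ a, ((Λ a : Vj m n n) : TQuot (max (2 * m + 1) (2 * n + 1))) = lamMap (2 * m + 1) hN a :=
    exists_lamEquiv hMN hN (F := alamRowJ) alamRowJ_rev (alamRowJ_posLabel hN)
      (isRightActionJ m n n).map_d
  refine ⟨PhiJ m n n, PsiJ m n n, isLeftActionJ m n n, isRightActionJ m n n,
    fun x y v => leftHom_rightHom _ _ _ x y v, Λ, fun lam => ?_, fun x w => ?_⟩
  · rw [hΛ]
    have := lamMap_vLam_eq hMN hN (alamRowJ_rev lam)
    simp only [alamRowJ_posLabel] at this
    exact this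
  · apply Subtype.ext
    have hw : proj (2 * m + 1) (2 * n + 1) n (w ⊗ₜ vLam (posLabel hN)) ∈ Vj m n n := by
      rw [← lamMap_apply hN, ← hΛ]
      exact (Λ w : Vj m n n).2
    have e : (Λ w : Vj m n n) = ⟨_, hw⟩ := Subtype.ext (hΛ w)
    rw [hΛ, e, PhiJ, leftHom_proj, actL_tmul, lamMap_apply]

end Alam

end IHowe
end

open IHowe in
theorem theoremA (m n : ℕ) :
    (∃ (Φ : Ui m →ₐ[Kq] Module.End Kq (Vi m n n))
        (Ψ : (Ui n)ᵐᵒᵖ →ₐ[Kq] Module.End Kq (Vi m n n)),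
      IsLeftActionI Φ ∧ IsRightActionI Ψ ∧ (∀ x y v, Φ x (Ψ y v) = Ψ y (Φ x v)) ∧
      ∃ Λ : ⨂[Kq]^n (Fin (2 * m) → Kq) ≃ₗ[Kq] weightSpaceI Ψ (rho (2 * n)),
        (∀ lam : Fin n → Fin (2 * m),
          ((Λ (vLam lam) : Vi m n n) : TQuot (max (2 * m) (2 * n))) = tA (AlamI lam)) ∧
        (∀ (x : Ui m) (w : ⨂[Kq]^n (Fin (2 * m) → Kq)),
          (Λ (U.tensorPow (U.natural (2 * m)) n x w) : Vi m n n) = Φ x (Λ w))) ∧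
    (∃ (Φ : Uj m →ₐ[Kq] Module.End Kq (Vj m n n))
        (Ψ : (Uj n)ᵐᵒᵖ →ₐ[Kq] Module.End Kq (Vj m n n)),
      IsLeftActionJ Φ ∧ IsRightActionJ Ψ ∧ (∀ x y v, Φ x (Ψ y v) = Ψ y (Φ x v)) ∧
      ∃ Λ : ⨂[Kq]^n (Fin (2 * m + 1) → Kq) ≃ₗ[Kq] weightSpaceJ Ψ (rho (2 * n + 1)),
        (∀ lam : Fin n → Fin (2 * m + 1),
          ((Λ (vLam lam) : Vj m n n) : TQuot (max (2 * m + 1) (2 * n + 1))) = tA (AlamJ lam)) ∧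
        (∀ (x : Uj m) (w : ⨂[Kq]^n (Fin (2 * m + 1) → Kq)),
          (Λ (U.tensorPow (U.natural (2 * m + 1)) n x w) : Vj m n n) = Φ x (Λ w))) := by
  exact ⟨bimodule_I m n, bimodule_J m n⟩
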